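/- **Setting.** A *marked binary tree* is a finite tree, all of whose vertices have valency 1 (terminals) or 3 (inner vertices), whose vertices are coloured white and black so that the two ends of each edge have different colours, together with the choice of one adjacent ("marked") edge at every inner vertex; it is embedded in $\mathbb C=\mathbb P^1\setminus\{\infty\}$ with edges regular $C^1$ arcs that meet only at common end points and leave each vertex in different directions. For a terminal $\lambda_k$ put $a_k=1$, $b_k=2$ if it is white and $a_k=2$, $b_k=1$ if it is black. The associated triple covering $C\to\mathbb P^1$ is the compact Riemann surface of $y_1^3=\prod_k(x-\lambda_k)^{a_k}$, with automorphism $\rho:(x,y_1)\mapsto(x,\omega y_1)$, $\omega=\frac{-1+\sqrt{-3}}2$, and with the function $y_2=\prod_k(x-\lambda_k)/y_1$, so that $y_2^3=\prod_k(x-\lambda_k)^{b_k}$. Put $d_1=\frac13\sum_k a_k-1$, $d_2=\frac13\sum_k b_k-1$. Over the complement of the tree $\Gamma$, $C$ consists of three sheets $C^{(0)},C^{(1)},C^{(2)}$: fix $\zeta$ with $\zeta^3=1$ and let $Y$ be the branch of $y_1$ on $\mathbb C\setminus\Gamma$ with $Y/x^{d_1+1}\to\zeta$ for $x\to\infty$;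 then $y_1=\omega^kY$ on $C^{(k)}$. For an inner vertex $v$ let $w_1,w_2,w_3$ be its neighbours in anticlockwise order, the edge $vw_3$ being the marked one. The cycle $A_v$ is the class of a closed curve on $C$, starting on $C^{(1)}$ if $v$ is black and on $C^{(2)}$ if $v$ is white, whose projection to $\mathbb C$ meets $\Gamma$ exactly twice, first in the interior of $vw_2$, where it passes to $C^{(2)}$ (resp. $C^{(1)}$), turning anticlockwise around the block of $w_2$, and then in the interior of $vw_1$, where it returns to the first sheet, turning clockwise around the block of $w_1$. Put $B_v=\rho^2(A_v)$ if $v$ is white and $B_v=\rho(A_v)$ if $v$ is black. **Degeneration.** Let $\lambda_i,\lambda_{i+1}$ be two terminals adjacent to a common inner vertex $p$, let $q$ be the third neighbour of $p$, and assume that $\lambda_i,\lambda_{i+1},q$ is the anticlockwise order at $p$ and that the edge $pq$ is marked at $p$. Let $\tilde\lambda$ be different from all $\lambda_k$, $k\ne i,i+1$. For small complex $t\neq0$ put $\lambda_k(t)=\lambda_k$ for $k\neq i,i+1$ and $\lambda_k(t)=\tilde\lambda+t(\lambda_k-\tilde\lambda)$ for $k=i,i+1$, and let $\Gamma(t)$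 be embeddings of the marked binary tree with terminals $\lambda_k(t)$ which degenerate to an embedded marked binary tree $\Gamma'$: the abstract tree of $\Gamma'$ is obtained by removing the terminals $\lambda_i,\lambda_{i+1}$, so that $p$ becomes a terminal, placed at $\tilde\lambda$ (the other terminals being the $\lambda_k$, $k\ne i,i+1$); $\Gamma(t)$ and $\Gamma'$ coincide outside a closed disc around $\tilde\lambda$ independent of $t$, and inside this disc there are only the edges from $p$ to $\lambda_i(t),\lambda_{i+1}(t)$ and the end at $p$ of the edge $pq$, resp. the end at $\tilde\lambda$ of the corresponding edge of $\Gamma'$. Let $C(t)$ and $\overline C$ be the triple coverings of $\Gamma(t)$ and $\Gamma'$ (with the same $\zeta$), with functions $y_1,y_2$ and $\overline{y_1},\overline{y_2}$, and let $B_v$ denote the corresponding cycles on each of them. So $\overline{y_1}^3=(x-\tilde\lambda)^2\prod_{k\ne i,i+1}(x-\lambda_k)^{a_k}$ and $\overline{y_2}^3=(x-\tilde\lambda)\prod_{k\ne i,i+1}(x-\lambda_k)^{b_k}$. Put $$\eta_j(t)=\frac{x^{j-1}dx}{y_1}\ (1\le j\le d_1),\qquad \widetilde{\eta_{j+d_1}}(t)=\frac{(x-\tilde\lambda)^{j-1}dx}{y_2}\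 (1\le j\le d_2),$$ $$\overline{\eta_j}=\frac{x^{j-1}dx}{\overline{y_1}}\ (1\le j\le d_1),\qquad \overline{\eta_{j+d_1}}=\frac{(x-\tilde\lambda)^{j-1}dx}{\overline{y_2}}\ (1\le j\le d_2-1).$$ **Proposition 5.1.** Assume that $\lambda_i$ and $\lambda_{i+1}$ are white. 1. We have $\lim_{t\to0}\int_{B_p}\eta_j(t)=0$ for $j=1,\dots,d_1$, $\lim_{t\to0}\int_{B_p}\widetilde{\eta_j}(t)=0$ for $j=d_1+2,\dots,d_1+d_2$, and $$\lim_{t\to0}t(\lambda_i-\lambda_{i+1})\Big(\int_{B_p}\widetilde{\eta_{d_1+1}}(t)\Big)^3=B^*(\tfrac13,\tfrac13)^3\prod_{k\ne i,i+1}(\tilde\lambda-\lambda_k)^{-b_k},\qquad B^*(\tfrac13,\tfrac13)=(\omega-1)B(\tfrac13,\tfrac13),$$ where $B(\cdot,\cdot)$ is Euler's beta function. 2. For every inner vertex $v\ne p$ the limit $\lim_{t\to0}\int_{B_v}\widetilde{\eta_{d_1+1}}(t)$ exists and is finite. 3. For every inner vertex $v\neq p$ we have $\lim_{t\to0}\int_{B_v}\eta_j(t)=\int_{B_v}\overline{\eta_j}$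 for $j=1,\dots,d_1$ and $\lim_{t\to0}\int_{B_v}\widetilde{\eta_j}(t)=\int_{B_v}\overline{\eta_{j-1}}$ for $j=d_1+2,\dots,d_1+d_2$. -/

import Mathlib

open Set Filter Topology

namespace TripleCover

/-- The primitive cube root of unity `ω = (-1 + √-3) / 2`. -/
noncomputable def omega : ℂ := (-1 + (Real.sqrt 3 : ℂ) * Complex.I) / 2

/-! ### Marked binary trees: combinatorial part -/

/-- The combinatorial part of a marked binary tree: a finite tree all of whose vertices have
valency one (terminals) or three (inner vertices), a colouring of all vertices in white and black
such that the two ends of every edge have different colours, and a choice (the marking) of one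
adjacent edge `v — mark v` for every inner vertex `v`. The values of `mark` at the terminals play
no role. -/
structure MarkedBinaryTree (V : Type*) [Fintype V] where
  graph : SimpleGraph V
  isTree : graph.IsTree
  valency : ∀ v, (graph.neighborSet v).ncard = 1 ∨ (graph.neighborSet v).ncard = 3
  isWhite : V → Bool
  isWhite_ne : ∀ u v, graph.Adj u v → isWhite u ≠ isWhite v
  mark : V → V
  adj_mark : ∀ v, (graph.neighborSet v).ncard = 3 → graph.Adj v (mark v)

namespace MarkedBinaryTree

variable {V : Type*} [Fintype V] (B : MarkedBinaryTree V)

/-- Inner vertices. -/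
def IsInner (v : V) : Prop := (B.graph.neighborSet v).ncard = 3

/-- Terminals. -/
def IsTerminal (v : V) : Prop := (B.graph.neighborSet v).ncard = 1

open Classical in
/-- The finite set of terminals. -/
noncomputable def terminals : Finset V := Finset.univ.filter fun v => B.IsTerminal v

/-- The numerator `a` of the branching index `a / 3` of a terminal: `1` if it is white and `2` if
it is black. -/
def a (v : V) : ℕ := if B.isWhite v then 1 else 2

/-- The complementary number `b = 3 - a`. -/
def b (v : V) : ℕ := if B.isWhite v then 2 else 1

/-- The number `∑ a / 3` (an integer, since the sum is divisible by three for a binary tree):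
the order of growth of `y₁` at infinity. -/
noncomputable def n₁ : ℕ := (∑ v ∈ B.terminals, B.a v) / 3

/-- The number `∑ b / 3` (again an integer). -/
noncomputable def n₂ : ℕ := (∑ v ∈ B.terminals, B.b v) / 3

/-- The number of holomorphic differentials of the form `x ^ (j - 1) dx / y₁`. -/
noncomputable def d₁ : ℕ := B.n₁ - 1

/-- The number of holomorphic differentials of the form `x ^ (j - 1) dx / y₂`. -/
noncomputable def d₂ : ℕ := B.n₂ - 1

/-- A cherry of the tree: two different terminals `l₁`, `l₂` adjacent to a common inner
vertex `p`, such that the third vertex `q` adjacent to `p` is the one to which the marked edge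
of `p` goes. -/
structure Cherry where
  (l₁ l₂ p q : V)
  ne : l₁ ≠ l₂
  terminal₁ : B.IsTerminal l₁
  terminal₂ : B.IsTerminal l₂
  inner : B.IsInner p
  adj₁ : B.graph.Adj p l₁
  adj₂ : B.graph.Adj p l₂
  mark_p : B.mark p = q
  ne₁ : q ≠ l₁
  ne₂ : q ≠ l₂

variable {B}

namespace Cherry

variable (H : B.Cherry)

/-- The vertices that remain when the two terminals of a cherry are removed. -/
abbrev Rest : Type _ := {v : V // v ∈ {w : V | w ≠ H.l₁ ∧ w ≠ H.l₂}}

noncomputable instance : Fintype H.Rest := Fintype.ofFinite _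

open Classical in
/-- The terminals other than `l₁` and `l₂`. -/
noncomputable def others : Finset V := B.terminals.filter fun k => k ≠ H.l₁ ∧ k ≠ H.l₂

lemma adj_q : B.graph.Adj H.p H.q := H.mark_p ▸ B.adj_mark H.p H.inner

lemma eq_p_of_adj₁ {v : V} (h : B.graph.Adj v H.l₁) : v = H.p := by
  obtain ⟨x, hx⟩ := Set.ncard_eq_one.1 H.terminal₁
  have h1 : v ∈ B.graph.neighborSet H.l₁ := h.symm
  have h2 : H.p ∈ B.graph.neighborSet H.l₁ := H.adj₁.symm
  rw [hx] at h1 h2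
  exact h1.trans h2.symm

lemma eq_p_of_adj₂ {v : V} (h : B.graph.Adj v H.l₂) : v = H.p := by
  obtain ⟨x, hx⟩ := Set.ncard_eq_one.1 H.terminal₂
  have h1 : v ∈ B.graph.neighborSet H.l₂ := h.symm
  have h2 : H.p ∈ B.graph.neighborSet H.l₂ := H.adj₂.symm
  rw [hx] at h1 h2
  exact h1.trans h2.symm

/-- The vertex `p` in the remaining tree, where it is a terminal. -/
def p' : H.Rest := ⟨H.p, H.adj₁.ne, H.adj₂.ne⟩

/-- The vertex `q` in the remaining tree. -/
def q' : H.Rest := ⟨H.q, H.ne₁, H.ne₂⟩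

lemma neighborSet_p : B.graph.neighborSet H.p = {H.l₁, H.l₂, H.q} := by
  symm
  apply Set.eq_of_subset_of_ncard_le
  · rintro x (rfl | rfl | rfl)
    · exact H.adj₁
    · exact H.adj₂
    · exact H.adj_q
  · rw [show (B.graph.neighborSet H.p).ncard = 3 from H.inner]
    exact (Set.ncard_eq_three.2 ⟨_, _, _, H.ne, H.ne₁.symm, H.ne₂.symm, rfl⟩).ge
  · exact Set.toFinite _

lemma ncard_rest (v : H.Rest) (hv : v ≠ H.p') :
    ((B.graph.induce {w : V | w ≠ H.l₁ ∧ w ≠ H.l₂}).neighborSet v).ncard =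
      (B.graph.neighborSet v.1).ncard := by
  rw [← Set.ncard_image_of_injective _ Subtype.val_injective]
  congr 1
  ext x
  constructor
  · rintro ⟨y, hy, rfl⟩
    exact hy
  · intro hx
    have hvp : v.1 ≠ H.p := fun h => hv (Subtype.ext h)
    have hx' : B.graph.Adj v.1 x := hx
    refine ⟨⟨x, ?_, ?_⟩, hx, rfl⟩
    · rintro rfl
      exact hvp (H.eq_p_of_adj₁ hx')
    · rintro rfl
      exact hvp (H.eq_p_of_adj₂ hx')

lemma ncard_rest_p :
    ((B.graph.induce {w : V | w ≠ H.l₁ ∧ w ≠ H.l₂}).neighborSet H.p').ncard = 1 := by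
  refine Set.ncard_eq_one.2 ⟨H.q', ?_⟩
  ext x
  constructor
  · intro hx
    have hx' : x.1 ∈ B.graph.neighborSet H.p := hx
    rw [H.neighborSet_p] at hx'
    rcases hx' with h | h | h
    · exact absurd h x.2.1
    · exact absurd h x.2.2
    · exact Subtype.ext h
  · rintro rfl
    exact H.adj_q

end Cherry

open Classical in
/-- The marked binary tree `(Γ', C', M')` obtained by removing the two terminals of a cherry: the
vertex `p` becomes a terminal, and colours and markings are inherited. This is the part containing
`q` of the decomposition of the tree along the edge `p — q`, where `p` plays the role of the new
terminal. -/
noncomputable def contract (B : MarkedBinaryTree V) (H : B.Cherry) : MarkedBinaryTree H.Rest where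
  graph := B.graph.induce {w : V | w ≠ H.l₁ ∧ w ≠ H.l₂}
  isTree := by
    have : Nonempty ({w : V | w ≠ H.l₁ ∧ w ≠ H.l₂} : Set V) := ⟨H.p'⟩
    refine ⟨⟨B.isTree.1.preconnected.induce_of_degree_eq_one ?_⟩, B.isTree.2.induce _⟩
    intro v hv
    have : v = H.l₁ ∨ v = H.l₂ := by
      by_contra hcon
      push Not at hcon
      exact hv hcon
    have h1 : (B.graph.neighborSet v).ncard = 1 := by
      rcases this with rfl | rfl
      · exact H.terminal₁
      · exact H.terminal₂
    obtain ⟨x, hx⟩ := Set.ncard_eq_one.1 h1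
    rw [hx]
    exact Set.subsingleton_singleton
  valency v := by
    by_cases hv : v = H.p'
    · subst hv
      exact Or.inl H.ncard_rest_p
    · rw [H.ncard_rest v hv]
      exact B.valency v.1
  isWhite v := B.isWhite v.1
  isWhite_ne u v h := B.isWhite_ne u.1 v.1 h
  mark v := if h : B.mark v.1 ≠ H.l₁ ∧ B.mark v.1 ≠ H.l₂ then ⟨B.mark v.1, h⟩ else v
  adj_mark v hv := by
    have hvp : v ≠ H.p' := by
      rintro rfl
      rw [H.ncard_rest_p] at hv
      omega
    rw [H.ncard_rest v hvp] at hv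
    have hm := B.adj_mark v.1 hv
    have hvp' : v.1 ≠ H.p := fun h => hvp (Subtype.ext h)
    have h : B.mark v.1 ≠ H.l₁ ∧ B.mark v.1 ≠ H.l₂ :=
      ⟨fun h => hvp' (H.eq_p_of_adj₁ (by rw [h] at hm; exact hm)),
        fun h => hvp' (H.eq_p_of_adj₂ (by rw [h] at hm; exact hm))⟩
    rw [dif_pos h]
    exact hm

end MarkedBinaryTree

/-! ### Plane embeddings, the triple covering and its sheets -/

/-- An embedding of the tree in the plane `ℂ = ℙ¹ ∖ {∞}`: the edges are embedded regular `C¹` arcs,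
parametrized by `[0, 1]`, which meet only at common end points and leave every vertex in
different directions. -/
structure PlaneEmbedding {V : Type*} [Fintype V] (B : MarkedBinaryTree V) where
  pos : V → ℂ
  pos_injective : Function.Injective pos
  arc : V → V → ℝ → ℂ
  arc_zero : ∀ u v, B.graph.Adj u v → arc u v 0 = pos u
  arc_symm : ∀ u v, B.graph.Adj u v → ∀ s ∈ Icc (0 : ℝ) 1, arc v u s = arc u v (1 - s)
  arc_contDiffOn : ∀ u v, B.graph.Adj u v → ContDiffOn ℝ 1 (arc u v) (Icc 0 1)
  arc_regular : ∀ u v, B.graph.Adj u v → ∀ s ∈ Icc (0 : ℝ) 1,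
    derivWithin (arc u v) (Icc 0 1) s ≠ 0
  arc_injOn : ∀ u v, B.graph.Adj u v → InjOn (arc u v) (Icc 0 1)
  arc_disjoint : ∀ u v u' v', B.graph.Adj u v → B.graph.Adj u' v' → s(u, v) ≠ s(u', v') →
    ∀ s ∈ Icc (0 : ℝ) 1, ∀ s' ∈ Icc (0 : ℝ) 1, arc u v s = arc u' v' s' →
      (s = 0 ∨ s = 1) ∧ (s' = 0 ∨ s' = 1)
  directions : ∀ v w w', B.graph.Adj v w → B.graph.Adj v w' → w ≠ w' →
    ¬ SameRay ℝ (derivWithin (arc v w) (Icc 0 1) 0) (derivWithin (arc v w') (Icc 0 1) 0)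

/-- The rays from the origin through the nonzero numbers `u`, `v`, `w` are different and follow each
other in anticlockwise order, i.e. the triangle formed by the points of these rays on the unit
circle is positively oriented. -/
def Anticlockwise (u v w : ℂ) : Prop :=
  0 < ((starRingEnd ℂ) (v / ‖v‖ - u / ‖u‖) * (w / ‖w‖ - u / ‖u‖)).im

namespace PlaneEmbedding

variable {V : Type*} [Fintype V] {B : MarkedBinaryTree V} (E : PlaneEmbedding B)

/-- The direction in which the edge `v — w` leaves `v`. -/
noncomputable def dir (v w : V) : ℂ := derivWithin (E.arc v w) (Icc 0 1) 0

/-- The edge `u — v` without its end points. -/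
def openEdge (u v : V) : Set ℂ := E.arc u v '' Ioo 0 1

/-- The embedded tree as a subset of the plane. -/
def support : Set ℂ := {x | ∃ u v, B.graph.Adj u v ∧ x ∈ E.arc u v '' Icc 0 1}

/-- The polynomial `∏ (x - λ_k) ^ a_k` over all terminals. -/
noncomputable def f (x : ℂ) : ℂ := ∏ k ∈ B.terminals, (x - E.pos k) ^ B.a k

/-- The function `y₂` on the curve `y₁ ^ 3 = ∏ (x - λ_k) ^ a_k`, i.e. the rational function
with `y₁ y₂ = ∏ (x - λ_k)`; it satisfies `y₂ ^ 3 = ∏ (x - λ_k) ^ b_k`. -/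
noncomputable def y₂ (x y : ℂ) : ℂ := (∏ k ∈ B.terminals, (x - E.pos k)) / y

/-- `Y` is the branch of `y₁` over the complement of the tree with `y₁ / x ^ n₁ → ζ` at infinity
(here `ζ ^ 3 = 1`). The sheet `C^(k)`, `k = 0, 1, 2`, is the set of points `(x, ω ^ k * Y x)` of the
curve with `x` outside the tree; the choice of `ζ` is the choice of the sheet that is called
`C^(0)`. -/
structure IsSheet (ζ : ℂ) (Y : ℂ → ℂ) : Prop where
  continuousOn : ContinuousOn Y E.supportᶜ
  cube : ∀ x ∈ E.supportᶜ, Y x ^ 3 = E.f x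
  atInfinity : Tendsto (fun x => Y x / x ^ B.n₁) (Bornology.cobounded ℂ) (𝓝 ζ)

end PlaneEmbedding

/-! ### Closed curves, the cycles `A_v`, `B_v`, and periods -/

/-- A closed curve on the affine curve `y ^ 3 = f x`, parametrized by `[0, 1]`, whose projection
to the `x`-plane is `C¹`. -/
structure ClosedCurve (f : ℂ → ℂ) where
  x : ℝ → ℂ
  y : ℝ → ℂ
  contDiffOn : ContDiffOn ℝ 1 x (Icc 0 1)
  continuousOn : ContinuousOn y (Icc 0 1)
  on_curve : ∀ s ∈ Icc (0 : ℝ) 1, y s ^ 3 = f (x s)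
  closed_x : x 0 = x 1
  closed_y : y 0 = y 1

lemma omega_pow_three : omega ^ 3 = 1 := by
  have h : ((Real.sqrt 3 : ℝ) : ℂ) ^ 2 = 3 := by
    rw [← Complex.ofReal_pow, Real.sq_sqrt (by norm_num)]
    norm_num
  have hI := Complex.I_sq
  unfold omega
  generalize ((Real.sqrt 3 : ℝ) : ℂ) = r at *
  have e : (-1 + r * Complex.I) ^ 3 =
      -1 + 3 * r * Complex.I - 3 * (r ^ 2 * Complex.I ^ 2)
        + r ^ 2 * r * (Complex.I ^ 2 * Complex.I) := by ring
  rw [div_pow, e, h, hI]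
  ring

/-- The action of the automorphism `ρ : (x, y) ↦ (x, ω y)` on closed curves. -/
noncomputable def ClosedCurve.rho {f : ℂ → ℂ} (c : ClosedCurve f) : ClosedCurve f where
  x := c.x
  y s := omega * c.y s
  contDiffOn := c.contDiffOn
  continuousOn := continuousOn_const.mul c.continuousOn
  on_curve s hs := by rw [mul_pow, omega_pow_three, one_mul, c.on_curve s hs]
  closed_x := c.closed_x
  closed_y := by rw [c.closed_y]

/-- The period of the differential `φ(x, y) dx`, i.e. its integral along a closed curve. -/
noncomputable def period {f : ℂ → ℂ} (φ : ℂ → ℂ → ℂ) (c : ClosedCurve f) : ℂ :=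
  ∫ s in (0 : ℝ)..1, φ (c.x s) (c.y s) * deriv c.x s

namespace PlaneEmbedding

variable {V : Type*} [Fintype V] {B : MarkedBinaryTree V} (E : PlaneEmbedding B)

/-- The closed curve `c` represents the cycle `A_v`. Let `w₁`, `w₂`, `mark v` be the three
neighbours of `v` in anticlockwise order. If `v` is black, `A_v` starts on the sheet `C^(1)`,
crosses the tree for the first time in the interior of the edge `v — w₂`, thereby passes to
`C^(2)`, crosses the tree for the second and last time in the interior of the edge `v — w₁`, thereby
returns to `C^(1)`, and closes up. If `v` is white, the roles of `C^(1)` and `C^(2)` are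
interchanged. (By the rule for patching the sheets, the passage from `C^(1)` to `C^(2)`, respectively
from `C^(2)` to `C^(1)` if `v` is white, means that the projection of `c` turns anticlockwise
around the block of `w₂`; it turns clockwise around the block of `w₁`.) As the complement of the
tree in `ℙ¹` is simply connected, this determines the homology class on the compact curve. -/
def IsCycleA (ζ : ℂ) (v : V) (c : ClosedCurve E.f) : Prop :=
  ∃ (w₁ w₂ : V) (Y : ℂ → ℂ) (s₁ s₂ : ℝ),
    B.graph.Adj v w₁ ∧ B.graph.Adj v w₂ ∧
    Anticlockwise (E.dir v w₁) (E.dir v w₂) (E.dir v (B.mark v)) ∧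
    E.IsSheet ζ Y ∧ 0 < s₁ ∧ s₁ < s₂ ∧ s₂ < 1 ∧
    c.x s₁ ∈ E.openEdge v w₂ ∧ c.x s₂ ∈ E.openEdge v w₁ ∧
    (∀ s ∈ Icc (0 : ℝ) 1, s ≠ s₁ → s ≠ s₂ → c.x s ∉ E.support) ∧
    (∀ s ∈ Ico 0 s₁ ∪ Ioc s₂ 1, c.y s = omega ^ (if B.isWhite v then 2 else 1) * Y (c.x s)) ∧
    (∀ s ∈ Ioo s₁ s₂, c.y s = omega ^ (if B.isWhite v then 1 else 2) * Y (c.x s))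

/-- The closed curve `c` represents the cycle `B_v`, where `B_v = ρ² (A_v)` if `v` is white and
`B_v = ρ (A_v)` if `v` is black. -/
def IsCycleB (ζ : ℂ) (v : V) (c : ClosedCurve E.f) : Prop :=
  ∃ c₀ : ClosedCurve E.f, E.IsCycleA ζ v c₀ ∧ c = if B.isWhite v then c₀.rho.rho else c₀.rho

/-- The differentials `η_j = x ^ (j - 1) dx / y₁`, for `1 ≤ j ≤ d₁`. -/
noncomputable def eta (_E : PlaneEmbedding B) (j : ℕ) (x y : ℂ) : ℂ := x ^ (j - 1) / y

/-- The differentials `η̃_j = (x - μ) ^ (j - d₁ - 1) dx / y₂`, for `d₁ + 1 ≤ j ≤ d₁ + d₂`. -/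
noncomputable def etaTilde (μ : ℂ) (j : ℕ) (x y : ℂ) : ℂ :=
  (x - μ) ^ (j - B.d₁ - 1) / E.y₂ x y

end PlaneEmbedding

/-! ### The degeneration -/

variable {V : Type*} [Fintype V] {B : MarkedBinaryTree V}

/-- The family of embedded trees `E t` (for small `t ≠ 0`) degenerates for `t → 0` to the embedded
tree `E'` with the terminal `p` at `μ`, the two terminals `l₁`, `l₂` moving to `μ` along
`λ_k(t) = μ + t (λ_k - μ)` and all other terminals being fixed. The trees `E t` and `E'` coincide
outside a fixed disc around `μ`, and inside the disc there are only the edges of `E t` from `p` to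
`l₁`, `l₂` and the end at `p` of the edge `p — q`. The terminals `l₁`, `l₂` are named so that
`l₁, l₂, q` is the anticlockwise order at `p`. -/
structure IsSimpleDegeneration (H : B.Cherry) (lam : V → ℂ) (μ : ℂ)
    (E : ℂ → PlaneEmbedding B) (E' : PlaneEmbedding (B.contract H)) : Prop where
  pos_p : E'.pos H.p' = μ
  pos_terminal : ∀ᶠ t in 𝓝[≠] (0 : ℂ), ∀ k, B.IsTerminal k → k ≠ H.l₁ → k ≠ H.l₂ →
    (E t).pos k = lam k
  pos_l₁ : ∀ᶠ t in 𝓝[≠] (0 : ℂ), (E t).pos H.l₁ = μ + t * (lam H.l₁ - μ)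
  pos_l₂ : ∀ᶠ t in 𝓝[≠] (0 : ℂ), (E t).pos H.l₂ = μ + t * (lam H.l₂ - μ)
  anticlockwise : ∀ᶠ t in 𝓝[≠] (0 : ℂ),
    Anticlockwise ((E t).dir H.p H.l₁) ((E t).dir H.p H.l₂) ((E t).dir H.p H.q)
  trees : ∃ r > (0 : ℝ), ∃ s₀ ∈ Ioo (0 : ℝ) 1,
    (∀ u w : H.Rest, (B.contract H).graph.Adj u w → u ≠ H.p' → w ≠ H.p' →
      ∀ s ∈ Icc (0 : ℝ) 1, r < dist (E'.arc u w s) μ) ∧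
    (∀ s ∈ Icc 0 s₀, dist (E'.arc H.p' H.q' s) μ ≤ r) ∧
    (∀ s ∈ Ioc s₀ 1, r < dist (E'.arc H.p' H.q' s) μ) ∧
    ∀ᶠ t in 𝓝[≠] (0 : ℂ),
      (∀ u w : H.Rest, (B.contract H).graph.Adj u w → u ≠ H.p' → w ≠ H.p' →
        ∀ s ∈ Icc (0 : ℝ) 1, (E t).arc u w s = E'.arc u w s) ∧
      (∀ s ∈ Icc s₀ 1, (E t).arc H.p H.q s = E'.arc H.p' H.q' s) ∧
      (∀ s ∈ Icc 0 s₀, dist ((E t).arc H.p H.q s) μ ≤ r) ∧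
      (∀ s ∈ Icc (0 : ℝ) 1, dist ((E t).arc H.p H.l₁ s) μ ≤ r) ∧
      (∀ s ∈ Icc (0 : ℝ) 1, dist ((E t).arc H.p H.l₂ s) μ ≤ r)

end TripleCover

open TripleCover

/-! All the differentials have the form `R dx / y₁ ^ e` with `R` entire and `e = 1` or `e = 2`,
since `1 / y₂ = ∏ (x - λ_k) ^ (a_k - 1) / y₁ ^ 2` (`div_y₂`). The tree is compact and connected and
`x R / Y ^ e` tends to zero at infinity, so `R / Y ^ e` has a primitive `F` off the tree
(`exists_primitive`). The cycle `B_v` runs on the branch `θ Y` with `θ ∈ {ω, ω²}`, crosses to `Y`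
and returns, so its period is a sum of two jumps between `F / θ ^ e` and `F` (`period_eq`). A jump
is constant along an edge, hence each crossing may be placed anywhere on its edge.

For `v ≠ p` the crossings are placed outside the disc. There `f_t = f' κ_t ^ 3` with an explicit
`κ_t` tending uniformly to 1. The complement of the disc and the tree is connected, so the
normalisation at infinity forces `Y_t = Y' κ_t`. The increments of the primitives then converge, and
so do the jumps up to the value of `F_t` at a base point, which drops out of the sum of the two
jumps (`cross_tendsto`, `tendsto_period`). This gives assertions 2 and 3 at once.

For `v = p` the crossings are pushed to the tips `a = λ_i(t)` and `b = λ_{i+1}(t)`, where `f` has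
simple zeros and `F` has limits because `e < 3`. The period becomes `(ω ^ (-2e) - 1) (F(b) - F(a))`,
and the difference is, up to a cube root of unity, the integral of `N dx / u ^ e` along the two
short edges, where `u ^ 3 = (x - a) (x - b)` and `N` is holomorphic near `μ`. It equals `(N(μ) +
O(t)) P` with `P = ∫ dx / u ^ e`, and `P ^ 3 (b - a) ^ (2e) = (b - a) ^ 3 S_e ^ 3`, where `S_2` is
the beta value (`exists_pathInt_pow`). As `b - a = t (λ_{i+1} - λ_i)`, the cube of `P` has order `t`
for `e = 1` and `1 / t` for `e = 2`, which yields assertion 1. Cubing removes the unknown roots of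
unity.

The delicate point is that nothing is assumed about the length or shape of the short edges as `t`
varies, so integrals along them cannot be estimated by absolute values. Integration by parts bounds
`∫ (x - a) ^ m dx / u ^ e` by `|b - a| ^ m |P|` for any path (`norm_pathInt_le`). The value of `P`
comes from a differential equation in the end point: after normalisation the integral from `α 0` to
`α σ` does not depend on `σ`, and for `σ → 0` the rescaled path becomes a straight segment
(`moment_div_eq`, `moment_div_pow`). -/

namespace TripleCover

/-! ### The Cauchy–Pompeiu formula -/

open MeasureTheory Complex

/-- The Wirtinger derivative `∂u/∂z̄`. -/
noncomputable def dbar (u : ℂ → ℂ) (w : ℂ) : ℂ :=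
  (fderiv ℝ u w 1 + I * fderiv ℝ u w I) / 2

lemma continuous_dbar {u : ℂ → ℂ} (hu : ContDiff ℝ 1 u) : Continuous (dbar u) := by
  have := hu.continuous_fderiv one_ne_zero
  unfold dbar
  fun_prop

/-- Rotation of the frame `1, i` to the radial and tangential directions at angle `θ`. In polar
coordinates this is what is left of `∂̄u / (w - z)` after the Jacobian has cancelled the radius. -/
lemma dbar_mul_exp (u : ℂ → ℂ) (w : ℂ) (θ : ℝ) :
    dbar u w * exp (-(θ * I)) =
      (fderiv ℝ u w (exp (θ * I)) + I * fderiv ℝ u w (I * exp (θ * I))) / 2 := by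
  have h1 : exp (θ * I) = (Real.cos θ : ℝ) • (1 : ℂ) + (Real.sin θ : ℝ) • I := by
    rw [exp_mul_I]; simp
  have h2 : I * exp (θ * I) = (-Real.sin θ : ℝ) • (1 : ℂ) + (Real.cos θ : ℝ) • I := by
    rw [exp_mul_I]; simp; ring_nf; simp; ring
  have h3 : exp (-(θ * I)) = Real.cos θ - Real.sin θ * I := by
    rw [← neg_mul, exp_mul_I]; simp; ring
  rw [h2, h1, h3, map_add, map_add, map_smul, map_smul, map_smul, map_smul]
  unfold dbar
  simp only [real_smul]
  push_cast
  ring_nf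
  simp
  ring

lemma hasDerivAt_comp_ray {u : ℂ → ℂ} (hu : ContDiff ℝ 1 u) (z e : ℂ) (r : ℝ) :
    HasDerivAt (fun r : ℝ => u (z + r * e)) (fderiv ℝ u (z + r * e) e) r := by
  have h := (hu.differentiable one_ne_zero (z + r * e)).hasFDerivAt
  have h2 : HasDerivAt (fun r : ℝ => z + r * e) e r := by
    simpa using ((hasDerivAt_id r).ofReal_comp.mul_const e).const_add z
  exact h.comp_hasDerivAt r h2

lemma hasDerivAt_comp_circle {u : ℂ → ℂ} (hu : ContDiff ℝ 1 u) (z : ℂ) (r θ : ℝ) :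
    HasDerivAt (fun θ : ℝ => u (z + r * exp (θ * I)))
      (r * fderiv ℝ u (z + r * exp (θ * I)) (I * exp (θ * I))) θ := by
  have h := (hu.differentiable one_ne_zero (z + r * exp (θ * I))).hasFDerivAt
  have h2 : HasDerivAt (fun θ : ℝ => z + r * exp (θ * I)) ((r : ℝ) • (I * exp (θ * I))) θ := by
    have h3 : HasDerivAt (fun θ : ℝ => exp (θ * I)) (exp (θ * I) * (1 * I)) θ :=
      ((hasDerivAt_id θ).ofReal_comp.mul_const I).cexp
    convert! (h3.const_mul (r : ℂ)).const_add z using 1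
    rw [real_smul]; ring
  convert! h.comp_hasDerivAt θ h2 using 1
  rw [map_smul, real_smul]

lemma integrableOn_rect {f : ℝ × ℝ → ℂ} (hf : Continuous f) (a b c d : ℝ) :
    IntegrableOn f (Ioc a b ×ˢ Ioc c d) :=
  (hf.integrableOn_Icc (a := (a, c)) (b := (b, d))).mono_set
    (fun _ hx => ⟨⟨hx.1.1.le, hx.2.1.le⟩, ⟨hx.1.2, hx.2.2⟩⟩)

/-- The Jacobian `r` of polar coordinates around `z` cancels the singularity. The radial derivative
integrates to the increment of `u` along each ray, the tangential one to zero around each circle. -/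
lemma integral_dbar_polar {u : ℂ → ℂ} (hu : ContDiff ℝ 1 u) (z : ℂ) {R : ℝ} (hR : 0 < R)
    (hg : ∀ w, R ≤ ‖w - z‖ → dbar u w = 0) :
    ∫ w, dbar u w / (w - z) =
      (∫ θ in (-Real.pi)..Real.pi, (u (z + R * exp (θ * I)) - u z)) / 2 := by
  have hpi : -Real.pi ≤ Real.pi := by linarith [Real.pi_pos]
  have e1 : ∫ w, dbar u w / (w - z) = ∫ w, dbar u (z + w) / w := by
    rw [← integral_add_left_eq_self (fun w => dbar u w / (w - z)) z]
    simp
  have cexpc : Continuous fun p : ℝ × ℝ => exp (p.2 * I) := by fun_prop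
  have cfd := hu.continuous_fderiv one_ne_zero
  set a : ℝ × ℝ → ℂ := fun p => fderiv ℝ u (z + p.1 * exp (p.2 * I)) (exp (p.2 * I)) with ha
  set b : ℝ × ℝ → ℂ := fun p => fderiv ℝ u (z + p.1 * exp (p.2 * I)) (I * exp (p.2 * I)) with hb
  have ca : Continuous a := by
    rw [ha]; exact (cfd.comp (by fun_prop)).clm_apply (by fun_prop)
  have cb : Continuous b := by
    rw [hb]; exact (cfd.comp (by fun_prop)).clm_apply (by fun_prop)
  rw [e1, ← Complex.integral_comp_polarCoord_symm]
  have e2 : ∫ p in polarCoord.target, p.1 • (dbar u (z + Complex.polarCoord.symm p) /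
      Complex.polarCoord.symm p) = ∫ p in Ioc 0 R ×ˢ Ioc (-Real.pi) Real.pi, (a p + I * b p) / 2 := by
    have hpt : ∀ p ∈ polarCoord.target, p.1 • (dbar u (z + Complex.polarCoord.symm p) /
      Complex.polarCoord.symm p) = (a p + I * b p) / 2 := by
      rintro p ⟨hp1, -⟩
      have hp1' : (p.1 : ℂ) ≠ 0 := by exact_mod_cast (ne_of_gt hp1)
      rw [ha, hb]
      simp only
      rw [← dbar_mul_exp, Complex.polarCoord_symm_apply]
      have : ((Real.cos p.2 : ℝ) : ℂ) + (Real.sin p.2 : ℝ) * I = exp (p.2 * I) := by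
        rw [exp_mul_I]; simp
      rw [this, exp_neg, real_smul]
      field_simp
    have hm : MeasurableSet polarCoord.target := polarCoord.open_target.measurableSet
    rw [setIntegral_congr_fun hm hpt]
    have h0 : (Ioc 0 R ×ˢ Ioo (-Real.pi) Real.pi : Set (ℝ × ℝ)) ⊆ polarCoord.target := by
      rintro p ⟨h1, h2⟩
      exact ⟨h1.1, h2⟩
    have e3 : ∫ p in polarCoord.target, (a p + I * b p) / 2 =
        ∫ p in Ioc 0 R ×ˢ Ioo (-Real.pi) Real.pi, (a p + I * b p) / 2 := by
      refine setIntegral_eq_of_subset_of_forall_sdiff_eq_zero hm h0 ?_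
      rintro p ⟨hp, hp'⟩
      have hp1 : 0 < p.1 := hp.1
      have hR' : R < p.1 := by
        by_contra hcon
        exact hp' ⟨⟨hp1, not_lt.1 hcon⟩, hp.2⟩
      simp only [ha, hb]
      rw [← dbar_mul_exp, hg, zero_mul]
      simp [abs_of_pos hp1, hR'.le]
    rw [e3]
    refine setIntegral_congr_set ?_
    rw [Measure.volume_eq_prod]
    exact Measure.set_prod_ae_eq (ae_eq_refl _) Ioo_ae_eq_Ioc
  rw [e2]
  have ia := integrableOn_rect ca 0 R (-Real.pi) Real.pi
  have ib := integrableOn_rect cb 0 R (-Real.pi) Real.pi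
  have e4 : ∫ p in Ioc 0 R ×ˢ Ioc (-Real.pi) Real.pi, (a p + I * b p) / 2 =
      ((∫ p in Ioc 0 R ×ˢ Ioc (-Real.pi) Real.pi, a p) +
        I * ∫ p in Ioc 0 R ×ˢ Ioc (-Real.pi) Real.pi, b p) / 2 := by
    rw [integral_div, integral_add ia (ib.const_mul I), integral_const_mul]
  rw [e4]
  -- For fixed `r`, `r b` is the derivative of a `2π`-periodic function of `θ`.
  have eb : ∫ p in Ioc 0 R ×ˢ Ioc (-Real.pi) Real.pi, b p = 0 := by
    rw [Measure.volume_eq_prod] at ib ⊢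
    rw [setIntegral_prod _ ib]
    refine setIntegral_eq_zero_of_forall_eq_zero fun r hr => ?_
    have hr' : (r : ℂ) ≠ 0 := by exact_mod_cast (ne_of_gt hr.1)
    have cbr : Continuous fun θ : ℝ => b (r, θ) := by fun_prop
    rw [← intervalIntegral.integral_of_le hpi]
    have := intervalIntegral.integral_eq_sub_of_hasDerivAt
      (fun θ _ => hasDerivAt_comp_circle hu z r θ)
      ((continuous_const.mul cbr).intervalIntegrable (-Real.pi) Real.pi)
    simp only [hb] at this ⊢
    rw [intervalIntegral.integral_const_mul] at this
    have h6 : exp (((-Real.pi : ℝ) : ℂ) * I) = exp ((Real.pi : ℂ) * I) := by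
      rw [exp_pi_mul_I]
      push_cast
      rw [neg_mul, exp_neg, exp_pi_mul_I]; norm_num
    rw [h6, sub_self] at this
    exact (mul_eq_zero.1 this).resolve_left hr'
  have ea : ∫ p in Ioc 0 R ×ˢ Ioc (-Real.pi) Real.pi, a p =
      ∫ θ in (-Real.pi)..Real.pi, (u (z + R * exp (θ * I)) - u z) := by
    rw [Measure.volume_eq_prod] at ia ⊢
    rw [setIntegral_prod _ ia, integral_integral_swap (f := fun x y => a (x, y)),
      intervalIntegral.integral_of_le hpi]
    · refine setIntegral_congr_fun measurableSet_Ioc fun θ _ => ?_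
      have car : Continuous fun r : ℝ => a (r, θ) := by fun_prop
      have := intervalIntegral.integral_eq_sub_of_hasDerivAt
        (fun r _ => hasDerivAt_comp_ray hu z (exp (θ * I)) r) (car.intervalIntegrable 0 R)
      rw [intervalIntegral.integral_of_le hR.le] at this
      simpa using this
    · rw [Measure.prod_restrict]
      exact ia
  rw [ea, eb, mul_zero, add_zero]

/-- The Cauchy–Pompeiu formula for a function vanishing at infinity. -/
theorem integral_dbar_div_sub {u : ℂ → ℂ} (hu : ContDiff ℝ 1 u)
    (h0 : Tendsto u (Bornology.cobounded ℂ) (𝓝 0)) {R₀ : ℝ} (hg : ∀ w, R₀ ≤ ‖w‖ → dbar u w = 0)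
    (z : ℂ) : ∫ w, dbar u w / (w - z) = -Real.pi * u z := by
  -- The left side does not depend on `R`, so `R` may tend to infinity; then the circle average of
  -- `u` vanishes and only `-u z` remains.
  have key : ∀ᶠ R : ℝ in atTop, ∫ w, dbar u w / (w - z) =
      (∫ θ in (-Real.pi)..Real.pi, (u (z + R * exp (θ * I)) - u z)) / 2 := by
    filter_upwards [eventually_gt_atTop 0, eventually_ge_atTop (R₀ + ‖z‖)] with R hR hR'
    refine integral_dbar_polar hu z hR fun w hw => hg w ?_
    have := norm_sub_le w z
    linarith
  have lim : Tendsto (fun R : ℝ => (∫ θ in (-Real.pi)..Real.pi,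
      (u (z + R * exp (θ * I)) - u z)) / 2) atTop (𝓝 (-Real.pi * u z)) := by
    have hval : -Real.pi * u z = (∫ _ in (-Real.pi)..Real.pi, (0 - u z)) / 2 := by
      rw [intervalIntegral.integral_const, real_smul]
      push_cast
      ring
    rw [hval]
    refine Tendsto.div_const ?_ 2
    have hlim : ∀ ε > 0, ∀ᶠ R : ℝ in atTop, ∀ θ : ℝ, ‖u (z + R * exp (θ * I))‖ < ε := by
      intro ε hε
      have := h0.eventually (Metric.ball_mem_nhds 0 hε)
      rw [(Metric.hasBasis_cobounded_compl_closedBall (0 : ℂ)).eventually_iff] at this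
      obtain ⟨r, -, hr⟩ := this
      filter_upwards [eventually_gt_atTop (r + ‖z‖), eventually_gt_atTop 0] with R hR hR0 θ
      have h1 : ‖(R : ℂ) * exp (θ * I)‖ = R := by
        rw [norm_mul, norm_exp_ofReal_mul_I, mul_one, norm_real, Real.norm_of_nonneg hR0.le]
      have h2 : r < ‖z + R * exp (θ * I)‖ := by
        have := norm_sub_le (z + R * exp (θ * I)) z
        rw [add_sub_cancel_left, h1] at this
        linarith
      have := hr (x := z + R * exp (θ * I)) (by simpa using h2)
      simpa using this
    refine intervalIntegral.tendsto_integral_filter_of_dominated_convergence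
      (fun _ => 1 + ‖u z‖) ?_ ?_ ?_ ?_
    · refine Eventually.of_forall fun R => ?_
      have : Continuous fun θ : ℝ => u (z + R * exp (θ * I)) - u z :=
        (hu.continuous.comp (by fun_prop)).sub continuous_const
      exact this.aestronglyMeasurable
    · filter_upwards [hlim 1 one_pos] with R hR
      refine Eventually.of_forall fun θ _ => ?_
      exact (norm_sub_le _ _).trans (by linarith [hR θ])
    · exact intervalIntegrable_const
    · refine Eventually.of_forall fun θ _ => ?_
      refine Tendsto.sub_const ?_ _
      rw [Metric.tendsto_nhds]
      intro ε hε
      filter_upwards [hlim ε hε] with R hR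
      simpa using hR θ
  exact tendsto_nhds_unique (tendsto_const_nhds.congr' key) lim

end TripleCover

/-! ### Chains of segments and winding numbers -/

namespace TripleCover

open MeasureTheory Complex

/-- The integral of `h` along the segment from `p` to `q`. -/
noncomputable def segInt (h : ℂ → ℂ) (p q : ℂ) : ℂ :=
  ∫ t in (0 : ℝ)..1, h (p + t * (q - p)) * (q - p)

lemma segment_point_mem {p q : ℂ} {t : ℝ} (ht : t ∈ Icc (0 : ℝ) 1) :
    p + t * (q - p) ∈ segment ℝ p q := by
  rw [segment_eq_image']
  exact ⟨t, ht, by simp⟩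

lemma segInt_eq_sub {h Φ : ℂ → ℂ} {p q : ℂ}
    (hΦ : ∀ z ∈ segment ℝ p q, HasDerivAt Φ (h z) z) (hc : ContinuousOn h (segment ℝ p q)) :
    segInt h p q = Φ q - Φ p := by
  have hline : Continuous fun t : ℝ => p + t * (q - p) := by fun_prop
  have := intervalIntegral.integral_eq_sub_of_hasDerivAt (a := (0 : ℝ)) (b := 1)
    (f := fun t : ℝ => Φ (p + t * (q - p))) (f' := fun t : ℝ => h (p + t * (q - p)) * (q - p)) ?_ ?_
  · simpa [segInt] using this
  · intro t ht
    rw [uIcc_of_le zero_le_one] at ht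
    have h1 : HasDerivAt (fun t : ℝ => p + t * (q - p)) (q - p) t := by
      simpa using ((hasDerivAt_id t).ofReal_comp.mul_const (q - p)).const_add p
    exact (hΦ _ (segment_point_mem ht)).comp t h1
  · apply ContinuousOn.intervalIntegrable
    rw [uIcc_of_le zero_le_one]
    exact (hc.comp hline.continuousOn fun t ht => segment_point_mem ht).mul continuousOn_const

lemma segInt_swap (h : ℂ → ℂ) (p q : ℂ) : segInt h q p = - segInt h p q := by
  unfold segInt
  have := intervalIntegral.integral_comp_sub_left (a := (0 : ℝ)) (b := 1)
    (fun t : ℝ => h (p + t * (q - p)) * (q - p)) 1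
  simp only [sub_self, sub_zero] at this
  rw [← this, ← intervalIntegral.integral_neg]
  congr 1
  ext t
  have : p + ((1 - t : ℝ) : ℂ) * (q - p) = q + t * (p - q) := by push_cast; ring
  rw [this]
  ring

/-- `l` is a formal sum of segments in `U` with boundary `q - p`. -/
def IsChain (U : Set ℂ) (p q : ℂ) (l : List (ℂ × ℂ)) : Prop :=
  (∀ s ∈ l, segment ℝ s.1 s.2 ⊆ U) ∧
    ∀ φ : ℂ → ℂ, (l.map fun s => φ s.2 - φ s.1).sum = φ q - φ p

/-- The integral of `h` along a formal sum of segments. -/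
noncomputable def chainInt (h : ℂ → ℂ) (l : List (ℂ × ℂ)) : ℂ :=
  (l.map fun s => segInt h s.1 s.2).sum

lemma IsChain.nil (U : Set ℂ) (p : ℂ) : IsChain U p p [] := by simp [IsChain]

lemma IsChain.single {U : Set ℂ} {p q : ℂ} (h : segment ℝ p q ⊆ U) : IsChain U p q [(p, q)] := by
  simp [IsChain, h]

lemma IsChain.append {U : Set ℂ} {p q r : ℂ} {l l' : List (ℂ × ℂ)} (h : IsChain U p q l)
    (h' : IsChain U q r l') : IsChain U p r (l ++ l') := by
  refine ⟨fun s hs => ?_, fun φ => ?_⟩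
  · rcases List.mem_append.1 hs with hs | hs
    exacts [h.1 s hs, h'.1 s hs]
  · rw [List.map_append, List.sum_append, h.2, h'.2]; ring

lemma IsChain.swap {U : Set ℂ} {p q : ℂ} {l : List (ℂ × ℂ)} (h : IsChain U p q l) :
    IsChain U q p (l.map Prod.swap) := by
  refine ⟨fun s hs => ?_, fun φ => ?_⟩
  · obtain ⟨s', hs', rfl⟩ := List.mem_map.1 hs
    rw [Prod.fst_swap, Prod.snd_swap, segment_symm]
    exact h.1 s' hs'
  · have := h.2 fun z => - φ z
    rw [List.map_map]
    convert! this using 1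
    · congr 1; apply List.map_congr_left; intro s _; simp; ring
    · ring

lemma chainInt_append (h : ℂ → ℂ) (l l' : List (ℂ × ℂ)) :
    chainInt h (l ++ l') = chainInt h l + chainInt h l' := by
  simp [chainInt]

lemma chainInt_swap (h : ℂ → ℂ) (l : List (ℂ × ℂ)) :
    chainInt h (l.map Prod.swap) = - chainInt h l := by
  unfold chainInt
  induction l with
  | nil => simp
  | cons s l ih =>
    simp only [List.map_cons, List.sum_cons, ih, Prod.fst_swap, Prod.snd_swap, segInt_swap h s.1 s.2]
    ring

/-- As `w` is closer to `w'` than the segment is, `(z - w) / (z - w')` stays in the unit disc around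
1, so its principal logarithm is a primitive of the difference of the two kernels. -/
lemma segInt_cauchyKernel_sub {p q w w' : ℂ} {δ : ℝ}
    (hd : ∀ z ∈ segment ℝ p q, δ ≤ dist z w') (hw : dist w w' < δ) :
    segInt (fun z => (z - w)⁻¹) p q - segInt (fun z => (z - w')⁻¹) p q =
      log ((q - w) / (q - w')) - log ((p - w) / (p - w')) := by
  have hδ : 0 < δ := dist_nonneg.trans_lt hw
  have h1 : ∀ z ∈ segment ℝ p q, z - w' ≠ 0 := fun z hz h => by
    have := hd z hz
    rw [dist_eq, h, norm_zero] at this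
    linarith
  have hlt : ∀ z ∈ segment ℝ p q, ‖(w - w') / (z - w')‖ < 1 := fun z hz => by
    rw [norm_div, div_lt_one (norm_pos_iff.2 (h1 z hz)), ← dist_eq, ← dist_eq]
    exact hw.trans_le (hd z hz)
  have heq : ∀ z ∈ segment ℝ p q, (z - w) / (z - w') = 1 - (w - w') / (z - w') := fun z hz => by
    have := h1 z hz
    field_simp; ring
  have h2 : ∀ z ∈ segment ℝ p q, (z - w) / (z - w') ∈ slitPlane := fun z hz => by
    rw [heq z hz]
    left
    have := (abs_re_le_norm _).trans_lt (hlt z hz)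
    rw [sub_re, one_re]
    linarith [(abs_lt.1 this).2]
  have h3 : ∀ z ∈ segment ℝ p q, z - w ≠ 0 := fun z hz h => by
    have := slitPlane_ne_zero (h2 z hz)
    rw [h, zero_div] at this
    exact this rfl
  have c1 : ContinuousOn (fun z => (z - w)⁻¹) (segment ℝ p q) :=
    ContinuousOn.inv₀ (by fun_prop) h3
  have c2 : ContinuousOn (fun z => (z - w')⁻¹) (segment ℝ p q) :=
    ContinuousOn.inv₀ (by fun_prop) h1
  have := segInt_eq_sub (h := fun z => (z - w)⁻¹ - (z - w')⁻¹)
    (Φ := fun z => log ((z - w) / (z - w'))) (p := p) (q := q) ?_ (c1.sub c2)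
  · rw [← this]
    unfold segInt
    have hline : Continuous fun t : ℝ => p + t * (q - p) := by fun_prop
    rw [← intervalIntegral.integral_sub]
    · congr 1; ext t; ring
    · apply ContinuousOn.intervalIntegrable
      rw [uIcc_of_le zero_le_one]
      exact (c1.comp hline.continuousOn fun t ht => segment_point_mem ht).mul continuousOn_const
    · apply ContinuousOn.intervalIntegrable
      rw [uIcc_of_le zero_le_one]
      exact (c2.comp hline.continuousOn fun t ht => segment_point_mem ht).mul continuousOn_const
  · intro z hz
    have hz1 := h1 z hz
    have hz3 := h3 z hz
    have := (((hasDerivAt_id z).sub_const w).div ((hasDerivAt_id z).sub_const w') hz1).clog (h2 z hz)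
    convert! this using 1
    simp only [id, Pi.div_apply]
    field_simp

/-- Local constancy of the winding number: the logarithm of `(z - w) / (z - w')` is single valued
along the chain, and its increments sum to zero because the boundary is zero. -/
lemma chainInt_cauchyKernel_eq {U : Set ℂ} {p : ℂ} {l : List (ℂ × ℂ)} (hl : IsChain U p p l)
    {w w' : ℂ} {δ : ℝ} (hd : ∀ s ∈ l, ∀ z ∈ segment ℝ s.1 s.2, δ ≤ dist z w')
    (hw : dist w w' < δ) :
    chainInt (fun z => (z - w)⁻¹) l = chainInt (fun z => (z - w')⁻¹) l := by
  have h1 : chainInt (fun z => (z - w)⁻¹) l - chainInt (fun z => (z - w')⁻¹) l =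
      (l.map fun s => log ((s.2 - w) / (s.2 - w')) - log ((s.1 - w) / (s.1 - w'))).sum := by
    clear hl
    unfold chainInt
    induction l with
    | nil => simp
    | cons s l ih =>
      simp only [List.map_cons, List.sum_cons]
      rw [← ih fun s' hs' => hd s' (List.mem_cons_of_mem _ hs'),
        ← segInt_cauchyKernel_sub (hd s List.mem_cons_self) hw]
      ring
  have h2 := hl.2 fun z => log ((z - w) / (z - w'))
  rw [h2, sub_self] at h1
  exact sub_eq_zero.1 h1

lemma isCompact_chain (l : List (ℂ × ℂ)) :
    IsCompact {z | ∃ s ∈ l, z ∈ segment ℝ s.1 s.2} := by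
  have : {z | ∃ s ∈ l, z ∈ segment ℝ s.1 s.2} = ⋃ s ∈ {s | s ∈ l}, segment ℝ s.1 s.2 := by
    ext z; simp
  rw [this]
  exact (List.finite_toSet l).isCompact_biUnion fun s _ => by
    rw [segment_eq_image']
    exact isCompact_Icc.image (by fun_prop)

lemma dbar_eq_zero {u : ℂ → ℂ} {w : ℂ} (h : DifferentiableAt ℂ u w) : dbar u w = 0 := by
  unfold dbar
  rw [h.fderiv_restrictScalars ℝ]
  have : (fderiv ℂ u w) I = I * fderiv ℂ u w 1 := by
    rw [← smul_eq_mul, ← map_smul, smul_eq_mul, mul_one]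
  simp only [ContinuousLinearMap.coe_restrictScalars', this]
  rw [← mul_assoc, I_mul_I]
  ring

lemma dbar_congr {u v : ℂ → ℂ} {w : ℂ} (h : u =ᶠ[𝓝 w] v) : dbar u w = dbar v w := by
  unfold dbar
  rw [h.fderiv_eq]

/-- The integral is, up to a factor, the coefficient of `1 / z` of `u` at infinity. It is extracted
from the Cauchy–Pompeiu formula at the points `z = n`, multiplied by `n`: the kernel `n / (w - n)`
tends to `-1` on the support, while `n u(n)` tends to zero. -/
lemma integral_dbar_eq_zero {u : ℂ → ℂ} (hu : ContDiff ℝ 1 u)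
    (h0 : Tendsto (fun z => z * u z) (Bornology.cobounded ℂ) (𝓝 0)) {R₀ : ℝ}
    (hg : ∀ w, R₀ ≤ ‖w‖ → dbar u w = 0) : ∫ w, dbar u w = 0 := by
  have hu0 : Tendsto u (Bornology.cobounded ℂ) (𝓝 0) := by
    have := (Filter.tendsto_inv₀_cobounded (α := ℂ)).mul h0
    rw [zero_mul] at this
    refine this.congr' ?_
    filter_upwards [Bornology.isBounded_def.1 (Bornology.isBounded_singleton (x := (0 : ℂ)))] with z hz
    have : z ≠ 0 := hz
    field_simp
  have hnat : Tendsto (fun n : ℕ => (n : ℂ)) atTop (Bornology.cobounded ℂ) := by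
    rw [← tendsto_norm_atTop_iff_cobounded]
    simpa using tendsto_natCast_atTop_atTop (R := ℝ)
  have hcs : HasCompactSupport (dbar u) := by
    refine HasCompactSupport.of_support_subset_isCompact (isCompact_closedBall (0 : ℂ) R₀) ?_
    intro w hw
    rw [mem_closedBall_zero_iff]
    by_contra hcon
    exact hw (hg w (not_le.1 hcon).le)
  have hint : Integrable (dbar u) := (continuous_dbar hu).integrable_of_hasCompactSupport hcs
  have lim1 : Tendsto (fun n : ℕ => ∫ w, dbar u w * ((n : ℂ) / (w - n))) atTop
      (𝓝 (∫ w, dbar u w * (-1))) := by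
    refine tendsto_integral_filter_of_dominated_convergence (fun w => ‖dbar u w‖ * 2) ?_ ?_ ?_ ?_
    · refine Eventually.of_forall fun n => ?_
      refine hint.aestronglyMeasurable.mul ?_
      exact (measurable_const.div (measurable_id.sub_const _)).aestronglyMeasurable
    · filter_upwards [eventually_ge_atTop (2 * ⌈|R₀|⌉₊ + 1)] with n hn
      refine Eventually.of_forall fun w => ?_
      by_cases hw : R₀ ≤ ‖w‖
      · simp [hg w hw]
      · rw [norm_mul]
        gcongr
        have hn' : 2 * |R₀| + 1 ≤ n := by
          have h1 := Nat.le_ceil |R₀|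
          have h2 : ((2 * ⌈|R₀|⌉₊ + 1 : ℕ) : ℝ) ≤ n := by exact_mod_cast hn
          push_cast at h2
          linarith
        have h3 : ‖(n : ℂ)‖ = n := by simp
        have h4 : (n : ℝ) - ‖w‖ ≤ ‖w - n‖ := by
          have := norm_sub_norm_le (n : ℂ) w
          rwa [h3, norm_sub_rev] at this
        have h5 := le_abs_self R₀
        have h6 : 0 ≤ |R₀| := abs_nonneg _
        rw [not_le] at hw
        rw [norm_div, h3, div_le_iff₀ (by linarith)]
        linarith
    · exact hint.norm.mul_const 2
    · refine Eventually.of_forall fun w => ?_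
      refine Tendsto.const_mul _ ?_
      have h1 : Tendsto (fun n : ℕ => (w * ((n : ℂ))⁻¹ - 1)⁻¹) atTop (𝓝 ((w * 0 - 1)⁻¹)) := by
        refine Tendsto.inv₀ (((Filter.tendsto_inv₀_cobounded (α := ℂ)).comp hnat).const_mul w
          |>.sub_const 1) (by simp)
      have h2 : ((w * 0 - 1 : ℂ))⁻¹ = -1 := by norm_num
      rw [h2] at h1
      refine h1.congr' ?_
      filter_upwards [eventually_gt_atTop 0] with n hn
      have hn' : (n : ℂ) ≠ 0 := by exact_mod_cast hn.ne'
      rw [← inv_div]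
      congr 1
      field_simp
  have lim2 : Tendsto (fun n : ℕ => ∫ w, dbar u w * ((n : ℂ) / (w - n))) atTop (𝓝 0) := by
    have h1 := ((h0.comp hnat).const_mul (-Real.pi : ℂ))
    rw [mul_zero] at h1
    refine h1.congr fun n => ?_
    have := integral_dbar_div_sub hu hu0 hg n
    simp only [Function.comp]
    rw [mul_left_comm, ← this, ← integral_const_mul]
    congr 1
    ext w
    ring
  have := tendsto_nhds_unique lim1 lim2
  rw [integral_mul_const] at this
  simpa using this

end TripleCover

/-! ### Cauchy's theorem and primitives outside a connected compact set -/

namespace TripleCover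

open MeasureTheory Complex

/-- Fubini, legitimate because the kernel is continuous on the product of the segment and the
disjoint compact set `T`. The sign comes from exchanging `w - z` and `z - w`. -/
lemma segInt_cauchyTransform {g : ℂ → ℂ} (hg : Continuous g) {T : Set ℂ} (hT : IsCompact T)
    (hgT : ∀ w ∉ T, g w = 0) {p q : ℂ} (hpq : ∀ z ∈ segment ℝ p q, z ∉ T) :
    Integrable (fun w => g w * segInt (fun z => (z - w)⁻¹) p q) ∧
    segInt (fun z => ∫ w, g w / (w - z)) p q =
      - ∫ w, g w * segInt (fun z => (z - w)⁻¹) p q := by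
  unfold segInt
  have hzero : ∀ z, ∫ w, g w / (w - z) = ∫ w in T, g w / (w - z) := fun z => by
    symm
    refine setIntegral_eq_integral_of_forall_compl_eq_zero fun w hw => ?_
    rw [hgT w hw, zero_div]
  have hzero' : ∫ w, g w * ∫ t in (0 : ℝ)..1, (p + t * (q - p) - w)⁻¹ * (q - p) =
      ∫ w in T, g w * ∫ t in (0 : ℝ)..1, (p + t * (q - p) - w)⁻¹ * (q - p) := by
    symm
    refine setIntegral_eq_integral_of_forall_compl_eq_zero fun w hw => ?_
    rw [hgT w hw, zero_mul]
  rw [hzero']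
  simp_rw [hzero]
  simp_rw [intervalIntegral.integral_of_le zero_le_one]
  have hcont : ContinuousOn (fun x : ℝ × ℂ => g x.2 / (x.2 - (p + x.1 * (q - p))) * (q - p))
      (Icc 0 1 ×ˢ T) := by
    refine ContinuousOn.mul (ContinuousOn.div (by fun_prop) (by fun_prop) ?_) (by fun_prop)
    rintro ⟨t, w⟩ ⟨ht, hw⟩ h
    have : w = p + t * (q - p) := sub_eq_zero.1 h
    exact hpq _ (segment_point_mem ht) (this ▸ hw)
  have hint : Integrable (fun x : ℝ × ℂ => g x.2 / (x.2 - (p + x.1 * (q - p))) * (q - p))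
      ((volume.restrict (Ioc (0 : ℝ) 1)).prod (volume.restrict T)) := by
    rw [Measure.prod_restrict]
    have h1 := hcont.integrableOn_compact (μ := volume) (isCompact_Icc.prod hT)
    exact IntegrableOn.mono_set h1 (prod_mono Ioc_subset_Icc_self subset_rfl)
  have e2 : ∀ (w : ℂ) (t : ℝ), g w / (w - (p + t * (q - p))) * (q - p) =
      - (g w * ((p + t * (q - p) - w)⁻¹ * (q - p))) := fun w t => by
    have : w - (p + t * (q - p)) = - (p + t * (q - p) - w) := by ring
    rw [this, div_eq_mul_inv, inv_neg]
    ring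
  constructor
  · rw [← integrableOn_iff_integrable_of_support_subset (s := T)]
    · refine hint.integral_prod_right.neg.congr (Eventually.of_forall fun w => ?_)
      simp only [Pi.neg_apply]
      rw [← integral_const_mul, ← integral_neg]
      congr 1
      ext t
      rw [e2, neg_neg]
    · intro w hw
      by_contra hcon
      exact hw (by simp [hgT w hcon])
  have e1 : ∀ t : ℝ, (∫ w in T, g w / (w - (p + t * (q - p)))) * (q - p) =
      ∫ w in T, g w / (w - (p + t * (q - p))) * (q - p) := fun t => by
    rw [integral_mul_const]
  simp_rw [e1]
  rw [integral_integral_swap hint, ← integral_neg]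
  congr 1
  ext w
  rw [← integral_const_mul, ← integral_neg]
  congr 1
  ext t
  exact e2 w t

lemma chainInt_cauchyTransform {g : ℂ → ℂ} (hg : Continuous g) {T : Set ℂ} (hT : IsCompact T)
    (hgT : ∀ w ∉ T, g w = 0) {l : List (ℂ × ℂ)}
    (hl : ∀ s ∈ l, ∀ z ∈ segment ℝ s.1 s.2, z ∉ T) :
    chainInt (fun z => ∫ w, g w / (w - z)) l =
      - ∫ w, g w * chainInt (fun z => (z - w)⁻¹) l := by
  have hint : ∀ l' : List (ℂ × ℂ), (∀ s ∈ l', ∀ z ∈ segment ℝ s.1 s.2, z ∉ T) →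
      Integrable fun w => g w * chainInt (fun z => (z - w)⁻¹) l' := by
    intro l'
    induction l' with
    | nil => simp [chainInt]
    | cons s l' ih =>
      intro h
      have h1 := (segInt_cauchyTransform hg hT hgT (h s List.mem_cons_self)).1
      have h2 := ih fun s' hs' => h s' (List.mem_cons_of_mem _ hs')
      refine (h1.add h2).congr (Eventually.of_forall fun w => ?_)
      simp [chainInt, mul_add]
  induction l with
  | nil => simp [chainInt]
  | cons s l ih =>
    have h1 := segInt_cauchyTransform hg hT hgT (hl s List.mem_cons_self)
    have h2 := fun s' (hs' : s' ∈ l) => hl s' (List.mem_cons_of_mem _ hs')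
    have h3 := ih h2
    have e : ∀ (h : ℂ → ℂ), chainInt h (s :: l) = segInt h s.1 s.2 + chainInt h l := fun h => by
      simp [chainInt]
    simp_rw [e, mul_add]
    rw [h1.2, h3, integral_add h1.1 (hint l h2)]
    ring

open Manifold in
lemma exists_cutoff {K T : Set ℂ} (hK : IsClosed K) (hKT : K ⊆ interior T) :
    ∃ χ : ℂ → ℝ, ContDiff ℝ 1 χ ∧ (∀ᶠ x in 𝓝ˢ K, χ x = 1) ∧ ∀ x ∉ T, χ x = 0 := by
  obtain ⟨f, h1, h2, -⟩ := exists_contMDiffMap_one_nhds_of_subset_interior (𝓘(ℝ, ℂ)) (n := 1) hK hKT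
  exact ⟨f, f.contMDiff.contDiff, h1, h2⟩

/-- Cauchy's theorem outside a compact connected set, for functions that vanish to order at least
two at infinity. -/
lemma chainInt_eq_zero {K : Set ℂ} (hK : IsCompact K) (hKc : IsPreconnected K) {h : ℂ → ℂ}
    (hh : DifferentiableOn ℂ h Kᶜ)
    (hinf : Tendsto (fun z => z * h z) (Bornology.cobounded ℂ) (𝓝 0)) {p : ℂ}
    {l : List (ℂ × ℂ)} (hl : IsChain Kᶜ p p l) : chainInt h l = 0 := by
  set S := {z | ∃ s ∈ l, z ∈ segment ℝ s.1 s.2} with hS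
  have hdisj : Disjoint K S := by
    rw [Set.disjoint_left]
    rintro z hz ⟨s, hs, hzs⟩
    exact hl.1 s hs hzs hz
  obtain ⟨δ, hδ, hd⟩ := hdisj.exists_thickenings hK (isCompact_chain l).isClosed
  have hdist : ∀ z ∈ S, ∀ w ∈ K, δ ≤ dist z w := fun z hz w hw => by
    by_contra hcon
    rw [not_le] at hcon
    exact Set.disjoint_left.1 hd (Metric.mem_thickening_iff.2 ⟨w, hw, hcon⟩)
      (Metric.self_subset_thickening hδ S hz)
  set T := Metric.cthickening (δ / 2) K with hTdef
  have hT : IsCompact T := hK.cthickening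
  have hTmem : ∀ w ∈ T, ∃ k ∈ K, dist w k < δ := by
    intro w hw
    rw [hTdef, hK.cthickening_eq_biUnion_closedBall (by positivity)] at hw
    obtain ⟨k, hk, hwk⟩ := mem_iUnion₂.1 hw
    exact ⟨k, hk, (Metric.mem_closedBall.1 hwk).trans_lt (by linarith)⟩
  have hST : ∀ z ∈ S, z ∉ T := fun z hz hzT => by
    obtain ⟨k, hk, hzk⟩ := hTmem z hzT
    exact absurd (hdist z hz k hk) (not_le.2 hzk)
  have hKT : K ⊆ interior T :=
    (Metric.self_subset_thickening (by positivity) K).trans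
      (interior_maximal (Metric.thickening_subset_cthickening _ _) Metric.isOpen_thickening)
  obtain ⟨χ, hχ, hχ1, hχ0⟩ := exists_cutoff hK.isClosed hKT
  rw [eventually_nhdsSet_iff_forall] at hχ1
  -- Cutting `h` off near `K` gives a globally `C¹` function that equals `h` on the chain and at
  -- infinity. There `h` is thus a Cauchy transform of `dbar u`, which is supported in `T`.
  set u : ℂ → ℂ := fun z => (1 - χ z : ℝ) * h z with hu
  have hKo : IsOpen Kᶜ := hK.isClosed.isOpen_compl
  have hun : ∀ z ∈ K, u =ᶠ[𝓝 z] fun _ => 0 := fun z hz => by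
    filter_upwards [hχ1 z hz] with x hx
    simp [hu, hx]
  have huc : ContDiff ℝ 1 u := by
    rw [contDiff_iff_contDiffAt]
    intro z
    by_cases hz : z ∈ K
    · exact (contDiffAt_const (c := (0 : ℂ))).congr_of_eventuallyEq (hun z hz)
    · have h1 : ContDiffAt ℝ 1 h z := by
        have : ContDiffOn ℂ 1 h Kᶜ := hh.contDiffOn hKo
        exact (this.contDiffAt (hKo.mem_nhds hz)).restrict_scalars ℝ
      exact (ofRealCLM.contDiff.contDiffAt.comp z
        (contDiff_const.sub hχ).contDiffAt).mul h1
  have huT : ∀ z ∉ T, u =ᶠ[𝓝 z] h := fun z hz => by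
    filter_upwards [hT.isClosed.isOpen_compl.mem_nhds hz] with x hx
    simp [hu, hχ0 x hx]
  have hKsub : K ⊆ T := hKT.trans interior_subset
  have hgT : ∀ w ∉ T, dbar u w = 0 := fun w hw => by
    rw [dbar_congr (huT w hw)]
    exact dbar_eq_zero (hh.differentiableAt (hKo.mem_nhds fun hwK => hw (hKsub hwK)))
  obtain ⟨R, hR⟩ := hT.isBounded.subset_closedBall 0
  have hgR : ∀ w, R + 1 ≤ ‖w‖ → dbar u w = 0 := fun w hw => hgT w fun hwT => by
    have := hR hwT
    rw [mem_closedBall_zero_iff] at this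
    linarith
  have hu0 : Tendsto (fun z => z * u z) (Bornology.cobounded ℂ) (𝓝 0) := by
    refine hinf.congr' ?_
    filter_upwards [Bornology.isBounded_def.1 hT.isBounded] with z hz
    rw [(huT z hz).eq_of_nhds]
  have hu00 : Tendsto u (Bornology.cobounded ℂ) (𝓝 0) := by
    have := (Filter.tendsto_inv₀_cobounded (α := ℂ)).mul hu0
    rw [zero_mul] at this
    refine this.congr' ?_
    filter_upwards [Bornology.isBounded_def.1 (Bornology.isBounded_singleton (x := (0 : ℂ)))]
      with z hz
    have : z ≠ 0 := hz
    field_simp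
  have hrep : ∀ z ∈ S, h z = (-(Real.pi : ℂ))⁻¹ * ∫ w, dbar u w / (w - z) := fun z hz => by
    have hpi : (Real.pi : ℂ) ≠ 0 := by exact_mod_cast Real.pi_ne_zero
    rw [integral_dbar_div_sub huc hu00 hgR z, (huT z (hST z hz)).eq_of_nhds]
    field_simp
  have e1 : chainInt h l = (-(Real.pi : ℂ))⁻¹ * chainInt (fun z => ∫ w, dbar u w / (w - z)) l := by
    have : ∀ l' : List (ℂ × ℂ), (∀ s ∈ l', s ∈ l) →
        chainInt h l' = (-(Real.pi : ℂ))⁻¹ * chainInt (fun z => ∫ w, dbar u w / (w - z)) l' := by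
      intro l'
      induction l' with
      | nil => simp [chainInt]
      | cons s l' ih =>
        intro hs
        have := ih fun s' hs' => hs s' (List.mem_cons_of_mem _ hs')
        unfold chainInt at this ⊢
        simp only [List.map_cons, List.sum_cons]
        rw [this, mul_add]
        congr 1
        unfold segInt
        rw [← intervalIntegral.integral_const_mul]
        refine intervalIntegral.integral_congr fun t ht => ?_
        rw [uIcc_of_le zero_le_one] at ht
        simp only
        rw [hrep _ ⟨s, hs s List.mem_cons_self, segment_point_mem ht⟩, mul_assoc]
    exact this l fun _ => id
  rw [e1, chainInt_cauchyTransform (continuous_dbar huc) hT hgT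
    (fun s hs z hz => hST z ⟨s, hs, hz⟩)]
  rcases K.eq_empty_or_nonempty with hKe | ⟨k₀, hk₀⟩
  · have : ∀ w, dbar u w = 0 := fun w => hgT w (by simp [hTdef, hKe])
    simp [this]
  -- This is where connectedness of `K` enters: the closed chain has the same winding number around
  -- all points of `K`, hence of `T`. It can be pulled out, leaving `∫ dbar u = 0`.
  have hconst : ∀ k ∈ K, chainInt (fun z => (z - k)⁻¹) l = chainInt (fun z => (z - k₀)⁻¹) l := by
    intro k hk
    refine hKc.induction₂ (fun a b => chainInt (fun z => (z - a)⁻¹) l =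
      chainInt (fun z => (z - b)⁻¹) l) ?_ (fun _ _ _ _ _ _ => Eq.trans) (fun _ _ _ _ => Eq.symm)
      hk hk₀
    intro x hx
    filter_upwards [nhdsWithin_le_nhds (Metric.ball_mem_nhds x hδ)] with y hy
    exact (chainInt_cauchyKernel_eq hl (fun s hs z hz => hdist z ⟨s, hs, hz⟩ x hx) hy).symm
  have e2 : ∫ w, dbar u w * chainInt (fun z => (z - w)⁻¹) l =
      ∫ w, dbar u w * chainInt (fun z => (z - k₀)⁻¹) l := by
    congr 1
    ext w
    by_cases hw : w ∈ T
    · obtain ⟨k, hk, hwk⟩ := hTmem w hw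
      rw [chainInt_cauchyKernel_eq hl (fun s hs z hz => hdist z ⟨s, hs, hz⟩ k hk) hwk, hconst k hk]
    · rw [hgT w hw, zero_mul, zero_mul]
  rw [e2, integral_mul_const, integral_dbar_eq_zero huc hu0 hgR]
  simp

/-- A holomorphic function on the complement of a compact connected set that vanishes to order at
least two at infinity has a primitive. -/
theorem exists_primitive {K : Set ℂ} (hK : IsCompact K) (hKc : IsPreconnected K) {h : ℂ → ℂ}
    (hh : DifferentiableOn ℂ h Kᶜ)
    (hinf : Tendsto (fun z => z * h z) (Bornology.cobounded ℂ) (𝓝 0)) :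
    ∃ F : ℂ → ℂ, ∀ z ∈ Kᶜ, HasDerivAt F (h z) z := by
  -- The complement of `K` is not assumed connected, so a base point is chosen in each class of
  -- points joined by chains; the primitive is the integral from that base point.
  let r : Setoid ℂ := ⟨fun p q => ∃ l, IsChain Kᶜ p q l, fun p => ⟨[], .nil _ p⟩,
    fun ⟨l, hl⟩ => ⟨_, hl.swap⟩, fun ⟨_, hl⟩ ⟨_, hl'⟩ => ⟨_, hl.append hl'⟩⟩
  have hout : ∀ z, ∃ l, IsChain Kᶜ (Quotient.mk r z).out z l := fun z => Quotient.mk_out (s := r) z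
  choose c hc using hout
  refine ⟨fun z => chainInt h (c z), fun z hz => ?_⟩
  have hKo : IsOpen Kᶜ := hK.isClosed.isOpen_compl
  obtain ⟨ε, hε, hball⟩ := Metric.isOpen_iff.1 hKo z hz
  obtain ⟨Φ, hΦ⟩ := (hh.mono hball).isExactOn_ball
  have hloc : (fun z' => chainInt h (c z')) =ᶠ[𝓝 z]
      fun z' => chainInt h (c z) + (Φ z' - Φ z) := by
    filter_upwards [Metric.ball_mem_nhds z hε] with z' hz'
    have hsegb : segment ℝ z z' ⊆ Metric.ball z ε :=
      (convex_ball z ε).segment_subset (Metric.mem_ball_self hε) hz'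
    have hseg : segment ℝ z z' ⊆ Kᶜ := hsegb.trans hball
    have hrel : Quotient.mk r z = Quotient.mk r z' := Quotient.sound ⟨_, .single hseg⟩
    have h1 := hc z'
    rw [← hrel] at h1
    have h2 := chainInt_eq_zero hK hKc hh hinf (((hc z).append (.single hseg)).append h1.swap)
    rw [chainInt_append, chainInt_append, chainInt_swap] at h2
    have h3 : chainInt h [(z, z')] = Φ z' - Φ z := by
      simp only [chainInt, List.map_cons, List.map_nil, List.sum_cons, List.sum_nil, add_zero]
      exact segInt_eq_sub (fun x hx => hΦ x (hsegb hx)) (hh.continuousOn.mono hseg)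
    rw [h3] at h2
    linear_combination -h2
  refine HasDerivAt.congr_of_eventuallyEq ?_ hloc
  exact ((hΦ z (Metric.mem_ball_self hε)).sub_const _).const_add _

end TripleCover

/-! ### Regular arcs and their two sides -/

namespace TripleCover

open Complex

/-- An embedded regular `C¹` arc, parametrized by `[0, 1]`. -/
structure IsArc (γ : ℝ → ℂ) : Prop where
  contDiffOn : ContDiffOn ℝ 1 γ (Icc 0 1)
  regular : ∀ s ∈ Icc (0 : ℝ) 1, derivWithin γ (Icc 0 1) s ≠ 0
  injOn : InjOn γ (Icc 0 1)

namespace IsArc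

variable {γ : ℝ → ℂ}

lemma hasDerivWithinAt (h : IsArc γ) {s : ℝ} (hs : s ∈ Icc (0 : ℝ) 1) :
    HasDerivWithinAt γ (derivWithin γ (Icc 0 1) s) (Icc 0 1) s :=
  ((h.contDiffOn.differentiableOn one_ne_zero) s hs).hasDerivWithinAt

lemma hasDerivAt (h : IsArc γ) {s : ℝ} (hs : s ∈ Ioo (0 : ℝ) 1) :
    HasDerivAt γ (derivWithin γ (Icc 0 1) s) s :=
  (h.hasDerivWithinAt (Ioo_subset_Icc_self hs)).hasDerivAt (Icc_mem_nhds hs.1 hs.2)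

lemma continuousOn (h : IsArc γ) : ContinuousOn γ (Icc 0 1) := h.contDiffOn.continuousOn

lemma continuousOn_derivWithin (h : IsArc γ) :
    ContinuousOn (derivWithin γ (Icc 0 1)) (Icc 0 1) :=
  h.contDiffOn.continuousOn_derivWithin (uniqueDiffOn_Icc one_pos) le_rfl

lemma isCompact_image (h : IsArc γ) : IsCompact (γ '' Icc 0 1) :=
  isCompact_Icc.image_of_continuousOn h.continuousOn

/-- A linear reparametrization of a piece of an arc (possibly reversing the direction). -/
lemma comp_affine (h : IsArc γ) {a b : ℝ} (hb : b ≠ 0)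
    (hab : ∀ s ∈ Icc (0 : ℝ) 1, a + b * s ∈ Icc (0 : ℝ) 1) : IsArc fun s => γ (a + b * s) := by
  have hd : ∀ s ∈ Icc (0 : ℝ) 1, HasDerivWithinAt (fun s => γ (a + b * s))
      (b • derivWithin γ (Icc 0 1) (a + b * s)) (Icc 0 1) s := fun s hs => by
    have h1 : HasDerivWithinAt (fun s : ℝ => a + b * s) b (Icc 0 1) s := by
      simpa using (((hasDerivAt_id s).const_mul b).const_add a).hasDerivWithinAt
    exact (h.hasDerivWithinAt (hab s hs)).scomp s h1 hab
  refine ⟨h.contDiffOn.comp (by fun_prop) hab, fun s hs => ?_, fun s hs s' hs' e => ?_⟩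
  · rw [(hd s hs).derivWithin (uniqueDiffOn_Icc one_pos s hs)]
    exact smul_ne_zero hb (h.regular _ (hab s hs))
  · have := h.injOn (hab s hs) (hab s' hs') e
    exact mul_left_cancel₀ hb (add_left_cancel this)

lemma reverse (h : IsArc γ) : IsArc fun s => γ (1 + -1 * s) :=
  h.comp_affine (by norm_num) fun s hs => ⟨by linarith [hs.2], by linarith [hs.1]⟩

/-- The expansion of an arc at its starting point. -/
lemma exists_expansion (h : IsArc γ) {ε : ℝ} (hε : 0 < ε) :
    ∃ s₁ ∈ Ioo (0 : ℝ) 1, ∀ s ∈ Icc 0 s₁,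
      ‖derivWithin γ (Icc 0 1) s - derivWithin γ (Icc 0 1) 0‖ ≤ ε ∧
      ‖γ s - γ 0 - s • derivWithin γ (Icc 0 1) 0‖ ≤ ε * s := by
  set v := derivWithin γ (Icc 0 1) 0 with hv
  have h0 : (0 : ℝ) ∈ Icc (0 : ℝ) 1 := ⟨le_rfl, zero_le_one⟩
  have hc := h.continuousOn_derivWithin 0 h0
  rw [Metric.continuousWithinAt_iff] at hc
  obtain ⟨δ, hδ, hc⟩ := hc ε hε
  obtain ⟨s₁, hs₁, hs₁δ, hs₁1⟩ : ∃ s₁ > 0, s₁ < δ ∧ s₁ < 1 :=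
    ⟨min (δ / 2) (1 / 2), by positivity, (min_le_left _ _).trans_lt (by linarith),
      (min_le_right _ _).trans_lt (by norm_num)⟩
  have hsub : ∀ s ∈ Icc 0 s₁, s ∈ Icc (0 : ℝ) 1 := fun s hs => ⟨hs.1, hs.2.trans hs₁1.le⟩
  have hder : ∀ s ∈ Icc 0 s₁, ‖derivWithin γ (Icc 0 1) s - v‖ ≤ ε := by
    intro s hs
    have := hc (hsub s hs) (by
      rw [Real.dist_0_eq_abs, abs_of_nonneg hs.1]
      exact hs.2.trans_lt hs₁δ)
    rw [dist_eq_norm] at this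
    exact this.le
  refine ⟨s₁, ⟨hs₁, hs₁1⟩, fun s hs => ⟨hder s hs, ?_⟩⟩
  have hd : ∀ s ∈ Icc 0 s₁, HasDerivWithinAt (fun s : ℝ => γ s - γ 0 - s • v)
      (derivWithin γ (Icc 0 1) s - v) (Icc 0 s₁) s := by
    intro s hs
    have h0 : HasDerivWithinAt γ (derivWithin γ (Icc 0 1) s) (Icc 0 s₁) s :=
      (h.hasDerivWithinAt (hsub s hs)).mono hsub
    have h1 := h0.sub_const (γ 0)
    have h2 := (hasDerivWithinAt_id s (Icc 0 s₁)).smul_const v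
    rw [one_smul] at h2
    exact h1.sub h2
  have := (convex_Icc (0 : ℝ) s₁).norm_image_sub_le_of_norm_hasDerivWithin_le
    hd hder (left_mem_Icc.2 hs₁.le) hs
  simpa [abs_of_nonneg hs.1] using this

/-- Near its starting point an arc leaves all circles around it, in a half plane. -/
lemma exists_strictMonoOn (h : IsArc γ) :
    ∃ s₁ ∈ Ioo (0 : ℝ) 1, StrictMonoOn (fun s => dist (γ s) (γ 0)) (Icc 0 s₁) ∧
      ∀ s ∈ Ioc 0 s₁, 0 < inner ℝ (derivWithin γ (Icc 0 1) 0) (γ s - γ 0) := by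
  set v := derivWithin γ (Icc 0 1) 0 with hv
  have hv0 : v ≠ 0 := h.regular 0 ⟨le_rfl, zero_le_one⟩
  have hvp : 0 < ‖v‖ := norm_pos_iff.2 hv0
  -- With this tolerance the three error terms in the inner product below amount to at most `1/4 +
  -- 1/4 + 1/16` of the main term `s ‖v‖ ^ 2`.
  obtain ⟨s₁, hs₁, he⟩ := h.exists_expansion (ε := ‖v‖ / 4) (by positivity)
  have key : ∀ s ∈ Ioc 0 s₁, ∀ w : ℂ, ‖w - v‖ ≤ ‖v‖ / 4 → 0 < inner ℝ w (γ s - γ 0) := by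
    intro s hs w hw
    have h2 := (he s ⟨hs.1.le, hs.2⟩).2
    set e₁ := γ s - γ 0 - s • v with he₁
    set e₂ := w - v with he₂
    have e1 : γ s - γ 0 = s • v + e₁ := by rw [he₁]; abel
    have e2 : w = v + e₂ := by rw [he₂]; abel
    rw [e1, e2, inner_add_left, inner_add_right, inner_add_right, inner_smul_right,
      inner_smul_right, real_inner_self_eq_norm_sq]
    have i1 := abs_le.1 (abs_real_inner_le_norm v e₁)
    have i2 := abs_le.1 (abs_real_inner_le_norm e₂ v)
    have i3 := abs_le.1 (abs_real_inner_le_norm e₂ e₁)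
    have hs0 := hs.1
    have j1 : ‖v‖ * ‖e₁‖ ≤ s * (‖v‖ ^ 2 / 4) := by nlinarith
    have j2 : ‖e₂‖ * ‖v‖ ≤ ‖v‖ ^ 2 / 4 := by nlinarith
    have j3 : ‖e₂‖ * ‖e₁‖ ≤ s * (‖v‖ ^ 2 / 16) := by
      calc ‖e₂‖ * ‖e₁‖ ≤ (‖v‖ / 4) * (‖v‖ / 4 * s) := by gcongr
        _ = _ := by ring
    have j4 : s * inner ℝ e₂ v ≥ - (s * (‖v‖ ^ 2 / 4)) := by nlinarith
    have : 0 < s * ‖v‖ ^ 2 := by positivity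
    linarith
  refine ⟨s₁, hs₁, ?_, fun s hs => key s hs v (by simp; positivity)⟩
  have hsub : ∀ s ∈ Icc 0 s₁, s ∈ Icc (0 : ℝ) 1 := fun s hs => ⟨hs.1, hs.2.trans hs₁.2.le⟩
  have hsq : StrictMonoOn (fun s => ‖γ s - γ 0‖ ^ 2) (Icc 0 s₁) := by
    refine strictMonoOn_of_deriv_pos (convex_Icc _ _) ?_ ?_
    · exact ((h.continuousOn.mono hsub).sub continuousOn_const).norm.pow 2
    · intro s hs
      rw [interior_Icc] at hs
      have h1 := ((h.hasDerivAt ⟨hs.1, hs.2.trans hs₁.2⟩).sub_const (γ 0)).norm_sq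
      rw [h1.deriv, real_inner_comm]
      have := key s ⟨hs.1, hs.2.le⟩ _ (he s ⟨hs.1.le, hs.2.le⟩).1
      linarith
  intro s hs s' hs' hss
  have := hsq hs hs' hss
  simp only [dist_eq_norm]
  exact lt_of_pow_lt_pow_left₀ 2 (norm_nonneg _) this

lemma exists_far (h : IsArc γ) {s₁ : ℝ} (hs₁ : 0 < s₁) :
    ∃ η > 0, ∀ s ∈ Icc s₁ 1, η ≤ dist (γ s) (γ 0) := by
  have hsub : Icc s₁ 1 ⊆ Icc (0 : ℝ) 1 := Icc_subset_Icc_left hs₁.le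
  have hK : IsCompact (γ '' Icc s₁ 1) :=
    isCompact_Icc.image_of_continuousOn (h.continuousOn.mono hsub)
  have h0 : γ 0 ∉ γ '' Icc s₁ 1 := by
    rintro ⟨s, hs, e⟩
    have := h.injOn (hsub hs) ⟨le_rfl, zero_le_one⟩ e
    linarith [hs.1]
  obtain ⟨η, hη, hb⟩ := Metric.isOpen_iff.1 hK.isClosed.isOpen_compl _ h0
  refine ⟨η, hη, fun s hs => ?_⟩
  by_contra hcon
  exact hb (Metric.mem_ball.2 (not_le.1 hcon)) ⟨s, hs, rfl⟩

/-- Small circles around the starting point of an arc meet it exactly once. -/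
lemma exists_circle (h : IsArc γ) : ∃ ρ₀ > 0, ∀ ρ ∈ Ioo 0 ρ₀, ∃ s ∈ Ioo (0 : ℝ) 1,
    ∀ s' ∈ Icc (0 : ℝ) 1, dist (γ s') (γ 0) = ρ ↔ s' = s := by
  obtain ⟨s₁, hs₁, hmono, -⟩ := h.exists_strictMonoOn
  obtain ⟨η, hη, hfar⟩ := h.exists_far hs₁.1
  refine ⟨η, hη, fun ρ hρ => ?_⟩
  have hsub : Icc 0 s₁ ⊆ Icc (0 : ℝ) 1 := Icc_subset_Icc_right hs₁.2.le
  have hc : ContinuousOn (fun s => dist (γ s) (γ 0)) (Icc 0 s₁) :=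
    continuous_dist.comp_continuousOn ((h.continuousOn.mono hsub).prodMk continuousOn_const)
  have hρmem : ρ ∈ Icc ((fun s => dist (γ s) (γ 0)) 0) ((fun s => dist (γ s) (γ 0)) s₁) := by
    simp only [dist_self]
    exact ⟨hρ.1.le, hρ.2.le.trans (hfar s₁ ⟨le_rfl, hs₁.2.le⟩)⟩
  obtain ⟨s, hs, hsρ⟩ := intermediate_value_Icc hs₁.1.le hc hρmem
  simp only at hsρ
  have hs0 : 0 < s := by
    rcases hs.1.eq_or_lt with h0 | h0
    · rw [← h0, dist_self] at hsρ
      exact absurd hρ.1 (by rw [hsρ]; exact lt_irrefl _)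
    · exact h0
  refine ⟨s, ⟨hs0, hs.2.trans_lt hs₁.2⟩, fun s' hs' => ⟨fun e => ?_, fun e => e ▸ hsρ⟩⟩
  have hs's : s' ∈ Icc 0 s₁ := by
    refine ⟨hs'.1, ?_⟩
    by_contra hcon
    have := hfar s' ⟨(not_le.1 hcon).le, hs'.2⟩
    linarith [hρ.2]
  exact hmono.injOn hs's hs (e.trans hsρ.symm)

/-- The ray opposite to the direction of an arc at its starting point does not meet it nearby. -/
lemma exists_ray (h : IsArc γ) : ∃ u : ℂ, ‖u‖ = 1 ∧ ∃ ρ₀ > 0, ∀ ρ ∈ Ioo (0 : ℝ) ρ₀,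
    γ 0 + ρ * u ∉ γ '' Icc 0 1 := by
  obtain ⟨s₁, hs₁, -, hpos⟩ := h.exists_strictMonoOn
  obtain ⟨η, hη, hfar⟩ := h.exists_far hs₁.1
  set v := derivWithin γ (Icc 0 1) 0 with hv
  have hv0 : v ≠ 0 := h.regular 0 ⟨le_rfl, zero_le_one⟩
  have hvp : 0 < ‖v‖ := norm_pos_iff.2 hv0
  have hu : ‖(-(‖v‖⁻¹ : ℝ)) • v‖ = 1 := by
    rw [norm_smul, norm_neg, norm_inv, norm_norm, inv_mul_cancel₀ hvp.ne']
  refine ⟨(-(‖v‖⁻¹ : ℝ)) • v, hu, η, hη, ?_⟩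
  rintro ρ hρ ⟨s, hs, e⟩
  have hdist : γ s - γ 0 = ρ * ((-(‖v‖⁻¹ : ℝ)) • v) := by rw [e]; ring
  have hd : dist (γ s) (γ 0) = ρ := by
    rw [dist_eq_norm, hdist, norm_mul, hu, mul_one, norm_real, Real.norm_of_nonneg hρ.1.le]
  have hs0 : 0 < s := by
    rcases hs.1.eq_or_lt with h0 | h0
    · rw [← h0, dist_self] at hd
      linarith [hρ.1]
    · exact h0
  have hss : s ≤ s₁ := by
    by_contra hcon
    have := hfar s ⟨(not_le.1 hcon).le, hs.2⟩
    linarith [hρ.2]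
  have := hpos s ⟨hs0, hss⟩
  rw [hdist, ← real_smul, inner_smul_right, inner_smul_right, real_inner_self_eq_norm_sq] at this
  have h3 : 0 < ρ * (‖v‖⁻¹ * ‖v‖ ^ 2) := mul_pos hρ.1 (by positivity)
  linarith

end IsArc

/-- Points of `Γ` near `x` separate a neighbourhood of `x` into at most two sides. -/
def TwoSided (Γ : Set ℂ) (x : ℂ) : Prop :=
  ∀ V ∈ 𝓝 x, ∃ U ⊆ V, IsOpen U ∧ x ∈ U ∧ ∃ S S' : Set ℂ, IsPreconnected S ∧ IsPreconnected S' ∧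
    S ∪ S' = U \ Γ ∧ ∀ x' ∈ U ∩ Γ, x' ∈ closure S ∧ x' ∈ closure S'

/-- The map `x + iy ↦ γ(x) + y i γ'(s)` has invertible derivative at `s`, hence straightens the arc
to the real axis. The distant part of the arc and `K` are closed and miss `γ s`, so in the image of
a small box only the axis is left, and the upper and lower half boxes are the sides. -/
lemma IsArc.twoSided {γ : ℝ → ℂ} (h : IsArc γ) {s : ℝ} (hs : s ∈ Ioo (0 : ℝ) 1) {K : Set ℂ}
    (hK : IsClosed K) (hsK : γ s ∉ K) : TwoSided (γ '' Icc 0 1 ∪ K) (γ s) := by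
  intro V hV
  set v := derivWithin γ (Icc 0 1) s with hv
  have hv0 : v ≠ 0 := h.regular s (Ioo_subset_Icc_self hs)
  have hstrict : HasStrictDerivAt γ v s := by
    have h1 : ContDiffAt ℝ 1 γ s := h.contDiffOn.contDiffAt (Icc_mem_nhds hs.1 hs.2)
    have h2 := h1.hasStrictDerivAt one_ne_zero
    rwa [(h.hasDerivAt hs).deriv] at h2
  set Ψ : ℂ → ℂ := fun z => γ z.re + z.im * (I * v) with hΨ
  set L : ℂ ≃L[ℝ] ℂ :=
    (ContinuousLinearEquiv.unitsEquivAut ℂ (Units.mk0 v hv0)).restrictScalars ℝ with hL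
  have hLapp : ∀ w, L w = w * v := fun w => rfl
  have hΨs : HasStrictFDerivAt Ψ (L : ℂ →L[ℝ] ℂ) (s : ℂ) := by
    have h1 : HasStrictFDerivAt (fun z : ℂ => γ z.re) _ (s : ℂ) :=
      HasStrictFDerivAt.comp (s : ℂ) (g := γ) (f := fun z : ℂ => z.re)
        (by simpa using hstrict.hasStrictFDerivAt) reCLM.hasStrictFDerivAt
    have h2 : HasStrictFDerivAt (fun z : ℂ => (z.im : ℂ) * (I * v)) _ (s : ℂ) :=
      ((ofRealCLM.comp imCLM).hasStrictFDerivAt (x := (s : ℂ))).mul_const' (I * v)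
    refine (h1.add h2).congr_fderiv ?_
    ext w
    simp only [_root_.add_apply, ContinuousLinearMap.comp_apply,
      ContinuousLinearEquiv.coe_coe, hLapp]
    simp
    apply Complex.ext <;> simp
    ring
  set e := hΨs.toOpenPartialHomeomorph Ψ with he
  have hse : (s : ℂ) ∈ e.source := hΨs.mem_toOpenPartialHomeomorph_source
  have hcoe : ⇑e = Ψ := hΨs.toOpenPartialHomeomorph_coe
  -- a box on which `Ψ` is injective
  obtain ⟨δ, hδ, hbox⟩ : ∃ δ > 0, ∀ z : ℂ, |z.re - s| < δ → |z.im| < δ → z ∈ e.source := by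
    obtain ⟨δ, hδ, hb⟩ := Metric.isOpen_iff.1 e.open_source _ hse
    refine ⟨δ / 2, by positivity, fun z h1 h2 => hb ?_⟩
    rw [Metric.mem_ball, dist_eq]
    refine (norm_le_abs_re_add_abs_im _).trans_lt ?_
    simp only [sub_re, ofReal_re, sub_im, ofReal_im, sub_zero]
    linarith
  have hinj : ∀ z z' : ℂ, z ∈ e.source → z' ∈ e.source → Ψ z = Ψ z' → z = z' :=
    fun z z' hz hz' hzz => e.injOn hz hz' (by rw [hcoe]; exact hzz)
  -- the far part of the arc
  have hfarK : IsCompact (γ '' (Icc 0 1 \ Ioo (s - δ) (s + δ))) :=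
    (isCompact_Icc.diff isOpen_Ioo).image_of_continuousOn (h.continuousOn.mono sdiff_subset)
  have hsfar : γ s ∉ γ '' (Icc 0 1 \ Ioo (s - δ) (s + δ)) := by
    rintro ⟨s', hs', e'⟩
    have := h.injOn hs'.1 (Ioo_subset_Icc_self hs) e'
    exact hs'.2 (by rw [this]; exact ⟨by linarith, by linarith⟩)
  have hnhds : V ∩ (γ '' (Icc 0 1 \ Ioo (s - δ) (s + δ)))ᶜ ∩ Kᶜ ∈ 𝓝 (Ψ s) := by
    have : Ψ s = γ s := by simp [hΨ]
    rw [this]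
    exact inter_mem (inter_mem hV (hfarK.isClosed.isOpen_compl.mem_nhds hsfar))
      (hK.isOpen_compl.mem_nhds hsK)
  have hcont : ContinuousAt Ψ s := hΨs.continuousAt
  obtain ⟨δ', hδ', hbox'⟩ : ∃ δ' > 0, δ' ≤ δ ∧ δ' < s ∧ δ' < 1 - s ∧
      ∀ z : ℂ, |z.re - s| < δ' → |z.im| < δ' →
        Ψ z ∈ V ∩ (γ '' (Icc 0 1 \ Ioo (s - δ) (s + δ)))ᶜ ∩ Kᶜ := by
    obtain ⟨δ₂, hδ₂, hb⟩ := Metric.mem_nhds_iff.1 (hcont.preimage_mem_nhds hnhds)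
    have h1s : 0 < 1 - s := by linarith [hs.2]
    have hs0 := hs.1
    refine ⟨min (min δ (δ₂ / 2)) (min (s / 2) ((1 - s) / 2)), by positivity,
      (min_le_left _ _).trans (min_le_left _ _), ?_, ?_, fun z h1 h2 => hb ?_⟩
    · exact ((min_le_right _ _).trans (min_le_left _ _)).trans_lt (by linarith)
    · exact ((min_le_right _ _).trans (min_le_right _ _)).trans_lt (by linarith)
    rw [Metric.mem_ball, dist_eq]
    refine (norm_le_abs_re_add_abs_im _).trans_lt ?_
    simp only [sub_re, ofReal_re, sub_im, ofReal_im, sub_zero]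
    have : min (min δ (δ₂ / 2)) (min (s / 2) ((1 - s) / 2)) ≤ δ₂ / 2 :=
      (min_le_left _ _).trans (min_le_right _ _)
    linarith
  obtain ⟨hδδ, hδs, hδ1, hbox'⟩ := hbox'
  have hsrc : ∀ z : ℂ, |z.re - s| < δ' → |z.im| < δ' → z ∈ e.source :=
    fun z h1 h2 => hbox z (h1.trans_le hδδ) (h2.trans_le hδδ)
  set Q : Set ℂ := {z | |z.re - s| < δ' ∧ |z.im| < δ'} with hQ
  have hQo : IsOpen Q :=
    (isOpen_lt (f := fun z : ℂ => |z.re - s|) (by fun_prop) continuous_const).inter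
      (isOpen_lt (f := fun z : ℂ => |z.im|) (by fun_prop) continuous_const)
  have hQs : Q ⊆ e.source := fun z hz => hsrc z hz.1 hz.2
  have hconv : ∀ z ∈ Q, z.re ∈ Icc (0 : ℝ) 1 := fun z hz => by
    have := abs_lt.1 hz.1
    exact ⟨by linarith, by linarith⟩
  have honarc : ∀ z ∈ Q, Ψ z ∈ γ '' Icc 0 1 ∪ K ↔ z.im = 0 := by
    intro z hz
    constructor
    · rintro (⟨s', hs', e'⟩ | hzK)
      · have hnear : s' ∈ Ioo (s - δ) (s + δ) := by
          by_contra hcon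
          exact (hbox' z hz.1 hz.2).1.2 ⟨s', ⟨hs', hcon⟩, e'⟩
        have h1 : Ψ (s' : ℂ) = Ψ z := by rw [← e']; simp [hΨ]
        have h2 := hinj _ _ (hbox (s' : ℂ) (by
          rw [ofReal_re, abs_lt]; exact ⟨by linarith [hnear.1], by linarith [hnear.2]⟩)
          (by simpa using hδ)) (hQs hz) h1
        rw [← h2, ofReal_im]
      · exact absurd hzK (hbox' z hz.1 hz.2).2
    · intro h0
      left
      exact ⟨z.re, hconv z hz, by simp [hΨ, h0]⟩
  have hΨc : ContinuousOn Ψ Q := by rw [← hcoe]; exact e.continuousOn.mono hQs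
  have hre : ∀ t : ℝ, Convex ℝ {z : ℂ | |z.re - s| < t} := fun t => by
    have : {z : ℂ | |z.re - s| < t} = reCLM ⁻¹' Metric.ball s t := by
      ext z; simp [Real.dist_eq]
    rw [this]
    exact (convex_ball s t).is_linear_preimage reCLM.isBoundedLinearMap.toIsLinearMap
  have him : ∀ J : Set ℝ, Convex ℝ J → Convex ℝ {z : ℂ | z.im ∈ J} := fun J hJ =>
    hJ.is_linear_preimage imCLM.isBoundedLinearMap.toIsLinearMap
  have hpre : ∀ J : Set ℝ, Convex ℝ J → J ⊆ Ioo (-δ') δ' →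
      IsPreconnected (Ψ '' {z | |z.re - s| < δ' ∧ z.im ∈ J}) := by
    intro J hJ hJδ
    refine ((hre δ').inter (him J hJ)).isPreconnected.image _ (hΨc.mono ?_)
    exact fun z hz => ⟨hz.1, abs_lt.2 (hJδ hz.2)⟩
  refine ⟨Ψ '' Q, ?_, ?_, ?_, Ψ '' {z | |z.re - s| < δ' ∧ z.im ∈ Ioo 0 δ'},
    Ψ '' {z | |z.re - s| < δ' ∧ z.im ∈ Ioo (-δ') 0}, hpre _ (convex_Ioo _ _) ?_,
    hpre _ (convex_Ioo _ _) ?_, ?_, ?_⟩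
  · rintro _ ⟨z, hz, rfl⟩
    exact (hbox' z hz.1 hz.2).1.1
  · rw [← hcoe]
    exact e.isOpen_image_of_subset_source hQo hQs
  · exact ⟨s, by simp [hQ, hδ'], by simp [hΨ]⟩
  · exact Ioo_subset_Ioo_left (by linarith)
  · exact Ioo_subset_Ioo_right hδ'.le
  · ext x
    constructor
    · rintro (⟨z, ⟨h1, h2⟩, rfl⟩ | ⟨z, ⟨h1, h2⟩, rfl⟩)
      · have hz : z ∈ Q := ⟨h1, abs_lt.2 ⟨by linarith [h2.1], h2.2⟩⟩
        exact ⟨⟨z, hz, rfl⟩, fun hx => h2.1.ne' ((honarc z hz).1 hx)⟩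
      · have hz : z ∈ Q := ⟨h1, abs_lt.2 ⟨h2.1, by linarith [h2.2]⟩⟩
        exact ⟨⟨z, hz, rfl⟩, fun hx => h2.2.ne ((honarc z hz).1 hx)⟩
    · rintro ⟨⟨z, hz, rfl⟩, hx⟩
      have him0 : z.im ≠ 0 := fun h0 => hx ((honarc z hz).2 h0)
      have h2 := abs_lt.1 hz.2
      rcases him0.lt_or_gt with h0 | h0
      · exact Or.inr ⟨z, ⟨hz.1, h2.1, h0⟩, rfl⟩
      · exact Or.inl ⟨z, ⟨hz.1, h0, h2.2⟩, rfl⟩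
  · rintro x ⟨⟨z, hz, rfl⟩, hx⟩
    have h0 := (honarc z hz).1 hx
    have hcz : ContinuousAt Ψ z := hΨc.continuousAt (hQo.mem_nhds hz)
    have hlim : ∀ c : ℝ, Tendsto (fun ε : ℝ => Ψ (z + (c * ε : ℝ) * I)) (𝓝[>] 0) (𝓝 (Ψ z)) := by
      intro c
      refine hcz.tendsto.comp ?_
      have : Tendsto (fun ε : ℝ => z + (c * ε : ℝ) * I) (𝓝 0) (𝓝 (z + (c * 0 : ℝ) * I)) :=
        (by fun_prop : Continuous fun ε : ℝ => z + (c * ε : ℝ) * I).tendsto 0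
      simp only [mul_zero, ofReal_zero, zero_mul, add_zero] at this
      exact this.mono_left nhdsWithin_le_nhds
    constructor
    · refine mem_closure_of_tendsto (hlim 1) ?_
      filter_upwards [Ioo_mem_nhdsGT hδ'] with ε hε
      exact ⟨_, ⟨by simpa using hz.1, by simpa [h0] using hε⟩, rfl⟩
    · refine mem_closure_of_tendsto (hlim (-1)) ?_
      filter_upwards [Ioo_mem_nhdsGT hδ'] with ε hε
      exact ⟨_, ⟨by simpa using hz.1, by simpa [h0] using hε.symm⟩, rfl⟩

end TripleCover

/-! ### Circles around end points; attaching an arc does not separate -/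

namespace TripleCover

open Complex

/-- The point of the circle with centre `c` and radius `ρ` at the angle `θ`. -/
noncomputable def circlePt (c : ℂ) (ρ θ : ℝ) : ℂ := c + ρ * exp (θ * I)

lemma continuous_circlePt (c : ℂ) (ρ : ℝ) : Continuous (circlePt c ρ) := by
  unfold circlePt; fun_prop

lemma dist_circlePt (c : ℂ) {ρ : ℝ} (hρ : 0 < ρ) (θ : ℝ) : dist (circlePt c ρ θ) c = ρ := by
  rw [dist_eq, circlePt, add_sub_cancel_left, norm_mul, norm_exp_ofReal_mul_I, mul_one, norm_real,
    Real.norm_of_nonneg hρ.le]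

lemma exists_circlePt_eq {c z : ℂ} {ρ : ℝ} (hz : dist z c = ρ) (θ₁ : ℝ) :
    ∃ θ ∈ Ico θ₁ (θ₁ + 2 * Real.pi), z = circlePt c ρ θ := by
  refine ⟨toIcoMod Real.two_pi_pos θ₁ (arg (z - c)), toIcoMod_mem_Ico _ _ _, ?_⟩
  obtain ⟨n, hn⟩ : ∃ n : ℤ, toIcoMod Real.two_pi_pos θ₁ (arg (z - c)) =
      arg (z - c) - n * (2 * Real.pi) :=
    ⟨toIcoDiv Real.two_pi_pos θ₁ (arg (z - c)), by rw [toIcoMod, zsmul_eq_mul]⟩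
  have h1 : exp (((arg (z - c) - n * (2 * Real.pi) : ℝ) : ℂ) * I) = exp (arg (z - c) * I) := by
    rw [exp_eq_exp_iff_exists_int]
    exact ⟨-n, by push_cast; ring⟩
  rw [hn, circlePt, h1, ← hz, dist_eq, norm_mul_exp_arg_mul_I]
  ring

lemma circlePt_ne {c : ℂ} {ρ : ℝ} (hρ : 0 < ρ) {θ θ' : ℝ} (h1 : θ < θ')
    (h2 : θ' < θ + 2 * Real.pi) : circlePt c ρ θ ≠ circlePt c ρ θ' := by
  intro h
  have hρ' : (ρ : ℂ) ≠ 0 := by exact_mod_cast hρ.ne'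
  have h3 := mul_left_cancel₀ hρ' (add_left_cancel h)
  obtain ⟨n, hn⟩ := exp_eq_exp_iff_exists_int.1 h3
  have h4 : (θ : ℂ) = θ' + n * (2 * Real.pi) :=
    mul_right_cancel₀ I_ne_zero (by rw [hn]; ring)
  have h5 : θ = θ' + n * (2 * Real.pi) := by exact_mod_cast h4
  have hpi := Real.two_pi_pos
  have h6 : (n : ℝ) < 0 := by by_contra hcon; rw [not_lt] at hcon; nlinarith
  have h7 : (-1 : ℝ) < n := by by_contra hcon; rw [not_lt] at hcon; nlinarith
  have h8 : n < 0 := by exact_mod_cast h6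
  have h9 : -1 < n := by exact_mod_cast h7
  omega

/-- A circle without one point is the image of an open interval of angles. -/
lemma exists_angle {c x : ℂ} {ρ : ℝ} (hρ : 0 < ρ) (hx : dist x c = ρ) : ∃ θ₁ : ℝ,
    (∀ z, dist z c = ρ → z ≠ x → ∃ θ ∈ Ioo θ₁ (θ₁ + 2 * Real.pi), z = circlePt c ρ θ) ∧
    ∀ θ ∈ Ioo θ₁ (θ₁ + 2 * Real.pi), circlePt c ρ θ ≠ x := by
  obtain ⟨θ₁, -, h1⟩ := exists_circlePt_eq hx 0
  refine ⟨θ₁, fun z hz hzx => ?_, fun θ hθ h => ?_⟩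
  · obtain ⟨θ, hθ, e⟩ := exists_circlePt_eq hz θ₁
    refine ⟨θ, ⟨hθ.1.lt_of_ne ?_, hθ.2⟩, e⟩
    rintro rfl
    exact hzx (e.trans h1.symm)
  · exact circlePt_ne hρ hθ.1 hθ.2 (h1.symm.trans h.symm)

namespace IsArc

variable {γ : ℝ → ℂ}

/-- Small circles around the starting point of an arc, without the point of the arc on them. -/
lemma exists_circle_angle (h : IsArc γ) : ∃ u : ℂ, ‖u‖ = 1 ∧ ∃ ρ₀ > 0, ∀ ρ ∈ Ioo (0 : ℝ) ρ₀,
    γ 0 + ρ * u ∉ γ '' Icc 0 1 ∧ ∃ θ₁ : ℝ,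
    (∀ z, dist z (γ 0) = ρ → z ∉ γ '' Icc 0 1 →
      ∃ θ ∈ Ioo θ₁ (θ₁ + 2 * Real.pi), z = circlePt (γ 0) ρ θ) ∧
    ∀ θ ∈ Ioo θ₁ (θ₁ + 2 * Real.pi), circlePt (γ 0) ρ θ ∉ γ '' Icc 0 1 := by
  obtain ⟨ρ₁, hρ₁, hc⟩ := h.exists_circle
  obtain ⟨u, hu, ρ₂, hρ₂, hr⟩ := h.exists_ray
  refine ⟨u, hu, min ρ₁ ρ₂, lt_min hρ₁ hρ₂, fun ρ hρ =>
    ⟨hr ρ ⟨hρ.1, hρ.2.trans_le (min_le_right _ _)⟩, ?_⟩⟩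
  obtain ⟨s, hs, hs'⟩ := hc ρ ⟨hρ.1, hρ.2.trans_le (min_le_left _ _)⟩
  have hsd := (hs' s (Ioo_subset_Icc_self hs)).2 rfl
  obtain ⟨θ₁, h1, h2⟩ := exists_angle hρ.1 hsd
  refine ⟨θ₁, fun z hz hzγ => h1 z hz ?_, fun θ hθ => ?_⟩
  · rintro rfl
    exact hzγ ⟨s, Ioo_subset_Icc_self hs, rfl⟩
  · rintro ⟨s', hs'1, e⟩
    have := (hs' s' hs'1).1 (by rw [e, dist_circlePt _ hρ.1])
    subst this
    exact h2 θ hθ e.symm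

/-- A small disc around the starting point of an arc is not separated by the arc. -/
lemma exists_isPreconnected_slit (h : IsArc γ) : ∃ ρ₀ > 0, ∀ ρ ∈ Ioc 0 ρ₀,
    IsPreconnected (Metric.ball (γ 0) ρ \ γ '' Icc 0 1) := by
  obtain ⟨u, hu, ρ₀, hρ₀, hc⟩ := h.exists_circle_angle
  refine ⟨ρ₀, hρ₀, fun ρ hρ => isPreconnected_of_forall_constant fun f hf => ?_⟩
  -- Each circle loses only one point to the arc and so remains connected; the ray opposite to the
  -- arc links all the circles.
  have hray : ∀ r ∈ Ioo 0 ρ, ∀ r' ∈ Ioo 0 ρ, f (γ 0 + (r : ℂ) * u) = f (γ 0 + (r' : ℂ) * u) := by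
    intro r hr r' hr'
    have hpre : IsPreconnected ((fun r : ℝ => γ 0 + (r : ℂ) * u) '' Ioo 0 ρ) :=
      isPreconnected_Ioo.image _ (by fun_prop)
    refine hpre.constant (hf.mono ?_) ⟨r, hr, rfl⟩ ⟨r', hr', rfl⟩
    rintro _ ⟨r, hr, rfl⟩
    refine ⟨?_, (hc r ⟨hr.1, hr.2.trans_le hρ.2⟩).1⟩
    rw [Metric.mem_ball, dist_eq, add_sub_cancel_left, norm_mul, hu, mul_one, norm_real,
      Real.norm_of_nonneg hr.1.le]
    exact hr.2
  have hcirc : ∀ z ∈ Metric.ball (γ 0) ρ \ γ '' Icc 0 1, ∃ r ∈ Ioo 0 ρ,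
      f z = f (γ 0 + (r : ℂ) * u) := by
    rintro z ⟨hz, hzγ⟩
    have hr0 : 0 < dist z (γ 0) := by
      refine dist_pos.2 ?_
      rintro rfl
      exact hzγ ⟨0, ⟨le_rfl, zero_le_one⟩, rfl⟩
    obtain ⟨h1, θ₁, h2, h3⟩ := hc (dist z (γ 0)) ⟨hr0, (Metric.mem_ball.1 hz).trans_le hρ.2⟩
    refine ⟨dist z (γ 0), ⟨hr0, hz⟩, ?_⟩
    have hpre : IsPreconnected (circlePt (γ 0) (dist z (γ 0)) '' Ioo θ₁ (θ₁ + 2 * Real.pi)) :=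
      isPreconnected_Ioo.image _ (continuous_circlePt _ _).continuousOn
    have hu' : dist (γ 0 + (dist z (γ 0) : ℂ) * u) (γ 0) = dist z (γ 0) := by
      rw [dist_eq, add_sub_cancel_left, norm_mul, hu, mul_one, norm_real,
        Real.norm_of_nonneg hr0.le]
    refine hpre.constant (hf.mono ?_) ?_ ?_
    · rintro _ ⟨θ, hθ, rfl⟩
      refine ⟨?_, h3 θ hθ⟩
      rw [Metric.mem_ball, dist_circlePt _ hr0]
      exact hz
    · obtain ⟨θ, hθ, e⟩ := h2 z rfl hzγ
      exact ⟨θ, hθ, e.symm⟩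
    · obtain ⟨θ, hθ, e⟩ := h2 _ hu' h1
      exact ⟨θ, hθ, e.symm⟩
  intro x hx y hy
  obtain ⟨r, hr, e⟩ := hcirc x hx
  obtain ⟨r', hr', e'⟩ := hcirc y hy
  rw [e, e', hray r hr r' hr']

/-- Attaching an arc to a closed set at one end point does not disconnect the complement. -/
theorem isPreconnected_compl_union (h : IsArc γ) {K : Set ℂ} (hK : IsClosed K)
    (hKc : IsPreconnected Kᶜ) (h0 : γ 0 ∈ K) (hγK : ∀ s ∈ Ioc (0 : ℝ) 1, γ s ∉ K) :
    IsPreconnected (γ '' Icc 0 1 ∪ K)ᶜ := by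
  refine isPreconnected_of_forall_constant fun f hf => ?_
  set U' := (γ '' Icc 0 1 ∪ K)ᶜ with hU'
  have hU'o : IsOpen U' := (h.isCompact_image.isClosed.union hK).isOpen_compl
  -- the value at the tip
  obtain ⟨b, hb⟩ : ∃ b : Bool, ∀ᶠ x in 𝓝 (γ 1), ∀ᶠ z in 𝓝[U'] x, f z = b := by
    obtain ⟨ρ₀, hρ₀, hpre⟩ := h.reverse.exists_isPreconnected_slit
    have h1 : (fun s : ℝ => γ (1 + -1 * s)) '' Icc 0 1 = γ '' Icc 0 1 := by
      ext x
      constructor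
      · rintro ⟨s, hs, rfl⟩
        exact ⟨1 + -1 * s, ⟨by linarith [hs.2], by linarith [hs.1]⟩, rfl⟩
      · rintro ⟨s, hs, rfl⟩
        exact ⟨1 - s, ⟨by linarith [hs.2], by linarith [hs.1]⟩, by simp⟩
    simp only [mul_zero, add_zero] at hpre
    rw [h1] at hpre
    obtain ⟨ρ₁, hρ₁, hKb⟩ := Metric.isOpen_iff.1 hK.isOpen_compl _
      (hγK 1 ⟨one_pos, le_rfl⟩)
    set ρ := min ρ₀ ρ₁ with hρ
    have hρpos : 0 < ρ := lt_min hρ₀ hρ₁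
    have hp := hpre ρ ⟨hρpos, min_le_left _ _⟩
    have hsub : Metric.ball (γ 1) ρ \ γ '' Icc 0 1 ⊆ U' := by
      rintro z ⟨hz, hzγ⟩ (hz' | hz')
      · exact hzγ hz'
      · exact hKb (Metric.ball_subset_ball (min_le_right _ _) hz) hz'
    obtain ⟨b, hb⟩ : ∃ b, ∀ z ∈ Metric.ball (γ 1) ρ \ γ '' Icc 0 1, f z = b := by
      rcases (Metric.ball (γ 1) ρ \ γ '' Icc 0 1).eq_empty_or_nonempty with he | ⟨z₀, hz₀⟩
      · exact ⟨true, fun z hz => by rw [he] at hz; exact hz.elim⟩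
      · exact ⟨f z₀, fun z hz => hp.constant (hf.mono hsub) hz hz₀⟩
    refine ⟨b, ?_⟩
    filter_upwards [Metric.ball_mem_nhds (γ 1) hρpos] with x hx
    rw [eventually_nhdsWithin_iff]
    filter_upwards [Metric.isOpen_ball.mem_nhds hx] with z hz hzU
    exact hb z ⟨hz, fun hzγ => hzU (Or.inl hzγ)⟩
  -- At the tip both sides carry the same value `b` of the locally constant function. Two-sidedness
  -- transports this property along the arc, down to but not including the point on `K`.
  have hQ : ∀ s ∈ Ioc (0 : ℝ) 1, ∀ᶠ z in 𝓝[U'] (γ s), f z = b := by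
    have hc1 : ContinuousWithinAt γ (Icc 0 1) 1 := h.continuousOn 1 ⟨zero_le_one, le_rfl⟩
    have hev := hc1.tendsto.eventually hb
    rw [eventually_nhdsWithin_iff, Metric.eventually_nhds_iff] at hev
    obtain ⟨ε, hε, hev⟩ := hev
    obtain ⟨s₁, hs₁, hs₁ε⟩ : ∃ s₁ ∈ Ioo (0 : ℝ) 1, dist s₁ 1 < ε := by
      refine ⟨max (1 / 2) (1 - ε / 2), ⟨by positivity, max_lt (by norm_num) (by linarith)⟩, ?_⟩
      rw [Real.dist_eq, abs_sub_comm, abs_of_nonneg]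
      · linarith [le_max_right (1 / 2) (1 - ε / 2)]
      · linarith [max_le (show (1 / 2 : ℝ) ≤ 1 by norm_num) (show 1 - ε / 2 ≤ 1 by linarith)]
    have hQ1 := hev hs₁ε (Ioo_subset_Icc_self hs₁)
    intro s hs
    rcases hs.2.eq_or_lt with rfl | hs1
    · exact hb.self_of_nhds
    refine (isPreconnected_Ioo.induction₂ (fun s s' => (∀ᶠ z in 𝓝[U'] (γ s), f z = b) ↔
      ∀ᶠ z in 𝓝[U'] (γ s'), f z = b) ?_ (fun _ _ _ _ _ _ => Iff.trans) (fun _ _ _ _ => Iff.symm)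
      hs₁ ⟨hs.1, hs1⟩).1 hQ1
    intro t ht
    obtain ⟨U, -, hUo, htU, S, S', hS, hS', hSS, hcl⟩ :=
      h.twoSided ht hK (hγK t ⟨ht.1, ht.2.le⟩) univ univ_mem
    have hSU : S ∪ S' ⊆ U' := by rw [hSS]; exact fun z hz => hz.2
    have hchar : ∀ t' ∈ Icc (0 : ℝ) 1, γ t' ∈ U →
        ((∀ᶠ z in 𝓝[U'] (γ t'), f z = b) ↔ ∀ z ∈ S ∪ S', f z = b) := by
      intro t' ht' htU'
      constructor
      · intro hev
        obtain ⟨c1, c2⟩ := hcl _ ⟨htU', Or.inl ⟨t', ht', rfl⟩⟩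
        have aux : ∀ A : Set ℂ, IsPreconnected A → A ⊆ U' → γ t' ∈ closure A →
            ∀ z ∈ A, f z = b := by
          intro A hA hAU hAc z hz
          have h1 : ∀ᶠ z in 𝓝[A] (γ t'), f z = b := hev.filter_mono (nhdsWithin_mono _ hAU)
          have : (𝓝[A] (γ t')).NeBot := mem_closure_iff_nhdsWithin_neBot.1 hAc
          obtain ⟨z', hz'1, hz'2⟩ := (h1.and self_mem_nhdsWithin).exists
          rw [← hz'1]
          exact hA.constant (hf.mono hAU) hz hz'2
        rintro z (hz | hz)
        · exact aux S hS (subset_union_left.trans hSU) c1 z hz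
        · exact aux S' hS' (subset_union_right.trans hSU) c2 z hz
      · intro hall
        rw [eventually_nhdsWithin_iff]
        filter_upwards [hUo.mem_nhds htU'] with z hz hzU
        exact hall z (by rw [hSS]; exact ⟨hz, hzU⟩)
    have hcat : ContinuousWithinAt γ (Ioo 0 1) t :=
      (h.continuousOn t (Ioo_subset_Icc_self ht)).mono Ioo_subset_Icc_self
    filter_upwards [hcat.preimage_mem_nhdsWithin (hUo.mem_nhds htU), self_mem_nhdsWithin]
      with t' ht' ht'2
    rw [hchar t (Ioo_subset_Icc_self ht) htU, hchar t' (Ioo_subset_Icc_self ht'2) ht']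
  -- As both sides agree, `f` extends over the arc to a continuous function on the connected set
  -- `Kᶜ`, and is therefore constant.
  set g : ℂ → Bool := fun z => by classical exact if z ∈ γ '' Icc 0 1 then b else f z with hg
  have hgc : ContinuousOn g Kᶜ := by
    intro z hz
    refine ContinuousAt.continuousWithinAt ?_
    by_cases hzγ : z ∈ γ '' Icc 0 1
    · obtain ⟨s, hs, rfl⟩ := hzγ
      have hs0 : 0 < s := hs.1.lt_of_ne fun h => hz (h ▸ h0)
      have h1 := hQ s ⟨hs0, hs.2⟩
      rw [eventually_nhdsWithin_iff] at h1
      have : g =ᶠ[𝓝 (γ s)] fun _ => b := by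
        filter_upwards [h1, hK.isOpen_compl.mem_nhds hz] with x hx hxK
        by_cases hxγ : x ∈ γ '' Icc 0 1
        · simp only [hg, if_pos hxγ]
        · simp only [hg, if_neg hxγ]
          exact hx (by rintro (h | h); exacts [hxγ h, hxK h])
      exact this.continuousAt
    · have hzU : z ∈ U' := by rintro (h | h); exacts [hzγ h, hz h]
      have : g =ᶠ[𝓝 z] f := by
        filter_upwards [hU'o.mem_nhds hzU] with x hx
        simp only [hg, if_neg fun h => hx (Or.inl h)]
      exact (hf.continuousAt (hU'o.mem_nhds hzU)).congr this.symm
  intro x hx y hy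
  have h1 := hKc.constant hgc (fun h => hx (Or.inr h)) (fun h => hy (Or.inr h)) (x := x) (y := y)
  simpa only [hg, if_neg fun h => hx (Or.inl h), if_neg fun h => hy (Or.inl h)] using h1

end IsArc

end TripleCover

namespace TripleCover

open Complex

/-! ### Cube roots -/

lemma isSimplyConnected_of_convex {X : Type*} [NormedAddCommGroup X] [NormedSpace ℝ X] {s : Set X}
    (hs : Convex ℝ s) (hne : s.Nonempty) : IsSimplyConnected s := by
  have := hs.contractibleSpace hne
  exact SimplyConnectedSpace.ofContractible s

/-- Near a nonzero value a continuous cube root is the local inverse of `w ↦ w ^ 3` composed with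
`g`. The base field is general because the lemma serves both for holomorphic branches and for roots
along real paths. -/
lemma hasDerivAt_of_cube {𝕜 : Type*} [NontriviallyNormedField 𝕜] [NormedAlgebra 𝕜 ℂ] {y g : 𝕜 → ℂ}
    {x : 𝕜} {g' : ℂ} (hy : ContinuousAt y x) (h : ∀ᶠ z in 𝓝 x, y z ^ 3 = g z)
    (hg : HasDerivAt g g' x) (hx : y x ≠ 0) : HasDerivAt y (g' / (3 * y x ^ 2)) x := by
  have h1 : HasStrictDerivAt (fun w : ℂ => w ^ 3) (3 * y x ^ 2) (y x) := by
    simpa using hasStrictDerivAt_pow 3 (y x)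
  have h2 : 3 * y x ^ 2 ≠ 0 := mul_ne_zero (by norm_num) (pow_ne_zero _ hx)
  have h3 := h1.to_localInverse h2
  set ψ := h1.localInverse (fun w : ℂ => w ^ 3) (3 * y x ^ 2) (y x) h2 with hψ
  have h4 : y =ᶠ[𝓝 x] ψ ∘ g := by
    filter_upwards [h, hy.eventually (h1.eventually_left_inverse h2)] with z hz hz2
    rw [Function.comp, ← hz]
    exact hz2.symm
  rw [h.self_of_nhds] at h3
  have h5 := (h3.hasDerivAt.hasFDerivAt.restrictScalars 𝕜).comp_hasDerivAt x hg
  refine (h5.congr_of_eventuallyEq h4).congr_deriv ?_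
  simp [div_eq_mul_inv]

lemma differentiableAt_of_cube {y g : ℂ → ℂ} {x : ℂ} (hy : ContinuousAt y x)
    (h : ∀ᶠ z in 𝓝 x, y z ^ 3 = g z) (hg : DifferentiableAt ℂ g x) (hx : g x ≠ 0) :
    DifferentiableAt ℂ y x :=
  (hasDerivAt_of_cube hy h hg.hasDerivAt fun h0 => hx (by
    rw [← h.self_of_nhds, h0]; norm_num)).differentiableAt

lemma exists_cubeRoot_ball {g : ℂ → ℂ} {c : ℂ} {r : ℝ} (hr : 0 < r)
    (hg : DifferentiableOn ℂ g (Metric.ball c r)) (h0 : ∀ z ∈ Metric.ball c r, g z ≠ 0) :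
    ∃ y : ℂ → ℂ, DifferentiableOn ℂ y (Metric.ball c r) ∧
      ∀ z ∈ Metric.ball c r, y z ^ 3 = g z := by
  obtain ⟨y, hy, hy3⟩ := exists_continuousOn_pow_eq
    (isSimplyConnected_of_convex (convex_ball c r) ⟨c, Metric.mem_ball_self hr⟩)
    Metric.isOpen_ball hg.continuousOn (by rintro ⟨z, hz, e⟩; exact h0 z hz e) (n := 3) (by norm_num)
  refine ⟨y, fun z hz => ?_, fun z _ => hy3 z⟩
  have hn := Metric.isOpen_ball.mem_nhds hz
  exact (differentiableAt_of_cube (hy.continuousAt hn) (Eventually.of_forall hy3)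
    (hg.differentiableAt hn) (h0 z hz)).differentiableWithinAt

lemma finite_cubeRoots : {η : ℂ | η ^ 3 = 1}.Finite := by
  refine (Polynomial.nthRootsFinset 3 (1 : ℂ)).finite_toSet.subset fun η hη => ?_
  simpa [Polynomial.mem_nthRootsFinset (by norm_num : 0 < 3)] using hη

lemma cubeRoot_ne_zero {η : ℂ} (h : η ^ 3 = 1) : η ≠ 0 := by
  rintro rfl
  norm_num at h

lemma norm_cubeRoot {η : ℂ} (h : η ^ 3 = 1) : ‖η‖ = 1 :=
  norm_eq_one_of_pow_eq_one h (by norm_num)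

/-- The quotient is continuous with values in the finite set of cube roots of unity. All comparisons
of branches rest on this. -/
lemma exists_cubeRoot_ratio {X : Type*} [TopologicalSpace X] {S : Set X} (hS : IsPreconnected S)
    {y₁ y₂ : X → ℂ} (h₁ : ContinuousOn y₁ S) (h₂ : ContinuousOn y₂ S)
    (h : ∀ z ∈ S, y₁ z ^ 3 = y₂ z ^ 3) (h0 : ∀ z ∈ S, y₂ z ≠ 0) :
    ∃ η : ℂ, η ^ 3 = 1 ∧ ∀ z ∈ S, y₁ z = η * y₂ z := by
  rcases S.eq_empty_or_nonempty with rfl | ⟨z₀, hz₀⟩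
  · exact ⟨1, by norm_num, by simp⟩
  have hmaps : MapsTo (fun z => y₁ z / y₂ z) S {η : ℂ | η ^ 3 = 1} := fun z hz => by
    rw [mem_ofPred_eq, div_pow, h z hz, div_self (pow_ne_zero _ (h0 z hz))]
  refine ⟨y₁ z₀ / y₂ z₀, hmaps hz₀, fun z hz => ?_⟩
  have := hS.constant_of_mapsTo finite_cubeRoots.isDiscrete (f := fun z => y₁ z / y₂ z)
    (h₁.div h₂ h0) hmaps hz₀ hz
  rw [this, div_mul_cancel₀ _ (h0 z hz)]

/-- The difference is locally constant on `O`. The connected set `S` need not be open, so that it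
can be a side of the tree or an arc of a circle. -/
lemma eq_of_hasDerivAt_eq {S O : Set ℂ} (hS : IsPreconnected S) (hO : IsOpen O) (hSO : S ⊆ O)
    {F G h : ℂ → ℂ} (hF : ∀ z ∈ O, HasDerivAt F (h z) z) (hG : ∀ z ∈ O, HasDerivAt G (h z) z) :
    ∃ C, ∀ z ∈ S, F z = G z + C := by
  rcases S.eq_empty_or_nonempty with rfl | ⟨z₀, hz₀⟩
  · exact ⟨0, by simp⟩
  refine ⟨F z₀ - G z₀, fun z hz => ?_⟩
  have := hS.induction₂ (fun a b => F a - G a = F b - G b) ?_ (fun _ _ _ _ _ _ => Eq.trans)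
    (fun _ _ _ _ => Eq.symm) hz hz₀
  · linear_combination this
  · intro x hx
    obtain ⟨ε, hε, hb⟩ := Metric.isOpen_iff.1 hO x (hSO hx)
    filter_upwards [nhdsWithin_le_nhds (Metric.ball_mem_nhds x hε)] with w hw
    have hd : ∀ z ∈ Metric.ball x ε, HasDerivWithinAt (fun z => F z - G z) 0 (Metric.ball x ε) z :=
      fun z hz => by
        have := ((hF z (hb hz)).sub (hG z (hb hz))).hasDerivWithinAt (s := Metric.ball x ε)
        rw [sub_self] at this
        exact this
    have := (convex_ball x ε).norm_image_sub_le_of_norm_hasDerivWithin_le (C := 0) hd (by simp)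
      (Metric.mem_ball_self hε) hw
    rw [zero_mul, norm_le_zero_iff] at this
    exact (sub_eq_zero.1 this).symm

/-! ### Crossings -/

/-- The data `D` of a crossing at the point `x` of `Γ`: approaching `x` from two directions, the
branches `θ Y` and `θ' Y` of a function on the two sides fit together, and `D` is the difference of
the corresponding branches of the primitive `F`. -/
def Cross (Γ : Set ℂ) (Y F : ℂ → ℂ) (e : ℕ) (θ θ' x D : ℂ) : Prop :=
  ∃ z z' : ℕ → ℂ, (∀ n, z n ∉ Γ) ∧ (∀ n, z' n ∉ Γ) ∧ Tendsto z atTop (𝓝 x) ∧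
    Tendsto z' atTop (𝓝 x) ∧ Tendsto (fun n => θ * Y (z n) - θ' * Y (z' n)) atTop (𝓝 0) ∧
    Tendsto (fun n => F (z n) / θ ^ e - F (z' n) / θ' ^ e) atTop (𝓝 D)

/-- `v` and `w` are limits of `F` and `Y` when approaching the point `x` of `Γ`. -/
def SideValue (Γ : Set ℂ) (Y F : ℂ → ℂ) (x v w : ℂ) : Prop :=
  ∃ z : ℕ → ℂ, (∀ n, z n ∉ Γ) ∧ Tendsto z atTop (𝓝 x) ∧
    Tendsto (fun n => F (z n)) atTop (𝓝 v) ∧ Tendsto (fun n => Y (z n)) atTop (𝓝 w)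

/-- On the two sides `S`, `S'` of `Γ` in `U`, the function `Y` and the primitive `F` of `R / Y ^ e`
are given in terms of functions `y` and `Φ` that are holomorphic in a disc containing `U`. -/
structure LocalSides (Γ : Set ℂ) (Y F : ℂ → ℂ) (e : ℕ) (U S S' : Set ℂ) (y Φ : ℂ → ℂ)
    (η η' C C' : ℂ) : Prop where
  isOpen : IsOpen U
  union_eq : S ∪ S' = U \ Γ
  closure : ∀ x ∈ U ∩ Γ, x ∈ closure S ∧ x ∈ closure S'
  cube : η ^ 3 = 1
  cube' : η' ^ 3 = 1
  y_ne : ∀ z ∈ U, y z ≠ 0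
  y_cont : ContinuousOn y U
  Φ_cont : ContinuousOn Φ U
  Y_eq : ∀ z ∈ S, Y z = η * y z
  Y_eq' : ∀ z ∈ S', Y z = η' * y z
  F_eq : ∀ z ∈ S, F z = Φ z / η ^ e + C
  F_eq' : ∀ z ∈ S', F z = Φ z / η' ^ e + C'

namespace LocalSides

variable {Γ : Set ℂ} {Y F : ℂ → ℂ} {e : ℕ} {U S S' : Set ℂ} {y Φ : ℂ → ℂ} {η η' C C' : ℂ}

lemma symm (h : LocalSides Γ Y F e U S S' y Φ η η' C C') :
    LocalSides Γ Y F e U S' S y Φ η' η C' C :=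
  ⟨h.isOpen, by rw [union_comm]; exact h.union_eq, fun x hx => (h.closure x hx).symm, h.cube',
    h.cube, h.y_ne, h.y_cont, h.Φ_cont, h.Y_eq', h.Y_eq, h.F_eq', h.F_eq⟩

lemma subset (h : LocalSides Γ Y F e U S S' y Φ η η' C C') : S ⊆ U \ Γ :=
  h.union_eq ▸ subset_union_left

lemma exists_seq (h : LocalSides Γ Y F e U S S' y Φ η η' C C') {x : ℂ} (hx : x ∈ U ∩ Γ) :
    ∃ z : ℕ → ℂ, (∀ n, z n ∈ S) ∧ Tendsto z atTop (𝓝 x) :=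
  mem_closure_iff_seq_limit.1 (h.closure x hx).1

lemma tendsto (h : LocalSides Γ Y F e U S S' y Φ η η' C C') {x : ℂ} (hx : x ∈ U) {z : ℕ → ℂ}
    (hz : ∀ n, z n ∈ S) (hzx : Tendsto z atTop (𝓝 x)) :
    Tendsto (fun n => Y (z n)) atTop (𝓝 (η * y x)) ∧
      Tendsto (fun n => F (z n)) atTop (𝓝 (Φ x / η ^ e + C)) := by
  have hn := h.isOpen.mem_nhds hx
  constructor
  · exact (((h.y_cont.continuousAt hn).tendsto.comp hzx).const_mul η).congr
      fun n => (h.Y_eq _ (hz n)).symm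
  · exact ((((h.Φ_cont.continuousAt hn).tendsto.comp hzx).div_const (η ^ e)).add_const C).congr
      fun n => (h.F_eq _ (hz n)).symm

/-- Pass to subsequences lying on one side. -/
lemma exists_subseq (h : LocalSides Γ Y F e U S S' y Φ η η' C C') {x : ℂ} (hx : x ∈ U) {z : ℕ → ℂ}
    (hz : ∀ n, z n ∉ Γ) (hzx : Tendsto z atTop (𝓝 x)) :
    (∃ φ : ℕ → ℕ, StrictMono φ ∧ ∀ n, z (φ n) ∈ S) ∨
      (∃ φ : ℕ → ℕ, StrictMono φ ∧ ∀ n, z (φ n) ∈ S') := by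
  have hev : ∃ᶠ n in atTop, z n ∈ S ∨ z n ∈ S' := by
    refine Eventually.frequently ?_
    filter_upwards [hzx.eventually (h.isOpen.mem_nhds hx)] with n hn
    have : z n ∈ S ∪ S' := by rw [h.union_eq]; exact ⟨hn, hz n⟩
    exact this
  rcases frequently_or_distrib.1 hev with h1 | h1
  · exact Or.inl (extraction_of_frequently_atTop h1)
  · exact Or.inr (extraction_of_frequently_atTop h1)

/-- Compatibility of the branches makes the `Φ` parts of the two boundary values equal; only the
integration constants survive, and they do not depend on `x`. -/
lemma cross (h : LocalSides Γ Y F e U S S' y Φ η η' C C') {θ θ' x : ℂ} (hx : x ∈ U ∩ Γ)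
    (hθ : θ * η = θ' * η') : Cross Γ Y F e θ θ' x (C / θ ^ e - C' / θ' ^ e) := by
  obtain ⟨z, hz, hzx⟩ := h.exists_seq hx
  obtain ⟨z', hz', hzx'⟩ := h.symm.exists_seq hx
  obtain ⟨t1, t2⟩ := h.tendsto hx.1 hz hzx
  obtain ⟨t1', t2'⟩ := h.symm.tendsto hx.1 hz' hzx'
  refine ⟨z, z', fun n => (h.subset (hz n)).2, fun n => (h.symm.subset (hz' n)).2, hzx, hzx', ?_, ?_⟩
  · have := (t1.const_mul θ).sub (t1'.const_mul θ')
    rwa [← mul_assoc, ← mul_assoc, hθ, sub_self] at this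
  · have := (t2.div_const (θ ^ e)).sub (t2'.div_const (θ' ^ e))
    convert! this using 2
    have h1 : Φ x / η ^ e / θ ^ e = Φ x / η' ^ e / θ' ^ e := by
      rw [div_div, div_div, ← mul_pow, ← mul_pow, mul_comm η, mul_comm η', hθ]
    rw [add_div, add_div, h1]
    ring

/-- Along a subsequence each of the two approaching sequences stays on one side. They cannot stay on
the same side, because then the branches would match only for `θ = θ'`. The two orientations of the
crossing remain. -/
lemma of_cross (h : LocalSides Γ Y F e U S S' y Φ η η' C C') {θ θ' x D : ℂ} (hx : x ∈ U)
    (hne : θ ≠ θ') (hc : Cross Γ Y F e θ θ' x D) :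
    (θ * η = θ' * η' ∧ D = C / θ ^ e - C' / θ' ^ e) ∨
      (θ * η' = θ' * η ∧ D = C' / θ ^ e - C / θ' ^ e) := by
  obtain ⟨z, z', hz, hz', hzx, hzx', t1, t2⟩ := hc
  have aux : ∀ {S₁ S₁' S₂ S₂' : Set ℂ} {η₁ η₁' η₂ η₂' C₁ C₁' C₂ C₂' : ℂ}
      (_ : LocalSides Γ Y F e U S₁ S₁' y Φ η₁ η₁' C₁ C₁')
      (_ : LocalSides Γ Y F e U S₂ S₂' y Φ η₂ η₂' C₂ C₂') (φ : ℕ → ℕ), StrictMono φ →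
      (∀ n, z (φ n) ∈ S₁) → (∀ n, z' (φ n) ∈ S₂) →
      θ * η₁ = θ' * η₂ ∧ D = C₁ / θ ^ e - C₂ / θ' ^ e := by
    intro S₁ S₁' S₂ S₂' η₁ η₁' η₂ η₂' C₁ C₁' C₂ C₂' h₁ h₂ φ hφ hS₁ hS₂
    have hφt := hφ.tendsto_atTop
    obtain ⟨a1, a2⟩ := h₁.tendsto hx hS₁ (hzx.comp hφt)
    obtain ⟨b1, b2⟩ := h₂.tendsto hx hS₂ (hzx'.comp hφt)
    have e1 := tendsto_nhds_unique (t1.comp hφt) ((a1.const_mul θ).sub (b1.const_mul θ'))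
    have e2 := tendsto_nhds_unique (t2.comp hφt)
      ((a2.div_const (θ ^ e)).sub (b2.div_const (θ' ^ e)))
    have hy := h.y_ne x hx
    have e3 : θ * η₁ = θ' * η₂ := by
      have : (θ * η₁ - θ' * η₂) * y x = 0 := by rw [e1]; ring
      exact sub_eq_zero.1 ((mul_eq_zero.1 this).resolve_right hy)
    refine ⟨e3, ?_⟩
    have h1 : Φ x / η₁ ^ e / θ ^ e = Φ x / η₂ ^ e / θ' ^ e := by
      rw [div_div, div_div, ← mul_pow, ← mul_pow, mul_comm η₁, mul_comm η₂, e3]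
    rw [e2, add_div, add_div, h1]
    ring
  have hcancel : ∀ η₁ : ℂ, η₁ ^ 3 = 1 → θ * η₁ = θ' * η₁ → False := fun η₁ h3 h4 =>
    hne (mul_right_cancel₀ (cubeRoot_ne_zero h3) h4)
  rcases h.exists_subseq hx hz hzx with ⟨φ, hφ, hφS⟩ | ⟨φ, hφ, hφS⟩ <;>
  rcases h.exists_subseq hx (fun n => hz' (φ n)) (hzx'.comp hφ.tendsto_atTop) with
    ⟨ψ, hψ, hψS⟩ | ⟨ψ, hψ, hψS⟩
  · exact (hcancel η h.cube (aux h h (φ ∘ ψ) (hφ.comp hψ) (fun n => hφS _) hψS).1).elim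
  · exact Or.inl (aux h h.symm (φ ∘ ψ) (hφ.comp hψ) (fun n => hφS _) hψS)
  · exact Or.inr (aux h.symm h (φ ∘ ψ) (hφ.comp hψ) (fun n => hφS _) hψS)
  · exact (hcancel η' h.cube' (aux h.symm h.symm (φ ∘ ψ) (hφ.comp hψ) (fun n => hφS _) hψS).1).elim

/-- In either orientation `D` is built from the constants of the two sides alone, so a crossing can
be moved within `U`. -/
lemma cross_of_cross (h : LocalSides Γ Y F e U S S' y Φ η η' C C') {θ θ' x x' D : ℂ} (hx : x ∈ U)
    (hne : θ ≠ θ') (hc : Cross Γ Y F e θ θ' x D) (hx' : x' ∈ U ∩ Γ) : Cross Γ Y F e θ θ' x' D := by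
  rcases h.of_cross hx hne hc with ⟨h1, rfl⟩ | ⟨h1, rfl⟩
  · exact h.cross hx' h1
  · exact h.symm.cross hx' h1

lemma of_sideValue (h : LocalSides Γ Y F e U S S' y Φ η η' C C') {x v w : ℂ} (hx : x ∈ U)
    (hc : SideValue Γ Y F x v w) :
    (w = η * y x ∧ v = Φ x / η ^ e + C) ∨ (w = η' * y x ∧ v = Φ x / η' ^ e + C') := by
  obtain ⟨z, hz, hzx, t1, t2⟩ := hc
  rcases h.exists_subseq hx hz hzx with ⟨φ, hφ, hφS⟩ | ⟨φ, hφ, hφS⟩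
  · have := h.tendsto hx hφS (hzx.comp hφ.tendsto_atTop)
    exact Or.inl ⟨tendsto_nhds_unique (t2.comp hφ.tendsto_atTop) this.1,
      tendsto_nhds_unique (t1.comp hφ.tendsto_atTop) this.2⟩
  · have := h.symm.tendsto hx hφS (hzx.comp hφ.tendsto_atTop)
    exact Or.inr ⟨tendsto_nhds_unique (t2.comp hφ.tendsto_atTop) this.1,
      tendsto_nhds_unique (t1.comp hφ.tendsto_atTop) this.2⟩

lemma sideValue (h : LocalSides Γ Y F e U S S' y Φ η η' C C') {x : ℂ} (hx : x ∈ U ∩ Γ) :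
    SideValue Γ Y F x (Φ x / η ^ e + C) (η * y x) := by
  obtain ⟨z, hz, hzx⟩ := h.exists_seq hx
  obtain ⟨t1, t2⟩ := h.tendsto hx.1 hz hzx
  exact ⟨z, fun n => (h.subset (hz n)).2, hzx, t2, t1⟩

end LocalSides

/-- `Y` is a branch of `f ^ (1 / 3)` and `F` is a primitive of `R / Y ^ e` on the complement of
`Γ`. -/
structure BranchData (Γ : Set ℂ) (f R : ℂ → ℂ) (e : ℕ) (Y F : ℂ → ℂ) : Prop where
  isClosed : IsClosed Γ
  f_diff : Differentiable ℂ f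
  R_diff : Differentiable ℂ R
  f_ne : ∀ z ∉ Γ, f z ≠ 0
  Y_cont : ContinuousOn Y Γᶜ
  Y_cube : ∀ z ∉ Γ, Y z ^ 3 = f z
  F_deriv : ∀ z ∉ Γ, HasDerivAt F (R z / Y z ^ e) z

namespace BranchData

variable {Γ : Set ℂ} {f R Y F : ℂ → ℂ} {e : ℕ}

lemma Y_ne (h : BranchData Γ f R e Y F) {z : ℂ} (hz : z ∉ Γ) : Y z ≠ 0 := fun h0 =>
  h.f_ne z hz (by rw [← h.Y_cube z hz, h0]; norm_num)

/-- The local form of `Y` and `F` on a preconnected subset of a disc. -/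
lemma eqOn_of_isPreconnected (h : BranchData Γ f R e Y F) {O : Set ℂ} (hO : IsOpen O)
    {y Φ : ℂ → ℂ} (hy : ContinuousOn y O) (hy3 : ∀ z ∈ O, y z ^ 3 = f z)
    (hΦ : ∀ z ∈ O, HasDerivAt Φ (R z / y z ^ e) z) {S : Set ℂ} (hS : IsPreconnected S)
    (hSO : S ⊆ O \ Γ) :
    ∃ η C : ℂ, η ^ 3 = 1 ∧ (∀ z ∈ S, Y z = η * y z) ∧ ∀ z ∈ S, F z = Φ z / η ^ e + C := by
  have hyne : ∀ z ∈ O \ Γ, y z ≠ 0 := fun z hz h0 =>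
    h.f_ne z hz.2 (by rw [← hy3 z hz.1, h0]; norm_num)
  obtain ⟨η, hη, hYη⟩ := exists_cubeRoot_ratio hS (h.Y_cont.mono fun z hz => (hSO hz).2)
    (hy.mono fun z hz => (hSO hz).1)
    (fun z hz => by rw [h.Y_cube z (hSO hz).2, hy3 z (hSO hz).1]) fun z hz => hyne z (hSO hz)
  have hO' : IsOpen (O ∩ Γᶜ) := hO.inter h.isClosed.isOpen_compl
  -- the open set of points where `Y` is given by the same multiple of `y`
  set O₁ : Set ℂ := {z | z ∈ O ∩ Γᶜ ∧ ∀ᶠ w in 𝓝 z, Y w = η * y w} with hO₁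
  have hO₁o : IsOpen O₁ := by
    have : O₁ = (O ∩ Γᶜ) ∩ {z | ∀ᶠ w in 𝓝 z, Y w = η * y w} := rfl
    rw [this]
    exact hO'.inter isOpen_setOfPred_eventually_nhds
  have hSO₁ : S ⊆ O₁ := by
    intro z hz
    refine ⟨hSO hz, ?_⟩
    obtain ⟨ε, hε, hb⟩ := Metric.isOpen_iff.1 hO' z (hSO hz)
    obtain ⟨η₂, -, h₂⟩ := exists_cubeRoot_ratio (convex_ball z ε).isPreconnected
      (h.Y_cont.mono fun w hw => (hb hw).2) (hy.mono fun w hw => (hb hw).1)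
      (fun w hw => by rw [h.Y_cube w (hb hw).2, hy3 w (hb hw).1]) fun w hw => hyne w (hb hw)
    have e1 : η₂ = η := mul_right_cancel₀ (hyne z (hSO hz))
      ((h₂ z (Metric.mem_ball_self hε)).symm.trans (hYη z hz))
    filter_upwards [Metric.ball_mem_nhds z hε] with w hw
    rw [← e1]
    exact h₂ w hw
  obtain ⟨C, hC⟩ := eq_of_hasDerivAt_eq hS hO₁o hSO₁ (F := F) (G := fun z => Φ z / η ^ e)
    (h := fun z => R z / Y z ^ e) (fun z hz => h.F_deriv z hz.1.2) (fun z hz => by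
      refine ((hΦ z hz.1.1).div_const (η ^ e)).congr_deriv ?_
      rw [hz.2.self_of_nhds, mul_pow, div_div, mul_comm])
  exact ⟨η, C, hη, hYη, hC⟩

lemma exists_local (h : BranchData Γ f R e Y F) {x : ℂ} (hx : f x ≠ 0) :
    ∃ r > 0, ∃ y Φ : ℂ → ℂ, DifferentiableOn ℂ y (Metric.ball x r) ∧
      (∀ z ∈ Metric.ball x r, y z ^ 3 = f z) ∧ (∀ z ∈ Metric.ball x r, y z ≠ 0) ∧
      ∀ z ∈ Metric.ball x r, HasDerivAt Φ (R z / y z ^ e) z := by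
  obtain ⟨r, hr, hb⟩ := Metric.mem_nhds_iff.1 (h.f_diff.continuous.continuousAt.eventually_ne hx)
  obtain ⟨y, hy, hy3⟩ := exists_cubeRoot_ball hr h.f_diff.differentiableOn (fun z hz => hb hz)
  have hy0 : ∀ z ∈ Metric.ball x r, y z ≠ 0 := fun z hz h0 =>
    hb hz (by rw [← hy3 z hz, h0]; norm_num)
  obtain ⟨Φ, hΦ⟩ := DifferentiableOn.isExactOn_ball (f := fun z => R z / y z ^ e) (c := x) (r := r)
    (h.R_diff.differentiableOn.div (hy.pow e) fun z hz => pow_ne_zero _ (hy0 z hz))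
  exact ⟨r, hr, y, Φ, hy, hy3, hy0, hΦ⟩

lemma exists_localSides (h : BranchData Γ f R e Y F) {x : ℂ} (ht : TwoSided Γ x) (hx : f x ≠ 0) :
    ∃ U S S' y Φ η η' C C', x ∈ U ∧ LocalSides Γ Y F e U S S' y Φ η η' C C' ∧
      (∀ z ∈ U, y z ^ 3 = f z) ∧ ∀ z ∈ U, HasDerivAt Φ (R z / y z ^ e) z := by
  obtain ⟨r, hr, y, Φ, hy, hy3, hy0, hΦ⟩ := h.exists_local hx
  obtain ⟨U, hUb, hUo, hxU, S, S', hS, hS', hSS, hcl⟩ := ht _ (Metric.ball_mem_nhds x hr)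
  have hSU : S ⊆ Metric.ball x r \ Γ := fun z hz => by
    have : z ∈ U \ Γ := hSS ▸ Or.inl hz
    exact ⟨hUb this.1, this.2⟩
  have hSU' : S' ⊆ Metric.ball x r \ Γ := fun z hz => by
    have : z ∈ U \ Γ := hSS ▸ Or.inr hz
    exact ⟨hUb this.1, this.2⟩
  obtain ⟨η, C, hη, h1, h2⟩ :=
    h.eqOn_of_isPreconnected Metric.isOpen_ball hy.continuousOn hy3 hΦ hS hSU
  obtain ⟨η', C', hη', h1', h2'⟩ :=
    h.eqOn_of_isPreconnected Metric.isOpen_ball hy.continuousOn hy3 hΦ hS' hSU'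
  refine ⟨U, S, S', y, Φ, η, η', C, C', hxU, ⟨hUo, hSS, hcl, hη, hη', fun z hz => hy0 z (hUb hz),
    hy.continuousOn.mono hUb, fun z hz => (hΦ z (hUb hz)).continuousAt.continuousWithinAt,
    h1, h1', h2, h2'⟩, fun z hz => hy3 z (hUb hz), fun z hz => hΦ z (hUb hz)⟩

/-- The data of a crossing is the same at all points of an edge. -/
lemma cross_of_isPreconnected (h : BranchData Γ f R e Y F) {L : Set ℂ} (hL : IsPreconnected L)
    (hLΓ : L ⊆ Γ) (ht : ∀ x ∈ L, TwoSided Γ x) (hf : ∀ x ∈ L, f x ≠ 0) {θ θ' x x' D : ℂ}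
    (hne : θ ≠ θ') (hx : x ∈ L) (hx' : x' ∈ L) (hc : Cross Γ Y F e θ θ' x D) :
    Cross Γ Y F e θ θ' x' D := by
  refine (hL.induction₂ (fun a b => Cross Γ Y F e θ θ' a D ↔ Cross Γ Y F e θ θ' b D) ?_
    (fun _ _ _ _ _ _ => Iff.trans) (fun _ _ _ _ => Iff.symm) hx hx').1 hc
  intro w hw
  obtain ⟨U, S, S', y, Φ, η, η', C, C', hwU, hl, -⟩ := h.exists_localSides (ht w hw) (hf w hw)
  filter_upwards [nhdsWithin_le_nhds (hl.isOpen.mem_nhds hwU), self_mem_nhdsWithin] with w' h1 h2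
  exact ⟨fun hc => hl.cross_of_cross hwU hne hc ⟨h1, hLΓ h2⟩,
    fun hc => hl.cross_of_cross h1 hne hc ⟨hwU, hLΓ hw⟩⟩

end BranchData

end TripleCover

namespace TripleCover

open Complex

/-! ### Embedded trees -/

lemma MarkedBinaryTree.exists_adj {V : Type*} [Fintype V] (B : MarkedBinaryTree V) (v : V) :
    ∃ w, B.graph.Adj v w := by
  have : (B.graph.neighborSet v).ncard ≠ 0 := by rcases B.valency v with h | h <;> omega
  exact Set.nonempty_of_ncard_ne_zero this

lemma MarkedBinaryTree.mem_terminals {V : Type*} [Fintype V] {B : MarkedBinaryTree V} {v : V} :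
    v ∈ B.terminals ↔ B.IsTerminal v := by
  simp [terminals]

lemma MarkedBinaryTree.a_pos {V : Type*} [Fintype V] (B : MarkedBinaryTree V) (v : V) :
    0 < B.a v := by
  unfold a; split_ifs <;> norm_num

namespace PlaneEmbedding

variable {V : Type*} [Fintype V] {B : MarkedBinaryTree V} (E : PlaneEmbedding B) {u v u' v' : V}

lemma isArc (h : B.graph.Adj u v) : IsArc (E.arc u v) :=
  ⟨E.arc_contDiffOn u v h, E.arc_regular u v h, E.arc_injOn u v h⟩

lemma arc_one (h : B.graph.Adj u v) : E.arc u v 1 = E.pos v := by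
  have := E.arc_symm v u h.symm 1 ⟨zero_le_one, le_rfl⟩
  rw [this, sub_self, E.arc_zero v u h.symm]

lemma arc_image_subset (h : B.graph.Adj u v) :
    E.arc v u '' Icc 0 1 ⊆ E.arc u v '' Icc 0 1 := by
  rintro _ ⟨s, hs, rfl⟩
  exact ⟨1 - s, ⟨by linarith [hs.2], by linarith [hs.1]⟩, (E.arc_symm u v h s hs).symm⟩

lemma arc_image_symm (h : B.graph.Adj u v) :
    E.arc v u '' Icc 0 1 = E.arc u v '' Icc 0 1 :=
  (E.arc_image_subset h).antisymm (E.arc_image_subset h.symm)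

lemma openEdge_symm (h : B.graph.Adj u v) : E.openEdge v u = E.openEdge u v := by
  have aux : ∀ {u v : V}, B.graph.Adj u v → E.openEdge v u ⊆ E.openEdge u v := by
    rintro u v h _ ⟨s, hs, rfl⟩
    exact ⟨1 - s, ⟨by linarith [hs.2], by linarith [hs.1]⟩,
      (E.arc_symm u v h s (Ioo_subset_Icc_self hs)).symm⟩
  exact (aux h).antisymm (aux h.symm)

/-- The union of the edges different from `u — v`. -/
def otherEdges (u v : V) : Set ℂ :=
  ⋃ d ∈ {d : V × V | B.graph.Adj d.1 d.2 ∧ s(u, v) ≠ s(d.1, d.2)}, E.arc d.1 d.2 '' Icc 0 1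

lemma isClosed_otherEdges (u v : V) : IsClosed (E.otherEdges u v) :=
  (Set.toFinite _).isClosed_biUnion fun _ he => (E.isArc he.1).isCompact_image.isClosed

lemma mem_otherEdges {x : ℂ} : x ∈ E.otherEdges u v ↔
    ∃ u' v', B.graph.Adj u' v' ∧ s(u, v) ≠ s(u', v') ∧ x ∈ E.arc u' v' '' Icc 0 1 := by
  simp only [otherEdges, mem_iUnion₂]
  constructor
  · rintro ⟨e, ⟨h1, h2⟩, h3⟩
    exact ⟨e.1, e.2, h1, h2, h3⟩
  · rintro ⟨u', v', h1, h2, h3⟩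
    exact ⟨(u', v'), ⟨h1, h2⟩, h3⟩

lemma arc_subset_support (h : B.graph.Adj u v) : E.arc u v '' Icc 0 1 ⊆ E.support :=
  fun _ hx => ⟨u, v, h, hx⟩

lemma support_eq_union (h : B.graph.Adj u v) :
    E.support = E.arc u v '' Icc 0 1 ∪ E.otherEdges u v := by
  ext x
  constructor
  · rintro ⟨u', v', h', hx⟩
    by_cases he : s(u, v) = s(u', v')
    · left
      rcases Sym2.eq_iff.1 he with ⟨rfl, rfl⟩ | ⟨rfl, rfl⟩
      · exact hx
      · exact E.arc_image_subset h hx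
    · exact Or.inr (E.mem_otherEdges.2 ⟨u', v', h', he, hx⟩)
  · rintro (hx | hx)
    · exact E.arc_subset_support h hx
    · obtain ⟨u', v', h', -, hx⟩ := E.mem_otherEdges.1 hx
      exact E.arc_subset_support h' hx

lemma support_eq_biUnion :
    E.support = ⋃ e ∈ {e : V × V | B.graph.Adj e.1 e.2}, E.arc e.1 e.2 '' Icc 0 1 := by
  ext x
  simp only [mem_iUnion₂]
  constructor
  · rintro ⟨u', v', h', hx⟩
    exact ⟨(u', v'), h', hx⟩
  · rintro ⟨e, h', hx⟩
    exact ⟨e.1, e.2, h', hx⟩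

lemma isCompact_support : IsCompact E.support := by
  rw [support_eq_biUnion]
  exact (Set.toFinite _).isCompact_biUnion fun _ he => (E.isArc he).isCompact_image

lemma isClosed_support : IsClosed E.support := E.isCompact_support.isClosed

lemma pos_mem_arc (h : B.graph.Adj u v) : E.pos u ∈ E.arc u v '' Icc 0 1 :=
  ⟨0, ⟨le_rfl, zero_le_one⟩, E.arc_zero u v h⟩

lemma pos_mem_support (v : V) : E.pos v ∈ E.support := by
  obtain ⟨w, hw⟩ := B.exists_adj v
  exact E.arc_subset_support hw (E.pos_mem_arc hw)

lemma isPreconnected_arc (h : B.graph.Adj u v) : IsPreconnected (E.arc u v '' Icc 0 1) :=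
  isPreconnected_Icc.image _ (E.isArc h).continuousOn

lemma isPreconnected_support : IsPreconnected E.support := by
  obtain ⟨v₀⟩ := B.isTree.1.nonempty
  refine isPreconnected_of_forall (E.pos v₀) ?_
  have key : ∀ (u v : V), B.graph.Walk u v →
      ∃ t ⊆ E.support, E.pos u ∈ t ∧ E.pos v ∈ t ∧ IsPreconnected t := by
    intro u v w
    induction w with
    | nil => exact ⟨{E.pos _}, singleton_subset_iff.2 (E.pos_mem_support _), rfl, rfl,
        isPreconnected_singleton⟩
    | cons h _ ih =>
      obtain ⟨t, h1, h2, h3, h4⟩ := ih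
      refine ⟨_, union_subset (E.arc_subset_support h) h1, Or.inl (E.pos_mem_arc h), Or.inr h3,
        (E.isPreconnected_arc h).union _ ⟨1, ⟨zero_le_one, le_rfl⟩, E.arc_one h⟩ h2 h4⟩
  rintro x ⟨u, v, h, hx⟩
  obtain ⟨w⟩ := B.isTree.1.preconnected v₀ u
  obtain ⟨t, h1, h2, h3, h4⟩ := key _ _ w
  exact ⟨_, union_subset (E.arc_subset_support h) h1, Or.inr h2, Or.inl hx,
    (E.isPreconnected_arc h).union _ (E.pos_mem_arc h) h3 h4⟩

lemma arc_notMem_otherEdges (h : B.graph.Adj u v) {s : ℝ} (hs : s ∈ Ioo (0 : ℝ) 1) :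
    E.arc u v s ∉ E.otherEdges u v := by
  rw [mem_otherEdges]
  rintro ⟨u', v', h', hne, s', hs', e⟩
  rcases (E.arc_disjoint u v u' v' h h' hne s (Ioo_subset_Icc_self hs) s' hs' e.symm).1 with h1 | h1
  · exact hs.1.ne' h1
  · exact hs.2.ne h1

lemma twoSided (h : B.graph.Adj u v) {x : ℂ} (hx : x ∈ E.openEdge u v) : TwoSided E.support x := by
  obtain ⟨s, hs, rfl⟩ := hx
  rw [E.support_eq_union h]
  exact (E.isArc h).twoSided hs (E.isClosed_otherEdges u v) (E.arc_notMem_otherEdges h hs)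

lemma openEdge_subset (h : B.graph.Adj u v) : E.openEdge u v ⊆ E.support :=
  (image_mono Ioo_subset_Icc_self).trans (E.arc_subset_support h)

lemma isPreconnected_openEdge (h : B.graph.Adj u v) : IsPreconnected (E.openEdge u v) :=
  isPreconnected_Ioo.image _ ((E.isArc h).continuousOn.mono Ioo_subset_Icc_self)

lemma openEdge_nonempty (u v : V) : (E.openEdge u v).Nonempty :=
  ⟨_, 1 / 2, ⟨by norm_num, by norm_num⟩, rfl⟩

lemma pos_notMem_openEdge (h : B.graph.Adj u v) (w : V) : E.pos w ∉ E.openEdge u v := by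
  rintro ⟨s, hs, e⟩
  obtain ⟨w', hw'⟩ := B.exists_adj w
  by_cases he : s(u, v) = s(w, w')
  · have h0 : (0 : ℝ) ∈ Icc (0 : ℝ) 1 := ⟨le_rfl, zero_le_one⟩
    have h1 : (1 : ℝ) ∈ Icc (0 : ℝ) 1 := ⟨zero_le_one, le_rfl⟩
    rcases Sym2.eq_iff.1 he with ⟨rfl, rfl⟩ | ⟨rfl, rfl⟩
    · rw [← E.arc_zero _ _ h] at e
      exact hs.1.ne' ((E.isArc h).injOn (Ioo_subset_Icc_self hs) h0 e)
    · rw [← E.arc_one h] at e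
      exact hs.2.ne ((E.isArc h).injOn (Ioo_subset_Icc_self hs) h1 e)
  · refine E.arc_notMem_otherEdges h hs (E.mem_otherEdges.2 ⟨w, w', hw', he, ?_⟩)
    rw [e]
    exact E.pos_mem_arc hw'

lemma f_eq_zero_iff {x : ℂ} : E.f x = 0 ↔ ∃ k, B.IsTerminal k ∧ x = E.pos k := by
  unfold f
  rw [Finset.prod_eq_zero_iff]
  constructor
  · rintro ⟨k, hk, h⟩
    exact ⟨k, MarkedBinaryTree.mem_terminals.1 hk, sub_eq_zero.1 (pow_eq_zero_iff (B.a_pos k).ne' |>.1 h)⟩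
  · rintro ⟨k, hk, rfl⟩
    exact ⟨k, MarkedBinaryTree.mem_terminals.2 hk, by rw [sub_self, zero_pow (B.a_pos k).ne']⟩

lemma f_ne_zero_of_mem_openEdge (h : B.graph.Adj u v) {x : ℂ} (hx : x ∈ E.openEdge u v) :
    E.f x ≠ 0 := by
  rw [Ne, f_eq_zero_iff]
  rintro ⟨k, -, rfl⟩
  exact E.pos_notMem_openEdge h k hx

lemma f_ne_zero {x : ℂ} (hx : x ∉ E.support) : E.f x ≠ 0 := by
  rw [Ne, f_eq_zero_iff]
  rintro ⟨k, -, rfl⟩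
  exact hx (E.pos_mem_support k)

lemma f_pos_ne_zero {v : V} (hv : B.IsInner v) : E.f (E.pos v) ≠ 0 := by
  rw [Ne, f_eq_zero_iff]
  rintro ⟨k, hk, e⟩
  rw [E.pos_injective e] at hv
  have h1 : (B.graph.neighborSet k).ncard = 3 := hv
  have h2 : (B.graph.neighborSet k).ncard = 1 := hk
  omega

lemma differentiable_f : Differentiable ℂ E.f := by
  unfold f
  fun_prop

namespace IsSheet

variable {E} {ζ : ℂ} {Y : ℂ → ℂ}

lemma ne_zero (hY : E.IsSheet ζ Y) {z : ℂ} (hz : z ∉ E.support) : Y z ≠ 0 := fun h0 =>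
  E.f_ne_zero hz (by rw [← hY.cube z hz, h0]; norm_num)

lemma differentiableAt (hY : E.IsSheet ζ Y) {z : ℂ} (hz : z ∉ E.support) :
    DifferentiableAt ℂ Y z := by
  have hn := E.isClosed_support.isOpen_compl.mem_nhds hz
  refine differentiableAt_of_cube (hY.continuousOn.continuousAt hn) ?_ E.differentiable_f.differentiableAt
    (E.f_ne_zero hz)
  filter_upwards [hn] with w hw using hY.cube w hw

lemma tendsto_div (hY : E.IsSheet ζ Y) (hζ : ζ ^ 3 = 1) {R : ℂ → ℂ} {e : ℕ}
    (hR : Tendsto (fun z => z * R z / z ^ (e * B.n₁)) (Bornology.cobounded ℂ) (𝓝 0)) :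
    Tendsto (fun z => z * (R z / Y z ^ e)) (Bornology.cobounded ℂ) (𝓝 0) := by
  have h1 := hR.mul ((hY.atInfinity.inv₀ (cubeRoot_ne_zero hζ)).pow e)
  rw [zero_mul] at h1
  refine h1.congr' ?_
  have h0 : ∀ᶠ z : ℂ in Bornology.cobounded ℂ, z ≠ 0 := by
    have := (Set.finite_singleton (0 : ℂ)).isBounded
    exact Bornology.isBounded_def.1 this
  filter_upwards [h0] with z hz
  rw [inv_div, div_pow, ← pow_mul, mul_comm B.n₁ e]
  have := pow_ne_zero (e * B.n₁) hz
  field_simp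

/-- The differential `R dx / Y ^ e` is exact on the complement of the tree. -/
lemma exists_branchData (hY : E.IsSheet ζ Y) (hζ : ζ ^ 3 = 1) {R : ℂ → ℂ} (hR : Differentiable ℂ R)
    {e : ℕ} (hinf : Tendsto (fun z => z * R z / z ^ (e * B.n₁)) (Bornology.cobounded ℂ) (𝓝 0)) :
    ∃ F, BranchData E.support E.f R e Y F := by
  obtain ⟨F, hF⟩ := exists_primitive E.isCompact_support E.isPreconnected_support
    (h := fun z => R z / Y z ^ e)
    (fun z hz => (hR.differentiableAt.div ((hY.differentiableAt hz).pow e)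
      (pow_ne_zero _ (hY.ne_zero hz))).differentiableWithinAt) (hY.tendsto_div hζ hinf)
  exact ⟨F, E.isClosed_support, E.differentiable_f, hR, fun z hz => E.f_ne_zero hz,
    hY.continuousOn, hY.cube, hF⟩

end IsSheet

end PlaneEmbedding

/-! ### Periods and crossings -/

/-- Between crossings the integrand is the derivative of `F / κ ^ e` with `κ = θ` or `θ'`, so the
integral telescopes to the mismatches of these functions at `s₁` and `s₂`. The outer pieces fit
together at the parameters 0 and 1 because the curve is closed. -/
lemma BranchData.period_eq {Γ : Set ℂ} {f R Y F : ℂ → ℂ} {e : ℕ} (h : BranchData Γ f R e Y F)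
    {φ : ℂ → ℂ → ℂ} (hφ : ∀ x y, y ^ 3 = f x → f x ≠ 0 → φ x y = R x / y ^ e)
    (c : ClosedCurve f) {θ θ' : ℂ} {s₁ s₂ : ℝ} (h0 : 0 < s₁) (h12 : s₁ < s₂) (h1 : s₂ < 1)
    (hΓ : ∀ s ∈ Icc (0 : ℝ) 1, s ≠ s₁ → s ≠ s₂ → c.x s ∉ Γ)
    (hf₁ : f (c.x s₁) ≠ 0) (hf₂ : f (c.x s₂) ≠ 0)
    (hθ : ∀ s ∈ Ico 0 s₁ ∪ Ioc s₂ 1, c.y s = θ * Y (c.x s))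
    (hθ' : ∀ s ∈ Ioo s₁ s₂, c.y s = θ' * Y (c.x s)) :
    ∃ D₁ D₂, Cross Γ Y F e θ θ' (c.x s₁) D₁ ∧ Cross Γ Y F e θ' θ (c.x s₂) D₂ ∧
      period φ c = D₁ + D₂ := by
  have hfne : ∀ s ∈ Icc (0 : ℝ) 1, f (c.x s) ≠ 0 := by
    intro s hs
    by_cases e1 : s = s₁
    · rwa [e1]
    by_cases e2 : s = s₂
    · rwa [e2]
    exact h.f_ne _ (hΓ s hs e1 e2)
  have hyne : ∀ s ∈ Icc (0 : ℝ) 1, c.y s ≠ 0 := fun s hs e0 =>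
    hfne s hs (by rw [← c.on_curve s hs, e0]; norm_num)
  have hxc : ContinuousOn c.x (Icc 0 1) := c.contDiffOn.continuousOn
  set g : ℝ → ℂ := fun s => R (c.x s) / c.y s ^ e * derivWithin c.x (Icc 0 1) s with hg
  have hgc : ContinuousOn g (Icc 0 1) :=
    ((h.R_diff.continuous.comp_continuousOn hxc).div (c.continuousOn.pow e)
      fun s hs => pow_ne_zero _ (hyne s hs)).mul
      (c.contDiffOn.continuousOn_derivWithin (uniqueDiffOn_Icc one_pos) le_rfl)
  have hint : ∀ a ∈ Icc (0 : ℝ) 1, ∀ b ∈ Icc (0 : ℝ) 1,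
      IntervalIntegrable g MeasureTheory.volume a b := fun a ha b hb =>
    (hgc.mono ((convex_Icc 0 1).ordConnected.uIcc_subset ha hb)).intervalIntegrable
  -- `period` uses `deriv`, which is uncontrolled at the end points; it agrees with the one-sided
  -- derivative on the open interval.
  have hper : period φ c = ∫ s in (0 : ℝ)..1, g s := by
    unfold period
    refine intervalIntegral.integral_congr_ae ?_
    have : ∀ᵐ s : ℝ, s ≠ 1 := by simp [MeasureTheory.ae_iff]
    filter_upwards [this] with s hs1 hs
    rw [uIoc_of_le zero_le_one] at hs
    have hs' : s ∈ Ioo (0 : ℝ) 1 := ⟨hs.1, hs.2.lt_of_ne hs1⟩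
    rw [hφ _ _ (c.on_curve s (Ioo_subset_Icc_self hs')) (hfne s (Ioo_subset_Icc_self hs')), hg]
    simp only
    rw [derivWithin_of_mem_nhds (Icc_mem_nhds hs'.1 hs'.2)]
  set G : ℝ → ℂ := fun s => ∫ u in (0 : ℝ)..s, g u with hG
  have hGc : ContinuousOn G (Icc 0 1) := by
    have := intervalIntegral.continuousOn_primitive_interval (μ := MeasureTheory.volume)
      (f := g) (a := 0) (b := 1) (by rw [uIcc_of_le zero_le_one]; exact hgc.integrableOn_Icc)
    rwa [uIcc_of_le zero_le_one] at this
  have hGsub : ∀ a ∈ Icc (0 : ℝ) 1, ∀ b ∈ Icc (0 : ℝ) 1, ∫ u in a..b, g u = G b - G a :=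
    fun a ha b hb => by
      have h00 : (0 : ℝ) ∈ Icc (0 : ℝ) 1 := ⟨le_rfl, zero_le_one⟩
      rw [hG]
      exact (intervalIntegral.integral_interval_sub_left (hint 0 h00 b hb) (hint 0 h00 a ha)).symm
  have piece : ∀ (κ : ℂ) (a b : ℝ), 0 ≤ a → a ≤ b → b ≤ 1 → (∀ s ∈ Icc a b, s ≠ s₁ ∧ s ≠ s₂) →
      (∀ s ∈ Icc a b, c.y s = κ * Y (c.x s)) →
      F (c.x b) / κ ^ e - F (c.x a) / κ ^ e = G b - G a := by
    intro κ a b ha hab hb hs hκ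
    have hsub : Icc a b ⊆ Icc (0 : ℝ) 1 := Icc_subset_Icc ha hb
    rw [← hGsub a ⟨ha, hab.trans hb⟩ b ⟨ha.trans hab, hb⟩]
    refine (intervalIntegral.integral_eq_sub_of_hasDerivAt_of_le
      (f := fun s => F (c.x s) / κ ^ e) hab ?_ ?_
      (hint a ⟨ha, hab.trans hb⟩ b ⟨ha.trans hab, hb⟩)).symm
    · refine ContinuousOn.div_const (fun s hs' => ?_) _
      exact (h.F_deriv _ (hΓ s (hsub hs') (hs s hs').1 (hs s hs').2)).continuousAt.comp_continuousWithinAt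
        (hxc.mono hsub s hs')
    · intro s hs'
      have hs1 := Ioo_subset_Icc_self hs'
      have hn : Icc (0 : ℝ) 1 ∈ 𝓝 s := Icc_mem_nhds (ha.trans_lt hs'.1) (hs'.2.trans_le hb)
      have hd : HasDerivAt c.x (derivWithin c.x (Icc 0 1) s) s :=
        ((c.contDiffOn.differentiableOn one_ne_zero) s (hsub hs1)).hasDerivWithinAt.hasDerivAt hn
      have := ((h.F_deriv _ (hΓ s (hsub hs1) (hs s hs1).1 (hs s hs1).2)).comp s hd).div_const (κ ^ e)
      refine this.congr_deriv ?_
      rw [hg]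
      simp only
      rw [hκ s hs1, mul_pow, mul_div_right_comm, div_div, mul_comm (Y _ ^ e)]
  have seqL : ∀ a b : ℝ, a < b → ∃ z : ℕ → ℝ, (∀ n, z n ∈ Ioo a b) ∧ Tendsto z atTop (𝓝 b) :=
    fun a b hab => by
      have : b ∈ closure (Ioo a b) := by
        rw [closure_Ioo hab.ne]
        exact ⟨hab.le, le_rfl⟩
      exact mem_closure_iff_seq_limit.1 this
  have seqR : ∀ a b : ℝ, a < b → ∃ z : ℕ → ℝ, (∀ n, z n ∈ Ioo a b) ∧ Tendsto z atTop (𝓝 a) :=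
    fun a b hab => by
      have : a ∈ closure (Ioo a b) := by
        rw [closure_Ioo hab.ne]
        exact ⟨le_rfl, hab.le⟩
      exact mem_closure_iff_seq_limit.1 this
  obtain ⟨m, hm⟩ := exists_between h12
  have tend : ∀ (s : ℝ), s ∈ Icc (0 : ℝ) 1 → ∀ z : ℕ → ℝ, (∀ n, z n ∈ Icc (0 : ℝ) 1) →
      Tendsto z atTop (𝓝 s) → Tendsto (fun n => c.x (z n)) atTop (𝓝 (c.x s)) ∧
        Tendsto (fun n => c.y (z n)) atTop (𝓝 (c.y s)) ∧
        Tendsto (fun n => G (z n)) atTop (𝓝 (G s)) := fun s hs z hz ht => by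
    have ht' : Tendsto z atTop (𝓝[Icc 0 1] s) :=
      tendsto_nhdsWithin_iff.2 ⟨ht, Eventually.of_forall hz⟩
    exact ⟨(hxc s hs).tendsto.comp ht', (c.continuousOn s hs).tendsto.comp ht',
      (hGc s hs).tendsto.comp ht'⟩
  have hs₁ : s₁ ∈ Icc (0 : ℝ) 1 := ⟨h0.le, (h12.trans h1).le⟩
  have hs₂ : s₂ ∈ Icc (0 : ℝ) 1 := ⟨(h0.trans h12).le, h1.le⟩
  have hGz : G 0 = 0 := intervalIntegral.integral_same
  -- The one-sided limits of `F / θ ^ e` and `F / θ' ^ e` at the crossings, expressed by the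
  -- continuous primitive `G` and the values at `0`, `m` and `1`. This also proves that these limits
  -- exist.
  refine ⟨F (c.x 0) / θ ^ e + G s₁ - (F (c.x m) / θ' ^ e - (G m - G s₁)),
    F (c.x m) / θ' ^ e + (G s₂ - G m) - (F (c.x 1) / θ ^ e - (G 1 - G s₂)), ?_, ?_, ?_⟩
  · obtain ⟨z, hz, hzt⟩ := seqL 0 s₁ h0
    obtain ⟨z', hz', hzt'⟩ := seqR s₁ m hm.1
    have hzI : ∀ n, z n ∈ Icc (0 : ℝ) 1 := fun n => ⟨(hz n).1.le, (hz n).2.le.trans hs₁.2⟩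
    have hzI' : ∀ n, z' n ∈ Icc (0 : ℝ) 1 := fun n =>
      ⟨hs₁.1.trans (hz' n).1.le, (hz' n).2.le.trans (hm.2.trans h1).le⟩
    obtain ⟨a1, a2, a3⟩ := tend s₁ hs₁ z hzI hzt
    obtain ⟨b1, b2, b3⟩ := tend s₁ hs₁ z' hzI' hzt'
    refine ⟨fun n => c.x (z n), fun n => c.x (z' n),
      fun n => hΓ _ (hzI n) (hz n).2.ne ((hz n).2.trans h12).ne,
      fun n => hΓ _ (hzI' n) (hz' n).1.ne' ((hz' n).2.trans hm.2).ne, a1, b1, ?_, ?_⟩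
    · have := a2.sub b2
      rw [sub_self] at this
      refine this.congr fun n => ?_
      rw [hθ _ (Or.inl ⟨(hz n).1.le, (hz n).2⟩), hθ' _ ⟨(hz' n).1, (hz' n).2.trans hm.2⟩]
    · have := (a3.const_add (F (c.x 0) / θ ^ e)).sub
        ((b3.const_sub (G m)).const_sub (F (c.x m) / θ' ^ e))
      refine this.congr fun n => ?_
      have e1 := piece θ 0 (z n) le_rfl (hz n).1.le (hzI n).2
        (fun s hs => ⟨(hs.2.trans_lt (hz n).2).ne, (hs.2.trans_lt ((hz n).2.trans h12)).ne⟩)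
        (fun s hs => hθ s (Or.inl ⟨hs.1, hs.2.trans_lt (hz n).2⟩))
      have e2 := piece θ' (z' n) m (hzI' n).1 (hz' n).2.le (hm.2.trans h1).le
        (fun s hs => ⟨((hz' n).1.trans_le hs.1).ne', (hs.2.trans_lt hm.2).ne⟩)
        (fun s hs => hθ' s ⟨(hz' n).1.trans_le hs.1, hs.2.trans_lt hm.2⟩)
      rw [hGz] at e1
      linear_combination -e1 - e2
  · obtain ⟨z, hz, hzt⟩ := seqL m s₂ hm.2
    obtain ⟨z', hz', hzt'⟩ := seqR s₂ 1 h1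
    have hzI : ∀ n, z n ∈ Icc (0 : ℝ) 1 := fun n =>
      ⟨(h0.trans hm.1).le.trans (hz n).1.le, (hz n).2.le.trans hs₂.2⟩
    have hzI' : ∀ n, z' n ∈ Icc (0 : ℝ) 1 := fun n => ⟨hs₂.1.trans (hz' n).1.le, (hz' n).2.le⟩
    obtain ⟨a1, a2, a3⟩ := tend s₂ hs₂ z hzI hzt
    obtain ⟨b1, b2, b3⟩ := tend s₂ hs₂ z' hzI' hzt'
    refine ⟨fun n => c.x (z n), fun n => c.x (z' n),
      fun n => hΓ _ (hzI n) (hm.1.trans (hz n).1).ne' (hz n).2.ne,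
      fun n => hΓ _ (hzI' n) (h12.trans (hz' n).1).ne' (hz' n).1.ne', a1, b1, ?_, ?_⟩
    · have := a2.sub b2
      rw [sub_self] at this
      refine this.congr fun n => ?_
      rw [hθ' _ ⟨hm.1.trans (hz n).1, (hz n).2⟩, hθ _ (Or.inr ⟨(hz' n).1, (hz' n).2.le⟩)]
    · have := ((a3.sub_const (G m)).const_add (F (c.x m) / θ' ^ e)).sub
        ((b3.const_sub (G 1)).const_sub (F (c.x 1) / θ ^ e))
      refine this.congr fun n => ?_
      have e1 := piece θ' m (z n) (h0.trans hm.1).le (hz n).1.le (hzI n).2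
        (fun s hs => ⟨(hm.1.trans_le hs.1).ne', (hs.2.trans_lt (hz n).2).ne⟩)
        (fun s hs => hθ' s ⟨hm.1.trans_le hs.1, hs.2.trans_lt (hz n).2⟩)
      have e2 := piece θ (z' n) 1 (hzI' n).1 (hz' n).2.le le_rfl
        (fun s hs => ⟨((h12.trans (hz' n).1).trans_le hs.1).ne', ((hz' n).1.trans_le hs.1).ne'⟩)
        (fun s hs => hθ s (Or.inr ⟨(hz' n).1.trans_le hs.1, hs.2⟩))
      linear_combination -e1 - e2
  · rw [hper, show ∫ s in (0 : ℝ)..1, g s = G 1 from rfl, c.closed_x]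
    ring

end TripleCover

namespace TripleCover

open Complex

/-! ### Limits of crossings -/

/-- The mean value inequality on balls, propagated along a connected set. Only increments can
converge, since the primitives for different `t` have unrelated additive constants. -/
lemma tendsto_sub_of_hasDerivAt {ι : Type*} {l : Filter ι} {S : Set ℂ} (hS : IsPreconnected S)
    {G h : ι → ℂ → ℂ} {G' h' : ℂ → ℂ} (hG : ∀ᶠ t in l, ∀ z ∈ S, HasDerivAt (G t) (h t z) z)
    (hG' : ∀ z ∈ S, HasDerivAt G' (h' z) z)
    (hloc : ∀ x ∈ S, ∃ ρ > 0, Metric.ball x ρ ⊆ S ∧ ∀ ε > 0, ∀ᶠ t in l, ∀ z ∈ Metric.ball x ρ,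
      ‖h t z - h' z‖ ≤ ε) {x y : ℂ} (hx : x ∈ S) (hy : y ∈ S) :
    Tendsto (fun t => G t y - G t x) l (𝓝 (G' y - G' x)) := by
  refine hS.induction₂ (fun x y => Tendsto (fun t => G t y - G t x) l (𝓝 (G' y - G' x))) ?_
    (fun a b c _ _ _ h1 h2 => ?_) (fun a b _ _ h1 => ?_) hx hy
  · intro x hx
    obtain ⟨ρ, hρ, hb, hu⟩ := hloc x hx
    filter_upwards [nhdsWithin_le_nhds (Metric.ball_mem_nhds x hρ)] with y hy
    rw [Metric.tendsto_nhds]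
    intro ε hε
    filter_upwards [hG, hu (ε / (2 * ρ)) (by positivity)] with t h1 h2
    have hd : ∀ z ∈ Metric.ball x ρ,
        HasDerivWithinAt (G t - G') (h t z - h' z) (Metric.ball x ρ) z :=
      fun z hz => ((h1 z (hb hz)).sub (hG' z (hb hz))).hasDerivWithinAt
    have h3 := (convex_ball x ρ).norm_image_sub_le_of_norm_hasDerivWithin_le hd h2
      (Metric.mem_ball_self hρ) hy
    rw [dist_eq_norm]
    calc ‖G t y - G t x - (G' y - G' x)‖ = ‖(G t - G') y - (G t - G') x‖ := by
          congr 1; simp only [Pi.sub_apply]; ring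
      _ ≤ ε / (2 * ρ) * ‖y - x‖ := h3
      _ ≤ ε / (2 * ρ) * ρ := by
          gcongr
          exact (mem_ball_iff_norm.1 hy).le
      _ = ε / 2 := by field_simp
      _ < ε := by linarith
  · have := h1.add h2
    convert! this using 2 <;> ring
  · have := h1.neg
    convert! this using 2 <;> ring

/-- The branches `Y t` of cube roots, with primitives `F t` of `R / Y t ^ e`, tend to `Y'` and `F'`
on the open set `O`, in which the slits do not depend on `t`. -/
structure BranchLimit {ι : Type*} (l : Filter ι) (O : Set ℂ) (R : ℂ → ℂ) (e : ℕ)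
    (Γ : ι → Set ℂ) (f Y F : ι → ℂ → ℂ) (Γ' : Set ℂ) (f' Y' F' : ℂ → ℂ) (κ : ι → ℂ → ℂ) :
    Prop where
  data : ∀ᶠ t in l, BranchData (Γ t) (f t) R e (Y t) (F t)
  data' : BranchData Γ' f' R e Y' F'
  isOpen : IsOpen O
  isPreconnected : IsPreconnected (O \ Γ')
  mem_iff : ∀ᶠ t in l, ∀ x ∈ O, x ∈ Γ t ↔ x ∈ Γ'
  κ_diff : ∀ᶠ t in l, DifferentiableOn ℂ (κ t) O
  f_eq : ∀ᶠ t in l, ∀ x ∈ O, f t x = f' x * κ t x ^ 3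
  Y_eq : ∀ᶠ t in l, ∀ x ∈ O \ Γ', Y t x = Y' x * κ t x
  κ_tendsto : ∀ ε > 0, ∀ᶠ t in l, ∀ x ∈ O, ‖κ t x - 1‖ < ε

namespace BranchLimit

variable {ι : Type*} {l : Filter ι} {O : Set ℂ} {R : ℂ → ℂ} {e : ℕ} {Γ : ι → Set ℂ}
  {f Y F : ι → ℂ → ℂ} {Γ' : Set ℂ} {f' Y' F' : ℂ → ℂ} {κ : ι → ℂ → ℂ}

lemma κ_ne (h : BranchLimit l O R e Γ f Y F Γ' f' Y' F' κ) : ∀ᶠ t in l, ∀ x ∈ O, κ t x ≠ 0 := by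
  filter_upwards [h.κ_tendsto 1 one_pos] with t ht x hx h0
  have := ht x hx
  rw [h0] at this
  norm_num at this

lemma integrand_tendsto (h : BranchLimit l O R e Γ f Y F Γ' f' Y' F' κ) {S : Set ℂ} (hS : IsOpen S)
    (hSO : S ⊆ O) {g : ℂ → ℂ} (hg : ContinuousOn g S) {x : ℂ} (hx : x ∈ S) :
    ∃ ρ > 0, Metric.ball x ρ ⊆ S ∧ ∀ ε > 0, ∀ᶠ t in l, ∀ z ∈ Metric.ball x ρ,
      ‖g z / κ t z ^ e - g z‖ ≤ ε := by
  have h1 : ∀ᶠ z in 𝓝 x, ‖g z‖ < ‖g x‖ + 1 :=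
    (hg.continuousAt (hS.mem_nhds hx)).norm.eventually_lt_const (lt_add_one _)
  obtain ⟨ρ, hρ, hb⟩ := Metric.mem_nhds_iff.1 (h1.and (hS.mem_nhds hx))
  refine ⟨ρ, hρ, fun z hz => (hb hz).2, fun ε hε => ?_⟩
  have hc : ContinuousAt (fun w : ℂ => (w ^ e)⁻¹) 1 := by
    apply ContinuousAt.inv₀ (by fun_prop)
    simp
  obtain ⟨δ, hδ, hδ'⟩ := Metric.continuousAt_iff.1 hc (ε / (‖g x‖ + 1)) (by positivity)
  filter_upwards [h.κ_tendsto δ hδ] with t ht z hz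
  have h2 := hδ' (x := κ t z) (by rw [dist_eq_norm]; exact ht z (hSO (hb hz).2))
  rw [dist_eq_norm, one_pow, inv_one] at h2
  have h3 : g z / κ t z ^ e - g z = g z * ((κ t z ^ e)⁻¹ - 1) := by ring
  rw [h3, norm_mul]
  calc ‖g z‖ * ‖(κ t z ^ e)⁻¹ - 1‖ ≤ (‖g x‖ + 1) * (ε / (‖g x‖ + 1)) := by
        gcongr
        exact (hb hz).1.le
    _ = ε := by field_simp

lemma primitive_tendsto (h : BranchLimit l O R e Γ f Y F Γ' f' Y' F' κ) {b b₀ : ℂ}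
    (hb : b ∈ O \ Γ') (hb₀ : b₀ ∈ O \ Γ') :
    Tendsto (fun t => F t b - F t b₀) l (𝓝 (F' b - F' b₀)) := by
  have hW : IsOpen (O \ Γ') := h.isOpen.sdiff h.data'.isClosed
  refine tendsto_sub_of_hasDerivAt h.isPreconnected
    (h := fun t z => R z / Y' z ^ e / κ t z ^ e) (h' := fun z => R z / Y' z ^ e) ?_
    (fun z hz => h.data'.F_deriv z hz.2)
    (fun x hx => h.integrand_tendsto hW sdiff_subset (h.data'.R_diff.continuous.continuousOn.div
      ((h.data'.Y_cont.mono fun z hz => hz.2).pow e)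
      fun z hz => pow_ne_zero _ (h.data'.Y_ne hz.2)) hx) hb₀ hb
  filter_upwards [h.data, h.mem_iff, h.Y_eq] with t h1 h2 h3 z hz
  have := h1.F_deriv z fun hzt => hz.2 ((h2 z hz.1).1 hzt)
  rwa [h3 z hz, mul_pow, ← div_div] at this

/-- The jump is a combination of the integration constants on the two sides of `x`. Each constant is
`F t` minus the local primitive at a test point of that side, and converges once `F t b₀` is
subtracted, because the sides are connected to `b₀` off the tree. -/
theorem cross_tendsto [l.NeBot] (h : BranchLimit l O R e Γ f Y F Γ' f' Y' F' κ) {x b₀ : ℂ} (hx : x ∈ O ∩ Γ')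
    (ht : TwoSided Γ' x) (hf : f' x ≠ 0) (hb₀ : b₀ ∈ O \ Γ') {θ θ' : ℂ} (hθ : θ ^ 3 = 1)
    (hθ' : θ' ^ 3 = 1) (hne : θ ≠ θ') {D : ι → ℂ} {D' : ℂ}
    (hD : ∀ᶠ t in l, Cross (Γ t) (Y t) (F t) e θ θ' x (D t)) (hD' : Cross Γ' Y' F' e θ θ' x D') :
    Tendsto (fun t => D t - (F t b₀ / θ ^ e - F t b₀ / θ' ^ e)) l
      (𝓝 (D' - (F' b₀ / θ ^ e - F' b₀ / θ' ^ e))) := by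
  obtain ⟨r₁, hr₁, y, Φ', hy₁, hy3₁, hy0₁, hΦ₁⟩ := h.data'.exists_local hf
  obtain ⟨r₂, hr₂, hrO⟩ := Metric.isOpen_iff.1 h.isOpen x hx.1
  set r := min r₁ r₂
  have hr : 0 < r := lt_min hr₁ hr₂
  have hsub₁ : Metric.ball x r ⊆ Metric.ball x r₁ := Metric.ball_subset_ball (min_le_left _ _)
  have hsub : Metric.ball x r ⊆ O := (Metric.ball_subset_ball (min_le_right _ _)).trans hrO
  have hy := hy₁.mono hsub₁
  have hy3 : ∀ z ∈ Metric.ball x r, y z ^ 3 = f' z := fun z hz => hy3₁ z (hsub₁ hz)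
  have hy0 : ∀ z ∈ Metric.ball x r, y z ≠ 0 := fun z hz => hy0₁ z (hsub₁ hz)
  have hΦ : ∀ z ∈ Metric.ball x r, HasDerivAt Φ' (R z / y z ^ e) z := fun z hz => hΦ₁ z (hsub₁ hz)
  obtain ⟨U, hUb, hUo, hxU, S, S', hS, hS', hSS, hcl⟩ := ht _ (Metric.ball_mem_nhds x hr)
  have hSU : S ⊆ Metric.ball x r \ Γ' := fun z hz => by
    have : z ∈ U \ Γ' := hSS ▸ Or.inl hz
    exact ⟨hUb this.1, this.2⟩
  have hSU' : S' ⊆ Metric.ball x r \ Γ' := fun z hz => by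
    have : z ∈ U \ Γ' := hSS ▸ Or.inr hz
    exact ⟨hUb this.1, this.2⟩
  obtain ⟨η, C, hη, h1, h2⟩ :=
    h.data'.eqOn_of_isPreconnected Metric.isOpen_ball hy.continuousOn hy3 hΦ hS hSU
  obtain ⟨η', C', hη', h1', h2'⟩ :=
    h.data'.eqOn_of_isPreconnected Metric.isOpen_ball hy.continuousOn hy3 hΦ hS' hSU'
  have hl : LocalSides Γ' Y' F' e U S S' y Φ' η η' C C' :=
    ⟨hUo, hSS, hcl, hη, hη', fun z hz => hy0 z (hUb hz), hy.continuousOn.mono hUb,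
      fun z hz => (hΦ z (hUb hz)).continuousAt.continuousWithinAt, h1, h1', h2, h2'⟩
  obtain ⟨b₁, hb₁⟩ : S.Nonempty := closure_nonempty_iff.1 ⟨x, (hcl x ⟨hxU, hx.2⟩).1⟩
  obtain ⟨b₂, hb₂⟩ : S'.Nonempty := closure_nonempty_iff.1 ⟨x, (hcl x ⟨hxU, hx.2⟩).2⟩
  -- the local functions for `t`
  obtain ⟨Φ, hΦt⟩ : ∃ Φ : ι → ℂ → ℂ, ∀ᶠ t in l, ∀ z ∈ Metric.ball x r,
      HasDerivAt (Φ t) (R z / y z ^ e / κ t z ^ e) z := by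
    refine Filter.Eventually.choice (r := fun t (Φ : ℂ → ℂ) => ∀ z ∈ Metric.ball x r,
      HasDerivAt Φ (R z / y z ^ e / κ t z ^ e) z) ?_
    filter_upwards [h.κ_diff, h.κ_ne] with t ht1 ht2
    exact DifferentiableOn.isExactOn_ball (f := fun z => R z / y z ^ e / κ t z ^ e)
      ((h.data'.R_diff.differentiableOn.div (hy.pow e) fun z hz => pow_ne_zero _ (hy0 z hz)).div
        ((ht1.mono hsub).pow e) fun z hz => pow_ne_zero _ (ht2 z (hsub hz)))
  have hΦlim : ∀ b ∈ Metric.ball x r, Tendsto (fun t => Φ t b - Φ t x) l (𝓝 (Φ' b - Φ' x)) :=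
    fun b hb => tendsto_sub_of_hasDerivAt (convex_ball x r).isPreconnected hΦt hΦ
      (fun z hz => h.integrand_tendsto Metric.isOpen_ball hsub
        (h.data'.R_diff.continuous.continuousOn.div (hy.continuousOn.pow e)
          fun z hz => pow_ne_zero _ (hy0 z hz)) hz) (Metric.mem_ball_self hr) hb
  -- With the local root `y κ_t` the roots of unity `η`, `η'` of the two sides are the same as in
  -- the limit, since `Y t = Y' κ_t`. Hence the orientation of the crossing is also the same.
  have hloc : ∀ᶠ t in l, ∃ c c', LocalSides (Γ t) (Y t) (F t) e U S S' (fun z => y z * κ t z)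
      (fun z => Φ t z - Φ t x) η η' c c' := by
    filter_upwards [h.data, h.κ_diff, h.κ_ne, h.mem_iff, h.f_eq, h.Y_eq, hΦt]
      with t a1 a2 a3 a4 a5 a6 a7
    have hyc : ContinuousOn (fun z => y z * κ t z) (Metric.ball x r) :=
      hy.continuousOn.mul (a2.continuousOn.mono hsub)
    have hyt : ∀ z ∈ Metric.ball x r, (y z * κ t z) ^ 3 = f t z := fun z hz => by
      rw [mul_pow, hy3 z hz, a5 z (hsub hz)]
    have hΦd : ∀ z ∈ Metric.ball x r,
        HasDerivAt (fun z => Φ t z - Φ t x) (R z / (y z * κ t z) ^ e) z := fun z hz => by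
      rw [mul_pow, ← div_div]
      exact (a7 z hz).sub_const _
    have key : ∀ {T : Set ℂ} {η₁ : ℂ}, IsPreconnected T → T ⊆ Metric.ball x r \ Γ' → T.Nonempty →
        (∀ z ∈ T, Y' z = η₁ * y z) → (∀ z ∈ T, Y t z = η₁ * (y z * κ t z)) ∧
        ∃ c, ∀ z ∈ T, F t z = (Φ t z - Φ t x) / η₁ ^ e + c := by
      intro T η₁ hT hTs hTne hTη
      have b1 : ∀ z ∈ T, Y t z = η₁ * (y z * κ t z) := fun z hz => by
        rw [a6 z ⟨hsub (hTs hz).1, (hTs hz).2⟩, hTη z hz, mul_assoc]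
      obtain ⟨η₂, c, -, c1, c2⟩ := a1.eqOn_of_isPreconnected Metric.isOpen_ball hyc hyt hΦd hT
        (fun z hz => ⟨(hTs hz).1, fun hzt => (hTs hz).2 ((a4 z (hsub (hTs hz).1)).1 hzt)⟩)
      obtain ⟨z₀, hz₀⟩ := hTne
      have e1 : η₂ = η₁ := mul_right_cancel₀
        (mul_ne_zero (hy0 z₀ (hTs hz₀).1) (a3 z₀ (hsub (hTs hz₀).1)))
        ((c1 z₀ hz₀).symm.trans (b1 z₀ hz₀))
      exact ⟨b1, c, fun z hz => by rw [c2 z hz, e1]⟩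
    obtain ⟨d1, c, d2⟩ := key hS hSU ⟨b₁, hb₁⟩ h1
    obtain ⟨d1', c', d2'⟩ := key hS' hSU' ⟨b₂, hb₂⟩ h1'
    refine ⟨c, c', hUo, ?_, fun z hz => hcl z ⟨hz.1, (a4 z (hsub (hUb hz.1))).1 hz.2⟩, hη, hη',
      fun z hz => mul_ne_zero (hy0 z (hUb hz)) (a3 z (hsub (hUb hz))), hyc.mono hUb,
      fun z hz => (hΦd z (hUb hz)).continuousAt.continuousWithinAt, d1, d1', d2, d2'⟩
    rw [hSS]
    ext z
    constructor
    · rintro ⟨h3, h4⟩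
      exact ⟨h3, fun h5 => h4 ((a4 z (hsub (hUb h3))).1 h5)⟩
    · rintro ⟨h3, h4⟩
      exact ⟨h3, fun h5 => h4 ((a4 z (hsub (hUb h3))).2 h5)⟩
  have hb₁' : b₁ ∈ O \ Γ' := ⟨hsub (hSU hb₁).1, (hSU hb₁).2⟩
  have hb₂' : b₂ ∈ O \ Γ' := ⟨hsub (hSU' hb₂).1, (hSU' hb₂).2⟩
  have hη0 := pow_ne_zero e (cubeRoot_ne_zero hη)
  have hη0' := pow_ne_zero e (cubeRoot_ne_zero hη')
  have T₁ := ((h.primitive_tendsto hb₁' hb₀).sub ((hΦlim b₁ (hSU hb₁).1).div_const (η ^ e)))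
  have T₂ := ((h.primitive_tendsto hb₂' hb₀).sub ((hΦlim b₂ (hSU' hb₂).1).div_const (η' ^ e)))
  -- the two cases exclude each other
  have excl : ∀ {θ θ' : ℂ}, θ ^ 3 = 1 → θ' ^ 3 = 1 → θ ≠ θ' → θ * η = θ' * η' → θ * η' ≠ θ' * η := by
    intro θ θ' hθ hθ' hne e1 e2
    have h0 := cubeRoot_ne_zero hθ'
    have h3 : θ ^ 2 * (η * η') = θ' ^ 2 * (η * η') := by linear_combination θ * η' * e1 + θ' * η' * e2
    have h4 := mul_right_cancel₀ (mul_ne_zero (cubeRoot_ne_zero hη) (cubeRoot_ne_zero hη')) h3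
    refine hne (mul_left_cancel₀ (pow_ne_zero 2 h0) ?_)
    linear_combination -θ * h4 + hθ - hθ'
  rcases hl.of_cross hxU hne hD' with ⟨g1, rfl⟩ | ⟨g1, rfl⟩
  · have T := (T₁.div_const (θ ^ e)).sub (T₂.div_const (θ' ^ e))
    have hlim : (F' b₁ - F' b₀ - (Φ' b₁ - Φ' x) / η ^ e) / θ ^ e -
        (F' b₂ - F' b₀ - (Φ' b₂ - Φ' x) / η' ^ e) / θ' ^ e =
        C / θ ^ e - C' / θ' ^ e - (F' b₀ / θ ^ e - F' b₀ / θ' ^ e) := by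
      have e1 : Φ' x / η ^ e / θ ^ e = Φ' x / η' ^ e / θ' ^ e := by
        rw [div_div, div_div, ← mul_pow, ← mul_pow, mul_comm η, mul_comm η', g1]
      rw [h2 b₁ hb₁, h2' b₂ hb₂]
      linear_combination e1
    rw [hlim] at T
    refine T.congr' ?_
    filter_upwards [hloc, hD] with t ⟨c, c', hc⟩ hDt
    rcases hc.of_cross hxU hne hDt with ⟨-, k2⟩ | ⟨k1, -⟩
    · rw [k2, hc.F_eq _ hb₁, hc.F_eq' _ hb₂]
      ring
    · exact (excl hθ hθ' hne g1 k1).elim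
  · have T := (T₂.div_const (θ ^ e)).sub (T₁.div_const (θ' ^ e))
    have hlim : (F' b₂ - F' b₀ - (Φ' b₂ - Φ' x) / η' ^ e) / θ ^ e -
        (F' b₁ - F' b₀ - (Φ' b₁ - Φ' x) / η ^ e) / θ' ^ e =
        C' / θ ^ e - C / θ' ^ e - (F' b₀ / θ ^ e - F' b₀ / θ' ^ e) := by
      have e1 : Φ' x / η' ^ e / θ ^ e = Φ' x / η ^ e / θ' ^ e := by
        rw [div_div, div_div, ← mul_pow, ← mul_pow, mul_comm η', mul_comm η, g1]
      rw [h2 b₁ hb₁, h2' b₂ hb₂]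
      linear_combination e1
    rw [hlim] at T
    refine T.congr' ?_
    filter_upwards [hloc, hD] with t ⟨c, c', hc⟩ hDt
    rcases hc.of_cross hxU hne hDt with ⟨k1, -⟩ | ⟨-, k2⟩
    · exact (excl hθ hθ' hne k1 g1).elim
    · rw [k2, hc.F_eq _ hb₁, hc.F_eq' _ hb₂]
      ring

end BranchLimit

end TripleCover

namespace TripleCover

open Complex

/-! ### The complement of a disc and a tree growing out of it -/

lemma isPreconnected_compl_closedBall (c : ℂ) {r : ℝ} (hr : 0 ≤ r) :
    IsPreconnected (Metric.closedBall c r)ᶜ := by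
  have h1 : IsPreconnected ((fun p : ℝ × ℝ => circlePt c p.1 p.2) '' (Ioi r ×ˢ univ)) := by
    refine (isPreconnected_Ioi.prod isPreconnected_univ).image _ (Continuous.continuousOn ?_)
    unfold circlePt
    fun_prop
  convert! h1 using 1
  ext z
  rw [mem_compl_iff, Metric.mem_closedBall, not_le]
  constructor
  · intro hz
    obtain ⟨θ, -, e⟩ := exists_circlePt_eq (c := c) (z := z) rfl 0
    exact ⟨(dist z c, θ), ⟨hz, mem_univ _⟩, e.symm⟩
  · rintro ⟨⟨ρ, θ⟩, ⟨hρ, -⟩, rfl⟩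
    have hρ' : r < ρ := hρ
    simp only
    rwa [dist_circlePt c (hr.trans_lt hρ')]

/-- Uniqueness of the parent of `w` when the tree is rooted at `r`: both candidates extend to paths
from `r` to `w`, and there is only one. -/
lemma _root_.SimpleGraph.IsTree.eq_of_dist_eq {V : Type*} {G : SimpleGraph V} (hG : G.IsTree)
    {r u u' w : V} (h : G.Adj u w) (h' : G.Adj u' w) (hd : G.dist r w = G.dist r u + 1)
    (hd' : G.dist r w = G.dist r u' + 1) : u = u' := by
  obtain ⟨p, hp⟩ := hG.1.exists_walk_length_eq_dist r u
  obtain ⟨p', hp'⟩ := hG.1.exists_walk_length_eq_dist r u'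
  have h1 : (p.concat h).IsPath := (p.concat h).isPath_of_length_eq_dist (by
    rw [SimpleGraph.Walk.length_concat, hp, hd])
  have h2 : (p'.concat h').IsPath := (p'.concat h').isPath_of_length_eq_dist (by
    rw [SimpleGraph.Walk.length_concat, hp', hd'])
  have h3 := congrArg Subtype.val ((hG.2.subsingleton_path _ _).elim ⟨_, h1⟩ ⟨_, h2⟩)
  have h4 := congrArg SimpleGraph.Walk.penultimate h3
  simpa using h4

lemma _root_.SimpleGraph.Connected.exists_adj_dist {V : Type*} {G : SimpleGraph V}
    (hG : G.Connected) {r w : V} (h : w ≠ r) : ∃ u, G.Adj u w ∧ G.dist r w = G.dist r u + 1 := by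
  obtain ⟨p, hp⟩ := hG.exists_walk_length_eq_dist w r
  cases p with
  | nil => exact absurd rfl h
  | cons hadj p =>
    rename_i u
    refine ⟨u, hadj.symm, ?_⟩
    rw [SimpleGraph.Walk.length_cons] at hp
    have h1 := G.dist_le p
    have h2 : G.dist w r ≤ G.dist w u + G.dist u r := hG.dist_triangle
    rw [SimpleGraph.dist_eq_one_iff_adj.2 hadj] at h2
    rw [G.dist_comm (u := r) (v := w), G.dist_comm (u := r) (v := u)]
    omega

namespace PlaneEmbedding

variable {V : Type*} [Fintype V] {B : MarkedBinaryTree V} (E : PlaneEmbedding B)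

/-- Starting with `K`, the tree is grown edge by edge away from the leaf `p`. Each new arc touches
what is already there only at its starting point, so `isPreconnected_compl_union` applies at every
stage. -/
theorem isPreconnected_compl_support_union {p q : V} (hpq : B.graph.Adj p q)
    (huniq : ∀ w, B.graph.Adj p w → w = q) {K : Set ℂ} (hK : IsClosed K)
    (hKc : IsPreconnected Kᶜ) {s₀ : ℝ} (hs₀ : s₀ ∈ Ico (0 : ℝ) 1)
    (hin : ∀ s ∈ Icc 0 s₀, E.arc p q s ∈ K) (hout : ∀ s ∈ Ioc s₀ 1, E.arc p q s ∉ K)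
    (hK' : ∀ u w, B.graph.Adj u w → u ≠ p → w ≠ p → ∀ s ∈ Icc (0 : ℝ) 1, E.arc u w s ∉ K) :
    IsPreconnected (E.support ∪ K)ᶜ := by
  classical
  -- the first edge
  set K₁ := E.arc p q '' Icc 0 1 ∪ K with hK₁
  have hK₁c : IsClosed K₁ := (E.isArc hpq).isCompact_image.isClosed.union hK
  have hK₁p : IsPreconnected K₁ᶜ := by
    -- Only the part of the first edge after its exit from `K` is attached; the rest lies in `K`.
    have ha : IsArc fun s => E.arc p q (s₀ + (1 - s₀) * s) :=
      (E.isArc hpq).comp_affine (by linarith [hs₀.2]) fun s hs => ⟨by nlinarith [hs.1, hs₀.1, hs₀.2],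
        by nlinarith [hs.2, hs₀.2]⟩
    have h1 := ha.isPreconnected_compl_union hK hKc
      (by simpa using hin s₀ ⟨hs₀.1, le_rfl⟩) (fun s hs => hout _
        ⟨by nlinarith [hs.1, hs₀.2], by nlinarith [hs.2, hs₀.2]⟩)
    convert! h1 using 2
    ext x
    constructor
    · rintro (⟨s, hs, rfl⟩ | hx)
      · rcases le_or_gt s s₀ with h | h
        · exact Or.inr (hin s ⟨hs.1, h⟩)
        · refine Or.inl ⟨(s - s₀) / (1 - s₀), ⟨?_, ?_⟩, ?_⟩
          · exact div_nonneg (by linarith) (by linarith [hs₀.2])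
          · rw [div_le_one (by linarith [hs₀.2])]
            linarith [hs.2]
          · have : 1 - s₀ ≠ 0 := by linarith [hs₀.2]
            simp only
            congr 1
            field_simp
            ring
      · exact Or.inr hx
    · rintro (⟨s, hs, rfl⟩ | hx)
      · exact Or.inl ⟨_, ⟨by nlinarith [hs.1, hs₀.1, hs₀.2], by nlinarith [hs.2, hs₀.2]⟩, rfl⟩
      · exact Or.inr hx
  -- the vertex before `w` on the path from `p`
  have hpar : ∀ w, ∃ u, w ≠ p → B.graph.Adj u w ∧ B.graph.dist p w = B.graph.dist p u + 1 := by
    intro w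
    by_cases h : w = p
    · exact ⟨p, fun h' => absurd h h'⟩
    · obtain ⟨u, hu⟩ := B.isTree.1.exists_adj_dist h
      exact ⟨u, fun _ => hu⟩
  choose par hpar using hpar
  have hparq : ∀ w, w ≠ p → w ≠ q → par w ≠ p := fun w h1 h2 h3 =>
    h2 (huniq w (h3 ▸ (hpar w h1).1))
  set KT : Finset V → Set ℂ := fun T => (⋃ w ∈ T, E.arc (par w) w '' Icc 0 1) ∪ K₁ with hKT
  have key : ∀ T : Finset V, (∀ w ∈ T, w ≠ p ∧ w ≠ q ∧ (par w ∈ T ∨ par w = q)) →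
      IsPreconnected (KT T)ᶜ := by
    intro T
    -- Edges are indexed by their end farther from `p`. A vertex of maximal distance is nobody's
    -- parent in `T`, so removing it keeps `T` closed under parents.
    induction T using Finset.induction_on_max_value (B.graph.dist p) with
    | empty => intro _; simpa [hKT] using hK₁p
    | insert w T hw hmax ih =>
      intro hT
      have hT' : ∀ w' ∈ T, w' ≠ p ∧ w' ≠ q ∧ (par w' ∈ T ∨ par w' = q) := by
        intro w' hw'
        obtain ⟨h1, h2, h3⟩ := hT w' (Finset.mem_insert_of_mem hw')
        refine ⟨h1, h2, h3.imp_left fun h3 => ?_⟩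
        refine (Finset.mem_insert.1 h3).resolve_left fun h4 => ?_
        have h5 := (hpar w' h1).2
        rw [h4] at h5
        have := hmax w' hw'
        omega
      obtain ⟨hwp, hwq, hwpar⟩ := hT w (Finset.mem_insert_self w T)
      have hadj := (hpar w hwp).1
      have hclosed : IsClosed (KT T) := by
        refine IsClosed.union (T.finite_toSet.isClosed_biUnion fun w' hw' => ?_) hK₁c
        exact (E.isArc (hpar w' (hT' w' hw').1).1).isCompact_image.isClosed
      have h1 := (E.isArc hadj).isPreconnected_compl_union hclosed (ih hT') ?_ ?_
      · convert! h1 using 2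
        simp only [hKT, Finset.set_biUnion_insert]
        rw [union_assoc]
      · rw [E.arc_zero _ _ hadj]
        rcases hwpar with h2 | h2
        · rcases Finset.mem_insert.1 h2 with h3 | h3
          · exact absurd h3 hadj.ne
          · have h4 := (hpar _ (hT' _ h3).1).1
            refine Or.inl (mem_biUnion (x := par w) h3 ⟨1, ⟨zero_le_one, le_rfl⟩, E.arc_one h4⟩)
        · rw [h2]
          exact Or.inr (Or.inl ⟨1, ⟨zero_le_one, le_rfl⟩, E.arc_one hpq⟩)
      · intro s hs hmem
        have hsI : s ∈ Icc (0 : ℝ) 1 := Ioc_subset_Icc_self hs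
        -- Apart from its starting point, the new arc could meet an older edge only at `pos w`, and
        -- `w` is not an end of any of these.
        have hends : ∀ u' w', B.graph.Adj u' w' → s(par w, w) ≠ s(u', w') → w ≠ u' → w ≠ w' →
            E.arc (par w) w s ∉ E.arc u' w' '' Icc 0 1 := by
          rintro u' w' h' hne h2 h3 ⟨s', hs', e⟩
          obtain ⟨h4, h5⟩ := E.arc_disjoint _ _ _ _ hadj h' hne s hsI s' hs' e.symm
          have h6 : s = 1 := h4.resolve_left hs.1.ne'
          rw [h6, E.arc_one hadj] at e
          rcases h5 with rfl | rfl
          · rw [E.arc_zero _ _ h'] at e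
            exact h2 (E.pos_injective e).symm
          · rw [E.arc_one h'] at e
            exact h3 (E.pos_injective e).symm
        rcases hmem with hmem | hmem | hmem
        · obtain ⟨w', hw', hmem⟩ := mem_iUnion₂.1 hmem
          obtain ⟨a1, a2, a3⟩ := hT' w' hw'
          have hne : w ≠ w' := fun h => hw (h ▸ hw')
          have hne' : w ≠ par w' := by
            rcases a3 with a3 | a3
            · exact fun h => hw (h ▸ a3)
            · exact fun h => hwq (h.trans a3)
          refine hends _ _ (hpar w' a1).1 (fun he => ?_) hne' hne hmem
          rcases Sym2.eq_iff.1 he with ⟨-, h3⟩ | ⟨-, h3⟩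
          · exact hne h3
          · exact hne' h3
        · refine hends _ _ hpq (fun he => ?_) hwp hwq hmem
          rcases Sym2.eq_iff.1 he with ⟨-, h3⟩ | ⟨-, h3⟩
          · exact hwq h3
          · exact hwp h3
        · exact hK' _ _ hadj (hparq w hwp hwq) hwp s hsI hmem
  have hall := key (Finset.univ.filter fun w => w ≠ p ∧ w ≠ q) (by
    intro w hw
    obtain ⟨-, h1, h2⟩ := Finset.mem_filter.1 hw
    refine ⟨h1, h2, ?_⟩
    by_cases h3 : par w = q
    · exact Or.inr h3
    · exact Or.inl (Finset.mem_filter.2 ⟨Finset.mem_univ _, hparq w h1 h2, h3⟩))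
  convert! hall using 2
  have hedge : ∀ u w, B.graph.Adj u w → B.graph.dist p w = B.graph.dist p u + 1 →
      E.arc u w '' Icc 0 1 ⊆ KT (Finset.univ.filter fun w => w ≠ p ∧ w ≠ q) := by
    intro u w h hd x hx
    have hwp : w ≠ p := by
      rintro rfl
      rw [SimpleGraph.dist_self] at hd
      omega
    have hu : u = par w := B.isTree.eq_of_dist_eq h (hpar w hwp).1 hd (hpar w hwp).2
    by_cases hwq : w = q
    · subst hwq
      have hd1 : B.graph.dist p w = 1 := SimpleGraph.dist_eq_one_iff_adj.2 hpq
      have hu' : p = u := B.isTree.1.dist_eq_zero_iff.1 (by omega)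
      subst hu'
      exact Or.inr (Or.inl hx)
    · refine Or.inl (mem_biUnion (x := w) (Finset.mem_filter.2 ⟨Finset.mem_univ _, hwp, hwq⟩) ?_)
      rw [← hu]
      exact hx
  ext x
  constructor
  · rintro (⟨u, w, h, hx⟩ | hx)
    · rcases B.isTree.dist_eq_dist_add_one_of_adj p h with hd | hd
      · exact hedge w u h.symm hd (E.arc_image_subset h.symm hx)
      · exact hedge u w h hd hx
    · exact Or.inr (Or.inr hx)
  · rintro (hx | hx | hx)
    · obtain ⟨w, hw, hx⟩ := mem_iUnion₂.1 hx
      exact Or.inl (E.arc_subset_support (hpar w (Finset.mem_filter.1 hw).2.1).1 hx)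
    · exact Or.inl (E.arc_subset_support hpq hx)
    · exact Or.inr hx

end PlaneEmbedding

end TripleCover

namespace TripleCover

open Complex

/-! ### The tree without a cherry -/

namespace MarkedBinaryTree.Cherry

variable {V : Type*} [Fintype V] {B : MarkedBinaryTree V} (H : B.Cherry)

lemma eq_of_adj_p {v : V} (h : B.graph.Adj H.p v) : v = H.l₁ ∨ v = H.l₂ ∨ v = H.q := by
  have : v ∈ B.graph.neighborSet H.p := h
  rw [H.neighborSet_p] at this
  exact this

lemma adj_p'_q' : (B.contract H).graph.Adj H.p' H.q' := H.adj_q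

lemma eq_q'_of_adj {w : H.Rest} (h : (B.contract H).graph.Adj H.p' w) : w = H.q' := by
  rcases H.eq_of_adj_p (v := w.1) h with h | h | h
  · exact absurd h w.2.1
  · exact absurd h w.2.2
  · exact Subtype.ext h

lemma ne_p_of_ne {v : H.Rest} (h : v ≠ H.p') : v.1 ≠ H.p := fun h' => h (Subtype.ext h')

/-- A neighbour of a remaining vertex other than `p` remains. -/
lemma mem_rest_of_adj {v w : V} (hv : v ≠ H.p) (h : B.graph.Adj v w) : w ≠ H.l₁ ∧ w ≠ H.l₂ :=
  ⟨fun e => hv (H.eq_p_of_adj₁ (e ▸ h)), fun e => hv (H.eq_p_of_adj₂ (e ▸ h))⟩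

lemma not_isTerminal_p : ¬ B.IsTerminal H.p := by
  have h1 : (B.graph.neighborSet H.p).ncard = 3 := H.inner
  intro h
  have h2 : (B.graph.neighborSet H.p).ncard = 1 := h
  omega

lemma contract_isInner_iff {v : H.Rest} (h : v ≠ H.p') :
    (B.contract H).IsInner v ↔ B.IsInner v.1 := by
  unfold IsInner
  rw [← H.ncard_rest v h]
  rfl

lemma contract_isTerminal_iff {v : H.Rest} (h : v ≠ H.p') :
    (B.contract H).IsTerminal v ↔ B.IsTerminal v.1 := by
  unfold IsTerminal
  rw [← H.ncard_rest v h]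
  rfl

lemma contract_isTerminal_p' : (B.contract H).IsTerminal H.p' := H.ncard_rest_p

lemma contract_mark {v : H.Rest} (h : v ≠ H.p') (hv : B.IsInner v.1) :
    ((B.contract H).mark v).1 = B.mark v.1 := by
  have h1 := H.mem_rest_of_adj (H.ne_p_of_ne h) (B.adj_mark v.1 hv)
  simp only [contract, dif_pos h1]

lemma mem_others {k : V} : k ∈ H.others ↔ B.IsTerminal k ∧ k ≠ H.l₁ ∧ k ≠ H.l₂ := by
  simp [others, mem_terminals]

lemma l₂_notMem_others : H.l₂ ∉ H.others := by simp [mem_others]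

lemma p_notMem_others : H.p ∉ H.others := by simp [mem_others, H.not_isTerminal_p]

open Classical in
lemma terminals_eq : B.terminals = insert H.l₁ (insert H.l₂ H.others) := by
  ext k
  simp only [Finset.mem_insert, mem_others, mem_terminals]
  constructor
  · intro h
    tauto
  · rintro (rfl | rfl | h)
    · exact H.terminal₁
    · exact H.terminal₂
    · exact h.1

open Classical in
lemma l₁_notMem : H.l₁ ∉ insert H.l₂ H.others := by simp [mem_others, H.ne]

open Classical in
lemma contract_terminals_map : (B.contract H).terminals.map (Function.Embedding.subtype _) =
    insert H.p H.others := by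
  ext k
  simp only [Finset.mem_map, Function.Embedding.subtype_apply, Finset.mem_insert, mem_others,
    mem_terminals]
  constructor
  · rintro ⟨v, hv, rfl⟩
    by_cases h : v = H.p'
    · exact Or.inl (congrArg Subtype.val h)
    · exact Or.inr ⟨(H.contract_isTerminal_iff h).1 hv, v.2⟩
  · rintro (rfl | ⟨h1, h2⟩)
    · exact ⟨H.p', H.contract_isTerminal_p', rfl⟩
    · have h3 : (⟨k, h2⟩ : H.Rest) ≠ H.p' := fun h => by
        have h4 : k = H.p := congrArg Subtype.val h
        rw [h4] at h1
        exact H.not_isTerminal_p h1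
      exact ⟨⟨k, h2⟩, (H.contract_isTerminal_iff h3).2 h1, rfl⟩

lemma prod_terminals {M : Type*} [CommMonoid M] (g : V → M) :
    ∏ k ∈ B.terminals, g k = g H.l₁ * (g H.l₂ * ∏ k ∈ H.others, g k) := by
  classical
  rw [H.terminals_eq, Finset.prod_insert H.l₁_notMem, Finset.prod_insert H.l₂_notMem_others]

lemma prod_contract_terminals {M : Type*} [CommMonoid M] (g : V → M) :
    ∏ k ∈ (B.contract H).terminals, g k.1 = g H.p * ∏ k ∈ H.others, g k := by
  classical
  rw [← Finset.prod_insert H.p_notMem_others, ← H.contract_terminals_map, Finset.prod_map]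
  rfl

lemma sum_terminals (g : V → ℕ) :
    ∑ k ∈ B.terminals, g k = g H.l₁ + (g H.l₂ + ∑ k ∈ H.others, g k) := by
  classical
  rw [H.terminals_eq, Finset.sum_insert H.l₁_notMem, Finset.sum_insert H.l₂_notMem_others]

lemma sum_contract_terminals (g : V → ℕ) :
    ∑ k ∈ (B.contract H).terminals, g k.1 = g H.p + ∑ k ∈ H.others, g k := by
  classical
  rw [← Finset.sum_insert H.p_notMem_others, ← H.contract_terminals_map, Finset.sum_map]
  rfl

variable {H}

lemma isWhite_p (hw : B.isWhite H.l₁ = true) : B.isWhite H.p = false := by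
  have := B.isWhite_ne _ _ H.adj₁
  rw [hw] at this
  simpa using this

lemma a_p (hw : B.isWhite H.l₁ = true) : B.a H.p = 2 := by simp [a, isWhite_p hw]

lemma a_l₁ (hw : B.isWhite H.l₁ = true) : B.a H.l₁ = 1 := by simp [a, hw]

lemma a_l₂ (hw : B.isWhite H.l₂ = true) : B.a H.l₂ = 1 := by simp [a, hw]

/-- The new black terminal contributes `2 = 1 + 1`. So `y₁` keeps its order at infinity, and the
same `ζ` selects corresponding sheets on both curves. -/
lemma contract_n₁ (hw₁ : B.isWhite H.l₁ = true) (hw₂ : B.isWhite H.l₂ = true) :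
    (B.contract H).n₁ = B.n₁ := by
  unfold n₁
  have h1 : ∑ v ∈ (B.contract H).terminals, (B.contract H).a v =
      ∑ v ∈ (B.contract H).terminals, B.a v.1 := rfl
  rw [h1, H.sum_contract_terminals, H.sum_terminals, a_p hw₁, a_l₁ hw₁, a_l₂ hw₂]
  congr 1
  ring

end MarkedBinaryTree.Cherry

/-! ### The order of the neighbours of a vertex -/

lemma not_anticlockwise_self (u w : ℂ) : ¬ Anticlockwise u u w := by simp [Anticlockwise]

lemma Anticlockwise.not_swap {u v w : ℂ} (h : Anticlockwise u v w) : ¬ Anticlockwise v u w := by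
  unfold Anticlockwise at *
  generalize u / (‖u‖ : ℂ) = a at *
  generalize v / (‖v‖ : ℂ) = b at *
  generalize w / (‖w‖ : ℂ) = c at *
  simp only [map_sub, mul_im, sub_re, sub_im, conj_re, conj_im] at h ⊢
  nlinarith

lemma Anticlockwise.ne {u v w : ℂ} (h : Anticlockwise u v w) : u ≠ v ∧ u ≠ w ∧ v ≠ w := by
  refine ⟨?_, ?_, ?_⟩
  · rintro rfl
    exact not_anticlockwise_self _ _ h
  · rintro rfl
    simp [Anticlockwise] at h
  · rintro rfl
    unfold Anticlockwise at h
    simp only [map_sub, mul_im, sub_re, sub_im, conj_re, conj_im] at h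
    nlinarith

/-- The cyclic order and the marked edge determine the other two neighbours in order, so every curve
representing the cycle crosses the same two edges in the same order. -/
lemma MarkedBinaryTree.eq_of_anticlockwise {V : Type*} [Fintype V] {B : MarkedBinaryTree V} {v : V}
    (hv : B.IsInner v) (d : V → ℂ) {w₁ w₂ w₁' w₂' : V} (h₁ : B.graph.Adj v w₁)
    (h₂ : B.graph.Adj v w₂) (h : Anticlockwise (d w₁) (d w₂) (d (B.mark v)))
    (h₁' : B.graph.Adj v w₁') (h₂' : B.graph.Adj v w₂')
    (h' : Anticlockwise (d w₁') (d w₂') (d (B.mark v))) : w₁' = w₁ ∧ w₂' = w₂ := by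
  have aux : ∀ {a b : V}, d a ≠ d b → a ≠ b := fun h e => h (congrArg d e)
  have e := h.ne
  have e' := h'.ne
  have hN : B.graph.neighborSet v = {w₁, w₂, B.mark v} := by
    symm
    apply Set.eq_of_subset_of_ncard_le
    · rintro x (rfl | rfl | rfl)
      · exact h₁
      · exact h₂
      · exact B.adj_mark v hv
    · rw [show (B.graph.neighborSet v).ncard = 3 from hv]
      exact (Set.ncard_eq_three.2 ⟨_, _, _, aux e.1, aux e.2.1, aux e.2.2, rfl⟩).ge
    · exact Set.toFinite _
  have m₁ : w₁' ∈ B.graph.neighborSet v := h₁'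
  have m₂ : w₂' ∈ B.graph.neighborSet v := h₂'
  rw [hN] at m₁ m₂
  rcases m₁ with rfl | rfl | rfl
  · rcases m₂ with rfl | rfl | rfl
    · exact absurd rfl e'.1
    · exact ⟨rfl, rfl⟩
    · exact absurd rfl e'.2.2
  · rcases m₂ with rfl | rfl | rfl
    · exact absurd h' h.not_swap
    · exact absurd rfl e'.1
    · exact absurd rfl e'.2.2
  · exact absurd rfl e'.2.1

/-! ### The periods over the cycles `B_v` -/

lemma omega_ne_one : omega ≠ 1 := by
  intro h
  have h1 := congrArg re h
  simp only [omega] at h1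
  norm_num at h1

lemma omega_sq_ne_one : omega ^ 2 ≠ 1 := by
  intro h
  have h1 := omega_pow_three
  rw [pow_succ, h, one_mul] at h1
  exact omega_ne_one h1

/-- The factor by which the branch `Y` is multiplied on the outer part of the cycle `B_v`. -/
noncomputable def outerFactor (white : Bool) : ℂ := if white then omega else omega ^ 2

lemma outerFactor_pow (w : Bool) : outerFactor w ^ 3 = 1 := by
  unfold outerFactor
  split_ifs
  · exact omega_pow_three
  · rw [← pow_mul, mul_comm, pow_mul, omega_pow_three, one_pow]

lemma outerFactor_ne_one (w : Bool) : outerFactor w ≠ 1 := by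
  unfold outerFactor
  split_ifs
  · exact omega_ne_one
  · exact omega_sq_ne_one

/-- Applying `ρ` or `ρ²` turns the inner branch into `Y` itself, since `ω³ = 1`, and the outer one
into `ω Y` or `ω² Y`. The crossing points are then moved freely along their edges, which allows a
choice independent of `t`. -/
lemma PlaneEmbedding.IsCycleB.exists_cross {V : Type*} [Fintype V] {B : MarkedBinaryTree V}
    {E : PlaneEmbedding B} {ζ : ℂ} {v : V} {c : ClosedCurve E.f} (hc : E.IsCycleB ζ v c) :
    ∃ w₁ w₂ Y, B.graph.Adj v w₁ ∧ B.graph.Adj v w₂ ∧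
      Anticlockwise (E.dir v w₁) (E.dir v w₂) (E.dir v (B.mark v)) ∧ E.IsSheet ζ Y ∧
      ∀ (e : ℕ) (R F : ℂ → ℂ) (φ : ℂ → ℂ → ℂ), BranchData E.support E.f R e Y F →
        (∀ x y, y ^ 3 = E.f x → E.f x ≠ 0 → φ x y = R x / y ^ e) →
        ∀ x₁ ∈ E.openEdge v w₂, ∀ x₂ ∈ E.openEdge v w₁, ∃ D₁ D₂,
          Cross E.support Y F e (outerFactor (B.isWhite v)) 1 x₁ D₁ ∧
          Cross E.support Y F e 1 (outerFactor (B.isWhite v)) x₂ D₂ ∧ period φ c = D₁ + D₂ := by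
  obtain ⟨c₀, ⟨w₁, w₂, Y, s₁, s₂, h1, h2, h3, hY, a1, a2, a3, b1, b2, b3, b4, b5⟩, rfl⟩ := hc
  refine ⟨w₁, w₂, Y, h1, h2, h3, hY, fun e R F φ hF hφ x₁ hx₁ x₂ hx₂ => ?_⟩
  set c := (if B.isWhite v = true then c₀.rho.rho else c₀.rho) with hc
  have hcx : c.x = c₀.x := by rw [hc]; split_ifs <;> rfl
  have h4 : omega ^ 4 = omega := by rw [pow_succ, omega_pow_three, one_mul]
  have hout : ∀ s ∈ Ico 0 s₁ ∪ Ioc s₂ 1, c.y s = outerFactor (B.isWhite v) * Y (c.x s) := by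
    intro s hs
    rw [hcx, hc]
    have := b4 s hs
    unfold outerFactor
    split_ifs with hw
    · simp only [ClosedCurve.rho, this, hw, if_true]
      linear_combination Y (c₀.x s) * h4
    · simp only [ClosedCurve.rho, this, hw]
      simp only [Bool.false_eq_true, if_false]
      ring
  have hin : ∀ s ∈ Ioo s₁ s₂, c.y s = 1 * Y (c.x s) := by
    intro s hs
    rw [hcx, hc]
    have := b5 s hs
    split_ifs with hw
    · simp only [ClosedCurve.rho, this, hw, if_true]
      linear_combination Y (c₀.x s) * omega_pow_three
    · simp only [ClosedCurve.rho, this, hw]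
      simp only [Bool.false_eq_true, if_false]
      linear_combination Y (c₀.x s) * omega_pow_three
  obtain ⟨D₁, D₂, k1, k2, k3⟩ := hF.period_eq hφ c a1 a2 a3 (by rw [hcx]; exact b3)
    (by rw [hcx]; exact E.f_ne_zero_of_mem_openEdge h2 b1)
    (by rw [hcx]; exact E.f_ne_zero_of_mem_openEdge h1 b2) hout hin
  rw [hcx] at k1 k2
  refine ⟨D₁, D₂, ?_, ?_, k3⟩
  · exact hF.cross_of_isPreconnected (E.isPreconnected_openEdge h2) (E.openEdge_subset h2)
      (fun x hx => E.twoSided h2 hx) (fun x hx => E.f_ne_zero_of_mem_openEdge h2 hx)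
      (outerFactor_ne_one _) b1 hx₁ k1
  · exact hF.cross_of_isPreconnected (E.isPreconnected_openEdge h1) (E.openEdge_subset h1)
      (fun x hx => E.twoSided h1 hx) (fun x hx => E.f_ne_zero_of_mem_openEdge h1 hx)
      (outerFactor_ne_one _).symm b2 hx₂ k2

end TripleCover

namespace TripleCover

open Complex

/-! ### The periods over the cycles away from the collision -/

/-- The principal branch of `(1 - w) ^ (1 / 3)`. -/
noncomputable def cbrtOneSub (w : ℂ) : ℂ := (1 - w) ^ (((3 : ℕ) : ℂ)⁻¹)

lemma cbrtOneSub_pow (w : ℂ) : cbrtOneSub w ^ 3 = 1 - w := cpow_nat_inv_pow _ (by norm_num)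

lemma cbrtOneSub_zero : cbrtOneSub 0 = 1 := by simp [cbrtOneSub]

lemma differentiableAt_cbrtOneSub {w : ℂ} (hw : ‖w‖ < 1) : DifferentiableAt ℂ cbrtOneSub w := by
  have h1 : 1 - w ∈ slitPlane := by
    rw [sub_eq_add_neg]
    exact mem_slitPlane_of_norm_lt_one (by rwa [norm_neg])
  exact ((differentiableAt_const _).sub differentiableAt_id).cpow (differentiableAt_const _) h1

/-- The quotient of the cube roots of `(x - μ - w) (x - μ - w')` and `(x - μ) ^ 2`. -/
noncomputable def cbrtRatio (μ w w' x : ℂ) : ℂ :=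
  cbrtOneSub (w / (x - μ)) * cbrtOneSub (w' / (x - μ))

lemma norm_div_sub_lt {μ w x : ℂ} {r δ : ℝ} (hr : 0 < r) (hδ : 0 < δ) (hw : ‖w‖ < δ * r)
    (hx : r < dist x μ) : ‖w / (x - μ)‖ < δ := by
  rw [norm_div, ← dist_eq, div_lt_iff₀ (hr.trans hx)]
  calc ‖w‖ < δ * r := hw
    _ ≤ δ * dist x μ := by gcongr

lemma cbrtRatio_pow {μ w w' x : ℂ} (hx : x ≠ μ) :
    (x - μ) ^ 2 * cbrtRatio μ w w' x ^ 3 = (x - μ - w) * (x - μ - w') := by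
  have : x - μ ≠ 0 := sub_ne_zero.2 hx
  rw [cbrtRatio, mul_pow, cbrtOneSub_pow, cbrtOneSub_pow]
  field_simp

lemma differentiableAt_cbrtRatio {μ w w' x : ℂ} {r : ℝ} (hr : 0 < r) (hw : ‖w‖ < r)
    (hw' : ‖w'‖ < r) (hx : r < dist x μ) : DifferentiableAt ℂ (cbrtRatio μ w w') x := by
  have hne : x - μ ≠ 0 := by
    rw [← norm_pos_iff, ← dist_eq]
    exact hr.trans hx
  have h1 : ∀ w : ℂ, DifferentiableAt ℂ (fun x => w / (x - μ)) x := fun w =>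
    (differentiableAt_const _).div (differentiableAt_id.sub_const μ) hne
  have h2 : ∀ w : ℂ, ‖w‖ < r → DifferentiableAt ℂ (fun x => cbrtOneSub (w / (x - μ))) x :=
    fun w hw => DifferentiableAt.comp (g := cbrtOneSub) x
      (differentiableAt_cbrtOneSub (norm_div_sub_lt hr one_pos (by rwa [one_mul]) hx)) (h1 w)
  exact (h2 w hw).mul (h2 w' hw')

lemma continuousAt_cbrt_pair :
    ContinuousAt (fun p : ℂ × ℂ => cbrtOneSub p.1 * cbrtOneSub p.2) (0, 0) :=
  have h := (differentiableAt_cbrtOneSub (w := 0) (by simp)).continuousAt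
  (ContinuousAt.comp (x := ((0, 0) : ℂ × ℂ)) (g := cbrtOneSub) (f := fun p : ℂ × ℂ => p.1) h
    continuousAt_fst).mul (ContinuousAt.comp (x := ((0, 0) : ℂ × ℂ)) (g := cbrtOneSub)
    (f := fun p : ℂ × ℂ => p.2) h continuousAt_snd)

lemma exists_cbrtRatio_sub_one_lt (μ : ℂ) {r ε : ℝ} (hr : 0 < r) (hε : 0 < ε) : ∃ δ > 0,
    ∀ w w' x : ℂ, ‖w‖ < δ → ‖w'‖ < δ → r < dist x μ → ‖cbrtRatio μ w w' x - 1‖ < ε := by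
  obtain ⟨δ, hδ, h⟩ := Metric.continuousAt_iff.1 continuousAt_cbrt_pair ε hε
  refine ⟨δ * r, by positivity, fun w w' x hw hw' hx => ?_⟩
  have h1 := @h (w / (x - μ), w' / (x - μ)) (by
    rw [Prod.dist_eq, max_lt_iff, dist_zero_right, dist_zero_right]
    exact ⟨norm_div_sub_lt hr hδ hw hx, norm_div_sub_lt hr hδ hw' hx⟩)
  simpa [dist_eq, cbrtOneSub_zero, cbrtRatio] using h1

lemma tendsto_cbrtRatio_cobounded (μ w w' : ℂ) :
    Tendsto (cbrtRatio μ w w') (Bornology.cobounded ℂ) (𝓝 1) := by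
  have h1 : ∀ w : ℂ, Tendsto (fun x => w / (x - μ)) (Bornology.cobounded ℂ) (𝓝 0) := fun w => by
    have h2 : Tendsto (fun x : ℂ => x - μ) (Bornology.cobounded ℂ) (Bornology.cobounded ℂ) := by
      rw [← tendsto_norm_atTop_iff_cobounded]
      refine tendsto_atTop_mono (fun x => ?_)
        (tendsto_atTop_add_const_right _ (-‖μ‖) tendsto_norm_cobounded_atTop)
      have := norm_sub_norm_le x μ
      linarith
    have h3 := (tendsto_inv₀_cobounded.comp h2).const_mul w
    rw [mul_zero] at h3
    exact h3
  have h2 := continuousAt_cbrt_pair.tendsto.comp ((h1 w).prodMk_nhds (h1 w'))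
  simp only [cbrtOneSub_zero, mul_one] at h2
  exact h2

namespace IsSimpleDegeneration

variable {V : Type*} [Fintype V] {B : MarkedBinaryTree V} {H : B.Cherry} {lam : V → ℂ} {μ : ℂ}
  {E : ℂ → PlaneEmbedding B} {E' : PlaneEmbedding (B.contract H)}

lemma eventually_pos_eq (h : IsSimpleDegeneration H lam μ E E') {v : H.Rest} (hv : v ≠ H.p') :
    ∀ᶠ t in 𝓝[≠] (0 : ℂ), (E t).pos v = E'.pos v := by
  obtain ⟨r, hr, s₀, hs₀, hfar, hnear, hout, hev⟩ := h.trees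
  filter_upwards [hev] with t ⟨h1, h2, _⟩
  obtain ⟨w, hw⟩ := (B.contract H).exists_adj v
  have hw' : B.graph.Adj v.1 w.1 := hw
  by_cases hwp : w = H.p'
  · subst hwp
    have hq : v = H.q' := H.eq_q'_of_adj hw.symm
    subst hq
    have := h2 1 ⟨hs₀.2.le, le_rfl⟩
    rwa [E'.arc_one H.adj_p'_q', (E t).arc_one H.adj_q] at this
  · have := h1 v w hw hv hwp 0 ⟨le_rfl, zero_le_one⟩
    rwa [E'.arc_zero v w hw, (E t).arc_zero v.1 w.1 hw'] at this

/-- The direction depends only on the germ of the edge at `v`, which lies outside the disc even if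
the edge leads to `p`. -/
lemma eventually_dir_eq (h : IsSimpleDegeneration H lam μ E E') {v w : H.Rest} (hv : v ≠ H.p')
    (hvw : (B.contract H).graph.Adj v w) :
    ∀ᶠ t in 𝓝[≠] (0 : ℂ), (E t).dir v w = E'.dir v w := by
  obtain ⟨r, hr, s₀, hs₀, hfar, hnear, hout, hev⟩ := h.trees
  filter_upwards [hev] with t ⟨h1, h2, _⟩
  have h01 : (0 : ℝ) ∈ Icc (0 : ℝ) 1 := ⟨le_rfl, zero_le_one⟩
  unfold PlaneEmbedding.dir
  by_cases hwp : w = H.p'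
  · subst hwp
    have hq : v = H.q' := H.eq_q'_of_adj hvw.symm
    subst hq
    have key : ∀ s ∈ Icc (0 : ℝ) (1 - s₀), (E t).arc H.q H.p s = E'.arc H.q' H.p' s := by
      intro s hs
      have hs1 : s ∈ Icc (0 : ℝ) 1 := ⟨hs.1, by linarith [hs.2, hs₀.1]⟩
      rw [(E t).arc_symm _ _ H.adj_q s hs1, E'.arc_symm _ _ H.adj_p'_q' s hs1]
      exact h2 _ ⟨by linarith [hs.2], by linarith [hs.1]⟩
    refine Filter.EventuallyEq.derivWithin_eq ?_ (key 0 ⟨le_rfl, by linarith [hs₀.2]⟩)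
    have h3 : Iio (1 - s₀) ∈ 𝓝[Icc (0 : ℝ) 1] 0 :=
      nhdsWithin_le_nhds (Iio_mem_nhds (by linarith [hs₀.2]))
    filter_upwards [h3, self_mem_nhdsWithin] with s hs hs'
    exact key s ⟨hs'.1, (mem_Iio.1 hs).le⟩
  · exact derivWithin_congr (h1 v w hvw hv hwp) (h1 v w hvw hv hwp 0 h01)

/-- For an edge ending at `p` the point is taken on its part outside the disc, where the edges of `E
t` and `E'` agree. -/
lemma exists_mem_openEdge {v w : H.Rest} (hv : v ≠ H.p')
    (hvw : (B.contract H).graph.Adj v w) {r : ℝ} {s₀ : ℝ} (hs₀ : s₀ ∈ Ioo (0 : ℝ) 1)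
    (hfar : ∀ u w : H.Rest, (B.contract H).graph.Adj u w → u ≠ H.p' → w ≠ H.p' →
      ∀ s ∈ Icc (0 : ℝ) 1, r < dist (E'.arc u w s) μ)
    (hout : ∀ s ∈ Ioc s₀ 1, r < dist (E'.arc H.p' H.q' s) μ)
    (hev : ∀ᶠ t in 𝓝[≠] (0 : ℂ),
      (∀ u w : H.Rest, (B.contract H).graph.Adj u w → u ≠ H.p' → w ≠ H.p' →
        ∀ s ∈ Icc (0 : ℝ) 1, (E t).arc u w s = E'.arc u w s) ∧
      (∀ s ∈ Icc s₀ 1, (E t).arc H.p H.q s = E'.arc H.p' H.q' s)) :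
    ∃ x ∈ E'.openEdge v w, r < dist x μ ∧ ∀ᶠ t in 𝓝[≠] (0 : ℂ), x ∈ (E t).openEdge v w := by
  by_cases hwp : w = H.p'
  · subst hwp
    have hq : v = H.q' := H.eq_q'_of_adj hvw.symm
    subst hq
    obtain ⟨s, hs⟩ := exists_between hs₀.2
    have hs01 : s ∈ Ioo (0 : ℝ) 1 := ⟨hs₀.1.trans hs.1, hs.2⟩
    rw [E'.openEdge_symm H.adj_p'_q']
    refine ⟨_, ⟨s, hs01, rfl⟩, hout s ⟨hs.1, hs.2.le⟩, ?_⟩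
    filter_upwards [hev] with t ⟨_, h2⟩
    rw [(E t).openEdge_symm (u := H.p'.1) (v := H.q'.1) H.adj_q]
    exact ⟨s, hs01, h2 s ⟨hs.1.le, hs.2.le⟩⟩
  · have hs : (1 / 2 : ℝ) ∈ Ioo (0 : ℝ) 1 := ⟨by norm_num, by norm_num⟩
    refine ⟨_, ⟨_, hs, rfl⟩, hfar v w hvw hv hwp _ (Ioo_subset_Icc_self hs), ?_⟩
    filter_upwards [hev] with t ⟨h1, _⟩
    exact ⟨_, hs, h1 v w hvw hv hwp _ (Ioo_subset_Icc_self hs)⟩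

-- Where the fixed terminals of `E'` lie is not a hypothesis; it is read off from `E t` for a single
-- small `t`.
open Classical in
lemma prod_contract_pos (h : IsSimpleDegeneration H lam μ E E') (g : ℂ → ℕ → ℂ) :
    ∏ k ∈ (B.contract H).terminals, g (E'.pos k) ((B.contract H).a k) =
      g μ (B.a H.p) * ∏ k ∈ H.others, g (lam k) (B.a k) := by
  have h1 : ∀ k ∈ (B.contract H).terminals, g (E'.pos k) ((B.contract H).a k) =
      g (if k.1 = H.p then μ else lam k.1) (B.a k.1) := by
    intro k hk
    by_cases hkp : k = H.p'
    · subst hkp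
      rw [h.pos_p, if_pos (show H.p'.1 = H.p from rfl)]
      rfl
    · rw [if_neg (H.ne_p_of_ne hkp)]
      obtain ⟨t, ht1, ht2⟩ := ((h.eventually_pos_eq hkp).and h.pos_terminal).exists
      rw [← ht1, ht2 k.1 ((H.contract_isTerminal_iff hkp).1
        (MarkedBinaryTree.mem_terminals.1 hk)) k.2.1 k.2.2]
      rfl
  rw [Finset.prod_congr rfl h1,
    H.prod_contract_terminals fun k => g (if k = H.p then μ else lam k) (B.a k), if_pos rfl]
  congr 1
  refine Finset.prod_congr rfl fun k hk => ?_
  have hkp : k ≠ H.p := fun e => H.p_notMem_others (e ▸ hk)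
  rw [if_neg hkp]

lemma f_contract (h : IsSimpleDegeneration H lam μ E E') (hw₁ : B.isWhite H.l₁ = true) :
    ∀ x, E'.f x = (x - μ) ^ 2 * ∏ k ∈ H.others, (x - lam k) ^ B.a k := by
  intro x
  unfold PlaneEmbedding.f
  rw [h.prod_contract_pos fun z n => (x - z) ^ n, MarkedBinaryTree.Cherry.a_p hw₁]

lemma eventually_f_eq (h : IsSimpleDegeneration H lam μ E E') (hw₁ : B.isWhite H.l₁ = true)
    (hw₂ : B.isWhite H.l₂ = true) : ∀ᶠ t in 𝓝[≠] (0 : ℂ), ∀ x, (E t).f x =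
      (x - (μ + t * (lam H.l₁ - μ))) * (x - (μ + t * (lam H.l₂ - μ))) *
        ∏ k ∈ H.others, (x - lam k) ^ B.a k := by
  filter_upwards [h.pos_terminal, h.pos_l₁, h.pos_l₂] with t h1 h2 h3 x
  unfold PlaneEmbedding.f
  rw [H.prod_terminals, h2, h3, MarkedBinaryTree.Cherry.a_l₁ hw₁, MarkedBinaryTree.Cherry.a_l₂ hw₂,
    pow_one, pow_one, mul_assoc]
  congr 2
  refine Finset.prod_congr rfl fun k hk => ?_
  obtain ⟨a1, a2, a3⟩ := H.mem_others.1 hk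
  rw [h1 k a1 a2 a3]

/-- Both crossings are placed at points outside the disc that lie on the tree for all small `t`.
There the family is a perturbation by the factor `cbrtRatio` near 1, so `cross_tendsto` applies to
each of the two jumps. -/
theorem tendsto_period (h : IsSimpleDegeneration H lam μ E E') (hw₁ : B.isWhite H.l₁ = true)
    (hw₂ : B.isWhite H.l₂ = true) {ζ : ℂ} (hζ : ζ ^ 3 = 1) {v : H.Rest} (hv : B.IsInner v.1)
    (hvp : v ≠ H.p') {c : (t : ℂ) → ClosedCurve (E t).f}
    (hc : ∀ᶠ t in 𝓝[≠] (0 : ℂ), (E t).IsCycleB ζ v.1 (c t)) {c' : ClosedCurve E'.f}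
    (hc' : E'.IsCycleB ζ v c') {R : ℂ → ℂ} (hR : Differentiable ℂ R) {e : ℕ}
    (hinf : Tendsto (fun z => z * R z / z ^ (e * B.n₁)) (Bornology.cobounded ℂ) (𝓝 0))
    {φ : ℂ → ℂ → ℂ → ℂ} {φ' : ℂ → ℂ → ℂ}
    (hφ : ∀ᶠ t in 𝓝[≠] (0 : ℂ), ∀ x y, y ^ 3 = (E t).f x → (E t).f x ≠ 0 → φ t x y = R x / y ^ e)
    (hφ' : ∀ x y, y ^ 3 = E'.f x → E'.f x ≠ 0 → φ' x y = R x / y ^ e) :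
    Tendsto (fun t => period (φ t) (c t)) (𝓝[≠] 0) (𝓝 (period φ' c')) := by
  obtain ⟨r, hr, s₀, hs₀, hfar, hnear, hout, hev⟩ := h.trees
  have hev' := hev.mono fun t ht => (⟨ht.1, ht.2.1⟩ : _ ∧ _)
  have hn := MarkedBinaryTree.Cherry.contract_n₁ hw₁ hw₂
  -- the degenerate curve
  obtain ⟨w₁, w₂, Y', hw₁', hw₂', hord, hY', hcross'⟩ := hc'.exists_cross
  obtain ⟨F', hF'⟩ := hY'.exists_branchData hζ hR (e := e) (by rwa [hn])
  obtain ⟨x₁, hx₁, hx₁r, hx₁t⟩ := exists_mem_openEdge hvp hw₂' hs₀ hfar hout hev'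
  obtain ⟨x₂, hx₂, hx₂r, hx₂t⟩ := exists_mem_openEdge hvp hw₁' hs₀ hfar hout hev'
  obtain ⟨D₁', D₂', k1', k2', k3'⟩ := hcross' e R F' φ' hF' hφ' x₁ hx₁ x₂ hx₂
  -- the nearby curves
  set θ := outerFactor (B.isWhite v) with hθ
  have hadjm : (B.contract H).graph.Adj v ((B.contract H).mark v) :=
    (B.contract H).adj_mark v ((H.contract_isInner_iff hvp).2 hv)
  obtain ⟨A, hA⟩ : ∃ A : ℂ → (ℂ → ℂ) × (ℂ → ℂ) × ℂ × ℂ, ∀ᶠ t in 𝓝[≠] (0 : ℂ),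
      (E t).IsSheet ζ (A t).1 ∧ BranchData (E t).support (E t).f R e (A t).1 (A t).2.1 ∧
      Cross (E t).support (A t).1 (A t).2.1 e θ 1 x₁ (A t).2.2.1 ∧
      Cross (E t).support (A t).1 (A t).2.1 e 1 θ x₂ (A t).2.2.2 ∧
      period (φ t) (c t) = (A t).2.2.1 + (A t).2.2.2 := by
    refine Filter.Eventually.choice (r := fun t (A : (ℂ → ℂ) × (ℂ → ℂ) × ℂ × ℂ) =>
      (E t).IsSheet ζ A.1 ∧ BranchData (E t).support (E t).f R e A.1 A.2.1 ∧
      Cross (E t).support A.1 A.2.1 e θ 1 x₁ A.2.2.1 ∧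
      Cross (E t).support A.1 A.2.1 e 1 θ x₂ A.2.2.2 ∧
      period (φ t) (c t) = A.2.2.1 + A.2.2.2) ?_
    filter_upwards [hc, hφ, hx₁t, hx₂t, h.eventually_dir_eq hvp hw₁', h.eventually_dir_eq hvp hw₂',
      h.eventually_dir_eq hvp hadjm] with t hct hφt b₁ b₂ d₁ d₂ d₃
    obtain ⟨u₁, u₂, Y, hu₁, hu₂, hordt, hY, hcross⟩ := hct.exists_cross
    obtain ⟨F, hF⟩ := hY.exists_branchData hζ hR hinf
    have hu : u₁ = w₁.1 ∧ u₂ = w₂.1 := by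
      refine MarkedBinaryTree.eq_of_anticlockwise hv ((E t).dir v.1) (w₁ := w₁.1) (w₂ := w₂.1)
        hw₁' hw₂' ?_ hu₁ hu₂ hordt
      rw [H.contract_mark hvp hv] at d₃
      rw [d₁, d₂, d₃]
      exact hord
    obtain ⟨rfl, rfl⟩ := hu
    obtain ⟨D₁, D₂, k1, k2, k3⟩ := hcross e R F (φ t) hF hφt x₁ b₁ x₂ b₂
    exact ⟨(Y, F, D₁, D₂), hY, hF, k1, k2, k3⟩
  set O : Set ℂ := (Metric.closedBall μ r)ᶜ with hO
  have hOmem : ∀ {x : ℂ}, x ∈ O ↔ r < dist x μ := fun {x} => by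
    rw [hO, mem_compl_iff, Metric.mem_closedBall, not_le]
  have hmem : ∀ᶠ t in 𝓝[≠] (0 : ℂ), ∀ x ∈ O, x ∈ (E t).support ↔ x ∈ E'.support := by
    filter_upwards [hev] with t ⟨t1, t2, t3, t4, t5⟩ x hx
    rw [hOmem] at hx
    have leaf : ∀ {u w : V}, B.graph.Adj u w → x ∈ (E t).arc u w '' Icc 0 1 →
        (u = H.l₁ → False) ∧ (u = H.l₂ → False) := by
      refine fun {u w} huw hxu => ⟨?_, ?_⟩
      · rintro rfl
        have hwp := H.eq_p_of_adj₁ huw.symm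
        subst hwp
        obtain ⟨s, hs, rfl⟩ := (E t).arc_image_subset huw.symm hxu
        exact (t4 s hs).not_gt hx
      · rintro rfl
        have hwp := H.eq_p_of_adj₂ huw.symm
        subst hwp
        obtain ⟨s, hs, rfl⟩ := (E t).arc_image_subset huw.symm hxu
        exact (t5 s hs).not_gt hx
    have froms : ∀ s ∈ Icc (0 : ℝ) 1, r < dist ((E t).arc H.p H.q s) μ ∨
        r < dist (E'.arc H.p' H.q' s) μ → (E t).arc H.p H.q s = E'.arc H.p' H.q' s := by
      intro s hs hor
      rcases le_or_gt s s₀ with hss | hss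
      · rcases hor with hor | hor
        · exact absurd (t3 s ⟨hs.1, hss⟩) hor.not_ge
        · exact absurd (hnear s ⟨hs.1, hss⟩) hor.not_ge
      · exact t2 s ⟨hss.le, hs.2⟩
    constructor
    · rintro ⟨u, w, huw, hxu⟩
      have hu := leaf huw hxu
      have hw := leaf huw.symm ((E t).arc_image_subset huw.symm hxu)
      have fromp : ∀ {w : V}, B.graph.Adj H.p w → w ≠ H.l₁ → w ≠ H.l₂ →
          x ∈ (E t).arc H.p w '' Icc 0 1 → x ∈ E'.support := by
        rintro w hpw hw1 hw2 ⟨s, hs, rfl⟩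
        have hwq : w = H.q := by
          rcases H.eq_of_adj_p hpw with h1 | h1 | h1
          · exact absurd h1 hw1
          · exact absurd h1 hw2
          · exact h1
        subst hwq
        rw [froms s hs (Or.inl hx)]
        exact E'.arc_subset_support H.adj_p'_q' ⟨s, hs, rfl⟩
      by_cases hup : u = H.p
      · subst hup
        exact fromp huw hw.1 hw.2 hxu
      by_cases hwp : w = H.p
      · subst hwp
        exact fromp huw.symm hu.1 hu.2 ((E t).arc_image_subset huw.symm hxu)
      obtain ⟨s, hs, rfl⟩ := hxu
      have := t1 ⟨u, hu⟩ ⟨w, hw⟩ huw (fun e => hup (congrArg Subtype.val e))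
        (fun e => hwp (congrArg Subtype.val e)) s hs
      simp only at this
      rw [this]
      exact ⟨⟨u, hu⟩, ⟨w, hw⟩, huw, s, hs, rfl⟩
    · rintro ⟨u, w, huw, hxu⟩
      have fromp : ∀ {w : H.Rest}, (B.contract H).graph.Adj H.p' w →
          x ∈ E'.arc H.p' w '' Icc 0 1 → x ∈ (E t).support := by
        rintro w hpw ⟨s, hs, rfl⟩
        have hwq := H.eq_q'_of_adj hpw
        subst hwq
        rw [← froms s hs (Or.inr hx)]
        exact (E t).arc_subset_support H.adj_q ⟨s, hs, rfl⟩
      by_cases hup : u = H.p'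
      · subst hup
        exact fromp huw hxu
      by_cases hwp : w = H.p'
      · subst hwp
        exact fromp huw.symm (E'.arc_image_subset huw.symm hxu)
      obtain ⟨s, hs, rfl⟩ := hxu
      rw [← t1 u w huw hup hwp s hs]
      exact ⟨u.1, w.1, huw, s, hs, rfl⟩
  have hpre : IsPreconnected (O \ E'.support) := by
    have h1 := E'.isPreconnected_compl_support_union H.adj_p'_q' (fun w => H.eq_q'_of_adj)
      (Metric.isClosed_closedBall (x := μ) (ε := r)) (isPreconnected_compl_closedBall μ hr.le)
      ⟨hs₀.1.le, hs₀.2⟩ (fun s hs => hnear s hs)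
      (fun s hs => by rw [Metric.mem_closedBall, not_le]; exact hout s hs)
      (fun u w h1 h2 h3 s hs => by
        rw [Metric.mem_closedBall, not_le]; exact hfar u w h1 h2 h3 s hs)
    convert! h1 using 1
    rw [hO, compl_union, sdiff_eq, inter_comm]
  have hcob : O \ E'.support ∈ Bornology.cobounded ℂ := by
    have h1 : Bornology.IsBounded (Metric.closedBall μ r ∪ E'.support) :=
      Metric.isBounded_closedBall.union E'.isCompact_support.isBounded
    have h2 := Bornology.isBounded_def.1 h1
    rwa [compl_union] at h2
  obtain ⟨b₀, hb₀⟩ : (O \ E'.support).Nonempty := Filter.nonempty_of_mem hcob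
  set w₁t : ℂ → ℂ := fun t => t * (lam H.l₁ - μ) with hw₁t
  set w₂t : ℂ → ℂ := fun t => t * (lam H.l₂ - μ) with hw₂t
  have hsmall : ∀ a : ℂ, ∀ δ > 0, ∀ᶠ t in 𝓝[≠] (0 : ℂ), ‖t * a‖ < δ := by
    intro a δ hδ
    have : Tendsto (fun t : ℂ => ‖t * a‖) (𝓝 0) (𝓝 0) := by
      have hcont : Continuous fun t : ℂ => ‖t * a‖ := by fun_prop
      simpa using hcont.tendsto 0
    exact nhdsWithin_le_nhds (this.eventually_lt_const hδ)
  have hlim : BranchLimit (𝓝[≠] (0 : ℂ)) O R e (fun t => (E t).support) (fun t => (E t).f)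
      (fun t => (A t).1) (fun t => (A t).2.1) E'.support E'.f Y' F'
      (fun t => cbrtRatio μ (w₁t t) (w₂t t)) := by
    have hfeq : ∀ᶠ t in 𝓝[≠] (0 : ℂ), ∀ x ∈ O,
        (E t).f x = E'.f x * cbrtRatio μ (w₁t t) (w₂t t) x ^ 3 := by
      filter_upwards [h.eventually_f_eq hw₁ hw₂] with t ht x hx
      have hxμ : x ≠ μ := by
        rintro rfl
        rw [hOmem, dist_self] at hx
        exact hx.not_gt hr
      rw [ht, h.f_contract hw₁]
      have := cbrtRatio_pow (w := w₁t t) (w' := w₂t t) hxμ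
      linear_combination -(∏ k ∈ H.others, (x - lam k) ^ B.a k) * this
    have hκd : ∀ᶠ t in 𝓝[≠] (0 : ℂ), DifferentiableOn ℂ (cbrtRatio μ (w₁t t) (w₂t t)) O := by
      filter_upwards [hsmall (lam H.l₁ - μ) r hr, hsmall (lam H.l₂ - μ) r hr] with t g1 g2 x hx
      exact (differentiableAt_cbrtRatio hr g1 g2 (hOmem.1 hx)).differentiableWithinAt
    refine ⟨hA.mono fun t ht => ht.2.1, hF', Metric.isClosed_closedBall.isOpen_compl, hpre, hmem,
      hκd, hfeq, ?_, ?_⟩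
    · filter_upwards [hA, hfeq, hκd, hmem] with t ⟨hY, _⟩ g1 g2 g3
      -- On the connected exterior the two branches differ by a constant root of unity. Both have
      -- the leading coefficient `ζ` at infinity, so this constant is 1.
      obtain ⟨η, -, hη⟩ := exists_cubeRoot_ratio hpre (y₁ := (A t).1)
        (y₂ := fun x => Y' x * cbrtRatio μ (w₁t t) (w₂t t) x)
        (hY.continuousOn.mono fun x hx hxt => hx.2 ((g3 x hx.1).1 hxt))
        ((hY'.continuousOn.mono fun x hx => hx.2).mul (g2.continuousOn.mono sdiff_subset))
        (fun x hx => by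
          rw [hY.cube x fun hxt => hx.2 ((g3 x hx.1).1 hxt), mul_pow, hY'.cube x hx.2, g1 x hx.1])
        (fun x hx h0 => by
          have h1 : E'.f x * cbrtRatio μ (w₁t t) (w₂t t) x ^ 3 = 0 := by
            rw [← hY'.cube x hx.2, ← mul_pow, h0]
            norm_num
          rw [← g1 x hx.1] at h1
          exact (E t).f_ne_zero (fun hxt => hx.2 ((g3 x hx.1).1 hxt)) h1)
      have T1 : Tendsto (fun x => (A t).1 x / x ^ B.n₁) (Bornology.cobounded ℂ) (𝓝 (η * (ζ * 1))) := by
        have T2 := (hY'.atInfinity.mul (tendsto_cbrtRatio_cobounded μ (w₁t t) (w₂t t))).const_mul η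
        refine T2.congr' ?_
        filter_upwards [hcob] with x hx
        rw [hη x hx, hn]
        ring
      have e1 := tendsto_nhds_unique T1 hY.atInfinity
      have e2 : η = 1 := by
        rw [mul_one] at e1
        exact mul_right_cancel₀ (cubeRoot_ne_zero hζ) (by rw [e1, one_mul])
      intro x hx
      rw [hη x hx, e2, one_mul]
    · intro ε hε
      obtain ⟨δ, hδ, hδ'⟩ := exists_cbrtRatio_sub_one_lt μ hr hε
      filter_upwards [hsmall (lam H.l₁ - μ) δ hδ, hsmall (lam H.l₂ - μ) δ hδ] with t g1 g2 x hx
      exact hδ' _ _ _ g1 g2 (hOmem.1 hx)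
  have hθ1 : θ ≠ 1 := outerFactor_ne_one _
  have L₁ := hlim.cross_tendsto ⟨hOmem.2 hx₁r, E'.openEdge_subset hw₂' hx₁⟩ (E'.twoSided hw₂' hx₁)
    (E'.f_ne_zero_of_mem_openEdge hw₂' hx₁) hb₀ (outerFactor_pow _) (one_pow 3) hθ1
    (hA.mono fun t ht => ht.2.2.1) k1'
  have L₂ := hlim.cross_tendsto ⟨hOmem.2 hx₂r, E'.openEdge_subset hw₁' hx₂⟩ (E'.twoSided hw₁' hx₂)
    (E'.f_ne_zero_of_mem_openEdge hw₁' hx₂) hb₀ (one_pow 3) (outerFactor_pow _) hθ1.symm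
    (hA.mono fun t ht => ht.2.2.2.1) k2'
  have L := L₁.add L₂
  rw [k3']
  -- The two crossings exchange `θ` and 1 in opposite order, so the base point terms cancel.
  have e0 : D₁' - (F' b₀ / θ ^ e - F' b₀ / 1 ^ e) + (D₂' - (F' b₀ / 1 ^ e - F' b₀ / θ ^ e)) =
      D₁' + D₂' := by ring
  have L' : Tendsto _ _ (𝓝 (D₁' + D₂')) := e0 ▸ L
  refine L'.congr' ?_
  filter_upwards [hA] with t ht
  rw [ht.2.2.2.2]
  ring

end IsSimpleDegeneration

end TripleCover

namespace TripleCover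

open Complex

/-! ### Integrals along a path between two branch points -/

lemma natCast_mul_pow_pred (m : ℕ) (x : ℂ) : (m : ℂ) * x ^ (m - 1) * x = m * x ^ m := by
  cases m with
  | zero => simp
  | succ m => rw [Nat.add_sub_cancel, mul_assoc, ← pow_succ]

/-- The integral of the derivative of `(x - P) ^ m (x - Q) ^ n u ^ (3 - e)`, that is of `(x - P) ^
(m + 1 - e/3) (x - Q) ^ (n + 1 - e/3)`, which vanishes at both ends. -/
lemma integral_pow_mul_pow {α α' u : ℝ → ℂ} {a b : ℝ} (hab : a ≤ b) {P Q : ℂ} {e : ℕ} (he : e < 3)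
    (hα : ContinuousOn α (Icc a b)) (hd : ∀ τ ∈ Ioo a b, HasDerivAt α (α' τ) τ)
    (hu : ContinuousOn u (Icc a b)) (hu3 : ∀ τ ∈ Icc a b, u τ ^ 3 = (α τ - P) * (α τ - Q))
    (hu0 : ∀ τ ∈ Ioo a b, u τ ≠ 0) (ha : u a = 0) (hb : u b = 0) (m n : ℕ)
    (h₁ : IntervalIntegrable (fun τ => (α τ - P) ^ m * (α τ - Q) ^ (n + 1) / u τ ^ e * α' τ)
      MeasureTheory.volume a b)
    (h₂ : IntervalIntegrable (fun τ => (α τ - P) ^ (m + 1) * (α τ - Q) ^ n / u τ ^ e * α' τ)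
      MeasureTheory.volume a b) :
    (m + 1 - e / 3 : ℂ) * (∫ τ in a..b, (α τ - P) ^ m * (α τ - Q) ^ (n + 1) / u τ ^ e * α' τ) +
      (n + 1 - e / 3 : ℂ) * (∫ τ in a..b, (α τ - P) ^ (m + 1) * (α τ - Q) ^ n / u τ ^ e * α' τ) =
      0 := by
  -- The exponent `3 - e` of `u` is written as `j + 1`, to have no subtraction after
  -- differentiation.
  obtain ⟨j, hj⟩ : ∃ j, e + (j + 1) = 3 := ⟨2 - e, by omega⟩
  have hjc : (j + 1 : ℂ) = 3 - e := by
    have : ((e + (j + 1) : ℕ) : ℂ) = (3 : ℕ) := by rw [hj]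
    push_cast at this
    linear_combination this
  rw [← intervalIntegral.integral_const_mul, ← intervalIntegral.integral_const_mul,
    ← intervalIntegral.integral_add (h₁.const_mul _) (h₂.const_mul _)]
  have hint := (h₁.const_mul (m + 1 - e / 3 : ℂ)).add (h₂.const_mul (n + 1 - e / 3 : ℂ))
  rw [intervalIntegral.integral_eq_sub_of_hasDerivAt_of_le
    (f := fun τ => (α τ - P) ^ m * (α τ - Q) ^ n * u τ ^ (j + 1)) hab ?_ ?_ hint]
  · simp only [ha, hb]
    ring
  · exact (((hα.sub continuousOn_const).pow m).mul ((hα.sub continuousOn_const).pow n)).mul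
      (hu.pow _)
  · intro τ hτ
    have hτI := Ioo_subset_Icc_self hτ
    have hn : Icc a b ∈ 𝓝 τ := Icc_mem_nhds hτ.1 hτ.2
    have dX := (hd τ hτ).sub_const P
    have dZ := (hd τ hτ).sub_const Q
    have du := hasDerivAt_of_cube (hu.continuousAt hn)
      (g := fun τ => (α τ - P) * (α τ - Q)) (by filter_upwards [hn] with s hs using hu3 s hs)
      (dX.mul dZ) (hu0 τ hτ)
    have h := ((dX.pow m).mul (dZ.pow n)).mul (du.pow (j + 1))
    refine h.congr_deriv ?_
    have hu0' := hu0 τ hτ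
    have h3 := hu3 τ hτI
    simp only [Pi.pow_apply, Pi.mul_apply, Nat.add_sub_cancel]
    push_cast
    set X := α τ - P
    set Z := α τ - Q
    set w := u τ
    have hX := natCast_mul_pow_pred m X
    have hZ := natCast_mul_pow_pred n Z
    have q1 : w ^ (j + 1) = X * Z * (w ^ e)⁻¹ := by
      rw [← h3, ← hj, pow_add w e, mul_comm (w ^ e), mul_inv_cancel_right₀ (pow_ne_zero _ hu0')]
    have q2 : w ^ j / (3 * w ^ 2) = (w ^ e)⁻¹ / 3 := by
      have h4 : w ^ 2 = w ^ j * w ^ e := by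
        rw [← pow_add]
        congr 1
        omega
      rw [h4]
      field_simp
    rw [q1, hjc, mul_div_assoc, mul_div_assoc]
    have q3 : (3 - (e : ℂ)) * w ^ j * ((α' τ * Z + X * α' τ) / (3 * w ^ 2)) =
        (3 - e) * (α' τ * Z + X * α' τ) * ((w ^ e)⁻¹ / 3) := by rw [← q2]; ring
    rw [q3, div_eq_mul_inv, div_eq_mul_inv]
    linear_combination (Z ^ n * Z * (w ^ e)⁻¹ * α' τ) * hX + (X ^ m * X * (w ^ e)⁻¹ * α' τ) * hZ

/-- An injective `C¹` path, parametrized by `[0, 1]`, that is regular at the end points. -/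
structure IsSimplePath (α α' : ℝ → ℂ) : Prop where
  hasDeriv : ∀ τ ∈ Icc (0 : ℝ) 1, HasDerivWithinAt α (α' τ) (Icc 0 1) τ
  cont : ContinuousOn α' (Icc 0 1)
  injOn : InjOn α (Icc 0 1)
  deriv_zero : α' 0 ≠ 0
  deriv_one : α' 1 ≠ 0

namespace IsSimplePath

variable {α α' : ℝ → ℂ}

lemma continuousOn (h : IsSimplePath α α') : ContinuousOn α (Icc 0 1) :=
  fun τ hτ => (h.hasDeriv τ hτ).continuousWithinAt

lemma hasDerivAt (h : IsSimplePath α α') {τ : ℝ} (hτ : τ ∈ Ioo (0 : ℝ) 1) :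
    HasDerivAt α (α' τ) τ :=
  (h.hasDeriv τ (Ioo_subset_Icc_self hτ)).hasDerivAt (Icc_mem_nhds hτ.1 hτ.2)

lemma ne_zero (h : IsSimplePath α α') {τ : ℝ} (hτ : τ ∈ Ioc (0 : ℝ) 1) : α τ - α 0 ≠ 0 := fun e =>
  hτ.1.ne' (h.injOn (Ioc_subset_Icc_self hτ) ⟨le_rfl, zero_le_one⟩ (sub_eq_zero.1 e))

lemma ne_one (h : IsSimplePath α α') {τ : ℝ} (hτ : τ ∈ Ico (0 : ℝ) 1) : α τ - α 1 ≠ 0 := fun e =>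
  hτ.2.ne (h.injOn (Ico_subset_Icc_self hτ) ⟨zero_le_one, le_rfl⟩ (sub_eq_zero.1 e))

lemma reverse (h : IsSimplePath α α') : IsSimplePath (fun τ => α (1 - τ)) fun τ => -α' (1 - τ) := by
  have hmaps : MapsTo (fun τ : ℝ => 1 - τ) (Icc 0 1) (Icc 0 1) := fun τ hτ =>
    ⟨by linarith [hτ.2], by linarith [hτ.1]⟩
  refine ⟨fun τ hτ => ?_, (h.cont.comp (by fun_prop) hmaps).neg, fun τ hτ τ' hτ' e => ?_, ?_, ?_⟩
  · have h1 : HasDerivWithinAt (fun τ : ℝ => 1 - τ) (-1) (Icc 0 1) τ :=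
      ((hasDerivAt_id τ).const_sub 1).hasDerivWithinAt
    have h2 := (h.hasDeriv (1 - τ) (hmaps hτ)).scomp τ h1 hmaps
    rw [neg_one_smul] at h2
    exact h2
  · have := h.injOn (hmaps hτ) (hmaps hτ') e
    linarith
  · simpa using h.deriv_one
  · simpa using h.deriv_zero

/-- Near 0 this follows from the nonzero derivative there, elsewhere from injectivity and
compactness. It compares `u` with its model on the unit interval. -/
lemma exists_lower_bound (h : IsSimplePath α α') :
    ∃ c > 0, ∀ τ ∈ Icc (0 : ℝ) 1, c * τ ≤ ‖α τ - α 0‖ := by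
  have h01 : (0 : ℝ) ∈ Icc (0 : ℝ) 1 := ⟨le_rfl, zero_le_one⟩
  have hv : 0 < ‖α' 0‖ := norm_pos_iff.2 h.deriv_zero
  have h1 := (hasDerivWithinAt_iff_isLittleO.1 (h.hasDeriv 0 h01)).def (half_pos hv)
  rw [eventually_nhdsWithin_iff] at h1
  obtain ⟨δ, hδ, hb⟩ := Metric.eventually_nhds_iff.1 h1
  set δ' := min (δ / 2) 1 with hδ'
  have hδ'0 : 0 < δ' := lt_min (by linarith) one_pos
  have hsub : Icc δ' 1 ⊆ Icc (0 : ℝ) 1 := Icc_subset_Icc_left hδ'0.le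
  obtain ⟨τ₀, hτ₀, hmin⟩ := isCompact_Icc.exists_isMinOn (s := Icc δ' 1)
    ⟨1, min_le_right _ _, le_rfl⟩ (f := fun τ => ‖α τ - α 0‖)
      ((h.continuousOn.mono hsub).sub continuousOn_const).norm
  set M := ‖α τ₀ - α 0‖ with hM
  have hMpos : 0 < M := norm_pos_iff.2 (h.ne_zero ⟨hδ'0.trans_le hτ₀.1, hτ₀.2⟩)
  refine ⟨min (‖α' 0‖ / 2) M, lt_min (half_pos hv) hMpos, fun τ hτ => ?_⟩
  rcases lt_or_ge τ δ' with h2 | h2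
  · have h3 := hb (y := τ) (by
      rw [Real.dist_eq, sub_zero, abs_of_nonneg hτ.1]
      linarith [h2.trans_le (min_le_left _ _)]) hτ
    rw [sub_zero, Real.norm_of_nonneg hτ.1] at h3
    have h4 : ‖τ • α' 0‖ = τ * ‖α' 0‖ := by rw [norm_smul, Real.norm_of_nonneg hτ.1]
    have h5 := norm_sub_norm_le (τ • α' 0) (τ • α' 0 - (α τ - α 0))
    rw [sub_sub_cancel, ← norm_neg (τ • α' 0 - _), neg_sub, h4] at h5
    have h6 : min (‖α' 0‖ / 2) M * τ ≤ ‖α' 0‖ / 2 * τ :=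
      mul_le_mul_of_nonneg_right (min_le_left _ _) hτ.1
    linarith
  · have h3 : M ≤ ‖α τ - α 0‖ := isMinOn_iff.1 hmin τ ⟨h2, hτ.2⟩
    have h4 : min (‖α' 0‖ / 2) M * τ ≤ M * 1 :=
      mul_le_mul (min_le_right _ _) hτ.2 hτ.1 hMpos.le
    linarith

variable {u : ℝ → ℂ} {e : ℕ}

lemma u_ne (h : IsSimplePath α α')
    (hu3 : ∀ τ ∈ Icc (0 : ℝ) 1, u τ ^ 3 = (α τ - α 0) * (α τ - α 1)) {τ : ℝ}
    (hτ : τ ∈ Ioo (0 : ℝ) 1) : u τ ≠ 0 := fun e => by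
  have := hu3 τ (Ioo_subset_Icc_self hτ)
  rw [e, zero_pow three_ne_zero] at this
  exact mul_ne_zero (h.ne_zero (Ioo_subset_Ioc_self hτ)) (h.ne_one (Ioo_subset_Ico_self hτ)) this.symm

/-- The integrands with (mild) singularities at the end points are integrable. -/
lemma intervalIntegrable (h : IsSimplePath α α') (he : e < 3) (hu : ContinuousOn u (Icc 0 1))
    (hu3 : ∀ τ ∈ Icc (0 : ℝ) 1, u τ ^ 3 = (α τ - α 0) * (α τ - α 1)) {g : ℝ → ℂ}
    (hg : ContinuousOn g (Icc 0 1)) :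
    IntervalIntegrable (fun τ => g τ / u τ ^ e * α' τ) MeasureTheory.volume 0 1 := by
  obtain ⟨c₁, hc₁, hb₁⟩ := h.exists_lower_bound
  obtain ⟨c₂, hc₂, hb₂⟩ := h.reverse.exists_lower_bound
  obtain ⟨M, hM⟩ := isCompact_Icc.exists_bound_of_continuousOn (hg.mul h.cont)
  have he' : (0 : ℝ) < 1 - e / 3 := by
    have : (e : ℝ) < 3 := by exact_mod_cast he
    linarith
  have hre : 0 < (((1 - e / 3 : ℝ) : ℂ)).re := by rwa [ofReal_re]
  -- The lower bounds at both ends give `|u| ^ e ≥ (c₁ c₂ τ (1 - τ)) ^ (e/3)`, so a multiple of the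
  -- integrand of `B(1 - e/3, 1 - e/3)` dominates.
  have hbeta := (betaIntegral_convergent hre hre).norm.const_mul (((c₁ * c₂) ^ (e / 3 : ℝ))⁻¹ * M)
  rw [intervalIntegrable_iff_integrableOn_Ioo_of_le zero_le_one] at hbeta ⊢
  refine hbeta.mono' ?_ ?_
  · refine ContinuousOn.aestronglyMeasurable ?_ measurableSet_Ioo
    exact ((hg.mono Ioo_subset_Icc_self).div ((hu.mono Ioo_subset_Icc_self).pow e)
      fun τ hτ => pow_ne_zero _ (h.u_ne hu3 hτ)).mul (h.cont.mono Ioo_subset_Icc_self)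
  · refine (MeasureTheory.ae_restrict_iff' measurableSet_Ioo).2 (Eventually.of_forall fun τ hτ => ?_)
    have hτI := Ioo_subset_Icc_self hτ
    have hτ1 : 0 < 1 - τ := by linarith [hτ.2]
    have h1 := hb₁ τ hτI
    have h2 := hb₂ (1 - τ) ⟨hτ1.le, by linarith [hτ.1]⟩
    simp only [sub_sub_cancel, sub_zero] at h2
    have h3 : ‖u τ‖ ^ e = (‖α τ - α 0‖ * ‖α τ - α 1‖) ^ (e / 3 : ℝ) := by
      rw [← norm_mul, ← hu3 τ hτI, norm_pow, ← Real.rpow_natCast (‖u τ‖) 3, ← Real.rpow_mul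
        (norm_nonneg _), ← Real.rpow_natCast]
      congr 1
      push_cast
      field_simp
    have h4 : (c₁ * c₂) ^ (e / 3 : ℝ) * (τ ^ (e / 3 : ℝ) * (1 - τ) ^ (e / 3 : ℝ)) ≤ ‖u τ‖ ^ e := by
      rw [h3, ← Real.mul_rpow hτ.1.le hτ1.le, ← Real.mul_rpow (by positivity)
        (mul_nonneg hτ.1.le hτ1.le)]
      refine Real.rpow_le_rpow (mul_nonneg (by positivity) (mul_nonneg hτ.1.le hτ1.le)) ?_
        (by positivity)
      calc c₁ * c₂ * (τ * (1 - τ)) = (c₁ * τ) * (c₂ * (1 - τ)) := by ring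
        _ ≤ _ := mul_le_mul h1 h2 (mul_nonneg hc₂.le hτ1.le) (norm_nonneg _)
    have h5 : ‖((τ : ℂ) ^ (((1 - e / 3 : ℝ) : ℂ) - 1) *
        (1 - (τ : ℂ)) ^ (((1 - e / 3 : ℝ) : ℂ) - 1))‖ =
        (τ ^ (e / 3 : ℝ) * (1 - τ) ^ (e / 3 : ℝ))⁻¹ := by
      have e1 : ((1 - e / 3 : ℝ) : ℂ) - 1 = ((-(e / 3) : ℝ) : ℂ) := by push_cast; ring
      have e2 : (1 - (τ : ℂ)) = ((1 - τ : ℝ) : ℂ) := by push_cast; ring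
      rw [e1, e2, norm_mul, norm_cpow_eq_rpow_re_of_pos hτ.1, norm_cpow_eq_rpow_re_of_pos hτ1,
        ofReal_re, Real.rpow_neg hτ.1.le, Real.rpow_neg hτ1.le, mul_inv]
    rw [h5]
    have h6 : 0 < τ ^ (e / 3 : ℝ) * (1 - τ) ^ (e / 3 : ℝ) :=
      mul_pos (Real.rpow_pos_of_pos hτ.1 _) (Real.rpow_pos_of_pos hτ1 _)
    have h7 : 0 < (c₁ * c₂) ^ (e / 3 : ℝ) := Real.rpow_pos_of_pos (by positivity) _
    have hM0 : ‖g τ‖ * ‖α' τ‖ ≤ M := by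
      rw [← norm_mul]
      exact hM τ hτI
    have h8 : ‖g τ / u τ ^ e * α' τ‖ = (‖g τ‖ * ‖α' τ‖) * (‖u τ‖ ^ e)⁻¹ := by
      rw [norm_mul, norm_div, norm_pow]
      ring
    rw [h8]
    calc (‖g τ‖ * ‖α' τ‖) * (‖u τ‖ ^ e)⁻¹
        ≤ M * ((c₁ * c₂) ^ (e / 3 : ℝ) * (τ ^ (e / 3 : ℝ) * (1 - τ) ^ (e / 3 : ℝ)))⁻¹ := by
          refine mul_le_mul hM0 (inv_anti₀ (mul_pos h7 h6) h4) (by positivity)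
            ((mul_nonneg (norm_nonneg _) (norm_nonneg _)).trans hM0)
      _ = ((c₁ * c₂) ^ (e / 3 : ℝ))⁻¹ * M * (τ ^ (e / 3 : ℝ) * (1 - τ) ^ (e / 3 : ℝ))⁻¹ := by
          rw [mul_inv]; ring

/-- The integrals of `(x - a) ^ m (x - b) ^ n dx / u ^ e` along a path from `a` to `b`. -/
noncomputable def pathInt (α α' u : ℝ → ℂ) (e m n : ℕ) : ℂ :=
  ∫ τ in (0 : ℝ)..1, (α τ - α 0) ^ m * (α τ - α 1) ^ n / u τ ^ e * α' τ

variable (h : IsSimplePath α α') (he : e < 3) (hu : ContinuousOn u (Icc 0 1))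
  (hu3 : ∀ τ ∈ Icc (0 : ℝ) 1, u τ ^ 3 = (α τ - α 0) * (α τ - α 1))

include h he hu hu3

lemma intervalIntegrable_pow (m n : ℕ) :
    IntervalIntegrable (fun τ => (α τ - α 0) ^ m * (α τ - α 1) ^ n / u τ ^ e * α' τ)
      MeasureTheory.volume 0 1 :=
  h.intervalIntegrable he hu hu3 (((h.continuousOn.sub continuousOn_const).pow m).mul
    ((h.continuousOn.sub continuousOn_const).pow n))

lemma pathInt_total (m n : ℕ) : (m + 1 - e / 3 : ℂ) * pathInt α α' u e m (n + 1) +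
    (n + 1 - e / 3 : ℂ) * pathInt α α' u e (m + 1) n = 0 := by
  have h0 : u 0 = 0 := pow_eq_zero_iff three_ne_zero |>.1 (by
    rw [hu3 0 ⟨le_rfl, zero_le_one⟩]; ring)
  have h1 : u 1 = 0 := pow_eq_zero_iff three_ne_zero |>.1 (by
    rw [hu3 1 ⟨zero_le_one, le_rfl⟩]; ring)
  exact integral_pow_mul_pow zero_le_one he h.continuousOn (fun τ hτ => h.hasDerivAt hτ) hu hu3
    (fun τ hτ => h.u_ne hu3 hτ) h0 h1 m n (h.intervalIntegrable_pow he hu hu3 _ _)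
    (h.intervalIntegrable_pow he hu hu3 _ _)

lemma pathInt_sub (m n : ℕ) : pathInt α α' u e (m + 1) n - pathInt α α' u e m (n + 1) =
    (α 1 - α 0) * pathInt α α' u e m n := by
  unfold pathInt
  rw [← intervalIntegral.integral_sub (h.intervalIntegrable_pow he hu hu3 _ _)
    (h.intervalIntegrable_pow he hu hu3 _ _), ← intervalIntegral.integral_const_mul]
  congr 1
  ext τ
  ring

/-- The contiguity relation of the beta function, valid along every path: `pathInt_total` and
`pathInt_sub` are two linear equations for the two raised integrals. -/
lemma pathInt_succ_left (m n : ℕ) : (m + n + 2 - 2 * e / 3 : ℂ) * pathInt α α' u e (m + 1) n =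
    (m + 1 - e / 3) * (α 1 - α 0) * pathInt α α' u e m n := by
  linear_combination h.pathInt_total he hu hu3 m n +
    (m + 1 - e / 3 : ℂ) * h.pathInt_sub he hu hu3 m n

lemma pathInt_succ_right (m n : ℕ) : (m + n + 2 - 2 * e / 3 : ℂ) * pathInt α α' u e m (n + 1) =
    -((n + 1 - e / 3) * (α 1 - α 0) * pathInt α α' u e m n) := by
  linear_combination h.pathInt_total he hu hu3 m n -
    (n + 1 - e / 3 : ℂ) * h.pathInt_sub he hu hu3 m n

/-- Each step of the recursion multiplies by `(α 1 - α 0) (m + 1 - e/3) / (m + 2 - 2e/3)`, and the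
fraction is at most 1 because `e < 3`. The length of the path does not enter, which is essential
since it is not controlled as `t → 0`. -/
lemma norm_pathInt_le (m : ℕ) :
    ‖pathInt α α' u e m 0‖ ≤ ‖α 1 - α 0‖ ^ m * ‖pathInt α α' u e 0 0‖ := by
  induction m with
  | zero => simp
  | succ m ih =>
    have h1 := congrArg norm (h.pathInt_succ_left he hu hu3 m 0)
    have he' : (e : ℝ) < 3 := by exact_mod_cast he
    have c1 : (m + (0 : ℕ) + 2 - 2 * e / 3 : ℂ) = ((m + 2 - 2 * e / 3 : ℝ) : ℂ) := by push_cast; ring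
    have c2 : (m + 1 - e / 3 : ℂ) = ((m + 1 - e / 3 : ℝ) : ℂ) := by push_cast; ring
    have hm : (0 : ℝ) ≤ m := m.cast_nonneg
    have p1 : (0 : ℝ) < m + 2 - 2 * e / 3 := by linarith
    have p2 : (0 : ℝ) < m + 1 - e / 3 := by linarith
    rw [norm_mul, norm_mul, norm_mul, c1, c2, norm_real, norm_real, Real.norm_of_nonneg p1.le,
      Real.norm_of_nonneg p2.le] at h1
    have h2 : (m + 1 - e / 3 : ℝ) ≤ m + 2 - 2 * e / 3 := by linarith
    have h3 : (m + 2 - 2 * e / 3 : ℝ) * ‖pathInt α α' u e (m + 1) 0‖ ≤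
        (m + 2 - 2 * e / 3) * (‖α 1 - α 0‖ * ‖pathInt α α' u e m 0‖) := by
      rw [h1, mul_assoc]
      exact mul_le_mul_of_nonneg_right h2 (by positivity)
    calc ‖pathInt α α' u e (m + 1) 0‖ ≤ ‖α 1 - α 0‖ * ‖pathInt α α' u e m 0‖ :=
          le_of_mul_le_mul_left h3 p1
      _ ≤ ‖α 1 - α 0‖ * (‖α 1 - α 0‖ ^ m * ‖pathInt α α' u e 0 0‖) := by gcongr
      _ = _ := by ring

/-- With both exponents raised to 2 the integrand is the positive power `u ^ (6 - e)`, so the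
integral can be differentiated with respect to its end point. The factor 2 remains of `2 - 2e/3 = 2
(1 - e/3)` after cancelling `1 - e/3` in the first step. -/
lemma pathInt_two_two : (3 - 2 * e / 3 : ℂ) * (4 - 2 * e / 3) * (5 - 2 * e / 3) * 2 *
    pathInt α α' u e 2 2 =
      (2 - e / 3) ^ 2 * (1 - e / 3) * (α 1 - α 0) ^ 4 * pathInt α α' u e 0 0 := by
  have hne : (2 - 2 * e / 3 : ℂ) ≠ 0 := by
    intro h0
    have h1 : (e : ℂ) = 3 := by linear_combination (-3 / 2) * h0
    have h2 : e = 3 := by exact_mod_cast h1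
    omega
  have a1 := h.pathInt_succ_left he hu hu3 0 0
  have a2 := h.pathInt_succ_left he hu hu3 1 0
  have a3 := h.pathInt_succ_right he hu hu3 2 0
  have a4 := h.pathInt_succ_right he hu hu3 2 1
  push_cast at a1 a2 a3 a4
  have a1' : 2 * pathInt α α' u e 1 0 = (α 1 - α 0) * pathInt α α' u e 0 0 := by
    have h1 : (2 - 2 * e / 3 : ℂ) * (2 * pathInt α α' u e 1 0) =
        (2 - 2 * e / 3) * ((α 1 - α 0) * pathInt α α' u e 0 0) := by
      linear_combination 2 * a1
    exact mul_left_cancel₀ hne h1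
  set d := α 1 - α 0
  linear_combination (2 * (3 - 2 * e / 3 : ℂ) * (4 - 2 * e / 3)) * a4 -
    (2 * (3 - 2 * e / 3 : ℂ) * (2 - e / 3) * d) * a3 +
    (2 * (2 - e / 3 : ℂ) * (1 - e / 3) * d ^ 2) * a2 +
    ((2 - e / 3 : ℂ) ^ 2 * (1 - e / 3) * d ^ 3) * a1'

end IsSimplePath

end TripleCover

/-! ### Moments with variable end point and their differential equation -/

namespace TripleCover

open Complex

/-- At a zero of `g` no branch has to be chosen: `|y| ^ 3 = |g|` tends to zero. -/
lemma continuousWithinAt_of_cube {X : Type*} [TopologicalSpace X] {T : Set X} {y g : X → ℂ} {x : X}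
    (hx : x ∈ T) (hg : ContinuousWithinAt g T x) (h : ∀ z ∈ T, y z ^ 3 = g z) (h0 : g x = 0) :
    ContinuousWithinAt y T x := by
  have hy0 : y x = 0 := pow_eq_zero_iff three_ne_zero |>.1 (by rw [h x hx, h0])
  unfold ContinuousWithinAt
  rw [hy0, Metric.tendsto_nhds]
  intro ε hε
  have h1 : Tendsto (fun z => ‖g z‖) (𝓝[T] x) (𝓝 0) := by
    have h2 := hg.norm
    rwa [ContinuousWithinAt, h0, norm_zero] at h2
  filter_upwards [h1.eventually_lt_const (show (0 : ℝ) < ε ^ 3 by positivity),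
    self_mem_nhdsWithin] with z hz hzT
  rw [← h z hzT, norm_pow] at hz
  rw [dist_zero_right]
  exact lt_of_pow_lt_pow_left₀ 3 hε.le hz

namespace IsSimplePath

variable {α α' : ℝ → ℂ}

/-- The triangle `0 ≤ τ ≤ σ ≤ 1`. -/
def triangle : Set (ℝ × ℝ) := {p | 0 ≤ p.1 ∧ p.1 ≤ p.2 ∧ p.2 ≤ 1}

/-- A continuous cube root of the differences of the points of a simple path. -/
lemma exists_cubeRoot (h : IsSimplePath α α') : ∃ b : ℝ × ℝ → ℂ, ContinuousOn b triangle ∧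
    ∀ p ∈ triangle, b p ^ 3 = α p.1 - α p.2 := by
  -- An open convex, hence simply connected, set containing the triangle without its diagonal.
  -- Clamping the parameters to `[0, 1]` extends `α p.1 - α p.2` to it without zeros, by injectivity
  -- of the path.
  set S : Set (ℝ × ℝ) := {p | p.1 < p.2} ∩ ({p | p.1 < 1} ∩ {p | 0 < p.2}) with hS
  set g : ℝ × ℝ → ℂ := fun p => α (max p.1 0) - α (min p.2 1) with hg
  have hSo : IsOpen S := (isOpen_lt continuous_fst continuous_snd).inter
    ((isOpen_lt continuous_fst continuous_const).inter (isOpen_lt continuous_const continuous_snd))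
  have hSc : Convex ℝ S := by
    rintro ⟨a, b⟩ ⟨h1, h2, h3⟩ ⟨a', b'⟩ ⟨h1', h2', h3'⟩ s t hs ht hst
    simp only [mem_ofPred_eq] at h1 h2 h3 h1' h2' h3'
    have key : ∀ x y z w : ℝ, x < y → z < w → s * x + t * z < s * y + t * w := by
      intro x y z w hxy hzw
      rcases hs.eq_or_lt with rfl | hs
      · have : t = 1 := by linarith
        subst this
        linarith
      · nlinarith [mul_lt_mul_of_pos_left hxy hs, mul_le_mul_of_nonneg_left hzw.le ht]
    refine ⟨key _ _ _ _ h1 h1', ?_, ?_⟩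
    · have := key _ _ _ _ h2 h2'
      simp only [mem_ofPred_eq, Prod.fst_add, Prod.smul_fst, smul_eq_mul]
      linarith
    · have := key _ _ _ _ h3 h3'
      simp only [mem_ofPred_eq, Prod.snd_add, Prod.smul_snd, smul_eq_mul]
      linarith
  have m1 : ∀ p ∈ S, max p.1 0 ∈ Ico (0 : ℝ) 1 := fun p hp =>
    ⟨le_max_right _ _, max_lt hp.2.1 one_pos⟩
  have m2 : ∀ p ∈ S, min p.2 1 ∈ Ioc (0 : ℝ) 1 := fun p hp =>
    ⟨lt_min hp.2.2 one_pos, min_le_right _ _⟩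
  have hgc : ContinuousOn g S :=
    (h.continuousOn.comp (by fun_prop) fun p hp => Ico_subset_Icc_self (m1 p hp)).sub
      (h.continuousOn.comp (by fun_prop) fun p hp => Ioc_subset_Icc_self (m2 p hp))
  obtain ⟨b, hb, hb3⟩ := exists_continuousOn_pow_eq (isSimplyConnected_of_convex hSc
    ⟨(0, 1), by simp [hS]⟩) hSo hgc (by
      rintro ⟨p, hp, e⟩
      have h1 := h.injOn (Ico_subset_Icc_self (m1 p hp)) (Ioc_subset_Icc_self (m2 p hp))
        (sub_eq_zero.1 e)
      have h2 : max p.1 0 < min p.2 1 :=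
        max_lt (lt_min hp.1 hp.2.1) (lt_min hp.2.2 one_pos)
      exact h2.ne h1) (n := 3) three_ne_zero
  have hTS : ∀ p ∈ triangle, p.1 < p.2 → p ∈ S := fun p hp hlt =>
    ⟨hlt, hlt.trans_le hp.2.2, hp.1.trans_lt hlt⟩
  -- On the diagonal the difference is zero, so 0 is the only possible value and continuity there is
  -- automatic.
  set y : ℝ × ℝ → ℂ := fun p => if p.1 < p.2 then b p else 0 with hy
  have hy3 : ∀ p ∈ triangle, y p ^ 3 = α p.1 - α p.2 := by
    intro p hp
    by_cases hlt : p.1 < p.2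
    · simp only [hy, if_pos hlt, hb3, hg]
      rw [max_eq_left hp.1, min_eq_left hp.2.2]
    · simp only [hy, if_neg hlt]
      rw [le_antisymm hp.2.1 (not_lt.1 hlt)]
      ring
  refine ⟨y, fun p hp => ?_, hy3⟩
  by_cases hlt : p.1 < p.2
  · have h1 : ContinuousAt b p := hb.continuousAt (hSo.mem_nhds (hTS p hp hlt))
    refine (h1.congr ?_).continuousWithinAt
    filter_upwards [(isOpen_lt continuous_fst continuous_snd).mem_nhds hlt] with z hz
    exact (if_pos hz).symm
  · refine continuousWithinAt_of_cube hp (g := fun p => α p.1 - α p.2) ?_ hy3 ?_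
    · refine ((h.continuousOn.comp continuous_fst.continuousOn fun q hq =>
        ⟨hq.1, hq.2.1.trans hq.2.2⟩).sub (h.continuousOn.comp continuous_snd.continuousOn
        fun q hq => ⟨hq.1.trans hq.2.1, hq.2.2⟩)) p hp
    · rw [le_antisymm hp.2.1 (not_lt.1 hlt), sub_self]

lemma exists_bound (h : IsSimplePath α α') : ∃ L ≥ 1, (∀ τ ∈ Icc (0 : ℝ) 1, ‖α' τ‖ ≤ L) ∧
    ∀ τ ∈ Icc (0 : ℝ) 1, ∀ σ ∈ Icc (0 : ℝ) 1, ‖α τ - α σ‖ ≤ L * |τ - σ| := by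
  obtain ⟨L, hL⟩ := isCompact_Icc.exists_bound_of_continuousOn h.cont
  have hL' : ∀ τ ∈ Icc (0 : ℝ) 1, ‖α' τ‖ ≤ max L 1 := fun τ hτ => (hL τ hτ).trans (le_max_left _ _)
  exact ⟨max L 1, le_max_right _ _, hL', fun τ hτ σ hσ =>
    (convex_Icc 0 1).norm_image_sub_le_of_norm_hasDerivWithin_le h.hasDeriv hL' hσ hτ⟩

/-- The cube root of `α τ - α 0`. -/
def rootZero (b : ℝ × ℝ → ℂ) (σ : ℝ) : ℂ := -b (0, σ)

section Moment

variable {b : ℝ × ℝ → ℂ} (h : IsSimplePath α α') (hb : ContinuousOn b triangle)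
  (hb3 : ∀ p ∈ triangle, b p ^ 3 = α p.1 - α p.2)

include h hb hb3

omit h hb in
lemma rootZero_pow {σ : ℝ} (hσ : σ ∈ Icc (0 : ℝ) 1) : rootZero b σ ^ 3 = α σ - α 0 := by
  have := hb3 (0, σ) ⟨le_rfl, hσ.1, hσ.2⟩
  simp only at this
  rw [rootZero, neg_pow, this]
  ring

omit h hb3 in
lemma continuousOn_rootZero : ContinuousOn (rootZero b) (Icc 0 1) :=
  (hb.comp (by fun_prop) fun _ hσ => ⟨le_rfl, hσ.1, hσ.2⟩).neg

omit hb in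
lemma rootZero_ne {σ : ℝ} (hσ : σ ∈ Ioc (0 : ℝ) 1) : rootZero b σ ≠ 0 := fun e => by
  have := rootZero_pow hb3 (Ioc_subset_Icc_self hσ)
  rw [e, zero_pow three_ne_zero] at this
  exact h.ne_zero hσ this.symm

omit h hb in
lemma diag_eq_zero {σ : ℝ} (hσ : σ ∈ Icc (0 : ℝ) 1) : b (σ, σ) = 0 :=
  pow_eq_zero_iff three_ne_zero |>.1 (by rw [hb3 (σ, σ) ⟨hσ.1, le_rfl, hσ.2⟩, sub_self])

omit hb in
lemma root_ne {τ σ : ℝ} (h0 : 0 ≤ τ) (hlt : τ < σ) (h1 : σ ≤ 1) : b (τ, σ) ≠ 0 := fun e => by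
  have := hb3 (τ, σ) ⟨h0, hlt.le, h1⟩
  rw [e, zero_pow three_ne_zero] at this
  exact hlt.ne (h.injOn ⟨h0, hlt.le.trans h1⟩ ⟨h0.trans hlt.le, h1⟩ (sub_eq_zero.1 this.symm))

omit h hb3 in
lemma continuousOn_min {σ : ℝ} (hσ : σ ∈ Icc (0 : ℝ) 1) :
    ContinuousOn (fun τ => b (min τ σ, σ)) (Icc 0 1) :=
  hb.comp (by fun_prop) fun _ hτ => ⟨le_min hτ.1 hσ.1, min_le_right _ _, hσ.2⟩

lemma hasDerivAt_root_pow (k : ℕ) {τ σ : ℝ} (h0 : 0 ≤ τ) (hlt : τ < σ) (h1 : σ < 1) :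
    HasDerivAt (fun σ => b (min τ σ, σ) ^ (k + 3)) (-((k + 3) / 3 * b (τ, σ) ^ k * α' σ)) σ := by
  have hσ : σ ∈ Ioo (0 : ℝ) 1 := ⟨h0.trans_lt hlt, h1⟩
  have hn : Ioo τ 1 ∈ 𝓝 σ := Ioo_mem_nhds hlt h1
  have hc : ContinuousAt (fun σ => b (τ, σ)) σ := by
    have : ContinuousOn (fun σ => b (τ, σ)) (Ioo τ 1) :=
      hb.comp (by fun_prop) fun s hs => ⟨h0, hs.1.le, hs.2.le⟩
    exact this.continuousAt hn
  have hd := hasDerivAt_of_cube hc (g := fun σ => α τ - α σ)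
    (by filter_upwards [hn] with s hs using hb3 (τ, s) ⟨h0, hs.1.le, hs.2.le⟩)
    ((h.hasDerivAt hσ).const_sub (α τ)) (h.root_ne hb3 h0 hlt h1.le)
  refine ((hd.pow (k + 3)).congr_of_eventuallyEq ?_).congr_deriv ?_
  · filter_upwards [hn] with s hs
    rw [min_eq_left hs.1.le]
    rfl
  · have := h.root_ne hb3 h0 hlt h1.le
    rw [show k + 3 - 1 = k + 2 from rfl, pow_add _ k 2]
    push_cast
    field_simp

/-- A bound for the increments of the powers of the cube roots. -/
lemma exists_root_lipschitz (k : ℕ) : ∃ K ≥ 0, ∀ τ ∈ Icc (0 : ℝ) 1, ∀ σ ∈ Icc (0 : ℝ) 1,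
    ∀ σ' ∈ Icc (0 : ℝ) 1,
      ‖b (min τ σ, σ) ^ (k + 3) - b (min τ σ', σ') ^ (k + 3)‖ ≤ K * |σ - σ'| := by
  obtain ⟨L, hL1, hL, hLip⟩ := h.exists_bound
  have hbb : ∀ p ∈ triangle, ‖b p‖ ≤ L := by
    intro p hp
    have h1 : ‖b p‖ ^ 3 ≤ L ^ 3 := by
      rw [← norm_pow, hb3 p hp]
      have h2 := hLip p.1 ⟨hp.1, hp.2.1.trans hp.2.2⟩ p.2 ⟨hp.1.trans hp.2.1, hp.2.2⟩
      have h3 : |p.1 - p.2| ≤ 1 := by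
        rw [abs_le]
        constructor <;> linarith [hp.1, hp.2.1, hp.2.2]
      calc ‖α p.1 - α p.2‖ ≤ L * |p.1 - p.2| := h2
        _ ≤ L * 1 := by gcongr
        _ = L ^ 1 := by ring
        _ ≤ L ^ 3 := pow_le_pow_right₀ hL1 (by norm_num)
    exact le_of_pow_le_pow_left₀ three_ne_zero (by linarith) h1
  have hL0 : 0 ≤ L := by linarith
  set K : ℝ := (k + 3) / 3 * L ^ k * L with hK
  have hK0 : 0 ≤ K := by positivity
  have hKL : L ^ k * L ≤ K := by
    have h1 : (1 : ℝ) ≤ (k + 3) / 3 := by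
      rw [le_div_iff₀ (by norm_num)]
      linarith [(Nat.cast_nonneg k : (0 : ℝ) ≤ k)]
    rw [hK, mul_assoc]
    exact le_mul_of_one_le_left (by positivity) h1
  -- Three cases for `τ`: beyond both end points the powers vanish; between them the cube is bounded
  -- by the Lipschitz constant of `α`; below both the derivative is bounded. The exponent `k + 3`
  -- makes the bound uniform up to the diagonal, where the root itself need not be Lipschitz.
  have key : ∀ τ ∈ Icc (0 : ℝ) 1, ∀ σ ∈ Icc (0 : ℝ) 1, ∀ σ' ∈ Icc (0 : ℝ) 1, σ ≤ σ' →
      ‖b (min τ σ', σ') ^ (k + 3) - b (min τ σ, σ) ^ (k + 3)‖ ≤ K * (σ' - σ) := by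
    intro τ hτ σ hσ σ' hσ' hle
    rcases le_or_gt σ' τ with h1 | h1
    · rw [min_eq_right h1, min_eq_right (hle.trans h1), diag_eq_zero hb3 hσ, diag_eq_zero hb3 hσ',
        sub_self, norm_zero]
      exact mul_nonneg hK0 (by linarith)
    rcases le_or_gt σ τ with h2 | h2
    · rw [min_eq_right h2, diag_eq_zero hb3 hσ, zero_pow (by omega), sub_zero, min_eq_left h1.le,
        norm_pow, pow_add]
      have hp : (τ, σ') ∈ triangle := ⟨hτ.1, h1.le, hσ'.2⟩
      have h3 : ‖b (τ, σ')‖ ^ 3 ≤ L * (σ' - τ) := by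
        rw [← norm_pow, hb3 _ hp]
        have := hLip τ hτ σ' hσ'
        rwa [abs_sub_comm, abs_of_pos (by linarith)] at this
      calc ‖b (τ, σ')‖ ^ k * ‖b (τ, σ')‖ ^ 3 ≤ L ^ k * (L * (σ' - τ)) := by
            gcongr
            exact hbb _ hp
        _ = L ^ k * L * (σ' - τ) := by ring
        _ ≤ K * (σ' - σ) := by
            refine mul_le_mul hKL (by linarith) (by linarith) hK0
    · refine norm_image_sub_le_of_norm_deriv_right_le_segment (a := σ) (b := σ')
        (f := fun σ => b (min τ σ, σ) ^ (k + 3))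
        (f' := fun σ => -((k + 3) / 3 * b (τ, σ) ^ k * α' σ)) ?_ ?_ ?_ σ' ⟨hle, le_rfl⟩
      · refine (hb.comp (by fun_prop) fun s hs => ?_).pow _
        exact ⟨le_min hτ.1 (hσ.1.trans hs.1), min_le_right _ _, hs.2.trans hσ'.2⟩
      · intro x hx
        exact (h.hasDerivAt_root_pow hb hb3 k hτ.1 (h2.trans_le hx.1)
          (hx.2.trans_le hσ'.2)).hasDerivWithinAt
      · intro x hx
        have hx1 : x ∈ Icc (0 : ℝ) 1 := ⟨hσ.1.trans hx.1, hx.2.le.trans hσ'.2⟩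
        have e1 : ‖((k : ℂ) + 3) / 3‖ = (k + 3) / 3 := by
          have : ((k : ℂ) + 3) / 3 = (((k : ℝ) + 3) / 3 : ℝ) := by push_cast; ring
          rw [this, norm_real, Real.norm_of_nonneg (by positivity)]
        rw [norm_neg, norm_mul, norm_mul, norm_pow, e1, hK]
        gcongr
        · exact hbb _ ⟨hτ.1, (h2.trans_le hx.1).le, hx1.2⟩
        · exact hL x hx1
  refine ⟨K, hK0, fun τ hτ σ hσ σ' hσ' => ?_⟩
  rcases le_total σ σ' with hle | hle
  · rw [norm_sub_rev, abs_sub_comm, abs_of_nonneg (by linarith)]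
    exact key τ hτ σ hσ σ' hσ' hle
  · rw [abs_of_nonneg (by linarith)]
    exact key τ hτ σ' hσ' σ hσ hle

omit h hb hb3 in
/-- The integrals of `((x - α 0) (x - α σ)) ^ (k / 3 + 1) dx` along the path from `α 0` to `α σ`. -/
noncomputable def moment (α' : ℝ → ℂ) (b : ℝ × ℝ → ℂ) (k : ℕ) (σ : ℝ) : ℂ :=
  ∫ τ in (0 : ℝ)..1, rootZero b τ ^ (k + 3) * b (min τ σ, σ) ^ (k + 3) * α' τ

omit hb3 in
lemma continuousOn_integrand (m n : ℕ) {σ : ℝ} (hσ : σ ∈ Icc (0 : ℝ) 1) :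
    ContinuousOn (fun τ => rootZero b τ ^ m * b (min τ σ, σ) ^ n * α' τ) (Icc 0 1) :=
  (((continuousOn_rootZero hb).pow m).mul ((continuousOn_min hb hσ).pow n)).mul h.cont

lemma exists_integrand_lipschitz (k : ℕ) : ∃ K ≥ 0, ∀ τ ∈ Icc (0 : ℝ) 1, ∀ σ ∈ Icc (0 : ℝ) 1,
    ∀ σ' ∈ Icc (0 : ℝ) 1, ‖rootZero b τ ^ (k + 3) * b (min τ σ, σ) ^ (k + 3) * α' τ -
      rootZero b τ ^ (k + 3) * b (min τ σ', σ') ^ (k + 3) * α' τ‖ ≤ K * |σ - σ'| := by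
  obtain ⟨K, hK0, hK⟩ := h.exists_root_lipschitz hb hb3 k
  obtain ⟨M, hM⟩ := isCompact_Icc.exists_bound_of_continuousOn
    (((continuousOn_rootZero hb).pow (k + 3)).mul h.cont)
  have hM0 : 0 ≤ M := (norm_nonneg _).trans (hM 0 ⟨le_rfl, zero_le_one⟩)
  refine ⟨M * K, by positivity, fun τ hτ σ hσ σ' hσ' => ?_⟩
  have e1 : rootZero b τ ^ (k + 3) * b (min τ σ, σ) ^ (k + 3) * α' τ -
      rootZero b τ ^ (k + 3) * b (min τ σ', σ') ^ (k + 3) * α' τ =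
      (rootZero b τ ^ (k + 3) * α' τ) * (b (min τ σ, σ) ^ (k + 3) - b (min τ σ', σ') ^ (k + 3)) := by
    ring
  rw [e1, norm_mul, mul_assoc]
  exact mul_le_mul (hM τ hτ) (hK τ hτ σ hσ σ' hσ') (norm_nonneg _) hM0

lemma continuousOn_moment (k : ℕ) : ContinuousOn (moment α' b k) (Icc 0 1) := by
  obtain ⟨K, hK0, hK⟩ := h.exists_integrand_lipschitz hb hb3 k
  have hint : ∀ σ ∈ Icc (0 : ℝ) 1, IntervalIntegrable
      (fun τ => rootZero b τ ^ (k + 3) * b (min τ σ, σ) ^ (k + 3) * α' τ)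
      MeasureTheory.volume 0 1 := fun σ hσ => by
    refine ContinuousOn.intervalIntegrable ?_
    rw [uIcc_of_le zero_le_one]
    exact h.continuousOn_integrand hb _ _ hσ
  refine (LipschitzOnWith.of_dist_le_mul (K := ⟨K, hK0⟩) fun σ hσ σ' hσ' => ?_).continuousOn
  rw [dist_eq_norm, moment, moment, ← intervalIntegral.integral_sub (hint σ hσ) (hint σ' hσ')]
  refine (intervalIntegral.norm_integral_le_of_norm_le_const (C := K * |σ - σ'|) fun τ hτ => ?_).trans
    (by simp only [sub_zero, abs_one, mul_one]; exact le_rfl)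
  rw [uIoc_of_le zero_le_one] at hτ
  exact hK τ (Ioc_subset_Icc_self hτ) σ hσ σ' hσ'

/-- Because of `min τ σ` the integrand vanishes for `τ > σ`, so the domain of integration is fixed
and differentiation under the integral sign suffices. Positivity of `k` makes the stated derivative
of the integrand vanish there too, as a positive power of zero. -/
lemma hasDerivAt_moment (k : ℕ) (hk : 0 < k) {σ : ℝ} (hσ : σ ∈ Ioo (0 : ℝ) 1) :
    HasDerivAt (moment α' b k) (∫ τ in (0 : ℝ)..1, -((k + 3) / 3 * α' σ) *
      (rootZero b τ ^ (k + 3) * b (min τ σ, σ) ^ k * α' τ)) σ := by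
  obtain ⟨K, hK0, hK⟩ := h.exists_integrand_lipschitz hb hb3 k
  have hσI := Ioo_subset_Icc_self hσ
  have hn : Icc (0 : ℝ) 1 ∈ 𝓝 σ := Icc_mem_nhds hσ.1 hσ.2
  have hu : uIoc (0 : ℝ) 1 = Ioc 0 1 := uIoc_of_le zero_le_one
  refine (intervalIntegral.hasDerivAt_integral_of_dominated_loc_of_lip (s := Icc (0 : ℝ) 1)
    (F := fun σ τ => rootZero b τ ^ (k + 3) * b (min τ σ, σ) ^ (k + 3) * α' τ)
    (F' := fun τ => -((k + 3) / 3 * α' σ) * (rootZero b τ ^ (k + 3) * b (min τ σ, σ) ^ k * α' τ))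
    (bound := fun _ => K) hn ?_ ?_ ?_ ?_ ?_ ?_).2
  · filter_upwards [hn] with s hs
    rw [hu]
    exact ((h.continuousOn_integrand hb _ _ hs).mono Ioc_subset_Icc_self).aestronglyMeasurable
      measurableSet_Ioc
  · refine ContinuousOn.intervalIntegrable ?_
    rw [uIcc_of_le zero_le_one]
    exact h.continuousOn_integrand hb _ _ hσI
  · rw [hu]
    exact ((continuousOn_const.mul (h.continuousOn_integrand hb _ _ hσI)).mono
      Ioc_subset_Icc_self).aestronglyMeasurable measurableSet_Ioc
  · refine Eventually.of_forall fun τ hτ => LipschitzOnWith.of_dist_le_mul fun s hs s' hs' => ?_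
    rw [hu] at hτ
    have := hK τ (Ioc_subset_Icc_self hτ) s hs s' hs'
    rw [dist_eq_norm, Real.coe_nnabs, abs_of_nonneg hK0]
    exact this
  · exact intervalIntegrable_const
  · have hae : ∀ᵐ τ : ℝ, τ ≠ σ := by simp [MeasureTheory.ae_iff]
    filter_upwards [hae] with τ hτσ hτ
    rw [hu] at hτ
    rcases lt_or_gt_of_ne hτσ with hlt | hlt
    · have h1 := ((h.hasDerivAt_root_pow hb hb3 k hτ.1.le hlt hσ.2).const_mul
        (rootZero b τ ^ (k + 3))).mul_const (α' τ)
      refine h1.congr_deriv ?_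
      rw [min_eq_left hlt.le]
      ring
    · rw [min_eq_right hlt.le, diag_eq_zero hb3 hσI, zero_pow hk.ne', mul_zero, zero_mul, mul_zero]
      refine (hasDerivAt_const σ (0 : ℂ)).congr_of_eventuallyEq ?_
      filter_upwards [Ioo_mem_nhds hσ.1 hlt] with s hs
      rw [min_eq_right hs.2.le, diag_eq_zero hb3 ⟨hs.1.le, hs.2.le.trans hτ.2⟩, zero_pow (by omega),
        mul_zero, zero_mul]

lemma integral_min_eq (m n : ℕ) (hn : 0 < n) {σ : ℝ} (hσ : σ ∈ Icc (0 : ℝ) 1) :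
    ∫ τ in (0 : ℝ)..1, rootZero b τ ^ m * b (min τ σ, σ) ^ n * α' τ =
      ∫ τ in (0 : ℝ)..σ, rootZero b τ ^ m * b (τ, σ) ^ n * α' τ := by
  have hc := h.continuousOn_integrand hb m n hσ
  have h1 : IntervalIntegrable (fun τ => rootZero b τ ^ m * b (min τ σ, σ) ^ n * α' τ)
      MeasureTheory.volume 0 σ := by
    refine ContinuousOn.intervalIntegrable (hc.mono ?_)
    rw [uIcc_of_le hσ.1]
    exact Icc_subset_Icc_right hσ.2
  have h2 : IntervalIntegrable (fun τ => rootZero b τ ^ m * b (min τ σ, σ) ^ n * α' τ)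
      MeasureTheory.volume σ 1 := by
    refine ContinuousOn.intervalIntegrable (hc.mono ?_)
    rw [uIcc_of_le hσ.2]
    exact Icc_subset_Icc_left hσ.1
  rw [← intervalIntegral.integral_add_adjacent_intervals h1 h2]
  have h3 : ∫ τ in σ..1, rootZero b τ ^ m * b (min τ σ, σ) ^ n * α' τ = 0 := by
    rw [intervalIntegral.integral_congr (g := fun _ => (0 : ℂ)), intervalIntegral.integral_zero]
    intro τ hτ
    rw [uIcc_of_le hσ.2] at hτ
    change rootZero b τ ^ m * b (min τ σ, σ) ^ n * α' τ = 0
    rw [min_eq_right hτ.1, diag_eq_zero hb3 hσ, zero_pow hn.ne', mul_zero, zero_mul]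
  rw [h3, add_zero]
  refine intervalIntegral.integral_congr fun τ hτ => ?_
  rw [uIcc_of_le hσ.1] at hτ
  rw [min_eq_left hτ.2]

lemma moment_eq (k : ℕ) {σ : ℝ} (hσ : σ ∈ Icc (0 : ℝ) 1) :
    moment α' b k σ = ∫ τ in (0 : ℝ)..σ, (rootZero b τ * b (τ, σ)) ^ (k + 3) * α' τ := by
  rw [moment, h.integral_min_eq hb hb3 _ _ (by omega) hσ]
  simp only [mul_pow]

/-- The differential equation for the moments. -/
lemma moment_relation (k : ℕ) (hk : 0 < k) (hk3 : k ≤ 3) {σ : ℝ} (hσ : σ ∈ Ioo (0 : ℝ) 1) :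
    (2 * k + 9) / 3 * moment α' b k σ + (k + 3) / 3 * (α σ - α 0) *
      (∫ τ in (0 : ℝ)..1, rootZero b τ ^ (k + 3) * b (min τ σ, σ) ^ k * α' τ) = 0 := by
  have hσI := Ioo_subset_Icc_self hσ
  have hsub : Icc 0 σ ⊆ Icc (0 : ℝ) 1 := Icc_subset_Icc_right hσ.2.le
  rw [h.moment_eq hb hb3 k hσI, h.integral_min_eq hb hb3 _ _ hk hσI]
  have hc0 : ContinuousOn (rootZero b) (Icc 0 σ) := (continuousOn_rootZero hb).mono hsub
  have hc1 : ContinuousOn (fun τ => b (τ, σ)) (Icc 0 σ) :=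
    hb.comp (by fun_prop) fun s hs => ⟨hs.1, hs.2, hσ.2.le⟩
  obtain ⟨e, he⟩ : ∃ e, e + k = 3 := ⟨3 - k, by omega⟩
  have hec : (e : ℂ) = 3 - k := by
    have : ((e + k : ℕ) : ℂ) = (3 : ℕ) := by rw [he]
    push_cast at this
    linear_combination this
  have hz : ∀ τ ∈ Icc 0 σ, b (τ, σ) ^ 3 = α τ - α σ := fun τ hτ => hb3 (τ, σ) ⟨hτ.1, hτ.2, hσ.2.le⟩
  have hx : ∀ τ ∈ Icc 0 σ, rootZero b τ ^ 3 = α τ - α 0 := fun τ hτ => rootZero_pow hb3 (hsub hτ)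
  have hII : ∀ {g : ℝ → ℂ}, ContinuousOn g (Icc 0 σ) →
      IntervalIntegrable g MeasureTheory.volume 0 σ := fun hg => by
    refine ContinuousOn.intervalIntegrable ?_
    rwa [uIcc_of_le hσ.1.le]
  have alg1 : ∀ x z : ℂ, (x ^ 3) ^ 2 * (z ^ 3) ^ (1 + 1) / (x * z) ^ e = (x * z) ^ (k + 3) := by
    intro x z
    by_cases h0 : x * z = 0
    · have hr : (x * z) ^ (k + 3) = 0 := by rw [h0, zero_pow (by omega)]
      rw [hr]
      rcases mul_eq_zero.1 h0 with rfl | rfl <;> norm_num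
    · rw [div_eq_iff (pow_ne_zero _ h0), ← pow_add, ← pow_mul, ← pow_mul, ← mul_pow]
      congr 1
      omega
  have alg2 : ∀ x z : ℂ, (x ^ 3) ^ (2 + 1) * (z ^ 3) ^ 1 / (x * z) ^ e =
      x ^ 3 * (x ^ (k + 3) * z ^ k) := by
    intro x z
    by_cases h0 : x * z = 0
    · rcases mul_eq_zero.1 h0 with rfl | rfl
      · norm_num
      · rw [zero_pow hk.ne']
        norm_num
    · rw [div_eq_iff (pow_ne_zero _ h0), mul_pow]
      have e1 : (x ^ 3) ^ (2 + 1) = x ^ 3 * x ^ (k + 3) * x ^ e := by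
        rw [← pow_mul, ← pow_add, ← pow_add]
        congr 1
        omega
      have e2 : (z ^ 3) ^ 1 = z ^ k * z ^ e := by
        rw [← pow_mul, ← pow_add]
        congr 1
        omega
      rw [e1, e2]
      ring
  have hcα' := h.cont.mono hsub
  have c1 : ∀ τ ∈ Icc 0 σ, (α τ - α 0) ^ 2 * (α τ - α σ) ^ (1 + 1) / (rootZero b τ * b (τ, σ)) ^ e *
      α' τ = (rootZero b τ * b (τ, σ)) ^ (k + 3) * α' τ := fun τ hτ => by
    rw [← hx τ hτ, ← hz τ hτ, alg1]
  have c2 : ∀ τ ∈ Icc 0 σ, (α τ - α 0) ^ (2 + 1) * (α τ - α σ) ^ 1 / (rootZero b τ * b (τ, σ)) ^ e *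
      α' τ = (rootZero b τ * b (τ, σ)) ^ (k + 3) * α' τ +
        (α σ - α 0) * (rootZero b τ ^ (k + 3) * b (τ, σ) ^ k * α' τ) := fun τ hτ => by
    have e1 : α σ - α 0 = rootZero b τ ^ 3 - b (τ, σ) ^ 3 := by
      rw [hx τ hτ, hz τ hτ]
      ring
    rw [e1, ← hx τ hτ, ← hz τ hτ, alg2, mul_pow, pow_add (b (τ, σ)) k 3]
    ring
  have i1 : ContinuousOn (fun τ => (rootZero b τ * b (τ, σ)) ^ (k + 3) * α' τ) (Icc 0 σ) :=
    ((hc0.mul hc1).pow _).mul hcα'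
  have i2 : ContinuousOn (fun τ => rootZero b τ ^ (k + 3) * b (τ, σ) ^ k * α' τ) (Icc 0 σ) :=
    ((hc0.pow _).mul (hc1.pow _)).mul hcα'
  have hII1 : IntervalIntegrable (fun τ => (α τ - α 0) ^ 2 * (α τ - α σ) ^ (1 + 1) /
      (rootZero b τ * b (τ, σ)) ^ e * α' τ) MeasureTheory.volume 0 σ :=
    hII (i1.congr c1)
  have hII2 : IntervalIntegrable (fun τ => (α τ - α 0) ^ (2 + 1) * (α τ - α σ) ^ 1 /
      (rootZero b τ * b (τ, σ)) ^ e * α' τ) MeasureTheory.volume 0 σ :=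
    hII ((i1.add (continuousOn_const.mul i2)).congr c2)
  -- With `e = 3 - k` and exponents 2 and 1 the two integrals are the moment and, after `x - α 0 =
  -- (x - α σ) + (α σ - α 0)`, the moment plus a multiple of the integral in its derivative. The
  -- coefficients `(k + 6)/3` and `(k + 3)/3` add up to `(2k + 9)/3`.
  have main := integral_pow_mul_pow (u := fun τ => rootZero b τ * b (τ, σ)) (P := α 0) (Q := α σ) (e := e) hσ.1.le (by omega)
    (h.continuousOn.mono hsub) (fun τ hτ => h.hasDerivAt ⟨hτ.1, hτ.2.trans hσ.2⟩) (hc0.mul hc1)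
    (fun τ hτ => by rw [mul_pow, hx τ hτ, hz τ hτ])
    (fun τ hτ => mul_ne_zero (h.rootZero_ne hb3 ⟨hτ.1, (hτ.2.trans hσ.2).le⟩)
      (h.root_ne hb3 hτ.1.le hτ.2 hσ.2.le))
    (by rw [rootZero, diag_eq_zero hb3 ⟨le_rfl, zero_le_one⟩, neg_zero, zero_mul])
    (by rw [diag_eq_zero hb3 hσI, mul_zero]) 2 1 hII1 hII2
  have hu0 : uIcc 0 σ = Icc 0 σ := uIcc_of_le hσ.1.le
  rw [intervalIntegral.integral_congr (g := fun τ => (rootZero b τ * b (τ, σ)) ^ (k + 3) * α' τ)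
    (fun τ hτ => c1 τ (hu0 ▸ hτ)), intervalIntegral.integral_congr
    (g := fun τ => (rootZero b τ * b (τ, σ)) ^ (k + 3) * α' τ +
        (α σ - α 0) * (rootZero b τ ^ (k + 3) * b (τ, σ) ^ k * α' τ)) (fun τ hτ => c2 τ (hu0 ▸ hτ)),
    intervalIntegral.integral_add (hII i1) ((hII i2).const_mul _),
    intervalIntegral.integral_const_mul, hec] at main
  push_cast at main
  linear_combination main

/-- The normalized moments are constant. -/
lemma moment_div_eq (k : ℕ) (hk : 0 < k) (hk3 : k ≤ 3) {σ : ℝ} (hσ : σ ∈ Ioc (0 : ℝ) 1) :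
    moment α' b k 1 / rootZero b 1 ^ (2 * k + 9) =
      moment α' b k σ / rootZero b σ ^ (2 * k + 9) := by
  have hsub : Icc σ 1 ⊆ Icc (0 : ℝ) 1 := Icc_subset_Icc_left hσ.1.le
  -- The moment is homogeneous of degree `2 (k + 3)/3 + 1 = (2k + 9)/3` in `α σ - α 0`, whose cube
  -- root is `rootZero b σ`; `moment_relation` says exactly that the quotient has derivative zero.
  refine constant_of_has_deriv_right_zero (a := σ) (b := 1)
    (f := fun σ => moment α' b k σ / rootZero b σ ^ (2 * k + 9)) ?_ ?_ 1 ⟨hσ.2, le_rfl⟩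
  · exact ((h.continuousOn_moment hb hb3 k).mono hsub).div
      (((continuousOn_rootZero hb).mono hsub).pow _) fun s hs =>
        pow_ne_zero _ (h.rootZero_ne hb3 ⟨hσ.1.trans_le hs.1, hs.2⟩)
  · intro s hs
    have hs1 : s ∈ Ioo (0 : ℝ) 1 := ⟨hσ.1.trans_le hs.1, hs.2⟩
    have hsI := Ioo_subset_Icc_self hs1
    have hn : Icc (0 : ℝ) 1 ∈ 𝓝 s := Icc_mem_nhds hs1.1 hs1.2
    have hA0 := h.rootZero_ne hb3 (Ioo_subset_Ioc_self hs1)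
    have dM := h.hasDerivAt_moment hb hb3 k hk hs1
    rw [intervalIntegral.integral_const_mul] at dM
    have dA := hasDerivAt_of_cube ((continuousOn_rootZero hb).continuousAt hn)
      (g := fun σ => α σ - α 0) (by filter_upwards [hn] with x hx using rootZero_pow hb3 hx)
      ((h.hasDerivAt hs1).sub_const _) hA0
    have rel := h.moment_relation hb hb3 k hk hk3 hs1
    have dQ := dM.div (dA.pow (2 * k + 9)) (pow_ne_zero _ hA0)
    refine (dQ.congr_deriv ?_).hasDerivWithinAt
    set J := ∫ τ in (0 : ℝ)..1, rootZero b τ ^ (k + 3) * b (min τ s, s) ^ k * α' τ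
    rw [← rootZero_pow hb3 hsI] at rel
    simp only [Pi.pow_apply]
    rw [div_eq_zero_iff]
    left
    rw [show 2 * k + 9 - 1 = 2 * k + 6 + 2 from rfl, show 2 * k + 9 = 2 * k + 6 + 3 from rfl]
    push_cast
    set A := rootZero b s
    have e1 : A ^ (2 * k + 6 + 2) * (α' s / (3 * A ^ 2)) = A ^ (2 * k + 6) * α' s / 3 := by
      rw [pow_add]
      field_simp
    have e2 : moment α' b k s * ((2 * k + 6 + 3 : ℂ) * A ^ (2 * k + 6 + 2) * (α' s / (3 * A ^ 2))) =
        moment α' b k s * (2 * k + 9) * (A ^ (2 * k + 6) * α' s / 3) := by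
      rw [← e1]
      ring
    rw [e2, pow_add A (2 * k + 6) 3]
    linear_combination (-(A ^ (2 * k + 6) * α' s)) * rel

end Moment

end IsSimplePath

end TripleCover

/-! ### Comparison with the straight segment and the beta integral -/

namespace TripleCover

open Complex

/-- The real cube root of `- x (1 - x)`. -/
noncomputable def segmentRoot (x : ℝ) : ℂ := ((-(x * (1 - x)) ^ (1 / 3 : ℝ) : ℝ) : ℂ)

lemma segmentRoot_pow {x : ℝ} (hx : x ∈ Icc (0 : ℝ) 1) :
    segmentRoot x ^ 3 = ((-(x * (1 - x)) : ℝ) : ℂ) := by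
  have h0 : 0 ≤ x * (1 - x) := mul_nonneg hx.1 (by linarith [hx.2])
  rw [segmentRoot, ← ofReal_pow]
  congr 1
  rw [Odd.neg_pow (by decide), ← Real.rpow_natCast, ← Real.rpow_mul h0]
  norm_num

lemma continuous_segmentRoot : Continuous segmentRoot := by
  unfold segmentRoot
  refine continuous_ofReal.comp ((Continuous.rpow_const (by fun_prop) fun x => Or.inr ?_).neg)
  norm_num

lemma segmentRoot_ne {x : ℝ} (hx : x ∈ Ioo (0 : ℝ) 1) : segmentRoot x ≠ 0 := fun e => by
  have h := segmentRoot_pow (Ioo_subset_Icc_self hx)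
  rw [e, zero_pow three_ne_zero, eq_comm, ofReal_eq_zero] at h
  have : 0 < x * (1 - x) := mul_pos hx.1 (by linarith [hx.2])
  linarith

namespace IsSimplePath

variable {α α' : ℝ → ℂ}

/-- The mean value inequality for `α s - s α' 0`. Both points are arbitrary near 0, as the
differences to `α σ` are needed as well as those to `α 0`. -/
lemma exists_slope_lt (h : IsSimplePath α α') {ε : ℝ} (hε : 0 < ε) : ∃ δ > 0, δ ≤ 1 ∧
    (∀ τ ∈ Icc 0 δ, ‖α' τ - α' 0‖ ≤ ε) ∧ ∀ τ ∈ Icc 0 δ, ∀ τ' ∈ Icc 0 δ, τ ≠ τ' →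
      ‖(α τ - α τ') / ((τ - τ' : ℝ) : ℂ) - α' 0‖ ≤ ε := by
  have h1 := h.cont 0 ⟨le_rfl, zero_le_one⟩
  rw [Metric.continuousWithinAt_iff] at h1
  obtain ⟨δ, hδ, hb⟩ := h1 ε hε
  have hδ' : 0 < min (δ / 2) 1 := lt_min (by linarith) one_pos
  have hI : ∀ τ ∈ Icc 0 (min (δ / 2) 1), ‖α' τ - α' 0‖ ≤ ε := fun τ hτ => by
    have h2 := hb (x := τ) ⟨hτ.1, hτ.2.trans (min_le_right _ _)⟩ (by
      rw [Real.dist_eq, sub_zero, abs_of_nonneg hτ.1]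
      linarith [hτ.2.trans (min_le_left _ _)])
    rw [dist_eq] at h2
    exact h2.le
  refine ⟨min (δ / 2) 1, hδ', min_le_right _ _, hI, fun τ hτ τ' hτ' hne => ?_⟩
  have hsub : Icc 0 (min (δ / 2) 1) ⊆ Icc (0 : ℝ) 1 := Icc_subset_Icc_right (min_le_right _ _)
  have h3 := (convex_Icc 0 (min (δ / 2) 1)).norm_image_sub_le_of_norm_hasDerivWithin_le
    (f := fun s => α s - s • α' 0) (f' := fun s => α' s - α' 0) (fun s hs => by
      have := ((h.hasDeriv s (hsub hs)).mono hsub).sub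
        ((hasDerivWithinAt_id s (Icc 0 (min (δ / 2) 1))).smul_const (α' 0))
      rwa [one_smul] at this) hI hτ' hτ
  have hne' : ((τ - τ' : ℝ) : ℂ) ≠ 0 := by
    rw [Ne, ofReal_eq_zero, sub_eq_zero]
    exact hne
  have e1 : (α τ - α τ') / ((τ - τ' : ℝ) : ℂ) - α' 0 =
      (α τ - τ • α' 0 - (α τ' - τ' • α' 0)) / ((τ - τ' : ℝ) : ℂ) := by
    rw [div_sub' hne']
    congr 1
    simp only [real_smul]
    push_cast
    ring
  rw [e1, norm_div, norm_real, div_le_iff₀ (norm_pos_iff.2 (sub_ne_zero.2 hne))]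
  exact h3

/-- The path rescaled to `(α (σ x) - α 0) / (α σ - α 0)` tends with its derivative to the identity,
uniformly in `x`. Both expressions are quotients of slopes, all of which are close to `α' 0`. -/
lemma exists_ratio_lt (h : IsSimplePath α α') {ε : ℝ} (hε : 0 < ε) : ∃ δ > 0, δ ≤ 1 ∧
    ∀ σ ∈ Ioo 0 δ, ∀ x ∈ Ioo (0 : ℝ) 1,
      ‖(α (σ * x) - α 0) * (α (σ * x) - α σ) / (α σ - α 0) ^ 2 / ((-(x * (1 - x)) : ℝ) : ℂ) - 1‖ < ε ∧
      ‖σ * α' (σ * x) / (α σ - α 0) - 1‖ < ε := by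
  have hD := h.deriv_zero
  have hc : ContinuousAt (fun p : ℂ × ℂ × ℂ × ℂ =>
      (p.2.1 * p.2.2.1 / p.2.2.2 ^ 2, p.1 / p.2.2.2)) (α' 0, α' 0, α' 0, α' 0) := by
    refine ContinuousAt.prodMk ?_ ?_
    · exact ContinuousAt.div (by fun_prop) (by fun_prop) (pow_ne_zero _ hD)
    · exact ContinuousAt.div (by fun_prop) (by fun_prop) hD
  rw [Metric.continuousAt_iff] at hc
  obtain ⟨ε', hε', hb⟩ := hc ε hε
  obtain ⟨δ, hδ, hδ1, s1, s2⟩ := h.exists_slope_lt (half_pos hε')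
  refine ⟨δ, hδ, hδ1, fun σ hσ x hx => ?_⟩
  have m0 : (0 : ℝ) ∈ Icc 0 δ := ⟨le_rfl, hδ.le⟩
  have mσ : σ ∈ Icc 0 δ := Ioo_subset_Icc_self hσ
  have hσx : 0 < σ * x := mul_pos hσ.1 hx.1
  have hσx' : σ * x < σ := mul_lt_of_lt_one_right hσ.1 hx.2
  have mx : σ * x ∈ Icc 0 δ := ⟨hσx.le, hσx'.le.trans hσ.2.le⟩
  have lt : ∀ z, ‖z - α' 0‖ ≤ ε' / 2 → dist z (α' 0) < ε' := fun z hz => by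
    rw [dist_eq]
    linarith
  have key := hb (x := (α' (σ * x), (α (σ * x) - α 0) / ((σ * x - 0 : ℝ) : ℂ),
    (α (σ * x) - α σ) / ((σ * x - σ : ℝ) : ℂ), (α σ - α 0) / ((σ - 0 : ℝ) : ℂ))) (by
      rw [Prod.dist_eq, Prod.dist_eq, Prod.dist_eq]
      exact max_lt (lt _ (s1 _ mx)) (max_lt (lt _ (s2 _ mx _ m0 hσx.ne'))
        (max_lt (lt _ (s2 _ mx _ mσ hσx'.ne)) (lt _ (s2 _ mσ _ m0 hσ.1.ne')))))
  rw [Prod.dist_eq, max_lt_iff, dist_eq, dist_eq] at key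
  have hσ0 : (σ : ℂ) ≠ 0 := ofReal_ne_zero.2 hσ.1.ne'
  have hx0 : (x : ℂ) ≠ 0 := ofReal_ne_zero.2 hx.1.ne'
  have hx1 : (1 - x : ℂ) ≠ 0 := by
    rw [← ofReal_one, ← ofReal_sub, ofReal_ne_zero]
    linarith [hx.2]
  have hασ : α σ - α 0 ≠ 0 := h.ne_zero ⟨hσ.1, hσ.2.le.trans hδ1⟩
  have hx1' : (x - 1 : ℂ) ≠ 0 := by
    rw [← neg_sub]
    exact neg_ne_zero.2 hx1
  constructor
  · refine lt_of_eq_of_lt ?_ key.1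
    rw [← pow_two, div_self (pow_ne_zero 2 hD)]
    congr 2
    push_cast
    rw [sub_zero, sub_zero, show (σ * x - σ : ℂ) = σ * (x - 1) by ring]
    rw [show (-(x * (1 - x)) : ℂ) = x * (x - 1) by ring]
    field_simp
  · refine lt_of_eq_of_lt ?_ key.2
    rw [div_self hD]
    congr 2
    push_cast
    rw [sub_zero]
    field_simp

variable {b : ℝ × ℝ → ℂ} (h : IsSimplePath α α') (hb : ContinuousOn b triangle)
  (hb3 : ∀ p ∈ triangle, b p ^ 3 = α p.1 - α p.2)

include h hb hb3

/-- The substitution `τ = σ x` and homogeneity. It brings the normalised moment into a form with a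
limit for `σ → 0`. -/
lemma moment_div_eq_integral (k : ℕ) {σ : ℝ} (hσ : σ ∈ Ioc (0 : ℝ) 1) :
    moment α' b k σ / rootZero b σ ^ (2 * k + 9) = ∫ x in (0 : ℝ)..1,
      (rootZero b (σ * x) * b (σ * x, σ) / rootZero b σ ^ 2) ^ (k + 3) *
        (σ * α' (σ * x) / (α σ - α 0)) := by
  have hA := h.rootZero_ne hb3 hσ
  have h1 := intervalIntegral.integral_comp_mul_left (a := 0) (b := 1)
    (fun τ => (rootZero b τ * b (τ, σ)) ^ (k + 3) * α' τ) hσ.1.ne'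
  rw [mul_zero, mul_one, ← h.moment_eq hb hb3 k (Ioc_subset_Icc_self hσ), real_smul] at h1
  have hσ0 : (σ : ℂ) ≠ 0 := ofReal_ne_zero.2 hσ.1.ne'
  have h2 : moment α' b k σ = σ * ∫ x in (0 : ℝ)..1,
      (rootZero b (σ * x) * b (σ * x, σ)) ^ (k + 3) * α' (σ * x) := by
    rw [h1]
    push_cast
    rw [mul_inv_cancel_left₀ hσ0]
  rw [h2, ← intervalIntegral.integral_const_mul, ← intervalIntegral.integral_div]
  congr 1
  ext x
  rw [← rootZero_pow hb3 (Ioc_subset_Icc_self hσ), div_pow,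
    show 2 * k + 9 = 2 * (k + 3) + 3 by ring, pow_add (rootZero b σ) _ 3, pow_mul]
  field_simp

/-- The limit form of the normalized moments for `σ → 0`. -/
lemma moment_div_pow (k : ℕ) (hk : 0 < k) (hk3 : k ≤ 3) :
    (moment α' b k 1 / rootZero b 1 ^ (2 * k + 9)) ^ 3 =
      (∫ x in (0 : ℝ)..1, segmentRoot x ^ (k + 3)) ^ 3 := by
  set q : ℝ → ℝ → ℂ := fun σ x => rootZero b (σ * x) * b (σ * x, σ) / rootZero b σ ^ 2 with hq
  set w : ℝ → ℝ → ℂ := fun σ x => σ * α' (σ * x) / (α σ - α 0) with hw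
  set κ : ℝ → ℝ → ℂ := fun σ x => (α (σ * x) - α 0) * (α (σ * x) - α σ) / (α σ - α 0) ^ 2 /
    ((-(x * (1 - x)) : ℝ) : ℂ) with hκ
  set Q := moment α' b k 1 / rootZero b 1 ^ (2 * k + 9) with hQ
  have hmaps : ∀ σ ∈ Ioc (0 : ℝ) 1, ∀ x ∈ Icc (0 : ℝ) 1, 0 ≤ σ * x ∧ σ * x ≤ σ := fun σ hσ x hx =>
    ⟨mul_nonneg hσ.1.le hx.1, mul_le_of_le_one_right hσ.1.le hx.2⟩
  have hqc : ∀ σ ∈ Ioc (0 : ℝ) 1, ContinuousOn (q σ) (Icc 0 1) := fun σ hσ => by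
    refine ContinuousOn.div_const (ContinuousOn.mul ?_ ?_) _
    · exact (continuousOn_rootZero hb).comp (by fun_prop) fun x hx =>
        ⟨(hmaps σ hσ x hx).1, (hmaps σ hσ x hx).2.trans hσ.2⟩
    · exact hb.comp (by fun_prop) fun x hx => ⟨(hmaps σ hσ x hx).1, (hmaps σ hσ x hx).2, hσ.2⟩
  have hwc : ∀ σ ∈ Ioc (0 : ℝ) 1, ContinuousOn (w σ) (Icc 0 1) := fun σ hσ => by
    refine ContinuousOn.div_const (continuousOn_const.mul ?_) _
    exact h.cont.comp (by fun_prop) fun x hx =>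
        ⟨(hmaps σ hσ x hx).1, (hmaps σ hσ x hx).2.trans hσ.2⟩
  have hq3 : ∀ σ ∈ Ioc (0 : ℝ) 1, ∀ x ∈ Ioo (0 : ℝ) 1, q σ x ^ 3 = κ σ x * segmentRoot x ^ 3 := by
    intro σ hσ x hx
    have hxI := Ioo_subset_Icc_self hx
    have m := hmaps σ hσ x hxI
    have e0 : segmentRoot x ^ 3 ≠ 0 := pow_ne_zero _ (segmentRoot_ne hx)
    simp only [hκ]
    rw [← segmentRoot_pow hxI, div_mul_cancel₀ _ e0]
    simp only [hq]
    rw [div_pow, mul_pow, rootZero_pow hb3 ⟨m.1, m.2.trans hσ.2⟩, hb3 (σ * x, σ) ⟨m.1, m.2, hσ.2⟩,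
      ← pow_mul, mul_comm 2 3, pow_mul, rootZero_pow hb3 (Ioc_subset_Icc_self hσ)]
  obtain ⟨δ, hδ, hδ1, hlt⟩ := h.exists_ratio_lt one_pos
  -- The rescaled root `q σ` is `segmentRoot` times the principal root of a function close to 1, up
  -- to a root of unity. The latter is constant in `x` but may vary with `σ`; it is divided out
  -- before passing to the limit and disappears in the final cube.
  have hroot : ∀ σ : ℝ, ∃ η : ℂ, η ^ 3 = 1 ∧ (σ ∈ Ioo 0 δ → ∀ x ∈ Ioo (0 : ℝ) 1,
      q σ x = η * (segmentRoot x * cbrtOneSub (1 - κ σ x))) := by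
    intro σ
    by_cases hσ : σ ∈ Ioo 0 δ
    · have hσ1 : σ ∈ Ioc (0 : ℝ) 1 := ⟨hσ.1, hσ.2.le.trans hδ1⟩
      have hlt' : ∀ x ∈ Ioo (0 : ℝ) 1, ‖1 - κ σ x‖ < 1 := fun x hx => by
        rw [norm_sub_rev]
        exact (hlt σ hσ x hx).1
      have hκc : ContinuousOn (κ σ) (Ioo 0 1) := by
        have : ∀ x ∈ Ioo (0 : ℝ) 1, κ σ x = q σ x ^ 3 / segmentRoot x ^ 3 := fun x hx => by
          rw [hq3 σ hσ1 x hx, mul_div_cancel_right₀ _ (pow_ne_zero _ (segmentRoot_ne hx))]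
        refine ContinuousOn.congr ?_ this
        exact (((hqc σ hσ1).mono Ioo_subset_Icc_self).pow 3).div
          (continuous_segmentRoot.pow 3).continuousOn fun x hx => pow_ne_zero _ (segmentRoot_ne hx)
      have hcc : ContinuousOn (fun x => cbrtOneSub (1 - κ σ x)) (Ioo 0 1) := fun x hx =>
        ContinuousAt.comp_continuousWithinAt (g := cbrtOneSub)
          (differentiableAt_cbrtOneSub (hlt' x hx)).continuousAt ((continuousOn_const.sub hκc) x hx)
      obtain ⟨η, hη, he⟩ := exists_cubeRoot_ratio (isPreconnected_Ioo (a := (0 : ℝ)) (b := 1))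
        ((hqc σ hσ1).mono Ioo_subset_Icc_self)
        (y₂ := fun x => segmentRoot x * cbrtOneSub (1 - κ σ x))
        (continuous_segmentRoot.continuousOn.mul hcc) (fun x hx => by
          rw [mul_pow, cbrtOneSub_pow, hq3 σ hσ1 x hx]
          ring) (fun x hx => by
          refine mul_ne_zero (segmentRoot_ne hx) fun e => ?_
          have h1 := cbrtOneSub_pow (1 - κ σ x)
          rw [e, zero_pow three_ne_zero, sub_sub_cancel] at h1
          have h2 := hlt' x hx
          rw [← h1, sub_zero, norm_one] at h2
          exact lt_irrefl _ h2)
      exact ⟨η, hη, fun _ => he⟩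
    · exact ⟨1, by norm_num, fun h' => absurd h' hσ⟩
  choose η hη hηq using hroot
  have hη0 : ∀ σ, η σ ≠ 0 := fun σ e => by
    have := hη σ
    rw [e, zero_pow three_ne_zero] at this
    exact zero_ne_one this
  have hev : ∀ᶠ σ in 𝓝[>] (0 : ℝ), σ ∈ Ioo 0 δ := Ioo_mem_nhdsGT hδ
  have hlim : Tendsto (fun σ => ∫ x in (0 : ℝ)..1, ((η σ)⁻¹ * q σ x) ^ (k + 3) * w σ x) (𝓝[>] 0)
      (𝓝 (∫ x in (0 : ℝ)..1, segmentRoot x ^ (k + 3))) := by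
    refine intervalIntegral.tendsto_integral_filter_of_dominated_convergence
      (fun _ => 2 ^ (k + 3) * 2) ?_ ?_ intervalIntegrable_const ?_
    · filter_upwards [hev] with σ hσ
      have hσ1 : σ ∈ Ioc (0 : ℝ) 1 := ⟨hσ.1, hσ.2.le.trans hδ1⟩
      rw [uIoc_of_le zero_le_one]
      exact ((((continuousOn_const.mul (hqc σ hσ1)).pow _).mul (hwc σ hσ1)).mono
        Ioc_subset_Icc_self).aestronglyMeasurable measurableSet_Ioc
    · filter_upwards [hev] with σ hσ
      have hσ1 : σ ∈ Ioc (0 : ℝ) 1 := ⟨hσ.1, hσ.2.le.trans hδ1⟩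
      have hae : ∀ᵐ x : ℝ, x ≠ 1 := by simp [MeasureTheory.ae_iff]
      filter_upwards [hae] with x hx1 hx
      rw [uIoc_of_le zero_le_one] at hx
      have hxo : x ∈ Ioo (0 : ℝ) 1 := ⟨hx.1, lt_of_le_of_ne hx.2 hx1⟩
      have l := hlt σ hσ x hxo
      have two : ∀ z : ℂ, ‖z - 1‖ < 1 → ‖z‖ ≤ 2 := fun z hz => by
        have := norm_le_norm_sub_add z 1
        rw [norm_one] at this
        linarith
      have e1 : ‖(η σ)⁻¹ * q σ x‖ ≤ 2 := by
        have e2 : ‖(η σ)⁻¹ * q σ x‖ ^ 3 ≤ 2 ^ 3 := by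
          rw [← norm_pow, mul_pow, inv_pow, hη, inv_one, one_mul, hq3 σ hσ1 x hxo,
            segmentRoot_pow (Ioo_subset_Icc_self hxo), norm_mul, norm_real, norm_neg,
            Real.norm_of_nonneg (mul_nonneg hx.1.le (by linarith [hx.2]))]
          have := two _ l.1
          have h3 : x * (1 - x) ≤ 1 := by nlinarith [hx.1, hx.2]
          calc ‖κ σ x‖ * (x * (1 - x)) ≤ 2 * 1 :=
                mul_le_mul this h3 (mul_nonneg hx.1.le (by linarith [hx.2])) (by norm_num)
            _ ≤ 2 ^ 3 := by norm_num
        exact le_of_pow_le_pow_left₀ three_ne_zero (by norm_num) e2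
      rw [norm_mul, norm_pow]
      exact mul_le_mul (pow_le_pow_left₀ (norm_nonneg _) e1 _) (two _ l.2) (norm_nonneg _)
        (by positivity)
    · have hae : ∀ᵐ x : ℝ, x ≠ 1 := by simp [MeasureTheory.ae_iff]
      filter_upwards [hae] with x hx1 hx
      rw [uIoc_of_le zero_le_one] at hx
      have hxo : x ∈ Ioo (0 : ℝ) 1 := ⟨hx.1, lt_of_le_of_ne hx.2 hx1⟩
      have hκt : Tendsto (fun σ => κ σ x) (𝓝[>] 0) (𝓝 1) := by
        rw [Metric.tendsto_nhds]
        intro ε hε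
        obtain ⟨δ', hδ', -, hb'⟩ := h.exists_ratio_lt hε
        filter_upwards [Ioo_mem_nhdsGT hδ'] with σ hσ
        rw [dist_eq]
        exact (hb' σ hσ x hxo).1
      have hwt : Tendsto (fun σ => w σ x) (𝓝[>] 0) (𝓝 1) := by
        rw [Metric.tendsto_nhds]
        intro ε hε
        obtain ⟨δ', hδ', -, hb'⟩ := h.exists_ratio_lt hε
        filter_upwards [Ioo_mem_nhdsGT hδ'] with σ hσ
        rw [dist_eq]
        exact (hb' σ hσ x hxo).2
      have hct : Tendsto (fun σ => cbrtOneSub (1 - κ σ x)) (𝓝[>] 0) (𝓝 1) := by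
        have h1 : Tendsto (fun σ => 1 - κ σ x) (𝓝[>] 0) (𝓝 0) := by
          simpa using hκt.const_sub 1
        have h2 := (differentiableAt_cbrtOneSub (w := 0) (by simp)).continuousAt.tendsto.comp h1
        rwa [cbrtOneSub_zero] at h2
      have h3 := (((tendsto_const_nhds (x := segmentRoot x)).mul hct).pow (k + 3)).mul hwt
      rw [mul_one, mul_one] at h3
      refine h3.congr' ?_
      filter_upwards [hev] with σ hσ
      rw [hηq σ hσ x hxo, inv_mul_cancel_left₀ (hη0 σ)]
  have hlim3 := hlim.pow 3
  refine tendsto_nhds_unique (tendsto_const_nhds.congr' ?_) hlim3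
  filter_upwards [hev] with σ hσ
  have hσ1 : σ ∈ Ioc (0 : ℝ) 1 := ⟨hσ.1, hσ.2.le.trans hδ1⟩
  have e1 : (∫ x in (0 : ℝ)..1, ((η σ)⁻¹ * q σ x) ^ (k + 3) * w σ x) = (η σ)⁻¹ ^ (k + 3) * Q := by
    rw [hQ, h.moment_div_eq hb hb3 k hk hk3 hσ1, h.moment_div_eq_integral hb hb3 k hσ1,
      ← intervalIntegral.integral_const_mul]
    congr 1
    ext x
    rw [mul_pow, mul_assoc]
  rw [e1, mul_pow, ← pow_mul, mul_comm (k + 3) 3, pow_mul, inv_pow, hη, inv_one, one_pow, one_mul]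

end IsSimplePath

lemma isSimplePath_segment : IsSimplePath (fun τ => (τ : ℂ)) fun _ => 1 where
  hasDeriv _ _ := ofRealCLM.hasDerivWithinAt
  cont := continuousOn_const
  injOn _ _ _ _ h := ofReal_injective h
  deriv_zero := one_ne_zero
  deriv_one := one_ne_zero

/-- The integrals of `dx / (- x (1 - x)) ^ (e / 3)` over the segment from `0` to `1`. -/
noncomputable def segmentInt (e : ℕ) : ℂ := ∫ x in (0 : ℝ)..1, 1 / segmentRoot x ^ e

lemma segmentInt_two : segmentInt 2 = betaIntegral (1 / 3) (1 / 3) := by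
  unfold segmentInt betaIntegral
  refine intervalIntegral.integral_congr_ae (Eventually.of_forall fun x hx => ?_)
  rw [uIoc_of_le zero_le_one] at hx
  have h1 : 0 ≤ 1 - x := by linarith [hx.2]
  have e1 : (1 / 3 - 1 : ℂ) = ((-(2 / 3) : ℝ) : ℂ) := by push_cast; norm_num
  have e2 : (1 - (x : ℂ)) = ((1 - x : ℝ) : ℂ) := by push_cast; ring
  rw [e1, e2, ← ofReal_cpow hx.1.le, ← ofReal_cpow h1, ← ofReal_mul, segmentRoot, ← ofReal_pow,
    ← ofReal_one, ← ofReal_div]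
  congr 1
  rw [← Real.mul_rpow hx.1.le h1, neg_sq, ← Real.rpow_natCast, ← Real.rpow_mul
    (mul_nonneg hx.1.le h1), Real.rpow_neg (mul_nonneg hx.1.le h1), one_div]
  norm_num

namespace IsSimplePath

variable {α α' : ℝ → ℂ}

/-- The integral of `dx / u ^ e` with `u ^ 3 = (x - a) (x - b)` along a simple path from `a` to `b`
agrees with the one along the segment up to a cube root of unity. -/
lemma exists_pathInt_pow (h : IsSimplePath α α') : ∃ u : ℝ → ℂ, ContinuousOn u (Icc 0 1) ∧
    (∀ τ ∈ Icc (0 : ℝ) 1, u τ ^ 3 = (α τ - α 0) * (α τ - α 1)) ∧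
    ∀ e, 0 < e → e < 3 →
      pathInt α α' u e 0 0 ^ 3 * (α 1 - α 0) ^ (2 * e) = (α 1 - α 0) ^ 3 * segmentInt e ^ 3 := by
  obtain ⟨b, hb, hb3⟩ := h.exists_cubeRoot
  set u : ℝ → ℂ := fun τ => rootZero b τ * b (τ, 1) with hu
  have m1 : (1 : ℝ) ∈ Icc (0 : ℝ) 1 := ⟨zero_le_one, le_rfl⟩
  have huc : ContinuousOn u (Icc 0 1) := (continuousOn_rootZero hb).mul
    (hb.comp (by fun_prop) fun τ hτ => ⟨hτ.1, hτ.2, le_rfl⟩)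
  have hu3 : ∀ τ ∈ Icc (0 : ℝ) 1, u τ ^ 3 = (α τ - α 0) * (α τ - α 1) := fun τ hτ => by
    simp only [hu]
    rw [mul_pow, rootZero_pow hb3 hτ, hb3 (τ, 1) ⟨hτ.1, hτ.2, le_rfl⟩]
  have alg : ∀ (e k : ℕ), e + k = 3 → 0 < e → ∀ z : ℂ, (z ^ 3) ^ 2 / z ^ e = z ^ (k + 3) := by
    intro e k hek he z
    by_cases h0 : z = 0
    · rw [h0]
      simp
    · rw [div_eq_iff (pow_ne_zero _ h0), ← pow_mul, ← pow_add]
      congr 1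
      omega
  refine ⟨u, huc, hu3, fun e he0 he => ?_⟩
  obtain ⟨k, hek⟩ : ∃ k, e + k = 3 := ⟨3 - e, by omega⟩
  -- Since `k = 3 - e`, the integrand `(u ^ 3) ^ 2 / u ^ e` is `u ^ (k + 3)`, so the regularised
  -- integral is the moment with end point 1.
  have e1 : pathInt α α' u e 2 2 = moment α' b k 1 := by
    rw [h.moment_eq hb hb3 k m1]
    refine intervalIntegral.integral_congr fun τ hτ => ?_
    rw [uIcc_of_le zero_le_one] at hτ
    rw [← mul_pow, ← hu3 τ hτ, alg e k hek he0]
  have seg3 : ∀ τ ∈ Icc (0 : ℝ) 1, segmentRoot τ ^ 3 =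
      ((τ : ℂ) - ((0 : ℝ) : ℂ)) * (τ - ((1 : ℝ) : ℂ)) := fun τ hτ => by
    rw [segmentRoot_pow hτ]
    push_cast
    ring
  have e2 : pathInt (fun τ => (τ : ℂ)) (fun _ => 1) segmentRoot e 2 2 =
      ∫ x in (0 : ℝ)..1, segmentRoot x ^ (k + 3) := by
    refine intervalIntegral.integral_congr fun τ hτ => ?_
    rw [uIcc_of_le zero_le_one] at hτ
    beta_reduce
    rw [← mul_pow, ← seg3 τ hτ, alg e k hek he0, mul_one]
  have e3 : pathInt (fun τ => (τ : ℂ)) (fun _ => 1) segmentRoot e 0 0 = segmentInt e := by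
    unfold pathInt segmentInt
    simp
  have r1 := h.pathInt_two_two he huc hu3
  have r2 := isSimplePath_segment.pathInt_two_two he continuous_segmentRoot.continuousOn seg3
  rw [e1] at r1
  rw [e2, e3] at r2
  have hA : rootZero b 1 ≠ 0 := h.rootZero_ne hb3 ⟨one_pos, le_rfl⟩
  have r3 := h.moment_div_pow hb hb3 k (by omega) (by omega)
  have hA3 := rootZero_pow hb3 m1
  have hd : α 1 - α 0 ≠ 0 := h.ne_zero ⟨one_pos, le_rfl⟩
  rw [div_pow, div_eq_iff (pow_ne_zero _ (pow_ne_zero _ hA)), ← pow_mul, mul_comm (2 * k + 9) 3,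
    pow_mul, hA3] at r3
  set d := α 1 - α 0
  set P := pathInt α α' u e 0 0
  set M := moment α' b k 1
  set β := ∫ x in (0 : ℝ)..1, segmentRoot x ^ (k + 3)
  set S := segmentInt e
  have hc : (2 - e / 3 : ℂ) ^ 2 * (1 - e / 3) ≠ 0 := by
    have hne : ∀ m : ℕ, m ≠ e → (m : ℂ) - e ≠ 0 := fun m hm h0 =>
      hm (by exact_mod_cast sub_eq_zero.1 h0)
    refine mul_ne_zero (pow_ne_zero _ fun h0 => hne 6 (by omega) ?_) fun h0 => hne 3 (by omega) ?_
    · push_cast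
      linear_combination 3 * h0
    · push_cast
      linear_combination 3 * h0
  set c' := (2 - e / 3 : ℂ) ^ 2 * (1 - e / 3)
  set c := (3 - 2 * e / 3 : ℂ) * (4 - 2 * e / 3) * (5 - 2 * e / 3) * 2
  have r2' : c * β = c' * S := by
    rw [r2]
    push_cast
    ring
  have key : (c' * (d ^ 4 * P)) ^ 3 = c' ^ 3 * (S ^ 3 * d ^ (2 * k + 9)) := by
    rw [← mul_assoc, ← r1, mul_pow, r3, ← mul_assoc, ← mul_assoc, ← mul_pow, ← mul_pow, r2']
  rw [mul_pow] at key
  have key2 := mul_left_cancel₀ (pow_ne_zero 3 hc) key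
  -- The twelfth power stems from the cube of the `(α 1 - α 0) ^ 4` in `pathInt_two_two`; the
  -- exponents balance because `2k + 9 + 2e = 15`.
  refine mul_left_cancel₀ (pow_ne_zero 12 hd) ?_
  calc d ^ 12 * (P ^ 3 * d ^ (2 * e)) = (d ^ 4 * P) ^ 3 * d ^ (2 * e) := by ring
    _ = S ^ 3 * d ^ (2 * k + 9 + 2 * e) := by rw [key2]; ring
    _ = S ^ 3 * d ^ (12 + 3) := by congr 2; omega
    _ = _ := by ring

end IsSimplePath

end TripleCover

namespace TripleCover

open Complex

/-! ### Primitives near simple branch points and along the edges -/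

lemma SideValue.norm_sub_le {Γ : Set ℂ} {Y F : ℂ → ℂ} {x v w L : ℂ} {N : Set ℂ} {ε : ℝ}
    (h : SideValue Γ Y F x v w) (hN : N ∈ 𝓝 x) (hF : ∀ z ∈ N, z ∉ Γ → ‖F z - L‖ ≤ ε) :
    ‖v - L‖ ≤ ε := by
  obtain ⟨z, hz, hzx, t1, -⟩ := h
  refine le_of_tendsto (t1.sub_const L).norm ?_
  filter_upwards [hzx.eventually hN] with n hn using hF _ hn (hz n)

lemma exists_open_norm_sub_le {Γ : Set ℂ} {F : ℂ → ℂ} {b L : ℂ} (hL : Tendsto F (𝓝[Γᶜ] b) (𝓝 L))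
    {ε : ℝ} (hε : 0 < ε) : ∃ N, IsOpen N ∧ b ∈ N ∧ ∀ z ∈ N, z ∉ Γ → ‖F z - L‖ ≤ ε := by
  have h1 := (Metric.tendsto_nhds.1 hL) ε hε
  rw [eventually_nhdsWithin_iff, eventually_nhds_iff] at h1
  obtain ⟨N, hN, hNo, hbN⟩ := h1
  refine ⟨N, hNo, hbN, fun z hz hzΓ => ?_⟩
  have := hN z hz hzΓ
  rw [dist_eq] at this
  exact this.le

lemma tendsto_of_sideValue {Γ : Set ℂ} {Y F : ℂ → ℂ} {b L : ℂ} (hL : Tendsto F (𝓝[Γᶜ] b) (𝓝 L))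
    {ι : Type*} {l : Filter ι} {x v w : ι → ℂ} (hx : Tendsto x l (𝓝 b))
    (h : ∀ᶠ i in l, SideValue Γ Y F (x i) (v i) (w i)) : Tendsto v l (𝓝 L) := by
  rw [Metric.tendsto_nhds]
  intro ε hε
  obtain ⟨N, hNo, hbN, hN⟩ := exists_open_norm_sub_le hL (half_pos hε)
  filter_upwards [h, hx.eventually (hNo.mem_nhds hbN)] with i hi hiN
  rw [dist_eq]
  linarith [hi.norm_sub_le (hNo.mem_nhds hiN) hN]

/-- At crossings close to the tip both boundary values of `F` are close to `L`, so a jump that does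
not depend on the point can be computed in the limit at the tip. -/
lemma eq_of_frequently_cross {Γ : Set ℂ} {Y F : ℂ → ℂ} {e : ℕ} {θ θ' b L D : ℂ}
    (hL : Tendsto F (𝓝[Γᶜ] b) (𝓝 L)) (hθ : θ ^ 3 = 1) (hθ' : θ' ^ 3 = 1)
    (h : ∃ᶠ x in 𝓝 b, Cross Γ Y F e θ θ' x D) : D = L / θ ^ e - L / θ' ^ e := by
  refine eq_of_forall_dist_le fun ε hε => ?_
  obtain ⟨N, hNo, hbN, hN⟩ := exists_open_norm_sub_le hL (half_pos hε)
  obtain ⟨x, ⟨z, z', hz, hz', hzx, hzx', -, t⟩, hxN⟩ := (h.and_eventually (hNo.mem_nhds hbN)).exists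
  rw [dist_eq]
  refine le_of_tendsto (t.sub_const (L / θ ^ e - L / θ' ^ e)).norm ?_
  filter_upwards [hzx.eventually (hNo.mem_nhds hxN), hzx'.eventually (hNo.mem_nhds hxN)] with n h1 h2
  have e1 : F (z n) / θ ^ e - F (z' n) / θ' ^ e - (L / θ ^ e - L / θ' ^ e) =
      (F (z n) - L) / θ ^ e - (F (z' n) - L) / θ' ^ e := by ring
  rw [e1]
  refine (norm_sub_le _ _).trans ?_
  rw [norm_div, norm_div, norm_pow, norm_pow, norm_cubeRoot hθ, norm_cubeRoot hθ', one_pow, div_one,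
    div_one]
  linarith [hN _ h1 (hz n), hN _ h2 (hz' n)]

namespace BranchData

variable {Γ : Set ℂ} {f R Y F : ℂ → ℂ} {e : ℕ}

/-- The primitive extends continuously to the tip of a slit where `f` has a simple zero. -/
lemma exists_tendsto (h : BranchData Γ f R e Y F) (he : e < 3) {b : ℂ} {g : ℂ → ℂ}
    (hg : Differentiable ℂ g) (hfg : ∀ z, f z = (z - b) * g z) (hgb : g b ≠ 0)
    (hslit : ∃ ρ₀ > 0, ∀ ρ ∈ Ioc 0 ρ₀, IsPreconnected (Metric.ball b ρ \ Γ)) :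
    ∃ L, Tendsto F (𝓝[Γᶜ] b) (𝓝 L) := by
  obtain ⟨ρ₁, hρ₁, hb⟩ := Metric.mem_nhds_iff.1 (hg.continuous.continuousAt.eventually_ne hgb)
  obtain ⟨ρ₀, hρ₀, hpre⟩ := hslit
  obtain ⟨g₃, hg₃, hg3⟩ := exists_cubeRoot_ball hρ₁ hg.differentiableOn (fun z hz => hb hz)
  have hg0 : ∀ z ∈ Metric.ball b ρ₁, g₃ z ≠ 0 := fun z hz h0 =>
    hb hz (by rw [← hg3 z hz, h0]; norm_num)
  set ρ := min ρ₀ ρ₁ with hρ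
  have hρ0 : 0 < ρ := lt_min hρ₀ hρ₁
  have hsub : Metric.ball b ρ ⊆ Metric.ball b ρ₁ := Metric.ball_subset_ball (min_le_right _ _)
  set S := Metric.ball b ρ \ Γ with hS
  have hSo : IsOpen S := Metric.isOpen_ball.sdiff h.isClosed
  -- the local coordinate `u` with `u ^ 3 = z - b`
  set u : ℂ → ℂ := fun z => Y z / g₃ z with hu
  have hu3 : ∀ z ∈ S, u z ^ 3 = z - b := fun z hz => by
    simp only [hu]
    rw [div_pow, h.Y_cube z hz.2, hg3 z (hsub hz.1), hfg, mul_div_cancel_right₀ _ (hb (hsub hz.1))]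
  have huc : ContinuousOn u S := (h.Y_cont.mono fun z hz => hz.2).div
    (hg₃.continuousOn.mono fun z hz => hsub hz.1) fun z hz => hg0 z (hsub hz.1)
  have hu0 : ∀ z ∈ S, u z ≠ 0 := fun z hz => div_ne_zero (h.Y_ne hz.2) (hg0 z (hsub hz.1))
  -- The disc of the coordinate `u` that `u ↦ b + u ^ 3` maps into the disc of radius `ρ`.
  obtain ⟨δ, hδ, hδρ⟩ : ∃ δ > (0 : ℝ), δ ^ 3 = ρ := ⟨ρ ^ (3⁻¹ : ℝ), Real.rpow_pos_of_pos hρ0 _, by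
    rw [← Real.rpow_natCast, ← Real.rpow_mul hρ0.le]; norm_num⟩
  have hball : ∀ w ∈ Metric.ball (0 : ℂ) δ, b + w ^ 3 ∈ Metric.ball b ρ := fun w hw => by
    rw [mem_ball_zero_iff] at hw
    rw [Metric.mem_ball, dist_eq, add_sub_cancel_left, norm_pow, ← hδρ]
    exact pow_lt_pow_left₀ hw (norm_nonneg _) three_ne_zero
  have huδ : ∀ z ∈ S, u z ∈ Metric.ball (0 : ℂ) δ := fun z hz => by
    rw [mem_ball_zero_iff]
    refine lt_of_pow_lt_pow_left₀ 3 hδ.le ?_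
    rw [← norm_pow, hu3 z hz, hδρ, ← dist_eq]
    exact hz.1
  -- In the coordinate `u` one has `dz = 3 u ^ 2 du` and `Y = u g₃`, so the differential becomes
  -- holomorphic at `u = 0` because `e ≤ 2`. Its primitive `Ψ` provides the limit of `F`.
  obtain ⟨Ψ, hΨ⟩ := DifferentiableOn.isExactOn_ball
    (f := fun w => 3 * w ^ (2 - e) * (R (b + w ^ 3) / g₃ (b + w ^ 3) ^ e)) (c := (0 : ℂ)) (r := δ) (by
      refine DifferentiableOn.mul (by fun_prop) (DifferentiableOn.div ?_ (DifferentiableOn.pow ?_ e) ?_)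
      · exact (h.R_diff.comp (by fun_prop)).differentiableOn
      · exact hg₃.comp (by fun_prop) fun w hw => hsub (hball w hw)
      · exact fun w hw => pow_ne_zero _ (hg0 _ (hsub (hball w hw))))
  have hd : ∀ z ∈ S, HasDerivAt (fun z => Ψ (u z)) (R z / Y z ^ e) z := fun z hz => by
    have hn := hSo.mem_nhds hz
    have d1 := hasDerivAt_of_cube (huc.continuousAt hn)
      (by filter_upwards [hn] with w hw using hu3 w hw) ((hasDerivAt_id z).sub_const b) (hu0 z hz)
    have d2 := (hΨ (u z) (huδ z hz)).comp z d1
    refine d2.congr_deriv ?_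
    beta_reduce
    rw [hu3 z hz, add_sub_cancel]
    have hY : Y z = u z * g₃ z := (div_mul_cancel₀ _ (hg0 z (hsub hz.1))).symm
    have hu0' := hu0 z hz
    have hg0' := hg0 z (hsub hz.1)
    have h2 : u z ^ 2 = u z ^ (2 - e) * u z ^ e := by
      rw [← pow_add]
      congr 1
      omega
    rw [hY, mul_pow, h2]
    field_simp
  obtain ⟨C, hC⟩ := eq_of_hasDerivAt_eq (hpre ρ ⟨hρ0, min_le_left _ _⟩) hSo subset_rfl
    (fun z hz => h.F_deriv z hz.2) hd
  have hut : Tendsto u (𝓝[Γᶜ] b) (𝓝 0) := by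
    rw [Metric.tendsto_nhds]
    intro ε hε
    filter_upwards [self_mem_nhdsWithin, nhdsWithin_le_nhds (Metric.ball_mem_nhds b hρ0),
      nhdsWithin_le_nhds (Metric.ball_mem_nhds b (show 0 < ε ^ 3 by positivity))] with z h1 h2 h3
    rw [dist_zero_right]
    refine lt_of_pow_lt_pow_left₀ 3 hε.le ?_
    rw [← norm_pow, hu3 z ⟨h2, h1⟩, ← dist_eq]
    exact h3
  have h4 := ((hΨ 0 (Metric.mem_ball_self hδ)).continuousAt.tendsto.comp hut).add_const C
  refine ⟨_, h4.congr' ?_⟩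
  filter_upwards [self_mem_nhdsWithin, nhdsWithin_le_nhds (Metric.ball_mem_nhds b hρ0)] with z h1 h2
  exact (hC z ⟨h2, h1⟩).symm

/-- The lift of a path to the curve and the integral along it in terms of local data. -/
lemma exists_path_local {α α' W J : ℝ → ℂ} {I : Set ℝ}
    (hI : IsOpen I) (hα : ∀ τ ∈ I, HasDerivAt α (α' τ) τ) (hW : ContinuousOn W I)
    (hW3 : ∀ τ ∈ I, W τ ^ 3 = f (α τ)) (hf : ∀ τ ∈ I, f (α τ) ≠ 0)
    (hJ : ∀ τ ∈ I, HasDerivAt J (R (α τ) / W τ ^ e * α' τ) τ) {τ₀ : ℝ} (hτ₀ : τ₀ ∈ I) {U : Set ℂ}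
    (hU : IsOpen U) (hτU : α τ₀ ∈ U) {y Φ : ℂ → ℂ} (hy : ContinuousOn y U)
    (hy3 : ∀ z ∈ U, y z ^ 3 = f z) (hΦ : ∀ z ∈ U, HasDerivAt Φ (R z / y z ^ e) z) :
    ∃ ε > 0, ∃ κ c : ℂ, κ ^ 3 = 1 ∧ ∀ τ ∈ Metric.ball τ₀ ε, τ ∈ I ∧ α τ ∈ U ∧ W τ = κ * y (α τ) ∧
      J τ = Φ (α τ) / κ ^ e + c := by
  have hev : ∀ᶠ τ in 𝓝 τ₀, τ ∈ I ∧ α τ ∈ U := (hI.eventually_mem hτ₀).and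
    ((hα τ₀ hτ₀).continuousAt.eventually (hU.mem_nhds hτU))
  obtain ⟨ε, hε, hb⟩ := Metric.eventually_nhds_iff_ball.1 hev
  have hy0 : ∀ τ ∈ Metric.ball τ₀ ε, y (α τ) ≠ 0 := fun τ hτ h0 =>
    hf τ (hb τ hτ).1 (by rw [← hy3 _ (hb τ hτ).2, h0]; norm_num)
  obtain ⟨κ, hκ, hWκ⟩ := exists_cubeRoot_ratio (convex_ball τ₀ ε).isPreconnected
    (hW.mono fun τ hτ => (hb τ hτ).1) (y₂ := fun τ => y (α τ))
    (fun τ hτ => ((hy.continuousAt (hU.mem_nhds (hb τ hτ).2)).comp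
      (hα τ (hb τ hτ).1).continuousAt).continuousWithinAt)
    (fun τ hτ => by rw [hW3 τ (hb τ hτ).1, hy3 _ (hb τ hτ).2]) hy0
  refine ⟨ε, hε, κ, J τ₀ - Φ (α τ₀) / κ ^ e, hκ, fun τ hτ =>
    ⟨(hb τ hτ).1, (hb τ hτ).2, hWκ τ hτ, ?_⟩⟩
  have hd : ∀ s ∈ Metric.ball τ₀ ε, HasDerivWithinAt (fun s => J s - Φ (α s) / κ ^ e) 0
      (Metric.ball τ₀ ε) s := fun s hs => by
    have d1 := ((hΦ _ (hb s hs).2).scomp s (hα s (hb s hs).1)).div_const (κ ^ e)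
    have d2 := (hJ s (hb s hs).1).sub d1
    refine (d2.congr_deriv ?_).hasDerivWithinAt
    rw [hWκ s hs, mul_pow, smul_eq_mul]
    have := hy0 s hs
    have := cubeRoot_ne_zero hκ
    field_simp
    ring
  have := (convex_ball τ₀ ε).norm_image_sub_le_of_norm_hasDerivWithin_le (C := 0) hd (by simp)
    (Metric.mem_ball_self hε) hτ
  rw [zero_mul, norm_le_zero_iff, sub_eq_zero] at this
  linear_combination this

/-- Continuation of the values on one side of an edge. -/
lemma sideValue_of_sideValue (h : BranchData Γ f R e Y F) {α α' W J : ℝ → ℂ} {I : Set ℝ}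
    (hI : IsOpen I) (hIp : IsPreconnected I) (hα : ∀ τ ∈ I, HasDerivAt α (α' τ) τ)
    (hW : ContinuousOn W I) (hW3 : ∀ τ ∈ I, W τ ^ 3 = f (α τ)) (hf : ∀ τ ∈ I, f (α τ) ≠ 0)
    (hJ : ∀ τ ∈ I, HasDerivAt J (R (α τ) / W τ ^ e * α' τ) τ) (hΓ : ∀ τ ∈ I, α τ ∈ Γ)
    (ht : ∀ τ ∈ I, TwoSided Γ (α τ)) {η C : ℂ} {τ τ' : ℝ} (hτ : τ ∈ I) (hτ' : τ' ∈ I)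
    (hs : SideValue Γ Y F (α τ) (J τ / η ^ e + C) (η * W τ)) :
    SideValue Γ Y F (α τ') (J τ' / η ^ e + C) (η * W τ') := by
  refine (hIp.induction₂ (fun a b => SideValue Γ Y F (α a) (J a / η ^ e + C) (η * W a) ↔
    SideValue Γ Y F (α b) (J b / η ^ e + C) (η * W b)) ?_ (fun _ _ _ _ _ _ => Iff.trans)
    (fun _ _ _ _ => Iff.symm) hτ hτ').1 hs
  intro s hs
  obtain ⟨U, S, S', y, Φ, η₁, η₁', C₁, C₁', hsU, hl, hy3, hΦ⟩ := h.exists_localSides (ht s hs) (hf s hs)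
  obtain ⟨ε, hε, κ, c, hκ, hloc⟩ := exists_path_local hI hα hW hW3 hf hJ hs hl.isOpen hsU
    hl.y_cont hy3 hΦ
  have hκ0 := cubeRoot_ne_zero hκ
  -- the values on a fixed side
  have aux : ∀ {S S' : Set ℂ} {η₁ η₁' C₁ C₁' : ℂ}, LocalSides Γ Y F e U S S' y Φ η₁ η₁' C₁ C₁' →
      ∀ a ∈ Metric.ball s ε, ∀ b ∈ Metric.ball s ε, η * W a = η₁ * y (α a) →
      J a / η ^ e + C = Φ (α a) / η₁ ^ e + C₁ →
      SideValue Γ Y F (α b) (J b / η ^ e + C) (η * W b) := by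
    intro S S' η₁ η₁' C₁ C₁' hl a ha b hb e1 e2
    obtain ⟨haI, haU, hWa, hJa⟩ := hloc a ha
    obtain ⟨hbI, hbU, hWb, hJb⟩ := hloc b hb
    have e3 : η * κ = η₁ := by
      refine mul_right_cancel₀ (hl.y_ne _ haU) ?_
      rw [← e1, hWa, mul_assoc]
    have hη0 : η ≠ 0 := fun h0 => by
      rw [h0, zero_mul] at e3
      exact cubeRoot_ne_zero hl.cube e3.symm
    have e4 : ∀ z : ℂ, (z / κ ^ e + c) / η ^ e = z / η₁ ^ e + c / η ^ e := fun z => by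
      rw [add_div, div_div, ← mul_pow, mul_comm κ, e3]
    rw [hJa, e4] at e2
    have e5 : c / η ^ e + C = C₁ := by linear_combination e2
    have := hl.sideValue ⟨hbU, hΓ b hbI⟩
    rwa [hWb, ← mul_assoc, e3, hJb, e4, add_assoc, e5]
  have key : ∀ a ∈ Metric.ball s ε, ∀ b ∈ Metric.ball s ε,
      SideValue Γ Y F (α a) (J a / η ^ e + C) (η * W a) →
      SideValue Γ Y F (α b) (J b / η ^ e + C) (η * W b) := by
    intro a ha b hb hsa
    rcases hl.of_sideValue (hloc a ha).2.1 hsa with ⟨e1, e2⟩ | ⟨e1, e2⟩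
    · exact aux hl a ha b hb e1 e2
    · exact aux hl.symm a ha b hb e1 e2
  filter_upwards [nhdsWithin_le_nhds (Metric.ball_mem_nhds s hε)] with b hb
  exact ⟨key s (Metric.mem_ball_self hε) b hb, key b hb s (Metric.mem_ball_self hε)⟩

/-- The difference of the boundary values of `F` at two points joined by a path in `Γ`, if the values
on a side of `Γ` can be continued across an exceptional point `1 / 2`. -/
lemma exists_sub_eq_integral (h : BranchData Γ f R e Y F) {α α' W : ℝ → ℂ}
    (hα : ContinuousOn α (Icc 0 1)) (hα' : ContinuousOn α' (Icc 0 1))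
    (hd : ∀ τ ∈ Ioo (0 : ℝ) 1, HasDerivAt α (α' τ) τ)
    (hW : ContinuousOn W (Icc 0 1)) (hW3 : ∀ τ ∈ Ioo (0 : ℝ) 1, W τ ^ 3 = f (α τ))
    (hf : ∀ τ ∈ Ioo (0 : ℝ) 1, f (α τ) ≠ 0)
    (hint : IntervalIntegrable (fun τ => R (α τ) / W τ ^ e * α' τ) MeasureTheory.volume 0 1)
    (hΓ : ∀ τ ∈ Ioo (0 : ℝ) 1, α τ ∈ Γ)
    (ht : ∀ τ ∈ Ioo (0 : ℝ) 1, τ ≠ 1 / 2 → TwoSided Γ (α τ))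
    (hmid : ∀ ε > 0, ∃ τ₁ ∈ Ioo (1 / 2 - ε) (1 / 2 : ℝ), ∃ τ₂ ∈ Ioo (1 / 2 : ℝ) (1 / 2 + ε), ∃ S,
      IsPreconnected S ∧ S ⊆ Metric.ball (α (1 / 2)) ε \ Γ ∧ α τ₁ ∈ closure S ∧ α τ₂ ∈ closure S)
    {L₀ L₁ : ℂ} (hL₀ : Tendsto F (𝓝[Γᶜ] α 0) (𝓝 L₀)) (hL₁ : Tendsto F (𝓝[Γᶜ] α 1) (𝓝 L₁)) :
    ∃ η : ℂ, η ^ 3 = 1 ∧ L₁ - L₀ = (∫ τ in (0 : ℝ)..1, R (α τ) / W τ ^ e * α' τ) / η ^ e := by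
  set J : ℝ → ℂ := fun τ => ∫ s in (0 : ℝ)..τ, R (α s) / W s ^ e * α' s with hJdef
  have hW0 : ∀ τ ∈ Ioo (0 : ℝ) 1, W τ ≠ 0 := fun τ hτ h0 =>
    hf τ hτ (by rw [← hW3 τ hτ, h0]; norm_num)
  have hic : ContinuousOn (fun τ => R (α τ) / W τ ^ e * α' τ) (Ioo 0 1) :=
    ((h.R_diff.continuous.comp_continuousOn (hα.mono Ioo_subset_Icc_self)).div
      ((hW.mono Ioo_subset_Icc_self).pow e) fun τ hτ => pow_ne_zero _ (hW0 τ hτ)).mul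
      (hα'.mono Ioo_subset_Icc_self)
  have hJ : ∀ τ ∈ Ioo (0 : ℝ) 1, HasDerivAt J (R (α τ) / W τ ^ e * α' τ) τ := fun τ hτ => by
    have hn := Ioo_mem_nhds hτ.1 hτ.2
    refine intervalIntegral.integral_hasDerivAt_right (hint.mono_set ?_)
      (hic.stronglyMeasurableAtFilter isOpen_Ioo τ hτ) (hic.continuousAt hn)
    rw [uIcc_of_le hτ.1.le, uIcc_of_le zero_le_one]
    exact Icc_subset_Icc_right hτ.2.le
  have hJc : ContinuousOn J (Icc 0 1) := by
    have := intervalIntegral.continuousOn_primitive_interval (a := (0 : ℝ)) (b := 1)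
      (f := fun τ => R (α τ) / W τ ^ e * α' τ) (μ := MeasureTheory.volume)
      (by rwa [uIcc_of_le zero_le_one, ← intervalIntegrable_iff_integrableOn_Icc_of_le zero_le_one])
    rwa [uIcc_of_le zero_le_one] at this
  have hhalf : (1 / 2 : ℝ) ∈ Ioo (0 : ℝ) 1 := by constructor <;> norm_num
  obtain ⟨r, hr, y, Φ, hy, hy3, hy0, hΦ⟩ := h.exists_local (hf _ hhalf)
  have hWo := hW.mono Ioo_subset_Icc_self
  obtain ⟨ε, hε, κ, c, hκ, hloc⟩ := exists_path_local isOpen_Ioo hd hWo hW3 hf hJ hhalf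
    Metric.isOpen_ball (Metric.mem_ball_self hr) hy.continuousOn hy3 hΦ
  -- At the midpoint the set `Γ` may branch and need not be two-sided. The connected set `S` beside
  -- `Γ` touches the path before and after it, so the same constants `η` and `C` hold on both
  -- halves.
  obtain ⟨τ₁, hτ₁, τ₂, hτ₂, S, hS, hSsub, hc₁, hc₂⟩ := hmid (min ε r) (lt_min hε hr)
  obtain ⟨η₁, C₁, hη₁, hY₁, hF₁⟩ := h.eqOn_of_isPreconnected Metric.isOpen_ball hy.continuousOn hy3 hΦ
    hS (fun z hz => ⟨Metric.ball_subset_ball (min_le_right _ _) (hSsub hz).1, (hSsub hz).2⟩)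
  have hκ0 := cubeRoot_ne_zero hκ
  -- `η₁` compares `Y` with the local root `y` on `S`, and `κ` compares the lift `W` of the path
  -- with `y`; hence on this side `Y` is `η W`.
  set η := η₁ / κ with hη
  have hηκ : η * κ = η₁ := div_mul_cancel₀ _ hκ0
  have hη3 : η ^ 3 = 1 := by rw [hη, div_pow, hη₁, hκ, div_one]
  set C := C₁ - c / η ^ e with hC
  have hval : ∀ τ ∈ Metric.ball (1 / 2 : ℝ) ε, α τ ∈ closure S →
      SideValue Γ Y F (α τ) (J τ / η ^ e + C) (η * W τ) := by
    intro τ hτ hcl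
    obtain ⟨-, hU, hWτ, hJτ⟩ := hloc τ hτ
    obtain ⟨z, hz, hzx⟩ := mem_closure_iff_seq_limit.1 hcl
    have hn := Metric.isOpen_ball.mem_nhds hU
    refine ⟨z, fun n => (hSsub (hz n)).2, hzx, ?_, ?_⟩
    · have e1 : J τ / η ^ e + C = Φ (α τ) / η₁ ^ e + C₁ := by
        rw [hJτ, hC, add_div, div_div, ← mul_pow, mul_comm κ, hηκ]
        ring
      rw [e1]
      exact ((((hΦ _ hU).continuousAt.tendsto.comp hzx).div_const _).add_const C₁).congr
        fun n => (hF₁ _ (hz n)).symm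
    · rw [hWτ, ← mul_assoc, hηκ]
      exact (((hy.continuousOn.continuousAt hn).tendsto.comp hzx).const_mul η₁).congr
        fun n => (hY₁ _ (hz n)).symm
  have m₁ : τ₁ ∈ Metric.ball (1 / 2 : ℝ) ε := by
    rw [Metric.mem_ball, Real.dist_eq, abs_lt]
    constructor <;> linarith [hτ₁.1, hτ₁.2, min_le_left ε r]
  have m₂ : τ₂ ∈ Metric.ball (1 / 2 : ℝ) ε := by
    rw [Metric.mem_ball, Real.dist_eq, abs_lt]
    constructor <;> linarith [hτ₂.1, hτ₂.2, min_le_left ε r]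
  have sub₁ : Ioo (0 : ℝ) (1 / 2) ⊆ Ioo 0 1 := Ioo_subset_Ioo_right (by norm_num)
  have sub₂ : Ioo (1 / 2 : ℝ) 1 ⊆ Ioo 0 1 := Ioo_subset_Ioo_left (by norm_num)
  have side₁ : ∀ τ ∈ Ioo (0 : ℝ) (1 / 2), SideValue Γ Y F (α τ) (J τ / η ^ e + C) (η * W τ) :=
    fun τ hτ => h.sideValue_of_sideValue isOpen_Ioo isPreconnected_Ioo (fun s hs => hd s (sub₁ hs))
      (hWo.mono sub₁) (fun s hs => hW3 s (sub₁ hs)) (fun s hs => hf s (sub₁ hs))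
      (fun s hs => hJ s (sub₁ hs)) (fun s hs => hΓ s (sub₁ hs))
      (fun s hs => ht s (sub₁ hs) hs.2.ne) ⟨(hloc τ₁ m₁).1.1, hτ₁.2⟩ hτ (hval τ₁ m₁ hc₁)
  have side₂ : ∀ τ ∈ Ioo (1 / 2 : ℝ) 1, SideValue Γ Y F (α τ) (J τ / η ^ e + C) (η * W τ) :=
    fun τ hτ => h.sideValue_of_sideValue isOpen_Ioo isPreconnected_Ioo (fun s hs => hd s (sub₂ hs))
      (hWo.mono sub₂) (fun s hs => hW3 s (sub₂ hs)) (fun s hs => hf s (sub₂ hs))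
      (fun s hs => hJ s (sub₂ hs)) (fun s hs => hΓ s (sub₂ hs))
      (fun s hs => ht s (sub₂ hs) hs.1.ne') ⟨hτ₂.1, (hloc τ₂ m₂).1.2⟩ hτ (hval τ₂ m₂ hc₂)
  have h0 : (0 : ℝ) ∈ Icc (0 : ℝ) 1 := ⟨le_rfl, zero_le_one⟩
  have h1 : (1 : ℝ) ∈ Icc (0 : ℝ) 1 := ⟨zero_le_one, le_rfl⟩
  have g₀ : 𝓝[Ioo 0 (1 / 2)] (0 : ℝ) ≤ 𝓝[Icc 0 1] 0 :=
    nhdsWithin_mono _ (sub₁.trans Ioo_subset_Icc_self)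
  have g₁ : 𝓝[Ioo (1 / 2) 1] (1 : ℝ) ≤ 𝓝[Icc 0 1] 1 :=
    nhdsWithin_mono _ (sub₂.trans Ioo_subset_Icc_self)
  have ne₀ : (𝓝[Ioo 0 (1 / 2)] (0 : ℝ)).NeBot := left_nhdsWithin_Ioo_neBot (by norm_num)
  have ne₁ : (𝓝[Ioo (1 / 2) 1] (1 : ℝ)).NeBot := right_nhdsWithin_Ioo_neBot (by norm_num)
  have lim₀ := tendsto_of_sideValue hL₀ ((hα 0 h0).tendsto.mono_left g₀)
    (eventually_mem_nhdsWithin.mono side₁)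
  have lim₁ := tendsto_of_sideValue hL₁ ((hα 1 h1).tendsto.mono_left g₁)
    (eventually_mem_nhdsWithin.mono side₂)
  have lim₀' := (((hJc 0 h0).tendsto.mono_left g₀).div_const (η ^ e)).add_const C
  have lim₁' := (((hJc 1 h1).tendsto.mono_left g₁).div_const (η ^ e)).add_const C
  have e0 := tendsto_nhds_unique lim₀ lim₀'
  have e1 := tendsto_nhds_unique lim₁ lim₁'
  have hJ0 : J 0 = 0 := intervalIntegral.integral_same
  refine ⟨η, hη3, ?_⟩
  rw [e0, e1, hJ0]
  ring

end BranchData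

end TripleCover

namespace TripleCover

open Complex

/-! ### The embedded tree near a vertex -/

namespace PlaneEmbedding

variable {V : Type*} [Fintype V] {B : MarkedBinaryTree V} (E : PlaneEmbedding B)

lemma eq_of_arc_eq_pos {u v w : V} (h : B.graph.Adj u v) {s : ℝ} (hs : s ∈ Icc (0 : ℝ) 1)
    (e : E.arc u v s = E.pos w) : (s = 0 ∧ w = u) ∨ (s = 1 ∧ w = v) := by
  rcases hs.1.eq_or_lt with rfl | h0
  · exact Or.inl ⟨rfl, E.pos_injective (by rw [← e, E.arc_zero u v h])⟩
  rcases hs.2.eq_or_lt with rfl | h1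
  · exact Or.inr ⟨rfl, E.pos_injective (by rw [← e, E.arc_one h])⟩
  · exact absurd (e ▸ ⟨s, ⟨h0, h1⟩, rfl⟩ : E.pos w ∈ E.openEdge u v) (E.pos_notMem_openEdge h w)

/-- The finitely many edges that do not end at `v` form a closed set not containing `pos v`. -/
lemma exists_ball_support (v : V) : ∃ ρ₀ > 0, ∀ z ∈ E.support, dist z (E.pos v) < ρ₀ →
    ∃ w, B.graph.Adj v w ∧ z ∈ E.arc v w '' Icc 0 1 := by
  set K : Set ℂ := ⋃ d ∈ {d : V × V | B.graph.Adj d.1 d.2 ∧ v ≠ d.1 ∧ v ≠ d.2},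
    E.arc d.1 d.2 '' Icc 0 1 with hK
  have hKc : IsClosed K := (Set.toFinite _).isClosed_biUnion fun d hd =>
    (E.isArc hd.1).isCompact_image.isClosed
  have hvK : E.pos v ∈ Kᶜ := by
    intro h
    obtain ⟨d, ⟨hd, hd1, hd2⟩, s, hs, e⟩ := mem_iUnion₂.1 h
    rcases E.eq_of_arc_eq_pos hd hs e with ⟨-, h1⟩ | ⟨-, h1⟩
    · exact hd1 h1
    · exact hd2 h1
  obtain ⟨ρ₀, hρ₀, hb⟩ := Metric.isOpen_iff.1 hKc.isOpen_compl _ hvK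
  refine ⟨ρ₀, hρ₀, ?_⟩
  rintro z ⟨u, w, huw, hz⟩ hzv
  by_cases h1 : v = u
  · subst h1
    exact ⟨w, huw, hz⟩
  by_cases h2 : v = w
  · subst h2
    exact ⟨u, huw.symm, by rwa [E.arc_image_symm huw]⟩
  · exact absurd (mem_iUnion₂.2 ⟨(u, w), ⟨huw, h1, h2⟩, hz⟩) (hb hzv)

/-- Near a terminal the embedded tree is a slit. -/
lemma exists_isPreconnected_terminal {v : V} (hv : B.IsTerminal v) : ∃ ρ₀ > 0, ∀ ρ ∈ Ioc 0 ρ₀,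
    IsPreconnected (Metric.ball (E.pos v) ρ \ E.support) := by
  obtain ⟨w, hw⟩ := Set.ncard_eq_one.1 hv
  have hvw : B.graph.Adj v w := (hw ▸ mem_singleton w : w ∈ B.graph.neighborSet v)
  obtain ⟨ρ₁, hρ₁, h₁⟩ := E.exists_ball_support v
  obtain ⟨ρ₂, hρ₂, h₂⟩ := (E.isArc hvw).exists_isPreconnected_slit
  rw [E.arc_zero v w hvw] at h₂
  refine ⟨min ρ₁ ρ₂, lt_min hρ₁ hρ₂, fun ρ hρ => ?_⟩
  have e : Metric.ball (E.pos v) ρ \ E.support = Metric.ball (E.pos v) ρ \ E.arc v w '' Icc 0 1 := by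
    ext z
    refine and_congr_right fun hz => not_congr ⟨fun hzs => ?_, fun hzs => E.arc_subset_support hvw hzs⟩
    obtain ⟨w', hw', hz'⟩ := h₁ z hzs (lt_of_lt_of_le hz (hρ.2.trans (min_le_left _ _)))
    have : w' ∈ B.graph.neighborSet v := hw'
    rw [hw] at this
    rwa [mem_singleton_iff.1 this] at hz'
  rw [e]
  exact h₂ ρ ⟨hρ.1, hρ.2.trans (min_le_right _ _)⟩

lemma exists_tendsto_terminal {R Y F : ℂ → ℂ} {e : ℕ} (h : BranchData E.support E.f R e Y F)
    (he : e < 3) {v : V} (hv : B.IsTerminal v) (hw : B.isWhite v = true) :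
    ∃ L, Tendsto F (𝓝[E.supportᶜ] E.pos v) (𝓝 L) := by
  classical
  refine h.exists_tendsto he (g := fun z => ∏ k ∈ B.terminals.erase v, (z - E.pos k) ^ B.a k)
    (by fun_prop) (fun z => ?_) ?_ (E.exists_isPreconnected_terminal hv)
  · have ha : B.a v = 1 := by rw [MarkedBinaryTree.a, if_pos hw]
    rw [f, ← Finset.mul_prod_erase _ _ (MarkedBinaryTree.mem_terminals.2 hv), ha, pow_one]
  · refine Finset.prod_ne_zero_iff.2 fun k hk => pow_ne_zero _ (sub_ne_zero.2 fun e => ?_)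
    exact (Finset.mem_erase.1 hk).1 (E.pos_injective e).symm

/-- The difference of the branches of the primitive at an edge that ends at a terminal. -/
lemma cross_eq_of_terminal {R Y F : ℂ → ℂ} {e : ℕ} (h : BranchData E.support E.f R e Y F)
    {v w : V} (hvw : B.graph.Adj v w) {L θ θ' x D : ℂ}
    (hL : Tendsto F (𝓝[E.supportᶜ] E.pos w) (𝓝 L)) (hθ : θ ^ 3 = 1) (hθ' : θ' ^ 3 = 1)
    (hne : θ ≠ θ') (hx : x ∈ E.openEdge v w) (hc : Cross E.support Y F e θ θ' x D) :
    D = L / θ ^ e - L / θ' ^ e := by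
  refine eq_of_frequently_cross (Y := Y) hL hθ hθ' ?_
  have hall : ∀ x' ∈ E.openEdge v w, Cross E.support Y F e θ θ' x' D := fun x' hx' =>
    h.cross_of_isPreconnected (E.isPreconnected_openEdge hvw) (E.openEdge_subset hvw)
      (fun _ hz => E.twoSided hvw hz) (fun _ hz => E.f_ne_zero_of_mem_openEdge hvw hz) hne hx hx' hc
  have ht : Tendsto (E.arc v w) (𝓝[Ioo 0 1] 1) (𝓝 (E.pos w)) := by
    have := ((E.isArc hvw).continuousOn 1 ⟨zero_le_one, le_rfl⟩).tendsto
    rw [E.arc_one hvw] at this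
    exact this.mono_left (nhdsWithin_mono _ Ioo_subset_Icc_self)
  have : (𝓝[Ioo 0 1] (1 : ℝ)).NeBot := right_nhdsWithin_Ioo_neBot one_pos
  refine ht.frequently (Eventually.frequently ?_)
  filter_upwards [self_mem_nhdsWithin] with s hs using hall _ ⟨s, hs, rfl⟩

/-- At an inner vertex, points on two edges are joined by a circular arc that does not meet the
tree. -/
lemma exists_circle_inner {v w₁ w₂ w₃ : V} (h₁ : B.graph.Adj v w₁) (h₂ : B.graph.Adj v w₂)
    (h₃ : B.graph.Adj v w₃) (h12 : w₁ ≠ w₂) (h13 : w₁ ≠ w₃) (h23 : w₂ ≠ w₃)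
    (hN : ∀ w, B.graph.Adj v w → w = w₁ ∨ w = w₂ ∨ w = w₃) {ε : ℝ} (hε : 0 < ε) :
    ∃ s₁ ∈ Ioo 0 ε, ∃ s₂ ∈ Ioo 0 ε, ∃ S, IsPreconnected S ∧
      S ⊆ Metric.ball (E.pos v) ε \ E.support ∧ E.arc v w₁ s₁ ∈ closure S ∧
      E.arc v w₂ s₂ ∈ closure S := by
  have hδ : 0 < min ε 1 := lt_min hε one_pos
  obtain ⟨ρ₀, hρ₀, h0⟩ := E.exists_ball_support v
  have arcData : ∀ w, B.graph.Adj v w → ∃ r > 0, ∀ ρ ∈ Ioo 0 r, ∃ s ∈ Ioo 0 (min ε 1),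
      dist (E.arc v w s) (E.pos v) = ρ ∧
      ∀ z ∈ E.arc v w '' Icc 0 1, dist z (E.pos v) = ρ → z = E.arc v w s := by
    intro w hw
    obtain ⟨r₁, hr₁, k₁⟩ := (E.isArc hw).exists_circle
    obtain ⟨r₂, hr₂, k₂⟩ := (E.isArc hw).exists_far hδ
    rw [E.arc_zero v w hw] at k₁ k₂
    refine ⟨min r₁ r₂, lt_min hr₁ hr₂, fun ρ hρ => ?_⟩
    obtain ⟨s, hs, hiff⟩ := k₁ ρ ⟨hρ.1, hρ.2.trans_le (min_le_left _ _)⟩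
    have hds := (hiff s (Ioo_subset_Icc_self hs)).2 rfl
    refine ⟨s, ⟨hs.1, ?_⟩, hds, ?_⟩
    · by_contra hcon
      have := k₂ s ⟨not_lt.1 hcon, hs.2.le⟩
      linarith [hρ.2.trans_le (min_le_right _ _)]
    · rintro _ ⟨s', hs', rfl⟩ hd
      rw [(hiff s' hs').1 hd]
  obtain ⟨r₁, hr₁, k₁⟩ := arcData w₁ h₁
  obtain ⟨r₂, hr₂, k₂⟩ := arcData w₂ h₂
  obtain ⟨r₃, hr₃, k₃⟩ := arcData w₃ h₃
  set M := min (min ρ₀ ε) (min r₁ (min r₂ r₃)) with hM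
  have hMpos : 0 < M := lt_min (lt_min hρ₀ hε) (lt_min hr₁ (lt_min hr₂ hr₃))
  set ρ := M / 2 with hρ
  have hρ0 : 0 < ρ := half_pos hMpos
  have hρM : ρ < M := half_lt_self hMpos
  have l0 : ρ < ρ₀ := hρM.trans_le ((min_le_left _ _).trans (min_le_left _ _))
  have lε : ρ < ε := hρM.trans_le ((min_le_left _ _).trans (min_le_right _ _))
  have l1 : ρ < r₁ := hρM.trans_le ((min_le_right _ _).trans (min_le_left _ _))
  have l2 : ρ < r₂ := hρM.trans_le ((min_le_right _ _).trans ((min_le_right _ _).trans (min_le_left _ _)))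
  have l3 : ρ < r₃ :=
    hρM.trans_le ((min_le_right _ _).trans ((min_le_right _ _).trans (min_le_right _ _)))
  obtain ⟨s₁, hs₁, d₁, u₁⟩ := k₁ ρ ⟨hρ0, l1⟩
  obtain ⟨s₂, hs₂, d₂, u₂⟩ := k₂ ρ ⟨hρ0, l2⟩
  obtain ⟨s₃, hs₃, d₃, u₃⟩ := k₃ ρ ⟨hρ0, l3⟩
  have hlt : ∀ {s : ℝ}, s ∈ Ioo 0 (min ε 1) → s ∈ Ioo (0 : ℝ) ε ∧ s ∈ Ioo (0 : ℝ) 1 := fun hs =>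
    ⟨⟨hs.1, hs.2.trans_le (min_le_left _ _)⟩, ⟨hs.1, hs.2.trans_le (min_le_right _ _)⟩⟩
  have hdisj : ∀ {w w' : V} {s s' : ℝ}, B.graph.Adj v w → B.graph.Adj v w' → w ≠ w' →
      s ∈ Ioo (0 : ℝ) 1 → s' ∈ Ioo (0 : ℝ) 1 → E.arc v w s ≠ E.arc v w' s' := by
    intro w w' s s' hw hw' hne hs hs' e
    rcases (E.arc_disjoint v w v w' hw hw' (fun e => hne (Sym2.congr_right.1 e)) s
      (Ioo_subset_Icc_self hs) s' (Ioo_subset_Icc_self hs') e).1 with h | h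
    · exact hs.1.ne' h
    · exact hs.2.ne h
  set x₁ := E.arc v w₁ s₁
  set x₂ := E.arc v w₂ s₂
  set x₃ := E.arc v w₃ s₃
  have n13 : x₁ ≠ x₃ := hdisj h₁ h₃ h13 (hlt hs₁).2 (hlt hs₃).2
  have n23 : x₂ ≠ x₃ := hdisj h₂ h₃ h23 (hlt hs₂).2 (hlt hs₃).2
  have n12 : x₁ ≠ x₂ := hdisj h₁ h₂ h12 (hlt hs₁).2 (hlt hs₂).2
  have hcirc : ∀ z, dist z (E.pos v) = ρ → z ∈ E.support → z = x₁ ∨ z = x₂ ∨ z = x₃ := by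
    intro z hz hzs
    obtain ⟨w, hw, hzw⟩ := h0 z hzs (hz.trans_lt l0)
    rcases hN w hw with rfl | rfl | rfl
    · exact Or.inl (u₁ z hzw hz)
    · exact Or.inr (Or.inl (u₂ z hzw hz))
    · exact Or.inr (Or.inr (u₃ z hzw hz))
  -- The small circle meets the tree in exactly three points. Cut open at the third one, it contains
  -- an arc between the other two whose interior avoids the tree.
  obtain ⟨θ₁, hang, hne₃⟩ := exists_angle hρ0 d₃
  obtain ⟨a, ha, ea⟩ := hang x₁ d₁ n13
  obtain ⟨b, hb, eb⟩ := hang x₂ d₂ n23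
  have hab : a ≠ b := by
    rintro rfl
    exact n12 (ea.trans eb.symm)
  have key : ∀ a ∈ Ioo θ₁ (θ₁ + 2 * Real.pi), ∀ b ∈ Ioo θ₁ (θ₁ + 2 * Real.pi), a < b →
      (x₁ = circlePt (E.pos v) ρ a ∧ x₂ = circlePt (E.pos v) ρ b ∨
        x₁ = circlePt (E.pos v) ρ b ∧ x₂ = circlePt (E.pos v) ρ a) →
      ∃ S, IsPreconnected S ∧ S ⊆ Metric.ball (E.pos v) ε \ E.support ∧ x₁ ∈ closure S ∧
        x₂ ∈ closure S := by
    intro a ha b hb hab hx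
    have hcl : closure (Ioo a b) = Icc a b := closure_Ioo hab.ne
    have hmem : ∀ θ ∈ Icc a b, circlePt (E.pos v) ρ θ ∈ closure (circlePt (E.pos v) ρ '' Ioo a b) :=
      fun θ hθ => image_closure_subset_closure_image (continuous_circlePt _ _)
        ⟨θ, hcl ▸ hθ, rfl⟩
    refine ⟨circlePt (E.pos v) ρ '' Ioo a b, isPreconnected_Ioo.image _
      (continuous_circlePt _ _).continuousOn, ?_, ?_⟩
    · rintro _ ⟨θ, hθ, rfl⟩
      have hd := dist_circlePt (E.pos v) hρ0 θ
      refine ⟨by rw [Metric.mem_ball, hd]; exact lε, fun hs => ?_⟩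
      have n1 := circlePt_ne (c := E.pos v) hρ0 hθ.1 (by linarith [hθ.2, hb.2, ha.1])
      have n2 := circlePt_ne (c := E.pos v) hρ0 hθ.2 (by linarith [hθ.1, hb.2, ha.1])
      rcases hcirc _ hd hs with h | h | h
      · rcases hx with ⟨h1, -⟩ | ⟨h1, -⟩
        · exact n1 (h1.symm.trans h.symm)
        · exact n2 (h.trans h1)
      · rcases hx with ⟨-, h1⟩ | ⟨-, h1⟩
        · exact n2 (h.trans h1)
        · exact n1 (h1.symm.trans h.symm)
      · exact hne₃ θ ⟨ha.1.trans hθ.1, hθ.2.trans hb.2⟩ h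
    · rcases hx with ⟨h1, h2⟩ | ⟨h1, h2⟩
      · rw [h1, h2]
        exact ⟨hmem a ⟨le_rfl, hab.le⟩, hmem b ⟨hab.le, le_rfl⟩⟩
      · rw [h1, h2]
        exact ⟨hmem b ⟨hab.le, le_rfl⟩, hmem a ⟨le_rfl, hab.le⟩⟩
  refine ⟨s₁, (hlt hs₁).1, s₂, (hlt hs₂).1, ?_⟩
  rcases lt_or_gt_of_ne hab with h | h
  · exact key a ha b hb h (Or.inl ⟨ea, eb⟩)
  · exact key b hb a ha h (Or.inr ⟨ea, eb⟩)

/-! ### The path formed by two edges -/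

/-- The path from `u` to `w` along the edges `u — v` and `v — w`, parametrized so that it stops
at `v`. -/
noncomputable def twoEdges (u v w : V) (τ : ℝ) : ℂ :=
  if τ ≤ 1 / 2 then E.arc u v (1 - (1 - 2 * τ) ^ 2) else E.arc v w ((2 * τ - 1) ^ 2)

/-- The derivative of `twoEdges`. -/
noncomputable def twoEdgesDeriv (u v w : V) (τ : ℝ) : ℂ :=
  if τ ≤ 1 / 2 then (4 * (1 - 2 * τ)) • derivWithin (E.arc u v) (Icc 0 1) (1 - (1 - 2 * τ) ^ 2)
  else (4 * (2 * τ - 1)) • derivWithin (E.arc v w) (Icc 0 1) ((2 * τ - 1) ^ 2)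

variable {u v w : V}

lemma twoEdges_zero (h₁ : B.graph.Adj u v) : E.twoEdges u v w 0 = E.pos u := by
  rw [twoEdges, if_pos (by norm_num), ← E.arc_zero u v h₁]
  norm_num

lemma twoEdges_one (h₂ : B.graph.Adj v w) : E.twoEdges u v w 1 = E.pos w := by
  rw [twoEdges, if_neg (by norm_num), ← E.arc_one h₂]
  norm_num

lemma twoEdges_half (h₁ : B.graph.Adj u v) : E.twoEdges u v w (1 / 2) = E.pos v := by
  rw [twoEdges, if_pos le_rfl, ← E.arc_one h₁]
  norm_num

lemma twoEdges_eq_left {τ : ℝ} (hτ : τ ≤ 1 / 2) :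
    E.twoEdges u v w τ = E.arc u v (1 - (1 - 2 * τ) ^ 2) := if_pos hτ

lemma twoEdges_eq_right (h₁ : B.graph.Adj u v) (h₂ : B.graph.Adj v w) {τ : ℝ} (hτ : 1 / 2 ≤ τ) :
    E.twoEdges u v w τ = E.arc v w ((2 * τ - 1) ^ 2) := by
  rcases hτ.eq_or_lt with rfl | h
  · rw [E.twoEdges_half h₁, ← E.arc_zero v w h₂]
    norm_num
  · exact if_neg (not_le.2 h)

lemma left_mem_Icc {τ : ℝ} (hτ : τ ∈ Icc (0 : ℝ) (1 / 2)) : 1 - (1 - 2 * τ) ^ 2 ∈ Icc (0 : ℝ) 1 := by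
  constructor <;> nlinarith [hτ.1, hτ.2]

lemma right_mem_Icc {τ : ℝ} (hτ : τ ∈ Icc (1 / 2 : ℝ) 1) : (2 * τ - 1) ^ 2 ∈ Icc (0 : ℝ) 1 := by
  constructor <;> nlinarith [hτ.1, hτ.2]

lemma left_mem_Ioo {τ : ℝ} (hτ : τ ∈ Ioo (0 : ℝ) (1 / 2)) : 1 - (1 - 2 * τ) ^ 2 ∈ Ioo (0 : ℝ) 1 := by
  constructor <;> nlinarith [hτ.1, hτ.2]

lemma right_mem_Ioo {τ : ℝ} (hτ : τ ∈ Ioo (1 / 2 : ℝ) 1) : (2 * τ - 1) ^ 2 ∈ Ioo (0 : ℝ) 1 := by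
  constructor <;> nlinarith [hτ.1, hτ.2]

lemma twoEdges_mem_left {τ : ℝ} (hτ : τ ∈ Ioo (0 : ℝ) (1 / 2)) :
    E.twoEdges u v w τ ∈ E.openEdge u v :=
  ⟨_, left_mem_Ioo hτ, (E.twoEdges_eq_left hτ.2.le).symm⟩

lemma twoEdges_mem_right (h₁ : B.graph.Adj u v) (h₂ : B.graph.Adj v w) {τ : ℝ}
    (hτ : τ ∈ Ioo (1 / 2 : ℝ) 1) : E.twoEdges u v w τ ∈ E.openEdge v w :=
  ⟨_, right_mem_Ioo hτ, (E.twoEdges_eq_right h₁ h₂ hτ.1.le).symm⟩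

lemma twoEdgesDeriv_eq_right {τ : ℝ} (hτ : 1 / 2 ≤ τ) : E.twoEdgesDeriv u v w τ =
    (4 * (2 * τ - 1)) • derivWithin (E.arc v w) (Icc 0 1) ((2 * τ - 1) ^ 2) := by
  rcases hτ.eq_or_lt with rfl | h
  · rw [twoEdgesDeriv, if_pos le_rfl]
    norm_num
  · exact if_neg (not_le.2 h)

/-- The squares in the parameter make the speed vanish at `v` from both sides, so the corner there
is compatible with `C¹`. At the outer ends the speed is nonzero, as the analysis of the branch
points requires. -/
lemma isSimplePath_twoEdges (h₁ : B.graph.Adj u v) (h₂ : B.graph.Adj v w) (huw : u ≠ w) :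
    IsSimplePath (E.twoEdges u v w) (E.twoEdgesDeriv u v w) := by
  have A₁ := E.isArc h₁
  have A₂ := E.isArc h₂
  have hun : Icc (0 : ℝ) 1 = Icc 0 (1 / 2) ∪ Icc (1 / 2) 1 :=
    (Icc_union_Icc_eq_Icc (by norm_num) (by norm_num)).symm
  have D₁ : ∀ τ ∈ Icc (0 : ℝ) (1 / 2), HasDerivWithinAt (E.twoEdges u v w) (E.twoEdgesDeriv u v w τ)
      (Icc 0 (1 / 2)) τ := by
    intro τ hτ
    have d1 : HasDerivWithinAt (fun τ : ℝ => 1 - (1 - 2 * τ) ^ 2) (4 * (1 - 2 * τ)) (Icc 0 (1 / 2)) τ := by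
      have := (((((hasDerivAt_id τ).const_mul 2).const_sub 1).pow 2).const_sub 1).hasDerivWithinAt
        (s := Icc (0 : ℝ) (1 / 2))
      refine this.congr_deriv ?_
      simp
      ring
    have d2 := (A₁.hasDerivWithinAt (left_mem_Icc hτ)).scomp τ d1 fun _ hs => left_mem_Icc hs
    rw [twoEdgesDeriv, if_pos hτ.2]
    exact d2.congr (fun s hs => E.twoEdges_eq_left hs.2) (E.twoEdges_eq_left hτ.2)
  have D₂ : ∀ τ ∈ Icc (1 / 2 : ℝ) 1, HasDerivWithinAt (E.twoEdges u v w) (E.twoEdgesDeriv u v w τ)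
      (Icc (1 / 2) 1) τ := by
    intro τ hτ
    have d1 : HasDerivWithinAt (fun τ : ℝ => (2 * τ - 1) ^ 2) (4 * (2 * τ - 1)) (Icc (1 / 2) 1) τ := by
      have := ((((hasDerivAt_id τ).const_mul 2).sub_const 1).pow 2).hasDerivWithinAt
        (s := Icc (1 / 2 : ℝ) 1)
      refine this.congr_deriv ?_
      simp
      ring
    have d2 := (A₂.hasDerivWithinAt (right_mem_Icc hτ)).scomp τ d1 fun _ hs => right_mem_Icc hs
    rw [E.twoEdgesDeriv_eq_right hτ.1]
    exact d2.congr (fun s hs => E.twoEdges_eq_right h₁ h₂ hs.1) (E.twoEdges_eq_right h₁ h₂ hτ.1)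
  have m0 : (0 : ℝ) ∈ Icc (0 : ℝ) 1 := ⟨le_rfl, zero_le_one⟩
  have m1 : (1 : ℝ) ∈ Icc (0 : ℝ) 1 := ⟨zero_le_one, le_rfl⟩
  refine ⟨fun τ hτ => ?_, ?_, ?_, ?_, ?_⟩
  · rcases lt_trichotomy τ (1 / 2) with h | h | h
    · refine (D₁ τ ⟨hτ.1, h.le⟩).mono_of_mem_nhdsWithin ?_
      filter_upwards [self_mem_nhdsWithin, nhdsWithin_le_nhds (Iio_mem_nhds h)] with s hs hs'
      exact ⟨hs.1, hs'.le⟩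
    · subst h
      rw [hun]
      exact (D₁ _ ⟨by norm_num, le_rfl⟩).union (D₂ _ ⟨le_rfl, by norm_num⟩)
    · refine (D₂ τ ⟨h.le, hτ.2⟩).mono_of_mem_nhdsWithin ?_
      filter_upwards [self_mem_nhdsWithin, nhdsWithin_le_nhds (Ioi_mem_nhds h)] with s hs hs'
      exact ⟨hs'.le, hs.2⟩
  · rw [hun]
    refine ContinuousOn.union_of_isClosed ?_ ?_ isClosed_Icc isClosed_Icc
    · have : ContinuousOn (fun τ : ℝ => (4 * (1 - 2 * τ)) • derivWithin (E.arc u v) (Icc 0 1)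
          (1 - (1 - 2 * τ) ^ 2)) (Icc 0 (1 / 2)) :=
        ContinuousOn.smul (f := fun τ : ℝ => 4 * (1 - 2 * τ)) (by fun_prop) (A₁.continuousOn_derivWithin.comp
          (f := fun τ : ℝ => 1 - (1 - 2 * τ) ^ 2) (by fun_prop)
          fun _ hs => left_mem_Icc hs)
      exact this.congr fun s hs => if_pos hs.2
    · have : ContinuousOn (fun τ : ℝ => (4 * (2 * τ - 1)) • derivWithin (E.arc v w) (Icc 0 1)
          ((2 * τ - 1) ^ 2)) (Icc (1 / 2) 1) :=
        ContinuousOn.smul (f := fun τ : ℝ => 4 * (2 * τ - 1)) (by fun_prop) (A₂.continuousOn_derivWithin.comp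
          (f := fun τ : ℝ => (2 * τ - 1) ^ 2) (by fun_prop)
          fun _ hs => right_mem_Icc hs)
      exact this.congr fun s hs => E.twoEdgesDeriv_eq_right hs.1
  · have cross : ∀ τ ∈ Icc (0 : ℝ) (1 / 2), ∀ τ' ∈ Ioc (1 / 2 : ℝ) 1,
        E.twoEdges u v w τ ≠ E.twoEdges u v w τ' := by
      intro τ hτ τ' hτ' e
      rw [E.twoEdges_eq_left hτ.2, E.twoEdges_eq_right h₁ h₂ hτ'.1.le] at e
      have hs := left_mem_Icc hτ
      have hs' := right_mem_Icc (Ioc_subset_Icc_self hτ')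
      have hne : s(u, v) ≠ s(v, w) := by
        rw [Sym2.eq_swap]
        exact fun e => huw (Sym2.congr_right.1 e)
      have hd := E.arc_disjoint u v v w h₁ h₂ hne _ hs _ hs' e
      have hs0 : (2 * τ' - 1) ^ 2 = 1 := hd.2.resolve_left (by
        have : 0 < 2 * τ' - 1 := by linarith [hτ'.1]
        positivity)
      rw [hs0, E.arc_one h₂] at e
      rcases E.eq_of_arc_eq_pos h₁ hs e with ⟨-, h⟩ | ⟨-, h⟩
      · exact huw h.symm
      · exact h₂.ne h.symm
    intro τ hτ τ' hτ' e
    rcases le_or_gt τ (1 / 2) with h | h <;> rcases le_or_gt τ' (1 / 2) with h' | h'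
    · rw [E.twoEdges_eq_left h, E.twoEdges_eq_left h'] at e
      have := A₁.injOn (left_mem_Icc ⟨hτ.1, h⟩) (left_mem_Icc ⟨hτ'.1, h'⟩) e
      have h3 : 1 - 2 * τ = 1 - 2 * τ' := by
        refine (pow_left_inj₀ ?_ ?_ two_ne_zero).1 (by linarith) <;> linarith
      linarith
    · exact absurd e (cross τ ⟨hτ.1, h⟩ τ' ⟨h', hτ'.2⟩)
    · exact absurd e.symm (cross τ' ⟨hτ'.1, h'⟩ τ ⟨h, hτ.2⟩)
    · rw [E.twoEdges_eq_right h₁ h₂ h.le, E.twoEdges_eq_right h₁ h₂ h'.le] at e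
      have := A₂.injOn (right_mem_Icc ⟨h.le, hτ.2⟩) (right_mem_Icc ⟨h'.le, hτ'.2⟩) e
      have h3 : 2 * τ - 1 = 2 * τ' - 1 := by
        refine (pow_left_inj₀ ?_ ?_ two_ne_zero).1 this <;> linarith
      linarith
  · rw [twoEdgesDeriv, if_pos (by norm_num)]
    refine smul_ne_zero (by norm_num) (A₁.regular _ ?_)
    norm_num
  · rw [twoEdgesDeriv, if_neg (by norm_num)]
    refine smul_ne_zero (by norm_num) (A₂.regular _ ?_)
    norm_num

/-- The period over `B_p` in terms of an integral along the two edges of the cherry. -/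
theorem IsCycleB.exists_period_eq {E : PlaneEmbedding B} {H : B.Cherry} (hw₁ : B.isWhite H.l₁ = true)
    (hw₂ : B.isWhite H.l₂ = true)
    (hdir : Anticlockwise (E.dir H.p H.l₁) (E.dir H.p H.l₂) (E.dir H.p H.q)) {ζ : ℂ} (hζ : ζ ^ 3 = 1)
    {c : ClosedCurve E.f} (hc : E.IsCycleB ζ H.p c) {R : ℂ → ℂ} (hR : Differentiable ℂ R) {e : ℕ}
    (he : e < 3)
    (hinf : Tendsto (fun z => z * R z / z ^ (e * B.n₁)) (Bornology.cobounded ℂ) (𝓝 0))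
    {φ : ℂ → ℂ → ℂ} (hφ : ∀ x y, y ^ 3 = E.f x → E.f x ≠ 0 → φ x y = R x / y ^ e) {W : ℝ → ℂ}
    (hW : ContinuousOn W (Icc 0 1))
    (hW3 : ∀ τ ∈ Ioo (0 : ℝ) 1, W τ ^ 3 = E.f (E.twoEdges H.l₁ H.p H.l₂ τ))
    (hint : IntervalIntegrable (fun τ => R (E.twoEdges H.l₁ H.p H.l₂ τ) / W τ ^ e *
      E.twoEdgesDeriv H.l₁ H.p H.l₂ τ) MeasureTheory.volume 0 1) :
    ∃ η : ℂ, η ^ 3 = 1 ∧ period φ c = (1 / (omega ^ 2) ^ e - 1) *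
      ((∫ τ in (0 : ℝ)..1, R (E.twoEdges H.l₁ H.p H.l₂ τ) / W τ ^ e *
        E.twoEdgesDeriv H.l₁ H.p H.l₂ τ) / η ^ e) := by
  have h₁ := H.adj₁
  have h₂ := H.adj₂
  obtain ⟨w₁, w₂, Y, a₁, a₂, hord, hY, hcross⟩ := hc.exists_cross
  obtain ⟨rfl, rfl⟩ := MarkedBinaryTree.eq_of_anticlockwise H.inner (E.dir H.p) a₁ a₂ hord h₁ h₂
    (by rwa [H.mark_p])
  obtain ⟨F, hF⟩ := hY.exists_branchData hζ hR hinf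
  obtain ⟨x₂, hx₂⟩ := E.openEdge_nonempty H.p H.l₂
  obtain ⟨x₁, hx₁⟩ := E.openEdge_nonempty H.p H.l₁
  obtain ⟨D₁, D₂, k₁, k₂, hper⟩ := hcross e R F φ hF hφ x₂ hx₂ x₁ hx₁
  obtain ⟨L₁, hL₁⟩ := E.exists_tendsto_terminal hF he H.terminal₁ hw₁
  obtain ⟨L₂, hL₂⟩ := E.exists_tendsto_terminal hF he H.terminal₂ hw₂
  set θ := outerFactor (B.isWhite H.p) with hθ
  have hθ3 : θ ^ 3 = 1 := outerFactor_pow _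
  -- Both crossings are pushed to the terminals at the ends of their edges, so the period becomes
  -- `(1 / θ ^ e - 1) (L₂ - L₁)`.
  have e₁ := E.cross_eq_of_terminal hF h₂ hL₂ hθ3 (one_pow 3) (outerFactor_ne_one _) hx₂ k₁
  have e₂ := E.cross_eq_of_terminal hF h₁ hL₁ (one_pow 3) hθ3 (outerFactor_ne_one _).symm hx₁ k₂
  have hpath := E.isSimplePath_twoEdges h₁.symm h₂ H.ne
  have hmem : ∀ τ ∈ Ioo (0 : ℝ) 1, τ ≠ 1 / 2 →
      E.twoEdges H.l₁ H.p H.l₂ τ ∈ E.openEdge H.p H.l₁ ∨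
        E.twoEdges H.l₁ H.p H.l₂ τ ∈ E.openEdge H.p H.l₂ := by
    intro τ hτ hne
    rcases lt_or_gt_of_ne hne with h | h
    · left
      rw [E.openEdge_symm h₁.symm]
      exact E.twoEdges_mem_left ⟨hτ.1, h⟩
    · exact Or.inr (E.twoEdges_mem_right h₁.symm h₂ ⟨h, hτ.2⟩)
  have hf : ∀ τ ∈ Ioo (0 : ℝ) 1, E.f (E.twoEdges H.l₁ H.p H.l₂ τ) ≠ 0 := fun τ hτ => by
    by_cases h : τ = 1 / 2
    · rw [h, E.twoEdges_half h₁.symm]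
      exact E.f_pos_ne_zero H.inner
    · rcases hmem τ hτ h with h | h
      · exact E.f_ne_zero_of_mem_openEdge h₁ h
      · exact E.f_ne_zero_of_mem_openEdge h₂ h
  have hΓ : ∀ τ ∈ Ioo (0 : ℝ) 1, E.twoEdges H.l₁ H.p H.l₂ τ ∈ E.support := fun τ hτ => by
    by_cases h : τ = 1 / 2
    · rw [h, E.twoEdges_half h₁.symm]
      exact E.pos_mem_support _
    · rcases hmem τ hτ h with h | h
      · exact E.openEdge_subset h₁ h
      · exact E.openEdge_subset h₂ h
  have ht : ∀ τ ∈ Ioo (0 : ℝ) 1, τ ≠ 1 / 2 → TwoSided E.support (E.twoEdges H.l₁ H.p H.l₂ τ) := fun τ hτ hne => by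
    rcases hmem τ hτ hne with h | h
    · exact E.twoSided h₁ h
    · exact E.twoSided h₂ h
  have hmid : ∀ ε > 0, ∃ τ₁ ∈ Ioo (1 / 2 - ε) (1 / 2 : ℝ), ∃ τ₂ ∈ Ioo (1 / 2 : ℝ) (1 / 2 + ε), ∃ S,
      IsPreconnected S ∧ S ⊆ Metric.ball (E.twoEdges H.l₁ H.p H.l₂ (1 / 2)) ε \ E.support ∧
      E.twoEdges H.l₁ H.p H.l₂ τ₁ ∈ closure S ∧ E.twoEdges H.l₁ H.p H.l₂ τ₂ ∈ closure S := fun ε hε => by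
    -- The path parameters belonging to edge parameters `s₁`, `s₂` at `p` are `(1 - √s₁)/2` and `(1
    -- + √s₂)/2`, so `s < ε ^ 2` keeps them within `ε` of `1/2`.
    have hε' : 0 < min (ε ^ 2) (min ε 1) := lt_min (by positivity) (lt_min hε one_pos)
    obtain ⟨s₁, hs₁, s₂, hs₂, S, hS, hSsub, c₁, c₂⟩ := E.exists_circle_inner h₁ h₂ H.adj_q H.ne
      H.ne₁.symm H.ne₂.symm (fun w hw => H.eq_of_adj_p hw) hε'
    have sq : ∀ s ∈ Ioo 0 (min (ε ^ 2) (min ε 1)), √s ∈ Ioo 0 ε ∧ √s < 1 ∧ √s ^ 2 = s := by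
      intro s hs
      refine ⟨⟨Real.sqrt_pos.2 hs.1, ?_⟩, ?_, Real.sq_sqrt hs.1.le⟩
      · rw [Real.sqrt_lt' hε]
        exact hs.2.trans_le (min_le_left _ _)
      · rw [Real.sqrt_lt' one_pos, one_pow]
        exact hs.2.trans_le ((min_le_right _ _).trans (min_le_right _ _))
    obtain ⟨p₁, q₁, r₁⟩ := sq s₁ hs₁
    obtain ⟨p₂, q₂, r₂⟩ := sq s₂ hs₂
    refine ⟨(1 - √s₁) / 2, ⟨by linarith [p₁.1, p₁.2], by linarith [p₁.1]⟩, (1 + √s₂) / 2,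
      ⟨by linarith [p₂.1], by linarith [p₂.1, p₂.2]⟩, S, hS, ?_, ?_, ?_⟩
    · rw [E.twoEdges_half h₁.symm]
      exact hSsub.trans (sdiff_subset_sdiff_left (Metric.ball_subset_ball
        ((min_le_right _ _).trans (min_le_left _ _))))
    · rw [E.twoEdges_eq_left (by linarith [p₁.1])]
      have : 1 - (1 - 2 * ((1 - √s₁) / 2)) ^ 2 = 1 - s₁ := by
        rw [show 1 - 2 * ((1 - √s₁) / 2) = √s₁ by ring, r₁]
      rw [this, ← E.arc_symm H.l₁ H.p h₁.symm s₁ ⟨hs₁.1.le, by nlinarith [p₁.1]⟩]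
      exact c₁
    · rw [E.twoEdges_eq_right h₁.symm h₂ (by linarith [p₂.1])]
      have : (2 * ((1 + √s₂) / 2) - 1) ^ 2 = s₂ := by
        rw [show 2 * ((1 + √s₂) / 2) - 1 = √s₂ by ring, r₂]
      rwa [this]
  obtain ⟨η, hη, hLL⟩ := hF.exists_sub_eq_integral hpath.continuousOn hpath.cont
    (fun τ hτ => hpath.hasDerivAt hτ) hW hW3 hf hint hΓ ht hmid (L₀ := L₁) (L₁ := L₂)
    (by rwa [E.twoEdges_zero h₁.symm]) (by rwa [E.twoEdges_one h₂])
  refine ⟨η, hη, ?_⟩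
  rw [← hLL, hper, e₁, e₂, hθ, MarkedBinaryTree.Cherry.isWhite_p hw₁]
  simp only [outerFactor, one_pow, div_one, Bool.false_eq_true, if_false]
  ring

end PlaneEmbedding

end TripleCover

namespace TripleCover

open Complex

/-! ### The vanishing cycle -/

/-- The coefficients of the Taylor series of `N` at `μ`. -/
noncomputable def taylorCoeff (N : ℂ → ℂ) (μ : ℂ) (n : ℕ) : ℂ :=
  (n.factorial : ℂ)⁻¹ * iteratedDeriv n N μ

lemma hasSum_taylorCoeff {N : ℂ → ℂ} {μ : ℂ} {r : ℝ} (hN : DifferentiableOn ℂ N (Metric.ball μ r))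
    {z : ℂ} (hz : z ∈ Metric.ball μ r) :
    HasSum (fun n => taylorCoeff N μ n * (z - μ) ^ n) (N z) := by
  refine (hasSum_taylorSeries_on_ball hN hz).congr_fun fun n => ?_
  simp only [taylorCoeff, smul_eq_mul]
  ring

lemma summable_taylorCoeff {N : ℂ → ℂ} {μ : ℂ} {r r' : ℝ}
    (hN : DifferentiableOn ℂ N (Metric.ball μ r')) (hr : 0 ≤ r) (hrr : r < r') :
    Summable fun n => ‖taylorCoeff N μ n‖ * r ^ n := by
  have hz : μ + (r : ℂ) ∈ Metric.ball μ r' := by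
    rwa [Metric.mem_ball, dist_eq, add_sub_cancel_left, norm_real, Real.norm_of_nonneg hr]
  have h := (hasSum_taylorCoeff hN hz).summable.norm
  refine h.congr fun n => ?_
  rw [norm_mul, norm_pow, add_sub_cancel_left, norm_real, Real.norm_of_nonneg hr]

lemma taylorCoeff_zero (N : ℂ → ℂ) (μ : ℂ) : taylorCoeff N μ 0 = N μ := by
  simp [taylorCoeff]

namespace IsSimplePath

variable {α α' u : ℝ → ℂ} {e : ℕ} (h : IsSimplePath α α') (he : e < 3)
  (hu : ContinuousOn u (Icc 0 1)) (hu3 : ∀ τ ∈ Icc (0 : ℝ) 1, u τ ^ 3 = (α τ - α 0) * (α τ - α 1))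

include h he hu hu3

/-- Binomial expansion around the starting point and `norm_pathInt_le`. The bound is relative to
`pathInt` and independent of how far the path wanders. -/
lemma norm_integral_pow_le (μ : ℂ) (n : ℕ) :
    ‖∫ τ in (0 : ℝ)..1, (α τ - μ) ^ n / u τ ^ e * α' τ‖ ≤
      (‖α 1 - α 0‖ + ‖α 0 - μ‖) ^ n * ‖pathInt α α' u e 0 0‖ := by
  have e1 : (∫ τ in (0 : ℝ)..1, (α τ - μ) ^ n / u τ ^ e * α' τ) =
      ∑ m ∈ Finset.range (n + 1), (α 0 - μ) ^ (n - m) * n.choose m * pathInt α α' u e m 0 := by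
    unfold pathInt
    simp_rw [← intervalIntegral.integral_const_mul]
    rw [← intervalIntegral.integral_finsetSum fun m _ =>
      (h.intervalIntegrable_pow he hu hu3 m 0).const_mul _]
    congr 1
    ext τ
    rw [show α τ - μ = (α τ - α 0) + (α 0 - μ) by ring, add_pow, Finset.sum_div, Finset.sum_mul]
    refine Finset.sum_congr rfl fun m _ => ?_
    ring
  rw [e1, add_pow, Finset.sum_mul]
  refine (norm_sum_le _ _).trans (Finset.sum_le_sum fun m _ => ?_)
  rw [norm_mul, norm_mul, norm_pow, norm_natCast]
  calc ‖α 0 - μ‖ ^ (n - m) * n.choose m * ‖pathInt α α' u e m 0‖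
      ≤ ‖α 0 - μ‖ ^ (n - m) * n.choose m * (‖α 1 - α 0‖ ^ m * ‖pathInt α α' u e 0 0‖) := by
        gcongr
        exact h.norm_pathInt_le he hu hu3 m
    _ = _ := by ring

/-- The integral of `N / u ^ e` over a path close to `μ` is asymptotically `N μ` times the integral of
`1 / u ^ e`. -/
lemma norm_integral_sub_le {N : ℂ → ℂ} {μ : ℂ} {r r' : ℝ}
    (hN : DifferentiableOn ℂ N (Metric.ball μ r')) (hr : 0 < r) (hrr : r < r')
    (hα : ∀ τ ∈ Icc (0 : ℝ) 1, dist (α τ) μ ≤ r) (hρ : ‖α 1 - α 0‖ + ‖α 0 - μ‖ ≤ r) :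
    ‖(∫ τ in (0 : ℝ)..1, N (α τ) / u τ ^ e * α' τ) - N μ * pathInt α α' u e 0 0‖ ≤
      (‖α 1 - α 0‖ + ‖α 0 - μ‖) / r * (∑' n, ‖taylorCoeff N μ n‖ * r ^ n) *
        ‖pathInt α α' u e 0 0‖ := by
  set c := taylorCoeff N μ
  set ρ := ‖α 1 - α 0‖ + ‖α 0 - μ‖
  have hρ0 : 0 ≤ ρ := by positivity
  have hs := summable_taylorCoeff hN hr.le hrr
  have hbase := h.intervalIntegrable he hu hu3 (g := fun _ => (1 : ℂ)) continuousOn_const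
  have hsum : HasSum (fun n => ∫ τ in (0 : ℝ)..1, c n * ((α τ - μ) ^ n / u τ ^ e * α' τ))
      (∫ τ in (0 : ℝ)..1, N (α τ) / u τ ^ e * α' τ) := by
    -- That the path stays in the disc of radius `r` is used only to exchange sum and integral; the
    -- sizes of the terms are estimated afterwards by `norm_integral_pow_le`.
    refine intervalIntegral.hasSum_integral_of_dominated_convergence
      (fun n τ => ‖c n‖ * r ^ n * ‖1 / u τ ^ e * α' τ‖) (fun n => ?_) (fun n => ?_) ?_ ?_ ?_
    · have := (h.intervalIntegrable he hu hu3 (g := fun τ => (α τ - μ) ^ n)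
        ((h.continuousOn.sub continuousOn_const).pow n)).const_mul (c n)
      rw [uIoc_of_le zero_le_one]
      exact ((intervalIntegrable_iff_integrableOn_Ioc_of_le zero_le_one).1 this).aestronglyMeasurable
    · refine Eventually.of_forall fun τ hτ => ?_
      rw [uIoc_of_le zero_le_one] at hτ
      have h1 := hα τ (Ioc_subset_Icc_self hτ)
      rw [dist_eq] at h1
      rw [show (α τ - μ) ^ n / u τ ^ e * α' τ = (α τ - μ) ^ n * (1 / u τ ^ e * α' τ) by ring, norm_mul,
        norm_mul, norm_pow, mul_assoc]
      gcongr
    · exact Eventually.of_forall fun τ _ => hs.mul_right _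
    · simp_rw [tsum_mul_right]
      exact hbase.norm.const_mul _
    · refine Eventually.of_forall fun τ hτ => ?_
      rw [uIoc_of_le zero_le_one] at hτ
      have h1 := hasSum_taylorCoeff hN (Metric.mem_ball.2
        ((hα τ (Ioc_subset_Icc_self hτ)).trans_lt hrr))
      have h2 := h1.mul_right ((u τ ^ e)⁻¹ * α' τ)
      rw [← mul_assoc, ← div_eq_mul_inv] at h2
      refine h2.congr_fun fun n => ?_
      simp only [c]
      ring
  simp_rw [intervalIntegral.integral_const_mul] at hsum
  have hsum1 := (hasSum_nat_add_iff' 1).2 hsum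
  have e0 : (∑ n ∈ Finset.range 1, c n * ∫ τ in (0 : ℝ)..1, (α τ - μ) ^ n / u τ ^ e * α' τ) =
      N μ * pathInt α α' u e 0 0 := by
    simp only [Finset.range_one, Finset.sum_singleton, c, taylorCoeff_zero, pathInt, pow_zero, mul_one]
  rw [e0] at hsum1
  rw [← hsum1.tsum_eq]
  set P := pathInt α α' u e 0 0
  have hs1 : Summable fun n => ‖c (n + 1)‖ * r ^ (n + 1) := (summable_nat_add_iff 1).2 hs
  have hterm : ∀ n, ‖c (n + 1) * ∫ τ in (0 : ℝ)..1, (α τ - μ) ^ (n + 1) / u τ ^ e * α' τ‖ ≤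
      ρ / r * ‖P‖ * (‖c (n + 1)‖ * r ^ (n + 1)) := by
    intro n
    rw [norm_mul]
    have h1 := h.norm_integral_pow_le he hu hu3 μ (n + 1)
    -- One factor `ρ / r`, which is `O(t)` in the application, is split off from every term beyond
    -- the constant one; the rest is compared with the convergent series at radius `r`.
    have h2 : ρ ^ (n + 1) ≤ ρ / r * r ^ (n + 1) := by
      rw [pow_succ, pow_succ, ← mul_assoc, mul_comm (ρ / r), mul_assoc, div_mul_cancel₀ _ hr.ne']
      gcongr
    calc ‖c (n + 1)‖ * _ ≤ ‖c (n + 1)‖ * (ρ ^ (n + 1) * ‖P‖) := by gcongr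
      _ ≤ ‖c (n + 1)‖ * (ρ / r * r ^ (n + 1) * ‖P‖) := by gcongr
      _ = _ := by ring
  refine (tsum_of_norm_bounded (hs1.mul_left (ρ / r * ‖P‖)).hasSum hterm).trans ?_
  rw [tsum_mul_left]
  have h3 : ∑' n, ‖c (n + 1)‖ * r ^ (n + 1) ≤ ∑' n, ‖c n‖ * r ^ n := by
    rw [hs.tsum_eq_zero_add]
    exact le_add_of_nonneg_left (by positivity)
  calc ρ / r * ‖P‖ * ∑' n, ‖c (n + 1)‖ * r ^ (n + 1) ≤ ρ / r * ‖P‖ * ∑' n, ‖c n‖ * r ^ n := by gcongr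
    _ = _ := by ring

end IsSimplePath

namespace IsSimpleDegeneration

variable {V : Type*} [Fintype V] {B : MarkedBinaryTree V} {H : B.Cherry} {lam : V → ℂ} {μ : ℂ}
  {E : ℂ → PlaneEmbedding B} {E' : PlaneEmbedding (B.contract H)}

lemma lam_ne (h : IsSimpleDegeneration H lam μ E E') : lam H.l₁ ≠ lam H.l₂ := by
  obtain ⟨t, h1, h2⟩ := (h.pos_l₁.and h.pos_l₂).exists
  intro e
  rw [e, ← h2] at h1
  exact H.ne ((E t).pos_injective h1)

/-- The fixed terminals stay away from the disc. -/
lemma lt_dist_lam (h : IsSimpleDegeneration H lam μ E E') {r s₀ : ℝ} (hs₀ : s₀ ∈ Ioo (0 : ℝ) 1)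
    (hfar : ∀ u w : H.Rest, (B.contract H).graph.Adj u w → u ≠ H.p' → w ≠ H.p' →
      ∀ s ∈ Icc (0 : ℝ) 1, r < dist (E'.arc u w s) μ)
    (hout : ∀ s ∈ Ioc s₀ 1, r < dist (E'.arc H.p' H.q' s) μ) {k : V} (hk : k ∈ H.others) :
    r < dist (lam k) μ := by
  obtain ⟨k1, k2⟩ := H.mem_others.1 hk
  set v : H.Rest := ⟨k, k2⟩
  have hv : v ≠ H.p' := fun e => H.p_notMem_others (by
    have : k = H.p := congrArg Subtype.val e
    rwa [← this])
  obtain ⟨t, ht1, ht2⟩ := ((h.eventually_pos_eq hv).and h.pos_terminal).exists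
  rw [← ht2 k k1 k2.1 k2.2, show k = v.1 from rfl, ht1]
  obtain ⟨w, hw⟩ := (B.contract H).exists_adj v
  by_cases hwp : w = H.p'
  · subst hwp
    rw [H.eq_q'_of_adj hw.symm, ← E'.arc_one H.adj_p'_q']
    exact hout 1 ⟨hs₀.2, le_rfl⟩
  · have := hfar v w hw hv hwp 0 ⟨le_rfl, zero_le_one⟩
    rwa [E'.arc_zero v w hw] at this

/-- The asymptotic form of the periods over `B_p`. -/
theorem exists_period_eq (h : IsSimpleDegeneration H lam μ E E') (hw₁ : B.isWhite H.l₁ = true)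
    (hw₂ : B.isWhite H.l₂ = true) {ζ : ℂ} (hζ : ζ ^ 3 = 1) {c : (t : ℂ) → ClosedCurve (E t).f}
    (hc : ∀ᶠ t in 𝓝[≠] (0 : ℂ), (E t).IsCycleB ζ H.p (c t)) {R : ℂ → ℂ} (hR : Differentiable ℂ R)
    {e : ℕ} (he0 : 0 < e) (he : e < 3)
    (hinf : Tendsto (fun z => z * R z / z ^ (e * B.n₁)) (Bornology.cobounded ℂ) (𝓝 0))
    {φ : ℂ → ℂ → ℂ → ℂ}
    (hφ : ∀ᶠ t in 𝓝[≠] (0 : ℂ), ∀ x y, y ^ 3 = (E t).f x → (E t).f x ≠ 0 → φ t x y = R x / y ^ e) :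
    ∃ (ν : ℂ) (K : ℝ), ν ^ 3 = R μ ^ 3 / (∏ k ∈ H.others, (μ - lam k) ^ B.a k) ^ e ∧
      ∀ᶠ t in 𝓝[≠] (0 : ℂ), ∃ ε : ℂ, ‖ε‖ ≤ K * ‖t‖ ∧
        period (φ t) (c t) ^ 3 * (t * (lam H.l₂ - lam H.l₁)) ^ (2 * e) =
          (t * (lam H.l₂ - lam H.l₁)) ^ 3 *
            ((1 / (omega ^ 2) ^ e - 1) * segmentInt e * (ν + ε)) ^ 3 := by
  obtain ⟨r, hr, s₀, hs₀, hfar, hnear, hout, hev⟩ := h.trees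
  set f₀ : ℂ → ℂ := fun x => ∏ k ∈ H.others, (x - lam k) ^ B.a k with hf₀
  have hf₀d : Differentiable ℂ f₀ := by
    simp only [hf₀]
    fun_prop
  have hf₀ne : Metric.closedBall μ r ⊆ {x | f₀ x ≠ 0} := fun x hx =>
    Finset.prod_ne_zero_iff.2 fun k hk => pow_ne_zero _ (sub_ne_zero.2 fun e => by
      have h1 := h.lt_dist_lam hs₀ hfar hout hk
      rw [← e] at h1
      exact absurd (Metric.mem_closedBall.1 hx) (not_le.2 h1))
  -- The short edges may touch the boundary of the disc, so the holomorphic root `g` of the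
  -- remaining factors is needed on a slightly larger disc.
  obtain ⟨δ, hδ, hthick⟩ := (isCompact_closedBall μ r).exists_thickening_subset_open
    (isOpen_ne_fun hf₀d.continuous continuous_const) hf₀ne
  rw [thickening_closedBall hδ hr.le] at hthick
  obtain ⟨g, hg, hg3⟩ := exists_cubeRoot_ball (by linarith : 0 < δ + r) hf₀d.differentiableOn
    fun z hz => hthick hz
  have hrr : r < δ + r := by linarith
  have hμ : μ ∈ Metric.ball μ (δ + r) := Metric.mem_ball_self (by linarith)
  have hg0 : ∀ z ∈ Metric.ball μ (δ + r), g z ≠ 0 := fun z hz h0 =>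
    hthick hz (by rw [← hg3 z hz, h0]; norm_num)
  set N : ℂ → ℂ := fun z => R z / g z ^ e with hN
  have hNd : DifferentiableOn ℂ N (Metric.ball μ (δ + r)) :=
    hR.differentiableOn.div (hg.pow e) fun z hz => pow_ne_zero _ (hg0 z hz)
  set M := ∑' n, ‖taylorCoeff N μ n‖ * r ^ n with hM
  set κ := ‖lam H.l₂ - lam H.l₁‖ + ‖lam H.l₁ - μ‖ with hκ
  have hκ0 : 0 ≤ κ := by positivity
  refine ⟨N μ, κ / r * M, ?_, ?_⟩
  · simp only [hN]
    rw [div_pow, ← pow_mul, mul_comm e 3, pow_mul, hg3 μ hμ]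
  have hsmall : ∀ᶠ t in 𝓝[≠] (0 : ℂ), ‖t‖ * κ ≤ r := by
    have h1 : Tendsto (fun t : ℂ => ‖t‖ * κ) (𝓝[≠] 0) (𝓝 0) := by
      have : Tendsto (fun t : ℂ => ‖t‖ * κ) (𝓝 0) (𝓝 (‖(0 : ℂ)‖ * κ)) :=
        (continuous_norm.mul continuous_const).tendsto 0
      rw [norm_zero, zero_mul] at this
      exact this.mono_left nhdsWithin_le_nhds
    exact (h1.eventually_lt_const hr).mono fun _ => le_of_lt
  filter_upwards [hc, hφ, hev, h.pos_l₁, h.pos_l₂, h.anticlockwise, h.eventually_f_eq hw₁ hw₂, hsmall]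
    with t hct hφt ⟨_, _, _, hd₁, hd₂⟩ hp₁ hp₂ hdir hft hts
  have hpath := (E t).isSimplePath_twoEdges H.adj₁.symm H.adj₂ H.ne
  have z0 := (E t).twoEdges_zero (w := H.l₂) H.adj₁.symm
  have z1 := (E t).twoEdges_one (u := H.l₁) H.adj₂
  set α := (E t).twoEdges H.l₁ H.p H.l₂ with hα
  set α' := (E t).twoEdgesDeriv H.l₁ H.p H.l₂ with hα'
  have hαr : ∀ τ ∈ Icc (0 : ℝ) 1, dist (α τ) μ ≤ r := by
    intro τ hτ
    rcases le_total τ (1 / 2) with h1 | h1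
    · obtain ⟨s, hs, e1⟩ : α τ ∈ (E t).arc H.p H.l₁ '' Icc 0 1 := by
        rw [(E t).arc_image_symm H.adj₁.symm, hα, (E t).twoEdges_eq_left h1]
        exact ⟨_, PlaneEmbedding.left_mem_Icc ⟨hτ.1, h1⟩, rfl⟩
      rw [← e1]
      exact hd₁ s hs
    · rw [hα, (E t).twoEdges_eq_right H.adj₁.symm H.adj₂ h1]
      exact hd₂ _ (PlaneEmbedding.right_mem_Icc ⟨h1, hτ.2⟩)
  have hαb : ∀ τ ∈ Icc (0 : ℝ) 1, α τ ∈ Metric.ball μ (δ + r) := fun τ hτ =>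
    (hαr τ hτ).trans_lt hrr
  rw [hp₁] at z0
  rw [hp₂] at z1
  have hdiff : α 1 - α 0 = t * (lam H.l₂ - lam H.l₁) := by rw [z0, z1]; ring
  have hdiff0 : α 0 - μ = t * (lam H.l₁ - μ) := by rw [z0]; ring
  obtain ⟨u, hu, hu3, hP⟩ := hpath.exists_pathInt_pow
  have hgα : ContinuousOn (fun τ => g (α τ)) (Icc 0 1) :=
    hg.continuousOn.comp hpath.continuousOn hαb
  have hint := hpath.intervalIntegrable he hu hu3 (g := fun τ => N (α τ))
    (hNd.continuousOn.comp hpath.continuousOn hαb)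
  have hNW : ∀ τ, R (α τ) / (u τ * g (α τ)) ^ e * α' τ = N (α τ) / u τ ^ e * α' τ := fun τ => by
    simp only [hN]
    rw [mul_pow, div_div, mul_comm (g (α τ) ^ e)]
  obtain ⟨η, hη, hper⟩ := PlaneEmbedding.IsCycleB.exists_period_eq hw₁ hw₂ hdir hζ hct hR he hinf hφt
    (W := fun τ => u τ * g (α τ)) (hu.mul hgα) (fun τ hτ => by
      have hτI := Ioo_subset_Icc_self hτ
      rw [hft, mul_pow, hu3 τ hτI, hg3 _ (hαb τ hτI), z0, z1]) (by
      have h1 := hint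
      simp only [← hNW] at h1
      exact h1)
  have hI' : (∫ τ in (0 : ℝ)..1, R (α τ) / (u τ * g (α τ)) ^ e * α' τ) =
      ∫ τ in (0 : ℝ)..1, N (α τ) / u τ ^ e * α' τ := by simp only [hNW]
  replace hper : period (φ t) (c t) = (1 / (omega ^ 2) ^ e - 1) *
      ((∫ τ in (0 : ℝ)..1, N (α τ) / u τ ^ e * α' τ) / η ^ e) := by
    rw [← hI']
    exact hper
  have hest := hpath.norm_integral_sub_le he hu hu3 hNd hr hrr hαr (by
    rw [hdiff, hdiff0, norm_mul, norm_mul, ← mul_add]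
    exact hts)
  have hPt := hP e he0 he
  rw [hdiff, hdiff0, norm_mul, norm_mul, ← mul_add, ← hM, ← hκ] at hest
  rw [hdiff] at hPt
  set P := IsSimplePath.pathInt α α' u e 0 0
  set I := ∫ τ in (0 : ℝ)..1, N (α τ) / u τ ^ e * α' τ
  -- The error is bounded by a multiple of `‖P‖`, hence can be absorbed into the factor. In the case
  -- `P = 0` both sides vanish, so no nonvanishing of `P` is needed.
  have hε : ∃ ε : ℂ, ‖ε‖ ≤ κ / r * M * ‖t‖ ∧ I = P * (N μ + ε) := by
    by_cases hP0 : P = 0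
    · refine ⟨0, ?_, ?_⟩
      · rw [norm_zero]
        have : 0 ≤ M := tsum_nonneg fun n => by positivity
        positivity
      · rw [hP0, mul_zero, sub_zero, norm_zero, mul_zero, norm_le_zero_iff] at hest
        rw [hest, hP0, zero_mul]
    · refine ⟨(I - N μ * P) / P, ?_, ?_⟩
      · rw [norm_div, div_le_iff₀ (norm_pos_iff.2 hP0)]
        refine hest.trans_eq ?_
        ring
      · field_simp
        ring
  obtain ⟨ε, hεle, hI⟩ := hε
  refine ⟨ε, hεle, ?_⟩
  have hη3 : (η ^ e) ^ 3 = 1 := by rw [← pow_mul, mul_comm, pow_mul, hη, one_pow]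
  rw [hper, hI]
  have e1 : ((1 / (omega ^ 2) ^ e - 1) * (P * (N μ + ε) / η ^ e)) ^ 3 =
      ((1 / (omega ^ 2) ^ e - 1) * (N μ + ε)) ^ 3 * P ^ 3 := by
    rw [mul_pow, div_pow, hη3, div_one]
    ring
  rw [e1, mul_assoc, hPt]
  ring

/-- The periods over `B_p` tend to zero if the power of `y` in the denominator is small or the
differential vanishes at `μ`. -/
theorem tendsto_period_zero (h : IsSimpleDegeneration H lam μ E E') (hw₁ : B.isWhite H.l₁ = true)
    (hw₂ : B.isWhite H.l₂ = true) {ζ : ℂ} (hζ : ζ ^ 3 = 1) {c : (t : ℂ) → ClosedCurve (E t).f}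
    (hc : ∀ᶠ t in 𝓝[≠] (0 : ℂ), (E t).IsCycleB ζ H.p (c t)) {R : ℂ → ℂ} (hR : Differentiable ℂ R)
    {e : ℕ} (he : e = 1 ∨ e = 2 ∧ R μ = 0)
    (hinf : Tendsto (fun z => z * R z / z ^ (e * B.n₁)) (Bornology.cobounded ℂ) (𝓝 0))
    {φ : ℂ → ℂ → ℂ → ℂ}
    (hφ : ∀ᶠ t in 𝓝[≠] (0 : ℂ), ∀ x y, y ^ 3 = (E t).f x → (E t).f x ≠ 0 → φ t x y = R x / y ^ e) :
    Tendsto (fun t => period (φ t) (c t)) (𝓝[≠] 0) (𝓝 0) := by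
  obtain ⟨ν, K, hν, hev⟩ := h.exists_period_eq hw₁ hw₂ hζ hc hR (by omega) (by omega) hinf hφ
  have hδ : lam H.l₂ - lam H.l₁ ≠ 0 := sub_ne_zero.2 h.lam_ne.symm
  set δ := lam H.l₂ - lam H.l₁
  set A := (1 / (omega ^ 2) ^ e - 1) * segmentInt e
  have ht0 : Tendsto (fun t : ℂ => ‖t‖) (𝓝[≠] 0) (𝓝 0) := by
    have : Tendsto (fun t : ℂ => ‖t‖) (𝓝 0) (𝓝 ‖(0 : ℂ)‖) := continuous_norm.tendsto 0
    rw [norm_zero] at this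
    exact this.mono_left nhdsWithin_le_nhds
  -- the norms of the cubes are bounded by a function tending to zero
  obtain ⟨b, hb, hbt⟩ : ∃ b : ℂ → ℝ, Tendsto b (𝓝[≠] 0) (𝓝 0) ∧
      ∀ᶠ t in 𝓝[≠] (0 : ℂ), ‖period (φ t) (c t)‖ ^ 3 ≤ b t := by
    rcases he with rfl | ⟨rfl, hRμ⟩
    · refine ⟨fun t => ‖t‖ * ‖δ‖ * (‖A‖ * (‖ν‖ + K * ‖t‖)) ^ 3, ?_, ?_⟩
      · have := (ht0.mul_const ‖δ‖).mul ((((ht0.const_mul K).const_add ‖ν‖).const_mul ‖A‖).pow 3)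
        rwa [zero_mul, zero_mul] at this
      · filter_upwards [hev, self_mem_nhdsWithin] with t ⟨ε, hε, hper⟩ ht
        have hd : t * δ ≠ 0 := mul_ne_zero ht hδ
        -- For `e = 1` the cube has one factor `t`.
        have e1 : period (φ t) (c t) ^ 3 = t * δ * (A * (ν + ε)) ^ 3 := by
          refine mul_right_cancel₀ (pow_ne_zero 2 hd) ?_
          rw [show (t * δ) ^ 2 = (t * δ) ^ (2 * 1) by norm_num, hper]
          ring
        rw [← norm_pow, e1, norm_mul, norm_mul, norm_pow, norm_mul]
        have := (norm_add_le ν ε).trans (add_le_add_right hε _)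
        gcongr
    · have hν0 : ν = 0 := by
        rw [hRμ, zero_pow three_ne_zero, zero_div] at hν
        exact pow_eq_zero_iff three_ne_zero |>.1 hν
      refine ⟨fun t => ‖t‖ ^ 2 * ((‖A‖ * K) ^ 3 / ‖δ‖), ?_, ?_⟩
      · have := (ht0.pow 2).mul_const ((‖A‖ * K) ^ 3 / ‖δ‖)
        rwa [zero_pow two_ne_zero, zero_mul] at this
      · filter_upwards [hev, self_mem_nhdsWithin] with t ⟨ε, hε, hper⟩ ht
        have hd : t * δ ≠ 0 := mul_ne_zero ht hδ
        -- For `e = 2` the cube of the basic integral grows like `1 / t`, but `ν = 0` leaves `ε ^ 3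
        -- = O(t ^ 3)`.
        have e1 : period (φ t) (c t) ^ 3 * (t * δ) = (A * ε) ^ 3 := by
          refine mul_right_cancel₀ (pow_ne_zero 3 hd) ?_
          rw [hν0, zero_add] at hper
          rw [mul_assoc, show t * δ * (t * δ) ^ 3 = (t * δ) ^ (2 * 2) by ring, hper]
          ring
        have e2 := congrArg norm e1
        rw [norm_mul, norm_pow, norm_mul, norm_pow, norm_mul] at e2
        have ht' : 0 < ‖t‖ := norm_pos_iff.2 ht
        have hδ' : 0 < ‖δ‖ := norm_pos_iff.2 hδ
        have e3 : ‖period (φ t) (c t)‖ ^ 3 = (‖A‖ * ‖ε‖) ^ 3 / (‖t‖ * ‖δ‖) := by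
          rw [eq_div_iff (by positivity), e2]
        rw [e3, div_le_iff₀ (by positivity)]
        calc (‖A‖ * ‖ε‖) ^ 3 ≤ (‖A‖ * (K * ‖t‖)) ^ 3 := by gcongr
          _ = _ := by field_simp
  rw [tendsto_zero_iff_norm_tendsto_zero]
  have h3 : Tendsto (fun t => ‖period (φ t) (c t)‖ ^ 3) (𝓝[≠] 0) (𝓝 0) :=
    squeeze_zero' (Eventually.of_forall fun t => by positivity) hbt hb
  rw [Metric.tendsto_nhds] at h3 ⊢
  intro ε hε
  filter_upwards [h3 (ε ^ 3) (by positivity)] with t ht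
  rw [Real.dist_eq, sub_zero, abs_of_nonneg (by positivity)] at ht ⊢
  exact lt_of_pow_lt_pow_left₀ 3 hε.le ht

/-- The growth of the period over `B_p` if the differential does not vanish at `μ`. -/
theorem tendsto_mul_period_pow (h : IsSimpleDegeneration H lam μ E E') (hw₁ : B.isWhite H.l₁ = true)
    (hw₂ : B.isWhite H.l₂ = true) {ζ : ℂ} (hζ : ζ ^ 3 = 1) {c : (t : ℂ) → ClosedCurve (E t).f}
    (hc : ∀ᶠ t in 𝓝[≠] (0 : ℂ), (E t).IsCycleB ζ H.p (c t)) {R : ℂ → ℂ} (hR : Differentiable ℂ R)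
    (hinf : Tendsto (fun z => z * R z / z ^ (2 * B.n₁)) (Bornology.cobounded ℂ) (𝓝 0))
    {φ : ℂ → ℂ → ℂ → ℂ}
    (hφ : ∀ᶠ t in 𝓝[≠] (0 : ℂ), ∀ x y, y ^ 3 = (E t).f x → (E t).f x ≠ 0 → φ t x y = R x / y ^ 2) :
    Tendsto (fun t => t * (lam H.l₁ - lam H.l₂) * period (φ t) (c t) ^ 3) (𝓝[≠] 0)
      (𝓝 (((omega - 1) * betaIntegral (1 / 3) (1 / 3)) ^ 3 *
        (R μ ^ 3 / (∏ k ∈ H.others, (μ - lam k) ^ B.a k) ^ 2))) := by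
  obtain ⟨ν, K, hν, hev⟩ := h.exists_period_eq hw₁ hw₂ hζ hc hR (by norm_num) (by norm_num) hinf hφ
  have hδ : lam H.l₂ - lam H.l₁ ≠ 0 := sub_ne_zero.2 h.lam_ne.symm
  -- Here `1 / ω ^ 4 = ω²` and `ω² - 1 = (ω - 1) (-ω²)`. The resulting sign is the one between
  -- `λ_{i+1} - λ_i` and `λ_i - λ_{i+1}`.
  have hω : (1 / (omega ^ 2) ^ 2 - 1) ^ 3 = -(omega - 1) ^ 3 := by
    have h3 := omega_pow_three
    have h0 : omega ≠ 0 := cubeRoot_ne_zero h3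
    have h4 : (omega ^ 2) ^ 2 = omega := by linear_combination omega * h3
    have h5 : 1 / omega = omega ^ 2 := by
      rw [div_eq_iff h0]
      linear_combination -h3
    rw [h4, h5, show omega ^ 2 - 1 = (omega - 1) * (-omega ^ 2) by linear_combination h3]
    linear_combination (-(omega - 1) ^ 3 * (omega ^ 3 + 1)) * h3
  set A := (1 / (omega ^ 2) ^ 2 - 1) * segmentInt 2 with hA
  obtain ⟨ε, hε⟩ := hev.choice
  have hε0 : Tendsto ε (𝓝[≠] 0) (𝓝 0) := by
    rw [tendsto_zero_iff_norm_tendsto_zero]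
    have h1 : Tendsto (fun t : ℂ => K * ‖t‖) (𝓝[≠] 0) (𝓝 0) := by
      have : Tendsto (fun t : ℂ => K * ‖t‖) (𝓝 0) (𝓝 (K * ‖(0 : ℂ)‖)) :=
        (continuous_const.mul continuous_norm).tendsto 0
      rw [norm_zero, mul_zero] at this
      exact this.mono_left nhdsWithin_le_nhds
    exact squeeze_zero' (Eventually.of_forall fun t => norm_nonneg _) (hε.mono fun _ => And.left) h1
  have hlim := (((hε0.const_add ν).const_mul A).pow 3).neg
  have hval : -(A * (ν + 0)) ^ 3 = ((omega - 1) * betaIntegral (1 / 3) (1 / 3)) ^ 3 *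
      (R μ ^ 3 / (∏ k ∈ H.others, (μ - lam k) ^ B.a k) ^ 2) := by
    rw [← hν, ← segmentInt_two, hA, add_zero, mul_pow, mul_pow, hω]
    ring
  rw [hval] at hlim
  clear hval hA
  clear_value A
  refine hlim.congr' ?_
  filter_upwards [hε, self_mem_nhdsWithin] with t ⟨_, hper⟩ ht
  refine mul_right_cancel₀ (pow_ne_zero 3 (mul_ne_zero ht hδ)) ?_
  linear_combination hper

end IsSimpleDegeneration

end TripleCover

namespace TripleCover

open Complex

/-! ### Growth at infinity -/

lemma tendsto_sub_div_self_cobounded (l : ℂ) :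
    Tendsto (fun x : ℂ => (x - l) / x) (Bornology.cobounded ℂ) (𝓝 1) := by
  have h := (tendsto_inv₀_cobounded (α := ℂ)).const_mul l |>.const_sub 1
  rw [mul_zero, sub_zero] at h
  refine h.congr' ?_
  filter_upwards [Bornology.eventually_ne_cobounded (0 : ℂ)] with x hx
  field_simp

lemma tendsto_prod_sub_div_pow_cobounded {ι : Type*} (s : Finset ι) (l : ι → ℂ) (m : ι → ℕ) :
    Tendsto (fun x : ℂ => (∏ k ∈ s, (x - l k) ^ m k) / x ^ ∑ k ∈ s, m k) (Bornology.cobounded ℂ)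
      (𝓝 1) := by
  have h : Tendsto (fun x : ℂ => ∏ k ∈ s, ((x - l k) / x) ^ m k) (Bornology.cobounded ℂ)
      (𝓝 (∏ k ∈ s, 1 ^ m k)) :=
    tendsto_finsetProd s fun k _ => (tendsto_sub_div_self_cobounded (l k)).pow (m k)
  simp only [one_pow, Finset.prod_const_one] at h
  refine h.congr fun x => ?_
  simp only [div_pow]
  rw [Finset.prod_div_distrib, Finset.prod_pow_eq_pow_sum]

lemma tendsto_pow_div_pow_cobounded {m n : ℕ} (h : m < n) :
    Tendsto (fun x : ℂ => x ^ m / x ^ n) (Bornology.cobounded ℂ) (𝓝 0) := by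
  have h1 := (tendsto_inv₀_cobounded (α := ℂ)).pow (n - m)
  rw [zero_pow (by omega)] at h1
  refine h1.congr' ?_
  filter_upwards [Bornology.eventually_ne_cobounded (0 : ℂ)] with x hx
  rw [inv_pow, eq_div_iff (pow_ne_zero _ hx), ← Nat.sub_add_cancel h.le, pow_add,
    Nat.add_sub_cancel]
  field_simp

namespace PlaneEmbedding

variable {V : Type*} [Fintype V] {B : MarkedBinaryTree V} (E : PlaneEmbedding B)

/-- The existence of the sheets implies that the curve is not branched at infinity. -/
lemma IsSheet.sum_a {E : PlaneEmbedding B} {ζ : ℂ} {Y : ℂ → ℂ} (hY : E.IsSheet ζ Y)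
    (hζ : ζ ^ 3 = 1) : ∑ k ∈ B.terminals, B.a k = 3 * B.n₁ := by
  have h1 := tendsto_prod_sub_div_pow_cobounded B.terminals E.pos B.a
  have h2 := hY.atInfinity.pow 3
  rw [hζ] at h2
  -- As `n₁` is a quotient of natural numbers, only this inequality is automatic. If it were strict,
  -- `f` divided by its leading power would tend to 0 instead of 1.
  have hle : 3 * B.n₁ ≤ ∑ k ∈ B.terminals, B.a k := by
    unfold MarkedBinaryTree.n₁
    omega
  refine (hle.eq_of_not_lt fun hlt => ?_).symm
  have h3 := h2.mul (tendsto_pow_div_pow_cobounded hlt)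
  rw [mul_zero] at h3
  refine zero_ne_one (tendsto_nhds_unique (h3.congr' ?_) h1)
  have hb : ∀ᶠ x in Bornology.cobounded ℂ, x ∉ E.support :=
    (Bornology.isBounded_def.1 E.isCompact_support.isBounded)
  filter_upwards [hb, Bornology.eventually_ne_cobounded (0 : ℂ)]
    with x hx hx0
  rw [div_pow, hY.cube x hx, f, ← pow_mul, mul_comm B.n₁ 3]
  field_simp

/-- The product of all `x - λ_k` times that of their powers `a_k - 1` is `y ^ 3`. Thus both kinds of
differentials fit the shape `R dx / y ^ e` with entire `R`. -/
lemma div_y₂ {x y : ℂ} (hy : y ^ 3 = E.f x) (hf : E.f x ≠ 0) (c : ℂ) :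
    c / E.y₂ x y = c * (∏ k ∈ B.terminals, (x - E.pos k) ^ (B.a k - 1)) / y ^ 2 := by
  have h1 : (∏ k ∈ B.terminals, (x - E.pos k)) *
      ∏ k ∈ B.terminals, (x - E.pos k) ^ (B.a k - 1) = y ^ 3 := by
    rw [hy, f, ← Finset.prod_mul_distrib]
    refine Finset.prod_congr rfl fun k _ => ?_
    rw [← pow_succ']
    rw [Nat.sub_add_cancel (B.a_pos k)]
  have hy0 : y ≠ 0 := by
    rintro rfl
    exact hf (by rw [← hy]; norm_num)
  have hP : (∏ k ∈ B.terminals, (x - E.pos k)) ≠ 0 := by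
    intro h0
    rw [h0, zero_mul] at h1
    exact pow_ne_zero 3 hy0 h1.symm
  rw [y₂, div_div_eq_mul_div, div_eq_div_iff hP (pow_ne_zero 2 hy0)]
  linear_combination -c * h1

end PlaneEmbedding

namespace MarkedBinaryTree

variable {V : Type*} [Fintype V] {B : MarkedBinaryTree V}

lemma sum_b_add (h : ∑ k ∈ B.terminals, B.a k = 3 * B.n₁) :
    ∑ k ∈ B.terminals, B.b k + 3 * B.n₁ = B.terminals.card * 3 := by
  rw [← h, ← Finset.sum_add_distrib, ← smul_eq_mul, ← Finset.sum_const]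
  refine Finset.sum_congr rfl fun k _ => ?_
  unfold a b
  split_ifs <;> rfl

/-- With `N` terminals, `a + b = 3` gives `n₂ = N - n₁`, while the sum of the `a - 1` is `3 n₁ - N`.
-/
lemma sum_a_sub_one_add_n₂ (h : ∑ k ∈ B.terminals, B.a k = 3 * B.n₁) :
    ∑ k ∈ B.terminals, (B.a k - 1) + B.n₂ = 2 * B.n₁ := by
  have h1 : ∑ k ∈ B.terminals, (B.a k - 1) + B.terminals.card = 3 * B.n₁ := by
    rw [← h, Finset.card_eq_sum_ones, ← Finset.sum_add_distrib]
    exact Finset.sum_congr rfl fun k _ => Nat.sub_add_cancel (B.a_pos k)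
  have h2 := sum_b_add h
  unfold n₂
  omega

/-- The sum of the `b_k` is divisible by 3 and at least `2 + 2`, hence at least 6. So the
exceptional index `d₁ + 1` does not exceed `d₁ + d₂`. -/
lemma Cherry.two_le_n₂ {H : B.Cherry} (hw₁ : B.isWhite H.l₁ = true) (hw₂ : B.isWhite H.l₂ = true)
    (h : ∑ k ∈ B.terminals, B.a k = 3 * B.n₁) : 2 ≤ B.n₂ := by
  have h1 := H.sum_terminals B.b
  have h2 := sum_a_sub_one_add_n₂ h
  rw [show B.b H.l₁ = 2 by simp [b, hw₁], show B.b H.l₂ = 2 by simp [b, hw₂]] at h1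
  have h3 := sum_b_add h
  unfold n₂
  omega

lemma Cherry.sum_others_a_sub_one {H : B.Cherry} (hw₁ : B.isWhite H.l₁ = true)
    (hw₂ : B.isWhite H.l₂ = true) :
    ∑ k ∈ H.others, (B.a k - 1) = ∑ k ∈ B.terminals, (B.a k - 1) := by
  rw [H.sum_terminals fun k => B.a k - 1, Cherry.a_l₁ hw₁, Cherry.a_l₂ hw₂]
  simp

end MarkedBinaryTree

/-! ### The differentials over the common denominator `y₁ ^ 2` -/

namespace IsSimpleDegeneration

variable {V : Type*} [Fintype V] {B : MarkedBinaryTree V} {H : B.Cherry} {lam : V → ℂ} {μ : ℂ}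
  {E : ℂ → PlaneEmbedding B} {E' : PlaneEmbedding (B.contract H)}

/-- The common numerator of the differentials `η̃_j` on the curves of the family, if they are
written with the denominator `y₁ ^ 2`. -/
noncomputable def numerator (H : B.Cherry) (lam : V → ℂ) (μ : ℂ) (m : ℕ) (x : ℂ) : ℂ :=
  (x - μ) ^ m * ∏ k ∈ H.others, (x - lam k) ^ (B.a k - 1)

lemma differentiable_numerator (m : ℕ) : Differentiable ℂ (numerator H lam μ m) := by
  unfold numerator
  fun_prop

/-- A count of degrees: by `sum_a_sub_one_add_n₂` the numerator has degree `m + 2 n₁ - n₂`, which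
must be smaller than `2 n₁ - 1`. -/
lemma tendsto_numerator (hw₁ : B.isWhite H.l₁ = true) (hw₂ : B.isWhite H.l₂ = true)
    (h : ∑ k ∈ B.terminals, B.a k = 3 * B.n₁) {m : ℕ} (hm : m + 1 < B.n₂) :
    Tendsto (fun z => z * numerator H lam μ m z / z ^ (2 * B.n₁)) (Bornology.cobounded ℂ)
      (𝓝 0) := by
  have h1 := MarkedBinaryTree.sum_a_sub_one_add_n₂ h
  rw [← MarkedBinaryTree.Cherry.sum_others_a_sub_one hw₁ hw₂] at h1
  have h2 := (((tendsto_sub_div_self_cobounded μ).pow m).mul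
    (tendsto_prod_sub_div_pow_cobounded H.others lam fun k => B.a k - 1)).mul
    (tendsto_pow_div_pow_cobounded
      (show 1 + m + ∑ k ∈ H.others, (B.a k - 1) < 2 * B.n₁ by omega))
  rw [mul_zero] at h2
  refine h2.congr' ?_
  filter_upwards [Bornology.eventually_ne_cobounded (0 : ℂ)] with x hx
  rw [numerator, div_pow, pow_add, pow_add, pow_one]
  field_simp

lemma eventually_etaTilde_eq (h : IsSimpleDegeneration H lam μ E E')
    (hw₁ : B.isWhite H.l₁ = true) (hw₂ : B.isWhite H.l₂ = true) (j : ℕ) :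
    ∀ᶠ t in 𝓝[≠] (0 : ℂ), ∀ x y, y ^ 3 = (E t).f x → (E t).f x ≠ 0 →
      (E t).etaTilde μ j x y = numerator H lam μ (j - B.d₁ - 1) x / y ^ 2 := by
  filter_upwards [h.pos_terminal] with t ht x y hy hf
  rw [PlaneEmbedding.etaTilde, (E t).div_y₂ hy hf, numerator, H.prod_terminals,
    MarkedBinaryTree.Cherry.a_l₁ hw₁, MarkedBinaryTree.Cherry.a_l₂ hw₂, Nat.sub_self, pow_zero,
    pow_zero, one_mul, one_mul]
  congr 2
  refine Finset.prod_congr rfl fun k hk => ?_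
  obtain ⟨a1, a2, a3⟩ := H.mem_others.1 hk
  rw [ht k a1 a2 a3]

/-- In the contracted tree the terminal `p` has `a = 2`, which puts an additional factor `x - μ`
into the numerator. This is the reason for the shift of the index by one in the limit. -/
lemma etaTilde_contract_eq (h : IsSimpleDegeneration H lam μ E E')
    (hw₁ : B.isWhite H.l₁ = true) (hw₂ : B.isWhite H.l₂ = true) {j : ℕ} (hj : B.d₁ + 2 ≤ j)
    (x y : ℂ) (hy : y ^ 3 = E'.f x) (hf : E'.f x ≠ 0) :
    E'.etaTilde μ (j - 1) x y = numerator H lam μ (j - B.d₁ - 1) x / y ^ 2 := by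
  have hd : (B.contract H).d₁ = B.d₁ := by
    rw [MarkedBinaryTree.d₁, MarkedBinaryTree.Cherry.contract_n₁ hw₁ hw₂, MarkedBinaryTree.d₁]
  rw [PlaneEmbedding.etaTilde, E'.div_y₂ hy hf, numerator, hd,
    h.prod_contract_pos fun z n => (x - z) ^ (n - 1), MarkedBinaryTree.Cherry.a_p hw₁, ← mul_assoc,
    ← pow_add]
  congr 4
  omega

/-- The exponents satisfy `3 (a - 1) - 2 a = a - 3 = -b`. -/
lemma numerator_zero_pow_three_div (hμ : ∀ k ∈ H.others, μ - lam k ≠ 0) :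
    numerator H lam μ 0 μ ^ 3 / (∏ k ∈ H.others, (μ - lam k) ^ B.a k) ^ 2 =
      ∏ k ∈ H.others, ((μ - lam k) ^ B.b k)⁻¹ := by
  rw [numerator, pow_zero, one_mul, ← Finset.prod_pow, ← Finset.prod_pow, ← Finset.prod_div_distrib]
  refine Finset.prod_congr rfl fun k hk => ?_
  have := hμ k hk
  unfold MarkedBinaryTree.a MarkedBinaryTree.b
  split_ifs
  · rw [Nat.sub_self]
    field_simp
  · rw [show 2 - 1 = 1 from rfl]
    field_simp

lemma sub_lam_ne_zero (h : IsSimpleDegeneration H lam μ E E') {k : V} (hk : k ∈ H.others) :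
    μ - lam k ≠ 0 := by
  obtain ⟨r, hr, s₀, hs₀, hfar, -, hout, -⟩ := h.trees
  have := h.lt_dist_lam hs₀ hfar hout hk
  intro h0
  rw [sub_eq_zero.1 h0, dist_self] at this
  exact this.not_gt hr

lemma sum_a {ζ : ℂ} (hζ : ζ ^ 3 = 1)
    {c : (t : ℂ) → ClosedCurve (E t).f}
    (hc : ∀ᶠ t in 𝓝[≠] (0 : ℂ), (E t).IsCycleB ζ H.p (c t)) :
    ∑ k ∈ B.terminals, B.a k = 3 * B.n₁ := by
  obtain ⟨t, ht⟩ := hc.exists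
  obtain ⟨-, -, Y, -, -, -, hY, -⟩ := ht.exists_cross
  exact hY.sum_a hζ

end IsSimpleDegeneration

end TripleCover

theorem proposition5p1 {V : Type*} [Fintype V] (B : MarkedBinaryTree V) (H : B.Cherry)
    (hw₁ : B.isWhite H.l₁ = true) (hw₂ : B.isWhite H.l₂ = true)
    (lam : V → ℂ) (μ : ℂ)
    (E : ℂ → PlaneEmbedding B) (E' : PlaneEmbedding (B.contract H))
    (hE : IsSimpleDegeneration H lam μ E E')
    (ζ : ℂ) (hζ : ζ ^ 3 = 1)
    (c : (t : ℂ) → V → ClosedCurve (E t).f)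
    (hc : ∀ᶠ t in 𝓝[≠] (0 : ℂ), ∀ v, B.IsInner v → (E t).IsCycleB ζ v (c t v))
    (c' : H.Rest → ClosedCurve E'.f)
    (hc' : ∀ v, (B.contract H).IsInner v → E'.IsCycleB ζ v (c' v)) :
    -- the periods over `B_p`
    ((∀ j, 1 ≤ j → j ≤ B.d₁ →
        Tendsto (fun t => period ((E t).eta j) (c t H.p)) (𝓝[≠] 0) (𝓝 0)) ∧
      (∀ j, B.d₁ + 2 ≤ j → j ≤ B.d₁ + B.d₂ →
        Tendsto (fun t => period ((E t).etaTilde μ j) (c t H.p)) (𝓝[≠] 0) (𝓝 0)) ∧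
      Tendsto
        (fun t => t * (lam H.l₁ - lam H.l₂) *
          period ((E t).etaTilde μ (B.d₁ + 1)) (c t H.p) ^ 3)
        (𝓝[≠] 0)
        (𝓝 (((omega - 1) * Complex.betaIntegral (1 / 3) (1 / 3)) ^ 3 *
          ∏ k ∈ H.others, ((μ - lam k) ^ B.b k)⁻¹))) ∧
    -- the period of the exceptional differential over the other cycles is finite in the limit
    (∀ v, B.IsInner v → v ≠ H.p →
      ∃ L : ℂ, Tendsto (fun t => period ((E t).etaTilde μ (B.d₁ + 1)) (c t v)) (𝓝[≠] 0) (𝓝 L)) ∧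
    -- the limits of the other periods are periods of the degenerate curve
    (∀ v : H.Rest, B.IsInner v → v ≠ H.p' →
      (∀ j, 1 ≤ j → j ≤ B.d₁ →
        Tendsto (fun t => period ((E t).eta j) (c t v)) (𝓝[≠] 0)
          (𝓝 (period (E'.eta j) (c' v)))) ∧
      (∀ j, B.d₁ + 2 ≤ j → j ≤ B.d₁ + B.d₂ →
        Tendsto (fun t => period ((E t).etaTilde μ j) (c t v)) (𝓝[≠] 0)
          (𝓝 (period (E'.etaTilde μ (j - 1)) (c' v))))) := by
  have hcp : ∀ᶠ t in 𝓝[≠] (0 : ℂ), (E t).IsCycleB ζ H.p (c t H.p) :=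
    hc.mono fun t ht => ht H.p H.inner
  have hS := IsSimpleDegeneration.sum_a hζ hcp
  have hn₂ := MarkedBinaryTree.Cherry.two_le_n₂ hw₁ hw₂ hS
  have hR : ∀ n : ℕ, Differentiable ℂ fun x : ℂ => x ^ n := fun n => differentiable_pow n
  have hinf : ∀ j, 1 ≤ j → j ≤ B.d₁ → Tendsto (fun z : ℂ => z * z ^ (j - 1) / z ^ (1 * B.n₁))
      (Bornology.cobounded ℂ) (𝓝 0) := by
    intro j h1 h2
    simp_rw [← pow_succ']
    refine tendsto_pow_div_pow_cobounded ?_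
    unfold MarkedBinaryTree.d₁ at h2
    omega
  have heta : ∀ j, ∀ᶠ t in 𝓝[≠] (0 : ℂ), ∀ x y, y ^ 3 = (E t).f x → (E t).f x ≠ 0 →
      (E t).eta j x y = x ^ (j - 1) / y ^ 1 := fun j => Eventually.of_forall fun t x y _ _ => by
    rw [PlaneEmbedding.eta, pow_one]
  have hinf₂ : ∀ j, j ≤ B.d₁ + B.d₂ → Tendsto
      (fun z => z * IsSimpleDegeneration.numerator H lam μ (j - B.d₁ - 1) z / z ^ (2 * B.n₁))
      (Bornology.cobounded ℂ) (𝓝 0) := by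
    intro j hj
    refine IsSimpleDegeneration.tendsto_numerator hw₁ hw₂ hS ?_
    unfold MarkedBinaryTree.d₂ at hj
    omega
  have hd₂ : B.d₁ + 1 ≤ B.d₁ + B.d₂ := by
    unfold MarkedBinaryTree.d₂
    omega
  have hcv : ∀ v : H.Rest, B.IsInner v → ∀ᶠ t in 𝓝[≠] (0 : ℂ), (E t).IsCycleB ζ v.1 (c t v.1) :=
    fun v hv => hc.mono fun t ht => ht v.1 hv
  have hcv' : ∀ v : H.Rest, B.IsInner v → v ≠ H.p' → E'.IsCycleB ζ v (c' v) :=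
    fun v hv hvp => hc' v ((H.contract_isInner_iff hvp).2 hv)
  refine ⟨⟨fun j h1 h2 => ?_, fun j h1 h2 => ?_, ?_⟩, fun v hv hvp => ?_, fun v hv hvp =>
    ⟨fun j h1 h2 => ?_, fun j h1 h2 => ?_⟩⟩
  · exact hE.tendsto_period_zero hw₁ hw₂ hζ hcp (hR _) (Or.inl rfl) (hinf j h1 h2) (heta j)
  · refine hE.tendsto_period_zero hw₁ hw₂ hζ hcp (IsSimpleDegeneration.differentiable_numerator _)
      (Or.inr ⟨rfl, ?_⟩) (hinf₂ j h2) (hE.eventually_etaTilde_eq hw₁ hw₂ j)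
    rw [IsSimpleDegeneration.numerator, sub_self, zero_pow (by omega), zero_mul]
  · have h1 := hE.tendsto_mul_period_pow hw₁ hw₂ hζ hcp
      (IsSimpleDegeneration.differentiable_numerator _) (hinf₂ _ hd₂)
      (hE.eventually_etaTilde_eq hw₁ hw₂ (B.d₁ + 1))
    -- For the exceptional index the power of `x - μ` is zero, so the numerator does not vanish at
    -- `μ`.
    rwa [show B.d₁ + 1 - B.d₁ - 1 = 0 by omega,
      IsSimpleDegeneration.numerator_zero_pow_three_div fun k hk => hE.sub_lam_ne_zero hk] at h1
  · have hrest : v ≠ H.l₁ ∧ v ≠ H.l₂ := by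
      have h3 : (B.graph.neighborSet v).ncard = 3 := hv
      constructor
      · rintro rfl
        have h1 : (B.graph.neighborSet H.l₁).ncard = 1 := H.terminal₁
        omega
      · rintro rfl
        have h1 : (B.graph.neighborSet H.l₂).ncard = 1 := H.terminal₂
        omega
    have hvp' : (⟨v, hrest⟩ : H.Rest) ≠ H.p' := fun h => hvp (congrArg Subtype.val h)
    -- The limit is the period of the numerator over `y ^ 2` on the degenerate curve, that is of `dx
    -- / ((x - μ) y₂)`. This differential has a pole above `μ`, but the period is finite since the
    -- cycle avoids the branch points.
    exact ⟨_, hE.tendsto_period hw₁ hw₂ hζ hv hvp' (hcv ⟨v, hrest⟩ hv) (hcv' ⟨v, hrest⟩ hv hvp')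
      (IsSimpleDegeneration.differentiable_numerator _) (hinf₂ _ hd₂)
      (hE.eventually_etaTilde_eq hw₁ hw₂ (B.d₁ + 1)) fun _ _ _ _ => rfl⟩
  · exact hE.tendsto_period hw₁ hw₂ hζ hv hvp (hcv v hv) (hcv' v hv hvp) (hR _) (hinf j h1 h2)
      (heta j) fun x y _ _ => by rw [PlaneEmbedding.eta, pow_one]
  · exact hE.tendsto_period hw₁ hw₂ hζ hv hvp (hcv v hv) (hcv' v hv hvp)
      (IsSimpleDegeneration.differentiable_numerator _) (hinf₂ j h2)
      (hE.eventually_etaTilde_eq hw₁ hw₂ j) (hE.etaTilde_contract_eq hw₁ hw₂ h1)
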